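/- **Notation.** For an alphabet $\Sigma$, a *forest* over $\Sigma$ is a balanced string of parentheses $(_a$, $)_a$ with labels $a\in\Sigma$: the set of forests is the smallest set that contains the empty string, is closed under concatenation, and contains $(_a\,F\,)_a$ for every forest $F$ and $a\in\Sigma$. Positions are numbered from $0$, $F[i..j)$ is the fragment of $F$ at the positions $i,\dots,j-1$, and the *mate* of a parenthesis is the parenthesis matched with it. Write $\bar\Sigma=\Sigma\cup\{\varepsilon\}$. A weight function $w:\bar\Sigma^2\to\mathbb{R}_{\ge0}$ is *normalized* if $w(a,a)=0$ and $w(a,b)\ge1$ for all distinct $a,b\in\bar\Sigma$. A *forest alignment* of $F$ onto $G$ is a path from $(0,0)$ to $(|F|,|G|)$ with steps $(x,y)\to(x+1,y)$ (deleting $F[x]$), $(x,y)\to(x,y+1)$ (inserting $G[y]$) and $(x,y)\to(x+1,y+1)$ (aligning $F[x]$ to $G[y]$) such that, whenever two characters are aligned, their mates are also aligned with each other. Its cost is the sum of the costs of its steps, which are $\frac12w(a,\varepsilon)$, $\frac12w(\varepsilon,b)$ and $\frac12w(a,b)$, respectively, where $a$ is the label of $F[x]$ and $b$ is the label of $G[y]$.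 Let $\mathsf{ted}^w(F,G)$ be the minimum cost of a forest alignment of $F$ onto $G$, and let $\mathsf{ted}^w_{\le k}(F,G)$ be $\mathsf{ted}^w(F,G)$ if this value is at most $k$, and $\infty$ otherwise. For forests $F,G$ and an integer $k\ge1$, a fragment $F[p_F..q_F)$ is a *free block*, with the associated fragment $G[p_G..q_G)$, if $|p_F-p_G|\le2k$ and there are a balanced string $R$ (the period) with $4k\le|R|<8k$ and an integer $e\ge1$ (the exponent) such that $F[p_F-|R|\,..\,q_F+|R|)=R^{e+2}=G[p_G-|R|\,..\,q_G+|R|)$, where both of these fragments lie inside $F$ and $G$, respectively. **Theorem.** There is a deterministic algorithm (for the unit-cost random access machine with words of $O(\log(n+k))$ bits and with real numbers, which accesses $w$ only through a unit-cost oracle) that, given forests $F,G$ over an alphabet $\Sigma$ of total length $n=|F|+|G|$, oracle access to a normalized weight function $w:\bar\Sigma^2\to\mathbb{R}_{\ge0}$, an integer threshold $k\ge1$, and a collection of $t$ pairwise disjoint free blocks in $F$ (each given with its associated fragment of $G$, its period and its exponent) such that exactly $m$ characters of $F$ are not contained in any of these blocks, computes $\mathsf{ted}^w_{\le k}(F,G)$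 in $O(n\log n+mk^2\log n+tk^3\log n)$ time (in $O(1)$ time if $n=0$). -/

import Mathlib

open scoped NNReal

/-! ### Forests as balanced strings of parentheses -/

/-- The parentheses with labels in `α`: `op a` is opening and `cl a` is closing. -/
inductive Paren (α : Type*) where
  | op (a : α) : Paren α
  | cl (a : α) : Paren α

/-- The label of a parenthesis. -/
def Paren.label {α : Type*} : Paren α → α
  | .op a => a
  | .cl a => a

/-- The kind of a parenthesis: `0` for opening, `1` for closing. -/
def Paren.kind {α : Type*} : Paren α → ℕ
  | .op _ => 0
  | .cl _ => 1

/-- Balanced strings of parentheses, that is, forests with node labels in `α`. -/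
inductive BalancedStr {α : Type*} : List (Paren α) → Prop where
  | nil : BalancedStr []
  | append {F G : List (Paren α)} : BalancedStr F → BalancedStr G → BalancedStr (F ++ G)
  | wrap (a : α) {F : List (Paren α)} :
      BalancedStr F → BalancedStr ([Paren.op a] ++ F ++ [Paren.cl a])

/-- The fragment `X[i..j)` of a string. -/
def frag {β : Type*} (X : List β) (i j : ℕ) : List β := (X.take j).drop i

/-- The `e`-th power `X^e` of a string. -/
def strPow {β : Type*} (X : List β) (e : ℕ) : List β := (List.replicate e X).flatten

/-- `[i..j]` is a node of `F`: `F[i]` is opening, `F[j]` is closing and `F(i..j)` is balanced. -/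
def IsNode {α : Type*} (F : List (Paren α)) (i j : ℕ) : Prop :=
  i < j ∧ (∃ a, F[i]? = some (Paren.op a)) ∧ (∃ b, F[j]? = some (Paren.cl b)) ∧
    BalancedStr (frag F (i + 1) j)

/-- `j = mate_F(i)`: the positions `i` and `j` are the two parentheses of one node of `F`. -/
def IsMate {α : Type*} (F : List (Paren α)) (i j : ℕ) : Prop :=
  IsNode F i j ∨ IsNode F j i

/-! ### Alignments and the tree edit distance

The empty string `ε` is `none`, both as a label in `Option α` and as a character in
`Option (Paren α)`. -/

/-- A weight function is normalized if `w a a = 0` and `w a b ≥ 1` for distinct `a`, `b`. -/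
def Normalized {α : Type*} (w : Option α → Option α → ℝ≥0) : Prop :=
  (∀ a, w a a = 0) ∧ ∀ a b, a ≠ b → 1 ≤ w a b

/-- The weight function on parentheses that is induced by `w`: half of the weight of the labels. -/
noncomputable def parenWeight {α : Type*} (w : Option α → Option α → ℝ≥0)
    (p q : Option (Paren α)) : ℝ :=
  (w (p.map Paren.label) (q.map Paren.label) : ℝ) / 2

/-- The edges of the alignment graph of `X` and `Y`: horizontal, vertical and diagonal. -/
def AGEdge {β : Type*} (X Y : List β) (p q : ℕ × ℕ) : Prop :=
  (p.1 < X.length ∧ p.2 ≤ Y.length ∧ q = (p.1 + 1, p.2)) ∨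
  (p.1 ≤ X.length ∧ p.2 < Y.length ∧ q = (p.1, p.2 + 1)) ∨
  (p.1 < X.length ∧ p.2 < Y.length ∧ q = (p.1 + 1, p.2 + 1))

/-- The cost of the edge `p → q` of the alignment graph with respect to the weights `v`
(`X[i]?` is the character at position `i`, for positions `i` inside `X`). -/
noncomputable def edgeCost {β : Type*} (v : Option β → Option β → ℝ) (X Y : List β)
    (p q : ℕ × ℕ) : ℝ :=
  if q = (p.1 + 1, p.2) then v X[p.1]? none
  else if q = (p.1, p.2 + 1) then v none Y[p.2]?
  else v X[p.1]? Y[p.2]?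

/-- An alignment of `X` onto `Y`: a path in the alignment graph from `(0, 0)` to `(|X|, |Y|)`,
as its sequence of vertices. -/
def IsAlignment {β : Type*} (X Y : List β) (A : List (ℕ × ℕ)) : Prop :=
  A.head? = some (0, 0) ∧ A.getLast? = some (X.length, Y.length) ∧ A.IsChain (AGEdge X Y)

/-- The edges traversed by an alignment. -/
def pathEdges (A : List (ℕ × ℕ)) : List ((ℕ × ℕ) × (ℕ × ℕ)) := A.zip A.tail

/-- The total cost of the edges of an alignment. -/
noncomputable def alignCost {β : Type*} (v : Option β → Option β → ℝ) (X Y : List β)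
    (A : List (ℕ × ℕ)) : ℝ :=
  ((pathEdges A).map fun e => edgeCost v X Y e.1 e.2).sum

/-- The alignment `A` aligns the `i`-th character of `X` to the `j`-th character of `Y`. -/
def Aligns (A : List (ℕ × ℕ)) (i j : ℕ) : Prop := ((i, j), (i + 1, j + 1)) ∈ pathEdges A

/-- Forest alignments: whenever two characters are aligned, so are their mates. -/
def IsForestAlignment {α : Type*} (F G : List (Paren α)) (A : List (ℕ × ℕ)) : Prop :=
  IsAlignment F G A ∧
    ∀ i j i' j', Aligns A i j → IsMate F i i' → IsMate G j j' → Aligns A i' j'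

/-- The costs of the forest alignments of `F` onto `G`. -/
def tedCosts {α : Type*} (w : Option α → Option α → ℝ≥0) (F G : List (Paren α)) : Set ℝ :=
  {x | ∃ A, IsForestAlignment F G A ∧ alignCost (parenWeight w) F G A = x}

/-- The weighted tree edit distance: the minimum cost of a forest alignment. -/
noncomputable def ted {α : Type*} (w : Option α → Option α → ℝ≥0) (F G : List (Paren α)) : ℝ :=
  sInf (tedCosts w F G)

open Classical in
/-- The capped tree edit distance: `ted` if it is at most `k`, and `∞` otherwise. -/
noncomputable def tedLE {α : Type*} (w : Option α → Option α → ℝ≥0) (k : ℕ)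
    (F G : List (Paren α)) : WithTop ℝ :=
  if ted w F G ≤ k then (ted w F G : WithTop ℝ) else ⊤

theorem paths_finite {β : Type*} (X Y : List β) (z : ℕ × ℕ) :
    ∀ (N : ℕ) (p : ℕ × ℕ), X.length + Y.length + 1 ≤ p.1 + p.2 + N →
      {A : List (ℕ × ℕ) | A.head? = some p ∧ A.getLast? = some z ∧ A.IsChain (AGEdge X Y)}.Finite := by
  intro N
  induction N with
  | zero =>
    intro p hp
    refine (Set.finite_singleton [p]).subset ?_
    rintro A ⟨h1, h2, h3⟩
    rcases A with _ | ⟨a, _ | ⟨b, l⟩⟩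
    · simp at h1
    · simp_all
    · simp only [List.head?_cons, Option.some.injEq] at h1
      subst h1
      have := (List.isChain_cons_cons.1 h3).1
      rcases this with h | h | h <;> omega
  | succ N ih =>
    intro p hp
    have e1 := ih (p.1 + 1, p.2) (by simp; omega)
    have e2 := ih (p.1, p.2 + 1) (by simp; omega)
    have e3 := ih (p.1 + 1, p.2 + 1) (by simp; omega)
    refine ((Set.finite_singleton [p]).union
      (((e1.union e2).union e3).image (List.cons p))).subset ?_
    rintro A ⟨h1, h2, h3⟩
    rcases A with _ | ⟨a, _ | ⟨b, l⟩⟩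
    · simp at h1
    · simp_all
    · simp only [List.head?_cons, Option.some.injEq] at h1
      subst h1
      right
      refine ⟨b :: l, ?_, rfl⟩
      obtain ⟨h, h3⟩ := List.isChain_cons_cons.1 h3
      have h2 : (b :: l).getLast? = some z := by simpa using h2
      rcases h with h | h | h
      · left; left; exact ⟨by simp [h.2.2], h2, h3⟩
      · left; right; exact ⟨by simp [h.2.2], h2, h3⟩
      · right; exact ⟨by simp [h.2.2], h2, h3⟩

theorem exists_insertions {β : Type*} (X Y : List β) : ∀ (N y : ℕ), y + N = Y.length →
    ∃ A : List (ℕ × ℕ), A.head? = some (X.length, y) ∧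
      A.getLast? = some (X.length, Y.length) ∧ A.IsChain (AGEdge X Y) ∧ ∀ i j, ¬ Aligns A i j := by
  intro N
  induction N with
  | zero => intro y hy; exact ⟨[(X.length, y)], by simp, by simp; omega, by simp, by simp [Aligns, pathEdges]⟩
  | succ N ih =>
    intro y hy
    obtain ⟨A, h1, h2, h3, h4⟩ := ih (y + 1) (by omega)
    rcases A with _ | ⟨b, l⟩
    · simp at h1
    simp only [List.head?_cons, Option.some.injEq] at h1
    subst h1
    refine ⟨(X.length, y) :: (X.length, y + 1) :: l, by simp, by simpa using h2,
      List.isChain_cons_cons.2 ⟨.inr (.inl ⟨le_rfl, by simp; omega, rfl⟩), h3⟩, ?_⟩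
    intro i j h
    simp only [Aligns, pathEdges, List.tail_cons, List.zip_cons_cons, List.mem_cons,
      Prod.mk.injEq] at h
    rcases h with h | h
    · omega
    · exact h4 i j h

theorem exists_deletions {β : Type*} (X Y : List β) : ∀ (N x : ℕ), x + N = X.length →
    ∃ A : List (ℕ × ℕ), A.head? = some (x, 0) ∧
      A.getLast? = some (X.length, Y.length) ∧ A.IsChain (AGEdge X Y) ∧ ∀ i j, ¬ Aligns A i j := by
  intro N
  induction N with
  | zero =>
    intro x hx
    obtain rfl : x = X.length := by omega
    exact exists_insertions X Y Y.length 0 (by omega)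
  | succ N ih =>
    intro x hx
    obtain ⟨A, h1, h2, h3, h4⟩ := ih (x + 1) (by omega)
    rcases A with _ | ⟨b, l⟩
    · simp at h1
    simp only [List.head?_cons, Option.some.injEq] at h1
    subst h1
    refine ⟨(x, 0) :: (x + 1, 0) :: l, by simp, by simpa using h2,
      List.isChain_cons_cons.2 ⟨.inl ⟨by simp; omega, by simp, rfl⟩, h3⟩, ?_⟩
    intro i j h
    simp only [Aligns, pathEdges, List.tail_cons, List.zip_cons_cons, List.mem_cons,
      Prod.mk.injEq] at h
    rcases h with h | h
    · omega
    · exact h4 i j h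

/-- The minimum in the definition of `ted` is attained. -/
theorem ted_isLeast {α : Type*} (w : Option α → Option α → ℝ≥0) (F G : List (Paren α)) :
    IsLeast (tedCosts w F G) (ted w F G) := by
  have hf : (tedCosts w F G).Finite := by
    refine ((paths_finite F G (F.length, G.length) _ (0, 0) le_add_self).image
      (alignCost (parenWeight w) F G)).subset ?_
    rintro x ⟨A, hA, rfl⟩
    exact ⟨A, hA.1, rfl⟩
  have hn : (tedCosts w F G).Nonempty := by
    obtain ⟨A, h1, h2, h3, h4⟩ := exists_deletions F G F.length 0 (by omega)
    exact ⟨_, A, ⟨⟨h1, h2, h3⟩, fun i j _ _ h => absurd h (h4 i j)⟩, rfl⟩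
  exact ⟨hn.csInf_mem hf, fun x hx => csInf_le hf.bddBelow hx⟩

/-! ### Free blocks -/

/-- A block `F[pF..qF)`, with the associated fragment `G[pG..qG)`, the length `len` of the
period, and the exponent `exp`. The period itself is then `F[pF..pF+len)`. -/
structure Block where
  pF : ℕ
  qF : ℕ
  pG : ℕ
  qG : ℕ
  len : ℕ
  exp : ℕ

/-- `F[pF..qF)` and `G[pG..qG)` form a free pair, with a period of length `len` and exponent
`exp`. -/
def Block.IsFree {α : Type*} (k : ℕ) (F G : List (Paren α)) (b : Block) : Prop :=
  |(b.pF : ℤ) - (b.pG : ℤ)| ≤ 2 * (k : ℤ) ∧ 1 ≤ b.exp ∧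
  ∃ R : List (Paren α), BalancedStr R ∧ R.length = b.len ∧ 4 * k ≤ R.length ∧ R.length < 8 * k ∧
    R.length ≤ b.pF ∧ b.qF + R.length ≤ F.length ∧
    R.length ≤ b.pG ∧ b.qG + R.length ≤ G.length ∧
    frag F (b.pF - R.length) (b.qF + R.length) = strPow R (b.exp + 2) ∧
    frag G (b.pG - R.length) (b.qG + R.length) = strPow R (b.exp + 2)

/-- The fragments `F[pF..qF)` of two blocks are disjoint. -/
def Block.DisjointF (b c : Block) : Prop :=
  Disjoint (Finset.Ico b.pF b.qF) (Finset.Ico c.pF c.qF)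

open Classical in
/-- The number of characters of `F` that are not contained in any of the blocks. -/
noncomputable def nonFree {α : Type*} (F : List (Paren α)) (L : List Block) : ℕ :=
  ((Finset.range F.length).filter fun i => ∀ b ∈ L, ¬ (b.pF ≤ i ∧ i < b.qF)).card

/-! ### The machine model

A deterministic random access machine with word-sized natural numbers and with real numbers. It
has word and real variables and word and real arrays (a program names finitely many of them), and
accesses the labels of the input only through an oracle for `w`. A real cannot be converted into
a word. Every node of an expression, every assignment, and every test of a condition is a step. -/

/-- Word-valued expressions: constants, variables, array cells, and `+`, truncated `-`, `*` and
division with rounding down. -/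
inductive WExp where
  | const (c : ℕ) : WExp
  | var (x : ℕ) : WExp
  | cell (a : ℕ) (i : WExp) : WExp
  | add (e f : WExp) : WExp
  | sub (e f : WExp) : WExp
  | mul (e f : WExp) : WExp
  | div (e f : WExp) : WExp

/-- Real-valued expressions. `cast` turns a word into a real, and `query i j` is a call of the
oracle for the weight of the labels at the positions `i` and `j` of the input. -/
inductive RExp where
  | var (x : ℕ) : RExp
  | cell (a : ℕ) (i : WExp) : RExp
  | cast (e : WExp) : RExp
  | query (i j : WExp) : RExp
  | add (e f : RExp) : RExp
  | sub (e f : RExp) : RExp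
  | half (e : RExp) : RExp

/-- Conditions: comparisons and their Boolean combinations. -/
inductive BExp where
  | wle (e f : WExp) : BExp
  | rle (e f : RExp) : BExp
  | not (b : BExp) : BExp
  | and (b c : BExp) : BExp

/-- Programs. -/
inductive Cmd where
  | skip : Cmd
  | setW (x : ℕ) (e : WExp) : Cmd
  | setR (x : ℕ) (e : RExp) : Cmd
  | storeW (a : ℕ) (i e : WExp) : Cmd
  | storeR (a : ℕ) (i : WExp) (e : RExp) : Cmd
  | seq (c d : Cmd) : Cmd
  | ite (b : BExp) (c d : Cmd) : Cmd
  | while (b : BExp) (c : Cmd) : Cmd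

/-- The contents of the variables and of the arrays. -/
structure RAMState where
  wvar : ℕ → ℕ
  warr : ℕ → ℕ → ℕ
  rvar : ℕ → ℝ
  rarr : ℕ → ℕ → ℝ

/-- The number of steps of an evaluation. -/
def WExp.cost : WExp → ℕ
  | .const _ => 1
  | .var _ => 1
  | .cell _ i => i.cost + 1
  | .add e f => e.cost + f.cost + 1
  | .sub e f => e.cost + f.cost + 1
  | .mul e f => e.cost + f.cost + 1
  | .div e f => e.cost + f.cost + 1

/-- The number of steps of an evaluation; a call of the oracle is one step. -/
def RExp.cost : RExp → ℕ
  | .var _ => 1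
  | .cell _ i => i.cost + 1
  | .cast e => e.cost + 1
  | .query i j => i.cost + j.cost + 1
  | .add e f => e.cost + f.cost + 1
  | .sub e f => e.cost + f.cost + 1
  | .half e => e.cost + 1

/-- The number of steps of an evaluation. -/
def BExp.cost : BExp → ℕ
  | .wle e f => e.cost + f.cost + 1
  | .rle e f => e.cost + f.cost + 1
  | .not b => b.cost + 1
  | .and b c => b.cost + c.cost + 1

/-- The value of a word expression. -/
def WExp.eval (s : RAMState) : WExp → ℕ
  | .const c => c
  | .var x => s.wvar x
  | .cell a i => s.warr a (i.eval s)
  | .add e f => e.eval s + f.eval s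
  | .sub e f => e.eval s - f.eval s
  | .mul e f => e.eval s * f.eval s
  | .div e f => e.eval s / f.eval s

/-- The value of a real expression, where `orc i j` is the answer of the oracle for the
positions `i` and `j`. -/
noncomputable def RExp.eval (orc : ℕ → ℕ → ℝ) (s : RAMState) : RExp → ℝ
  | .var x => s.rvar x
  | .cell a i => s.rarr a (i.eval s)
  | .cast e => (e.eval s : ℝ)
  | .query i j => orc (i.eval s) (j.eval s)
  | .add e f => e.eval orc s + f.eval orc s
  | .sub e f => e.eval orc s - f.eval orc s
  | .half e => e.eval orc s / 2

/-- The truth of a condition. -/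
def BExp.eval (orc : ℕ → ℕ → ℝ) (s : RAMState) : BExp → Prop
  | .wle e f => e.eval s ≤ f.eval s
  | .rle e f => e.eval orc s ≤ f.eval orc s
  | .not b => ¬ b.eval orc s
  | .and b c => b.eval orc s ∧ c.eval orc s

/-- Assignment to a word variable. -/
def RAMState.setW (s : RAMState) (x v : ℕ) : RAMState :=
  { s with wvar := Function.update s.wvar x v }

/-- Assignment to a real variable. -/
def RAMState.setR (s : RAMState) (x : ℕ) (v : ℝ) : RAMState :=
  { s with rvar := Function.update s.rvar x v }

/-- Assignment to a cell of a word array. -/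
def RAMState.storeW (s : RAMState) (a i v : ℕ) : RAMState :=
  { s with warr := Function.update s.warr a (Function.update (s.warr a) i v) }

/-- Assignment to a cell of a real array. -/
def RAMState.storeR (s : RAMState) (a i : ℕ) (v : ℝ) : RAMState :=
  { s with rarr := Function.update s.rarr a (Function.update (s.rarr a) i v) }

/-- `Exec orc B c s s' T`: run from the state `s`, the program `c` halts in the state `s'` after
exactly `T` steps. Only words of value at most `B` can be stored and used as addresses of a
store: a program that attempts to exceed `B` there has no execution. (The intermediate values of
an expression of a fixed program are then bounded by a fixed power of `B + 2`.) -/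
inductive Exec (orc : ℕ → ℕ → ℝ) (B : ℕ) : Cmd → RAMState → RAMState → ℕ → Prop where
  | skip (s : RAMState) : Exec orc B .skip s s 1
  | setW (s : RAMState) (x : ℕ) (e : WExp) (h : e.eval s ≤ B) :
      Exec orc B (.setW x e) s (s.setW x (e.eval s)) (e.cost + 1)
  | setR (s : RAMState) (x : ℕ) (e : RExp) :
      Exec orc B (.setR x e) s (s.setR x (e.eval orc s)) (e.cost + 1)
  | storeW (s : RAMState) (a : ℕ) (i e : WExp) (hi : i.eval s ≤ B) (h : e.eval s ≤ B) :
      Exec orc B (.storeW a i e) s (s.storeW a (i.eval s) (e.eval s)) (i.cost + e.cost + 1)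
  | storeR (s : RAMState) (a : ℕ) (i : WExp) (e : RExp) (hi : i.eval s ≤ B) :
      Exec orc B (.storeR a i e) s (s.storeR a (i.eval s) (e.eval orc s)) (i.cost + e.cost + 1)
  | seq {c d : Cmd} {s s' s'' : RAMState} {T T' : ℕ} (hc : Exec orc B c s s' T)
      (hd : Exec orc B d s' s'' T') : Exec orc B (.seq c d) s s'' (T + T')
  | iteTrue {b : BExp} {c d : Cmd} {s s' : RAMState} {T : ℕ} (hb : b.eval orc s)
      (hc : Exec orc B c s s' T) : Exec orc B (.ite b c d) s s' (b.cost + 1 + T)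
  | iteFalse {b : BExp} {c d : Cmd} {s s' : RAMState} {T : ℕ} (hb : ¬ b.eval orc s)
      (hd : Exec orc B d s s' T) : Exec orc B (.ite b c d) s s' (b.cost + 1 + T)
  | whileFalse {b : BExp} {c : Cmd} {s : RAMState} (hb : ¬ b.eval orc s) :
      Exec orc B (.while b c) s s (b.cost + 1)
  | whileTrue {b : BExp} {c : Cmd} {s s' s'' : RAMState} {T T' : ℕ} (hb : b.eval orc s)
      (hc : Exec orc B c s s' T) (hw : Exec orc B (.while b c) s' s'' T') :
      Exec orc B (.while b c) s s'' (b.cost + 1 + T + T')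

/-- Executions are deterministic. -/
theorem Exec.det {orc : ℕ → ℕ → ℝ} {B : ℕ} {c : Cmd} {s s₁ s₂ : RAMState} {T₁ T₂ : ℕ}
    (h₁ : Exec orc B c s s₁ T₁) (h₂ : Exec orc B c s s₂ T₂) : s₁ = s₂ ∧ T₁ = T₂ := by
  induction h₁ generalizing s₂ T₂ with
  | skip | setW | setR | storeW | storeR => cases h₂; exact ⟨rfl, rfl⟩
  | seq _ _ ih ih' =>
    cases h₂ with
    | seq hc hd =>
      obtain ⟨rfl, rfl⟩ := ih hc
      obtain ⟨rfl, rfl⟩ := ih' hd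
      exact ⟨rfl, rfl⟩
  | iteTrue hb _ ih =>
    cases h₂ with
    | iteTrue _ hc => obtain ⟨rfl, rfl⟩ := ih hc; exact ⟨rfl, rfl⟩
    | iteFalse hb' => exact absurd hb hb'
  | iteFalse hb _ ih =>
    cases h₂ with
    | iteTrue hb' => exact absurd hb' hb
    | iteFalse _ hd => obtain ⟨rfl, rfl⟩ := ih hd; exact ⟨rfl, rfl⟩
  | whileFalse hb =>
    cases h₂ with
    | whileFalse => exact ⟨rfl, rfl⟩
    | whileTrue hb' => exact absurd hb' hb
  | whileTrue hb _ _ ih ih' =>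
    cases h₂ with
    | whileFalse hb' => exact absurd hb hb'
    | whileTrue _ hc hw =>
      obtain ⟨rfl, rfl⟩ := ih hc
      obtain ⟨rfl, rfl⟩ := ih' hw
      exact ⟨rfl, rfl⟩

/-! ### Input and output -/

/-- Oracle access to `w`: for the positions `i`, `j` of the string `F · G`, the weight of the
labels at these positions; a position outside of this string stands for `ε`. -/
noncomputable def oracle {α : Type*} (w : Option α → Option α → ℝ≥0) (F G : List (Paren α))
    (i j : ℕ) : ℝ :=
  (w ((F ++ G)[i]?.map Paren.label) ((F ++ G)[j]?.map Paren.label) : ℝ)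

/-- The initial state. The word variables `0, 1, 2, 3` hold `|F|`, `|G|`, `k` and the number of
blocks; the word array `0` holds the kinds of the parentheses of `F · G`; the word arrays
`1, …, 6` hold the data of the blocks. Everything else is zero. -/
noncomputable def initState {α : Type*} (F G : List (Paren α)) (k : ℕ) (L : List Block) :
    RAMState where
  wvar
    | 0 => F.length
    | 1 => G.length
    | 2 => k
    | 3 => L.length
    | _ => 0
  warr
    | 0 => fun i => ((F ++ G)[i]?.map Paren.kind).getD 0
    | 1 => fun i => (L[i]?.map Block.pF).getD 0
    | 2 => fun i => (L[i]?.map Block.qF).getD 0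
    | 3 => fun i => (L[i]?.map Block.pG).getD 0
    | 4 => fun i => (L[i]?.map Block.qG).getD 0
    | 5 => fun i => (L[i]?.map Block.len).getD 0
    | 6 => fun i => (L[i]?.map Block.exp).getD 0
    | _ => fun _ => 0
  rvar _ := 0
  rarr _ _ := 0

/-- The output: `∞` if the word variable `0` is zero, and otherwise the real variable `0`. -/
noncomputable def RAMState.output (s : RAMState) : WithTop ℝ :=
  if s.wvar 0 = 0 then ⊤ else (s.rvar 0 : WithTop ℝ)

/-- The program `P`, with oracle access to `w` and words of value at most `B`, halts on the given
input within `T` steps with the output `out`. -/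
def Computes {α : Type*} (P : Cmd) (B : ℕ) (w : Option α → Option α → ℝ≥0)
    (F G : List (Paren α)) (k : ℕ) (L : List Block) (out : WithTop ℝ) (T : ℝ) : Prop :=
  ∃ (s : RAMState) (T' : ℕ), Exec (oracle w F G) B P (initState F G k L) s T' ∧
    s.output = out ∧ (T' : ℝ) ≤ T

set_option linter.unusedSimpArgs false


/-! An alignment of cost at most `k` stays within distance `2k` of the main diagonal, because every
insertion and every deletion costs at least 1/2 (`IsPath.band_bound`). A vertex (x, y) of this band
is encoded by the offset y - x + 2k, a number between 0 and 4k, so the distances from a fragment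
F[l..r) to all relevant fragments of G form a (4k+1) × (4k+1) matrix. `FragAlign` describes forest
alignments of fragments by the recursion that aligns two nodes together with their insides;
`IsForestAlignment.fragAlign` and `FragAlign.exists_forestAlignment` connect it with the definition
of `ted`. An entry has to be exact only up to the threshold: `GoodEntry` always asks for a lower
bound, but for a realizing alignment only if the value is at most `k`, so that k + 1 can play the
role of infinity.

Two operations produce matrices. Extending a fragment by one character takes O(k²) time
(`rightStep_spec`, `leftStep_spec`), provided that the distances between the inside of the node
completed by this character and the insides of nodes of G are known. Since the opening parenthesis
of a node of G determines its closing one, these inner distances are only one number per offset.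
Concatenating two fragments at a boundary that no node crosses is a min-plus product, in O(k³) time
(`mulMat_spec`).

Free blocks are handled by periodicity. As 4k ≤ |R|, the band around a block sees only periodic
parts of F and G, so all periods of the block have the same matrix (`Jump.periodic`). A block
without its first period is called a jump; its matrix is a power of the matrix of the first period
and is computed by repeated squaring, in O(k³ log n) time (`power_spec`). Afterwards a jump is
crossed by a single product.

To account for this, a position outside of the jumps has weight 1, the start of a jump has weight
|R|, and the rest of the jump has weight 0. A product costs O(k³) = O(k²|R|), so a fragment is
always extended at a cost of O(k²) per unit of weight. The total weight is at most m + 16kt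
(`prefixWt_length_le`).

It remains to treat all nodes without starting anew for each of them. A node is heavy if it has more
than half of the weight of its parent, and light otherwise. For every light node, `run` starts with
an empty fragment in the innermost node of the heavy path below it and expands this fragment to the
whole light node. It extends to the right unless the next character closes a node that opens to the
left of the fragment; then it extends to the left until the opening parenthesis is next, and adds
both parentheses. The nodes that do not contain the starting position have been treated before, and
the inside of a node of the heavy path is at some moment exactly the current fragment, when its
inner distances are recorded. The invariant is `RunInv`. The cost is O(k²) times the weight of the
light node (`run_spec`). Weights at least double from a light node to the next light node around it,
so every position is in O(log n) light nodes and all runs together cost O(k² (m + kt) log n)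
(`card_light_le`, `sum_light_le`).

The nodes are treated in the order of their closing parentheses (`SweepInv`). The matrix of a jump
is needed before the enclosing nodes are treated, and it needs the inner distances of all nodes in
the first period. These are available because no such node is the heavy child of a node around the
block: the jump weighs as much as the period (`Jump.not_heavy`). -/

/-! ### Matching in balanced strings -/

/-- The contribution of a parenthesis to the nesting depth. -/
def Paren.sgn {α : Type*} : Paren α → ℤ
  | .op _ => 1
  | .cl _ => -1

/-- The nesting depth of the string `F` before position `x`. -/
def depth {α : Type*} (F : List (Paren α)) (x : ℕ) : ℤ := ((F.take x).map Paren.sgn).sum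

theorem frag_getElem? {β : Type*} (X : List β) (i j t : ℕ) :
    (frag X i j)[t]? = if i + t < j then X[i + t]? else none := by
  simp [frag, List.getElem?_take]

theorem frag_length {β : Type*} (X : List β) (i j : ℕ) :
    (frag X i j).length = min j X.length - i := by
  simp [frag]

theorem depth_succ_op {α : Type*} {F : List (Paren α)} {x : ℕ} {a : α}
    (h : F[x]? = some (.op a)) : depth F (x + 1) = depth F x + 1 := by
  simp [depth, List.take_add_one, h, Paren.sgn]

theorem depth_succ_cl {α : Type*} {F : List (Paren α)} {x : ℕ} {a : α}
    (h : F[x]? = some (.cl a)) : depth F (x + 1) = depth F x - 1 := by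
  simp [depth, List.take_add_one, h, Paren.sgn]; ring

theorem BalancedStr.depth_facts {α : Type*} {F : List (Paren α)} (h : BalancedStr F) :
    (F.map Paren.sgn).sum = 0 ∧ ∀ x, 0 ≤ depth F x := by
  induction h with
  | nil => simp [depth]
  | @append F G _ _ ih ih' =>
    refine ⟨by simp [ih.1, ih'.1], fun x => ?_⟩
    have h1 := ih.2 x
    have h2 := ih'.2 (x - F.length)
    simp only [depth, List.take_append, List.map_append, List.sum_append] at *
    exact add_nonneg h1 h2
  | @wrap a F hF ih =>
    refine ⟨by simp [ih.1, Paren.sgn], fun x => ?_⟩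
    rcases x with _ | x
    · simp [depth]
    have h1 := ih.2 x
    simp only [depth, List.cons_append, List.nil_append, List.take_succ_cons, List.take_append,
      List.map_append, List.map_cons, List.sum_append, List.sum_cons] at *
    rcases Nat.eq_zero_or_pos (x - F.length) with h0 | h0
    · simp only [h0, Paren.sgn, List.take_zero, List.map_nil, List.sum_nil]; linarith
    · obtain ⟨z, hz⟩ := Nat.exists_eq_succ_of_ne_zero h0.ne'
      simp only [hz, Paren.sgn, List.take_succ_cons, List.take_nil, List.map_cons, List.map_nil,
        List.sum_cons, List.sum_nil]; linarith

/-- The depth is the only invariant needed: inside of a node it never falls below its value after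
the opening parenthesis, and right after the closing one it does. Uniqueness of mates and nesting
follow by comparing depths at one position. -/
theorem IsNode.depth_facts {α : Type*} {F : List (Paren α)} {i j : ℕ} (h : IsNode F i j) :
    depth F (i + 1) = depth F i + 1 ∧ depth F (j + 1) = depth F j - 1 ∧
      depth F j = depth F (i + 1) ∧ ∀ x, i + 1 ≤ x → x ≤ j → depth F (i + 1) ≤ depth F x := by
  obtain ⟨hij, ⟨a, ha⟩, ⟨b, hb⟩, hB⟩ := h
  have key : ∀ x, i + 1 ≤ x → x ≤ j →
      depth F x = depth F (i + 1) + depth (frag F (i + 1) j) (x - (i + 1)) := by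
    intro x h1 h2
    have : F.take x = F.take (i + 1) ++ (frag F (i + 1) j).take (x - (i + 1)) := by
      apply List.ext_getElem?
      intro t
      have hj : j < F.length := by
        by_contra hc
        simp [List.getElem?_eq_none (not_lt.1 hc)] at hb
      simp only [List.getElem?_append, List.getElem?_take, frag_getElem?, List.length_take]
      split_ifs <;> first | rfl | omega | (congr 1; omega)
    simp [depth, this]
  refine ⟨depth_succ_op ha, depth_succ_cl hb, ?_, fun x h1 h2 => ?_⟩
  · rw [key j hij le_rfl]
    have hl : (frag F (i + 1) j).length ≤ j - (i + 1) := by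
      rw [frag_length]; omega
    have h0 : depth (frag F (i + 1) j) (j - (i + 1)) = 0 := by
      rw [depth, List.take_of_length_le hl, hB.depth_facts.1]
    rw [h0, add_zero]
  · rw [key x h1 h2]
    have := hB.depth_facts.2 (x - (i + 1))
    linarith

theorem IsNode.lt {α : Type*} {F : List (Paren α)} {i j : ℕ} (h : IsNode F i j) : i < j := h.1

theorem IsNode.lt_length {α : Type*} {F : List (Paren α)} {i j : ℕ} (h : IsNode F i j) :
    j < F.length := by
  obtain ⟨_, _, ⟨b, hb⟩, _⟩ := h
  by_contra hc
  simp [List.getElem?_eq_none (not_lt.1 hc)] at hb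

theorem IsNode.right_unique {α : Type*} {F : List (Paren α)} {i j j' : ℕ} (h : IsNode F i j)
    (h' : IsNode F i j') : j = j' := by
  obtain ⟨_, h2, h3, h4⟩ := h.depth_facts
  obtain ⟨_, h2', h3', h4'⟩ := h'.depth_facts
  have := h.lt; have := h'.lt
  by_contra hne
  rcases Nat.lt_or_gt_of_ne hne with hlt | hlt
  · have := h4' (j + 1) (by omega) (by omega); omega
  · have := h4 (j' + 1) (by omega) (by omega); omega

theorem IsNode.left_unique {α : Type*} {F : List (Paren α)} {i i' j : ℕ} (h : IsNode F i j)
    (h' : IsNode F i' j) : i = i' := by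
  obtain ⟨h1, h2, h3, h4⟩ := h.depth_facts
  obtain ⟨h1', h2', h3', h4'⟩ := h'.depth_facts
  have := h.lt; have := h'.lt
  by_contra hne
  rcases Nat.lt_or_gt_of_ne hne with hlt | hlt
  · have := h4 i' (by omega) (by omega); omega
  · have := h4' i (by omega) (by omega); omega

theorem IsNode.left_ne_right {α : Type*} {F : List (Paren α)} {i j i' j' : ℕ} (h : IsNode F i j)
    (h' : IsNode F i' j') : i ≠ j' := by
  rintro rfl
  obtain ⟨a, ha⟩ := h.2.1
  obtain ⟨b, hb⟩ := h'.2.2.1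
  rw [ha] at hb; simp at hb

theorem IsNode.nest {α : Type*} {F : List (Paren α)} {i j i' j' : ℕ} (h : IsNode F i j)
    (h' : IsNode F i' j') (h1 : i < i') (h2 : i' < j) : j' < j := by
  obtain ⟨a1, a2, a3, a4⟩ := h.depth_facts
  obtain ⟨b1, b2, b3, b4⟩ := h'.depth_facts
  rcases Nat.lt_trichotomy j' j with hc | hc | hc
  · exact hc
  · subst hc; have := h.left_unique h'; omega
  · have := b4 (j + 1) (by omega) (by omega)
    have := a4 i' (by omega) (by omega)
    omega

/-- Being a node depends on the characters from `i` to `j` only, so nodes can be moved between a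
string, its fragments and its periodic copies. -/
theorem IsNode.congr {α : Type*} {F F' : List (Paren α)} {i j i' j' : ℕ}
    (hF : ∀ t, i + t ≤ j → F[i + t]? = F'[i' + t]?) (hj : j + i' = j' + i) (h : IsNode F i j) :
    IsNode F' i' j' := by
  obtain ⟨hij, ⟨a, ha⟩, ⟨b, hb⟩, hB⟩ := h
  refine ⟨by omega, ⟨a, ?_⟩, ⟨b, ?_⟩, ?_⟩
  · rw [← ha]; exact (hF 0 (by omega)).symm
  · rw [← hb]
    have := hF (j - i) (by omega)
    rw [show i + (j - i) = j by omega, show i' + (j - i) = j' by omega] at this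
    exact this.symm
  · convert hB using 1
    apply List.ext_getElem?
    intro t
    rw [frag_getElem?, frag_getElem?]
    have := hF (1 + t)
    split_ifs with h1 h2 h2
    · rw [add_assoc, ← this (by omega), add_assoc]
    · omega
    · omega
    · rfl

theorem BalancedStr.exists_node {α : Type*} {F : List (Paren α)} (h : BalancedStr F) :
    ∀ x < F.length, ∃ y, IsNode F x y ∨ IsNode F y x := by
  induction h with
  | nil => simp
  | @append F G _ _ ih ih' =>
    intro x hx
    have hL : ∀ {i j}, IsNode F i j → IsNode (F ++ G) i j := fun {i j} hn =>
      hn.congr (fun t ht => by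
        have := hn.lt_length
        rw [List.getElem?_append_left (by omega)]) rfl
    have hR : ∀ {i j}, IsNode G i j → IsNode (F ++ G) (F.length + i) (F.length + j) := fun {i j} hn =>
      hn.congr (fun t ht => by
        rw [List.getElem?_append_right (by omega)]
        congr 1; omega) (by omega)
    by_cases hlt : x < F.length
    · obtain ⟨y, hy | hy⟩ := ih x hlt
      · exact ⟨y, .inl (hL hy)⟩
      · exact ⟨y, .inr (hL hy)⟩
    · rw [List.length_append] at hx
      obtain ⟨y, hy⟩ := ih' (x - F.length) (by omega)
      refine ⟨F.length + y, ?_⟩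
      rw [show x = F.length + (x - F.length) by omega]
      exact hy.imp hR hR
  | @wrap a F hF ih =>
    intro x hx
    have hM : ∀ {i j}, IsNode F i j → IsNode ([Paren.op a] ++ F ++ [Paren.cl a]) (i + 1) (j + 1) :=
      fun {i j} hn => hn.congr (fun t ht => by
        have := hn.lt_length
        rw [List.getElem?_append_left (by simp; omega), List.getElem?_append_right (by simp; omega)]
        congr 1; simp) (by omega)
    have hW : IsNode ([Paren.op a] ++ F ++ [Paren.cl a]) 0 (F.length + 1) := by
      refine ⟨by omega, ⟨a, by simp⟩, ⟨a, ?_⟩, ?_⟩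
      · rw [List.getElem?_append_right (by simp)]; simp
      · convert hF using 1
        simp [frag]
    simp at hx
    rcases Nat.eq_zero_or_pos x with rfl | h0
    · exact ⟨_, .inl hW⟩
    rcases Nat.lt_or_ge x (F.length + 1) with h1 | h1
    · obtain ⟨y, hy⟩ := ih (x - 1) (by omega)
      refine ⟨y + 1, ?_⟩
      rw [show x = (x - 1) + 1 by omega]
      exact hy.imp hM hM
    · obtain rfl : x = F.length + 1 := by omega
      exact ⟨0, .inr hW⟩

/-- Nodes do not cross the boundary of a balanced fragment. -/
theorem IsNode.mem_balanced_iff {α : Type*} {F : List (Paren α)} {p q i j : ℕ}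
    (hB : BalancedStr (frag F p q)) (hq : q ≤ F.length) (h : IsNode F i j) :
    (p ≤ i ∧ i < q) ↔ (p ≤ j ∧ j < q) := by
  have key : ∀ x, p ≤ x → x < q → ∃ y, p ≤ y ∧ y < q ∧ (IsNode F x y ∨ IsNode F y x) := by
    intro x h1 h2
    have hl : (frag F p q).length = q - p := by rw [frag_length]; omega
    obtain ⟨y, hy⟩ := hB.exists_node (x - p) (by omega)
    have hlift : ∀ {i j}, IsNode (frag F p q) i j → IsNode F (p + i) (p + j) ∧ p + j < q :=
      fun {i j} hn => by
        have := hn.lt_length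
        refine ⟨hn.congr (fun t ht => ?_) (by omega), by omega⟩
        rw [frag_getElem?, if_pos (by omega), add_assoc]
    rcases hy with hy | hy
    · obtain ⟨h3, h4⟩ := hlift hy
      refine ⟨p + y, by omega, h4, .inl ?_⟩
      convert h3 using 1; omega
    · obtain ⟨h3, h4⟩ := hlift hy
      have := hy.lt
      refine ⟨p + y, by omega, by omega, .inr ?_⟩
      convert h3 using 1; omega
  constructor
  · rintro ⟨h1, h2⟩
    obtain ⟨y, h3, h4, h5 | h5⟩ := key i h1 h2
    · rw [h.right_unique h5]; exact ⟨h3, h4⟩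
    · exact absurd rfl (h.left_ne_right h5)
  · rintro ⟨h1, h2⟩
    obtain ⟨y, h3, h4, h5 | h5⟩ := key j h1 h2
    · exact absurd rfl (h5.left_ne_right h)
    · rw [h.left_unique h5]; exact ⟨h3, h4⟩

theorem isNode_append_left {α : Type*} {F G : List (Paren α)} {i j : ℕ} (hj : j < F.length) :
    IsNode (F ++ G) i j ↔ IsNode F i j :=
  ⟨fun h => h.congr (fun t ht => by rw [List.getElem?_append_left (by omega)]) rfl,
    fun h => h.congr (fun t ht => by rw [List.getElem?_append_left (by omega)]) rfl⟩

theorem isNode_append_right {α : Type*} {F G : List (Paren α)} {i j : ℕ} :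
    IsNode (F ++ G) (F.length + i) (F.length + j) ↔ IsNode G i j :=
  ⟨fun h => h.congr (fun t ht => by
      rw [List.getElem?_append_right (by omega)]; congr 1; omega) (by omega),
    fun h => h.congr (fun t ht => by
      rw [List.getElem?_append_right (by omega)]; congr 1; omega) (by omega)⟩


/-! ### Forest alignments of fragments within a band -/

section FragmentAlignment

variable {α : Type*} (w : Option α → Option α → ℝ≥0) (k : ℕ) (F G : List (Paren α))

/-- The cost of deleting the character at position `x`. -/
noncomputable def delCost (x : ℕ) : ℝ := parenWeight w F[x]? none

/-- The cost of inserting the character at position `y`. -/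
noncomputable def insCost (y : ℕ) : ℝ := parenWeight w none G[y]?

/-- The cost of aligning the characters at positions `x` and `y`. -/
noncomputable def subCost (x y : ℕ) : ℝ := parenWeight w F[x]? G[y]?

/-- The vertices of the alignment graph at distance at most `2k` from the main diagonal. -/
def InBand (x y : ℕ) : Prop :=
  x ≤ F.length ∧ y ≤ G.length ∧ x ≤ y + 2 * k ∧ y ≤ x + 2 * k

/-- `FragAlign w k F G l y r y' c`: some forest alignment of `F[l..r)` onto `G[y..y')` within the
band has cost `c`. -/
inductive FragAlign : ℕ → ℕ → ℕ → ℕ → ℝ → Prop where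
  | nil {x y : ℕ} (h : InBand k F G x y) : FragAlign x y x y 0
  | del {x y r y' : ℕ} {c : ℝ} (h : InBand k F G x y) (hc : FragAlign (x + 1) y r y' c) :
      FragAlign x y r y' (delCost w F x + c)
  | ins {x y r y' : ℕ} {c : ℝ} (h : InBand k F G x y) (hc : FragAlign x (y + 1) r y' c) :
      FragAlign x y r y' (insCost w G y + c)
  | sub {x y m z r y' : ℕ} {c d : ℝ} (h : InBand k F G x y) (hF : IsNode F x m)
      (hG : IsNode G y z) (hc : FragAlign (x + 1) (y + 1) m z c)
      (hd : FragAlign (m + 1) (z + 1) r y' d) :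
      FragAlign x y r y' (subCost w F G x y + c + (subCost w F G m z + d))

variable {w k F G}

theorem parenWeight_nonneg (p q : Option (Paren α)) : 0 ≤ parenWeight w p q := by
  unfold parenWeight; positivity

theorem FragAlign.le {l y r y' : ℕ} {c : ℝ} (h : FragAlign w k F G l y r y' c) :
    l ≤ r ∧ y ≤ y' := by
  induction h with
  | nil => exact ⟨le_rfl, le_rfl⟩
  | del _ _ ih => omega
  | ins _ _ ih => omega
  | sub _ _ _ _ _ ih ih' => omega

theorem FragAlign.band_left {l y r y' : ℕ} {c : ℝ} (h : FragAlign w k F G l y r y' c) :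
    InBand k F G l y := by
  cases h <;> assumption

theorem FragAlign.band_right {l y r y' : ℕ} {c : ℝ} (h : FragAlign w k F G l y r y' c) :
    InBand k F G r y' := by
  induction h <;> assumption

theorem FragAlign.append {l y p q r y' : ℕ} {c d : ℝ} (h : FragAlign w k F G l y p q c)
    (h' : FragAlign w k F G p q r y' d) : FragAlign w k F G l y r y' (c + d) := by
  induction h with
  | nil => simpa using h'
  | del hb _ ih => rw [add_assoc]; exact .del hb (ih h')
  | ins hb _ ih => rw [add_assoc]; exact .ins hb (ih h')
  | sub hb hF hG hc _ _ ih' =>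
    convert FragAlign.sub hb hF hG hc (ih' h') using 1
    ring

theorem FragAlign.single_del {x y : ℕ} (h : InBand k F G x y) (h' : InBand k F G (x + 1) y) :
    FragAlign w k F G x y (x + 1) y (delCost w F x) := by
  simpa using FragAlign.del (w := w) h (.nil h')

theorem FragAlign.single_ins {x y : ℕ} (h : InBand k F G x y) (h' : InBand k F G x (y + 1)) :
    FragAlign w k F G x y x (y + 1) (insCost w G y) := by
  simpa using FragAlign.ins (w := w) h (.nil h')

/-- The last step of a fragment alignment. -/
theorem FragAlign.tail {l y r y' : ℕ} {c : ℝ} (h : FragAlign w k F G l y r y' c) :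
    (l = r ∧ y = y' ∧ c = 0) ∨
    (∃ r₀ d, r = r₀ + 1 ∧ FragAlign w k F G l y r₀ y' d ∧ c = d + delCost w F r₀) ∨
    (∃ z₀ d, y' = z₀ + 1 ∧ FragAlign w k F G l y r z₀ d ∧ c = d + insCost w G z₀) ∨
    (∃ m z r₀ z₀ d e, r = r₀ + 1 ∧ y' = z₀ + 1 ∧ IsNode F m r₀ ∧ IsNode G z z₀ ∧
      FragAlign w k F G l y m z d ∧ FragAlign w k F G (m + 1) (z + 1) r₀ z₀ e ∧
      c = d + e + subCost w F G m z + subCost w F G r₀ z₀) := by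
  induction h with
  | nil => exact .inl ⟨rfl, rfl, rfl⟩
  | @del x y r y' c hb hc ih =>
    right
    rcases ih with ⟨rfl, rfl, rfl⟩ | ⟨r₀, d, rfl, h1, rfl⟩ | ⟨z₀, d, rfl, h1, rfl⟩ |
      ⟨m, z, r₀, z₀, d, e, rfl, rfl, h1, h2, h3, h4, rfl⟩
    · exact .inl ⟨x, 0, rfl, .nil hb, by ring⟩
    · exact .inl ⟨r₀, _, rfl, .del hb h1, by ring⟩
    · exact .inr (.inl ⟨z₀, _, rfl, .del hb h1, by ring⟩)
    · exact .inr (.inr ⟨m, z, r₀, z₀, _, e, rfl, rfl, h1, h2, .del hb h3, h4, by ring⟩)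
  | @ins x y r y' c hb hc ih =>
    right
    rcases ih with ⟨rfl, rfl, rfl⟩ | ⟨r₀, d, rfl, h1, rfl⟩ | ⟨z₀, d, rfl, h1, rfl⟩ |
      ⟨m, z, r₀, z₀, d, e, rfl, rfl, h1, h2, h3, h4, rfl⟩
    · exact .inr (.inl ⟨y, 0, rfl, .nil hb, by ring⟩)
    · exact .inl ⟨r₀, _, rfl, .ins hb h1, by ring⟩
    · exact .inr (.inl ⟨z₀, _, rfl, .ins hb h1, by ring⟩)
    · exact .inr (.inr ⟨m, z, r₀, z₀, _, e, rfl, rfl, h1, h2, .ins hb h3, h4, by ring⟩)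
  | @sub x y a b r y' c d hb hF hG hc hd ih ih' =>
    right
    rcases ih' with ⟨rfl, rfl, rfl⟩ | ⟨r₀, d, rfl, h1, rfl⟩ | ⟨z₀, d, rfl, h1, rfl⟩ |
      ⟨m, z, r₀, z₀, d, e, rfl, rfl, h1, h2, h3, h4, rfl⟩
    · exact .inr (.inr ⟨x, y, a, b, 0, c, rfl, rfl, hF, hG, .nil hb, hc, by ring⟩)
    · exact .inl ⟨r₀, _, rfl, .sub hb hF hG hc h1, by ring⟩
    · exact .inr (.inl ⟨z₀, _, rfl, .sub hb hF hG hc h1, by ring⟩)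
    · exact .inr (.inr ⟨m, z, r₀, z₀, _, e, rfl, rfl, h1, h2, .sub hb hF hG hc h3, h4, by ring⟩)

/-- A fragment alignment passes through every position that no node of the fragment crosses. -/
theorem FragAlign.split {l y r y' p : ℕ} {c : ℝ} (h : FragAlign w k F G l y r y' c)
    (hl : l ≤ p) (hr : p ≤ r)
    (hp : ∀ i j, IsNode F i j → l ≤ i → j < r → i < p → p ≤ j → False) :
    ∃ q d e, FragAlign w k F G l y p q d ∧ FragAlign w k F G p q r y' e ∧ c = d + e := by
  induction h with
  | @nil x y hb =>
    obtain rfl : x = p := by omega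
    exact ⟨y, 0, 0, .nil hb, .nil hb, by ring⟩
  | @del x y r y' c hb hc ih =>
    rcases hl.eq_or_lt with rfl | hl
    · exact ⟨y, 0, _, .nil hb, .del hb hc, by ring⟩
    · obtain ⟨q, d, e, h1, h2, rfl⟩ := ih hl hr (fun i j h h1 h2 => hp i j h (by omega) h2)
      exact ⟨q, _, e, .del hb h1, h2, by ring⟩
  | @ins x y r y' c hb hc ih =>
    obtain ⟨q, d, e, h1, h2, rfl⟩ := ih hl hr hp
    exact ⟨q, _, e, .ins hb h1, h2, by ring⟩
  | @sub x y m z r y' c d hb hF hG hc hd ih ih' =>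
    rcases hl.eq_or_lt with rfl | hl
    · exact ⟨y, 0, _, .nil hb, .sub hb hF hG hc hd, by ring⟩
    · have h1 := hd.le
      have h2 := hF.lt
      -- The first aligned node does not cross `p`, so it ends before `p`, and the cut is in the
      -- alignment of the part after it.
      have h3 : m < p := by
        by_contra hc
        exact hp x m hF le_rfl (by omega) hl (by omega)
      obtain ⟨q, d, e, h4, h5, rfl⟩ := ih' (by omega) hr
        (fun i j h h1 h2 => hp i j h (by omega) h2)
      exact ⟨q, _, e, .sub hb hF hG hc h4, h5, by ring⟩

/-- Fragment alignments depend on the characters of the fragments only. -/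
theorem FragAlign.shift {l y r y' : ℕ} {c : ℝ} (h : FragAlign w k F G l y r y' c) :
    ∀ {l₂ y₂ r₂ z₂ : ℕ}, y + l₂ = y₂ + l → r + l₂ = r₂ + l → y' + y₂ = z₂ + y →
    (∀ t, l + t < r → F[l + t]? = F[l₂ + t]?) → (∀ t, y + t < y' → G[y + t]? = G[y₂ + t]?) →
    r₂ ≤ F.length → z₂ ≤ G.length → FragAlign w k F G l₂ y₂ r₂ z₂ c := by
  induction h with
  | nil hb =>
    intro l₂ y₂ r₂ z₂ h1 h2 h3 hF hG hr hz
    obtain rfl : l₂ = r₂ := by omega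
    obtain rfl : y₂ = z₂ := by omega
    refine .nil ⟨hr, hz, ?_, ?_⟩ <;> obtain ⟨_, _, _, _⟩ := hb <;> omega
  | @del x y r y' c hb hc ih =>
    intro l₂ y₂ r₂ z₂ h1 h2 h3 hF hG hr hz
    have hle := hc.le
    have e : delCost w F x = delCost w F l₂ := by
      have := hF 0 (by omega)
      simp only [add_zero] at this
      rw [delCost, delCost, this]
    rw [e]
    refine .del ⟨by omega, by omega, ?_, ?_⟩ (ih (by omega) (by omega) h3 (fun t ht => ?_) hG hr hz)
    · obtain ⟨_, _, _, _⟩ := hb; omega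
    · obtain ⟨_, _, _, _⟩ := hb; omega
    · rw [add_assoc, add_assoc]; exact hF _ (by omega)
  | @ins x y r y' c hb hc ih =>
    intro l₂ y₂ r₂ z₂ h1 h2 h3 hF hG hr hz
    have hle := hc.le
    have e : insCost w G y = insCost w G y₂ := by
      have := hG 0 (by omega)
      simp only [add_zero] at this
      rw [insCost, insCost, this]
    rw [e]
    refine .ins ⟨by omega, by omega, ?_, ?_⟩ (ih (by omega) h2 (by omega) hF (fun t ht => ?_) hr hz)
    · obtain ⟨_, _, _, _⟩ := hb; omega
    · obtain ⟨_, _, _, _⟩ := hb; omega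
    · rw [add_assoc, add_assoc]; exact hG _ (by omega)
  | @sub x y m z r y' c d hb hNF hNG hc hd ih ih' =>
    intro l₂ y₂ r₂ z₂ h1 h2 h3 hF hG hr hz
    have hle := hc.le
    have hle' := hd.le
    have e1 : subCost w F G x y = subCost w F G l₂ y₂ := by
      have h1 := hF 0 (by omega)
      have h2 := hG 0 (by omega)
      simp only [add_zero] at h1 h2
      rw [subCost, subCost, h1, h2]
    have e2 : subCost w F G m z = subCost w F G (l₂ + (m - x)) (y₂ + (z - y)) := by
      have h1 := hF (m - x) (by omega)
      have h2 := hG (z - y) (by omega)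
      rw [show x + (m - x) = m by omega] at h1
      rw [show y + (z - y) = z by omega] at h2
      rw [subCost, subCost, h1, h2]
    rw [e1, e2]
    refine .sub ⟨by omega, by omega, ?_, ?_⟩
      (hNF.congr (fun t ht => hF t (by omega)) (by omega))
      (hNG.congr (fun t ht => hG t (by omega)) (by omega))
      (ih (by omega) (by omega) (by omega) (fun t ht => ?_) (fun t ht => ?_) (by omega) (by omega))
      (ih' (by omega) (by omega) (by omega) (fun t ht => ?_) (fun t ht => ?_) hr hz)
    · obtain ⟨_, _, _, _⟩ := hb; omega
    · obtain ⟨_, _, _, _⟩ := hb; omega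
    · rw [add_assoc, add_assoc]; exact hF _ (by omega)
    · rw [add_assoc, add_assoc]; exact hG _ (by omega)
    · have := hF (m + 1 + t - x) (by omega)
      rwa [show x + (m + 1 + t - x) = m + 1 + t by omega,
        show l₂ + (m + 1 + t - x) = l₂ + (m - x) + 1 + t by omega] at this
    · have := hG (z + 1 + t - y) (by omega)
      rwa [show y + (z + 1 + t - y) = z + 1 + t by omega,
        show y₂ + (z + 1 + t - y) = y₂ + (z - y) + 1 + t by omega] at this

end FragmentAlignment

/-! ### Paths in the alignment graph -/

/-- A path in the alignment graph from `p` to `q`. -/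
def IsPath {β : Type*} (X Y : List β) (p q : ℕ × ℕ) (A : List (ℕ × ℕ)) : Prop :=
  A.head? = some p ∧ A.getLast? = some q ∧ A.IsChain (AGEdge X Y)

section Path

variable {β : Type*} {X Y : List β} {p q u v : ℕ × ℕ} {A B : List (ℕ × ℕ)}

theorem pathEdges_cons_cons (p b : ℕ × ℕ) (l : List (ℕ × ℕ)) :
    pathEdges (p :: b :: l) = (p, b) :: pathEdges (b :: l) := by
  simp [pathEdges]

theorem pathEdges_append (hA : A.getLast? = some u) (hB : B.head? = some v) :
    pathEdges (A ++ B) = pathEdges A ++ (u, v) :: pathEdges B := by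
  induction A with
  | nil => simp at hA
  | cons a A ih =>
    cases A with
    | nil =>
      cases B with
      | nil => simp at hB
      | cons b B =>
        simp only [List.getLast?_singleton, Option.some.injEq, List.head?_cons] at hA hB
        subst hA hB
        simp [pathEdges]
    | cons a' A =>
      have := ih (by simpa using hA)
      simp only [List.cons_append, pathEdges_cons_cons] at this ⊢
      rw [this]

theorem IsPath.append (hA : IsPath X Y p u A) (hB : IsPath X Y v q B) (he : AGEdge X Y u v) :
    IsPath X Y p q (A ++ B) := by
  obtain ⟨h1, h2, h3⟩ := hA
  obtain ⟨h4, h5, h6⟩ := hB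
  refine ⟨by simp [List.head?_append, h1], by simp [List.getLast?_append, h5], ?_⟩
  rw [List.isChain_append]
  refine ⟨h3, h6, ?_⟩
  intro a ha b hb
  rw [h2] at ha; rw [h4] at hb
  simp only [Option.mem_def, Option.some.injEq] at ha hb
  subst ha hb
  exact he

theorem IsPath.exists_append (hA : IsPath X Y p q A) (h : (u, v) ∈ pathEdges A) :
    ∃ A₁ A₂, A = A₁ ++ A₂ ∧ IsPath X Y p u A₁ ∧ IsPath X Y v q A₂ ∧ AGEdge X Y u v := by
  induction A generalizing p with
  | nil => simp [pathEdges] at h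
  | cons a A ih =>
    cases A with
    | nil => simp [pathEdges] at h
    | cons b A =>
      obtain ⟨h1, h2, h3⟩ := hA
      obtain ⟨h4, h5⟩ := List.isChain_cons_cons.1 h3
      simp only [List.head?_cons, Option.some.injEq] at h1
      subst h1
      rw [pathEdges_cons_cons, List.mem_cons] at h
      have h2 : (b :: A).getLast? = some q := by simpa using h2
      rcases h with h | h
      · simp only [Prod.mk.injEq] at h
        obtain ⟨rfl, rfl⟩ := h
        exact ⟨[u], v :: A, rfl, ⟨rfl, rfl, by simp⟩, ⟨rfl, h2, h5⟩, h4⟩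
      · obtain ⟨A₁, A₂, e, h6, h7, h8⟩ := ih ⟨rfl, h2, h5⟩ h
        have hne : A₁ ≠ [] := by rintro rfl; simp [IsPath] at h6
        refine ⟨a :: A₁, A₂, by rw [e]; rfl, ⟨rfl, ?_, ?_⟩, h7, h8⟩
        · cases A₁ with
          | nil => exact absurd rfl hne
          | cons x t => simpa using h6.2.1
        · cases A₁ with
          | nil => exact absurd rfl hne
          | cons x t =>
            have : x = b := by simpa using h6.1
            subst this
            exact List.isChain_cons_cons.2 ⟨h4, h6.2.2⟩

theorem IsPath.mem_bounds (hA : IsPath X Y p q A) (h : u ∈ A) :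
    p.1 ≤ u.1 ∧ p.2 ≤ u.2 ∧ u.1 ≤ q.1 ∧ u.2 ≤ q.2 := by
  induction A generalizing p u with
  | nil => simp at h
  | cons a A ih =>
    obtain ⟨h1, h2, h3⟩ := hA
    simp only [List.head?_cons, Option.some.injEq] at h1
    subst h1
    cases A with
    | nil =>
      simp at h h2
      subst h h2
      simp
    | cons b A =>
      obtain ⟨h4, h5⟩ := List.isChain_cons_cons.1 h3
      have h2 : (b :: A).getLast? = some q := by simpa using h2
      have hab : a.1 ≤ b.1 ∧ a.2 ≤ b.2 := by
        rcases h4 with h | h | h <;> simp [h.2.2]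
      rw [List.mem_cons] at h
      rcases h with rfl | h
      · have := ih (u := b) ⟨rfl, h2, h5⟩ List.mem_cons_self
        omega
      · have := ih ⟨rfl, h2, h5⟩ h
        omega

theorem IsPath.aligns_bounds (hA : IsPath X Y p q A) {i j : ℕ} (h : Aligns A i j) :
    p.1 ≤ i ∧ p.2 ≤ j ∧ i + 1 ≤ q.1 ∧ j + 1 ≤ q.2 := by
  obtain ⟨A₁, A₂, rfl, h1, h2, h3⟩ := hA.exists_append h
  have m1 : (i, j) ∈ A₁ := List.mem_of_getLast? h1.2.1
  have m2 : (i + 1, j + 1) ∈ A₂ := List.mem_of_head? h2.1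
  have := hA.mem_bounds (List.mem_append_left A₂ m1)
  have := hA.mem_bounds (List.mem_append_right A₁ m2)
  simp only at *
  omega

/-- A path is monotone, so its aligned pairs form a chain in both coordinates. Hence the mates of
two aligned characters are on the same side of them. -/
theorem IsPath.aligns_cases (hA : IsPath X Y p q A) {i j i' j' : ℕ} (h : Aligns A i j)
    (h' : Aligns A i' j') :
    (i' < i ∧ j' < j) ∨ (i' = i ∧ j' = j) ∨ (i < i' ∧ j < j') := by
  obtain ⟨A₁, A₂, rfl, h1, h2, h3⟩ := hA.exists_append h
  rw [Aligns, pathEdges_append h1.2.1 h2.1, List.mem_append, List.mem_cons] at h'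
  rcases h' with h' | h' | h'
  · have := h1.aligns_bounds h'
    simp only at this; omega
  · simp only [Prod.mk.injEq] at h'; omega
  · have := h2.aligns_bounds h'
    simp only at this; omega

theorem alignCost_append (V : Option β → Option β → ℝ) (hA : A.getLast? = some u)
    (hB : B.head? = some v) :
    alignCost V X Y (A ++ B) = alignCost V X Y A + edgeCost V X Y u v + alignCost V X Y B := by
  simp [alignCost, pathEdges_append hA hB]; ring

theorem alignCost_singleton (V : Option β → Option β → ℝ) (p : ℕ × ℕ) :
    alignCost V X Y [p] = 0 := by
  simp [alignCost, pathEdges]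

end Path

/-! ### Forest alignments as fragment alignments within the band -/

section Conversion

variable {α : Type*} {w : Option α → Option α → ℝ≥0} {k : ℕ} {F G : List (Paren α)}

/-- Every aligned pair of characters is aligned together with its pair of mates. -/
def SelfClosed (F G : List (Paren α)) (A : List (ℕ × ℕ)) : Prop :=
  ∀ i j, Aligns A i j → ∃ i' j', Aligns A i' j' ∧
    (IsNode F i i' ∧ IsNode G j j' ∨ IsNode F i' i ∧ IsNode G j' j)

theorem edgeCost_del (V : Option (Paren α) → Option (Paren α) → ℝ) (x y : ℕ) :
    edgeCost V F G (x, y) (x + 1, y) = V F[x]? none := by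
  simp [edgeCost]

theorem edgeCost_ins (V : Option (Paren α) → Option (Paren α) → ℝ) (x y : ℕ) :
    edgeCost V F G (x, y) (x, y + 1) = V none G[y]? := by
  simp [edgeCost]

theorem edgeCost_sub (V : Option (Paren α) → Option (Paren α) → ℝ) (x y : ℕ) :
    edgeCost V F G (x, y) (x + 1, y + 1) = V F[x]? G[y]? := by
  simp [edgeCost]

/-- In the case of aligned nodes, the path of the inside and the path of the rest are linked by the
two diagonal edges at the opening and at the closing parentheses; these carry the two `subCost`
terms. -/
theorem FragAlign.exists_path {l y r y' : ℕ} {c : ℝ} (h : FragAlign w k F G l y r y' c) :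
    ∃ A, IsPath F G (l, y) (r, y') A ∧ SelfClosed F G A ∧
      alignCost (parenWeight w) F G A = c := by
  induction h with
  | @nil x y hb => exact ⟨[(x, y)], ⟨rfl, rfl, by simp⟩, by simp [SelfClosed, Aligns, pathEdges],
      alignCost_singleton _ _⟩
  | @del x y r y' c hb hc ih =>
    obtain ⟨A, h1, h2, h3⟩ := ih
    have hb' := hc.band_left
    have e : pathEdges ([(x, y)] ++ A) = _ :=
      pathEdges_append (u := (x, y)) rfl h1.1
    have hA : ∀ i j, Aligns ([(x, y)] ++ A) i j ↔ Aligns A i j := by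
      intro i j
      rw [Aligns, e]
      simp [pathEdges, Aligns]
      omega
    refine ⟨[(x, y)] ++ A, IsPath.append ⟨rfl, rfl, by simp⟩ h1
      (.inl ⟨hb'.1, hb.2.1, rfl⟩), fun i j h => ?_, ?_⟩
    · obtain ⟨i', j', h4, h5⟩ := h2 i j ((hA i j).1 h)
      exact ⟨i', j', (hA i' j').2 h4, h5⟩
    · rw [alignCost_append (u := (x, y)) _ rfl h1.1, alignCost_singleton, edgeCost_del, h3, zero_add]
      rfl
  | @ins x y r y' c hb hc ih =>
    obtain ⟨A, h1, h2, h3⟩ := ih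
    have hb' := hc.band_left
    have e : pathEdges ([(x, y)] ++ A) = _ :=
      pathEdges_append (u := (x, y)) rfl h1.1
    have hA : ∀ i j, Aligns ([(x, y)] ++ A) i j ↔ Aligns A i j := by
      intro i j
      rw [Aligns, e]
      simp [pathEdges, Aligns]
      omega
    refine ⟨[(x, y)] ++ A, IsPath.append ⟨rfl, rfl, by simp⟩ h1
      (.inr (.inl ⟨hb.1, hb'.2.1, rfl⟩)), fun i j h => ?_, ?_⟩
    · obtain ⟨i', j', h4, h5⟩ := h2 i j ((hA i j).1 h)
      exact ⟨i', j', (hA i' j').2 h4, h5⟩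
    · rw [alignCost_append (u := (x, y)) _ rfl h1.1, alignCost_singleton, edgeCost_ins, h3, zero_add]
      rfl
  | @sub x y m z r y' c d hb hF hG hc hd ih ih' =>
    obtain ⟨A, h1, h2, h3⟩ := ih
    obtain ⟨B, g1, g2, g3⟩ := ih'
    have hb1 := hc.band_left
    have hb2 := hd.band_left
    have e1 : pathEdges (A ++ B) = _ := pathEdges_append h1.2.1 g1.1
    have hAB : IsPath F G (x + 1, y + 1) (r, y') (A ++ B) :=
      IsPath.append h1 g1 (.inr (.inr ⟨hb2.1, hb2.2.1, rfl⟩))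
    have e : pathEdges ([(x, y)] ++ (A ++ B)) = _ :=
      pathEdges_append (u := (x, y)) rfl hAB.1
    have hA : ∀ i j, Aligns ([(x, y)] ++ (A ++ B)) i j ↔
        (i = x ∧ j = y) ∨ Aligns A i j ∨ (i = m ∧ j = z) ∨ Aligns B i j := by
      intro i j
      rw [Aligns, e, e1]
      simp [pathEdges, Aligns]
    refine ⟨[(x, y)] ++ (A ++ B), IsPath.append ⟨rfl, rfl, by simp⟩ hAB
      (.inr (.inr ⟨hb1.1, hb1.2.1, rfl⟩)), fun i j h => ?_, ?_⟩
    · rcases (hA i j).1 h with ⟨rfl, rfl⟩ | h | ⟨rfl, rfl⟩ | h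
      · exact ⟨m, z, (hA _ _).2 (.inr (.inr (.inl ⟨rfl, rfl⟩))), .inl ⟨hF, hG⟩⟩
      · obtain ⟨i', j', h4, h5⟩ := h2 i j h
        exact ⟨i', j', (hA i' j').2 (.inr (.inl h4)), h5⟩
      · exact ⟨x, y, (hA _ _).2 (.inl ⟨rfl, rfl⟩), .inr ⟨hF, hG⟩⟩
      · obtain ⟨i', j', h4, h5⟩ := g2 i j h
        exact ⟨i', j', (hA i' j').2 (.inr (.inr (.inr h4))), h5⟩
    · rw [alignCost_append (u := (x, y)) _ rfl hAB.1, alignCost_singleton, edgeCost_sub,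
        alignCost_append _ h1.2.1 g1.1, edgeCost_sub, h3, g3, zero_add]
      simp only [subCost]
      ring

/-- Induction on the length of the path. If the first edge aligns two characters, then the path also
aligns their mates; it is cut at that edge into the path of the inside and the path of the rest.
Since nodes are nested, both pieces are self-closed again. -/
theorem IsPath.fragAlign : ∀ (N : ℕ) {A : List (ℕ × ℕ)} {p q : ℕ × ℕ}, A.length ≤ N →
    IsPath F G p q A → (∀ v ∈ A, InBand k F G v.1 v.2) → SelfClosed F G A →
    FragAlign w k F G p.1 p.2 q.1 q.2 (alignCost (parenWeight w) F G A) := by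
  intro N
  induction N with
  | zero =>
    intro A p q hN hA
    obtain rfl : A = [] := by simpa using hN
    simp [IsPath] at hA
  | succ N ih =>
    intro A p q hN hA hb hs
    obtain ⟨h1, h2, h3⟩ := id hA
    rcases A with _ | ⟨a, _ | ⟨b, l⟩⟩
    · simp at h1
    · simp at h1 h2
      subst h1 h2
      rw [alignCost_singleton]
      exact .nil (hb _ (by simp))
    simp only [List.head?_cons, Option.some.injEq] at h1
    subst h1
    obtain ⟨he, h5⟩ := List.isChain_cons_cons.1 h3
    have h2 : (b :: l).getLast? = some q := by simpa using h2
    have hp : IsPath F G b q (b :: l) := ⟨rfl, h2, h5⟩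
    have hcost : alignCost (parenWeight w) F G (a :: b :: l) =
        edgeCost (parenWeight w) F G a b + alignCost (parenWeight w) F G (b :: l) := by
      simp [alignCost, pathEdges_cons_cons]
    have hal : ∀ i j, Aligns (a :: b :: l) i j ↔ (a = (i, j) ∧ b = (i + 1, j + 1)) ∨
        Aligns (b :: l) i j := by
      intro i j
      simp only [Aligns, pathEdges_cons_cons, List.mem_cons, Prod.mk.injEq]
      constructor <;> rintro (⟨rfl, rfl⟩ | h) <;> simp_all
    have hb' : ∀ v ∈ b :: l, InBand k F G v.1 v.2 := fun v hv => hb v (List.mem_cons_of_mem _ hv)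
    have hN' : (b :: l).length ≤ N := by simpa using hN
    have hband := hb a List.mem_cons_self
    have hoff : (∀ i j, ¬ (a = (i, j) ∧ b = (i + 1, j + 1))) →
        FragAlign w k F G b.1 b.2 q.1 q.2 (alignCost (parenWeight w) F G (b :: l)) := by
      intro hno
      refine ih hN' hp hb' fun i j h => ?_
      obtain ⟨i', j', h6, h7⟩ := hs i j ((hal i j).2 (.inr h))
      exact ⟨i', j', ((hal i' j').1 h6).resolve_left (hno i' j'), h7⟩
    obtain ⟨x, y⟩ := a
    rw [hcost]
    rcases he with ⟨_, _, rfl⟩ | ⟨_, _, rfl⟩ | ⟨_, _, rfl⟩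
    · rw [edgeCost_del]
      exact .del hband (hoff (by simp))
    · rw [edgeCost_ins]
      exact .ins hband (hoff (by simp))
    · simp only at *
      rw [edgeCost_sub]
      obtain ⟨m, z, h6, h7⟩ := hs x y ((hal x y).2 (.inl ⟨rfl, rfl⟩))
      have hge := hA.aligns_bounds h6
      have hnode : IsNode F x m ∧ IsNode G y z := by
        rcases h7 with h7 | h7
        · exact h7
        · have := h7.1.lt
          simp only at hge; omega
      obtain ⟨hnF, hnG⟩ := hnode
      have hxm := hnF.lt
      have hin : Aligns ((x + 1, y + 1) :: l) m z := by
        refine ((hal m z).1 h6).resolve_left ?_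
        simp; omega
      obtain ⟨A₁, A₂, e, g1, g2, g3⟩ := hp.exists_append hin
      have hlen : A₁.length + A₂.length ≤ N := by
        rw [← List.length_append, ← e]; exact hN'
      have hsplit : ∀ i j, Aligns ((x + 1, y + 1) :: l) i j ↔
          Aligns A₁ i j ∨ (i = m ∧ j = z) ∨ Aligns A₂ i j := by
        intro i j
        rw [Aligns, e, pathEdges_append g1.2.1 g2.1]
        simp [Aligns]
      have c1 : SelfClosed F G A₁ := by
        intro i j h
        have hbd := g1.aligns_bounds h
        simp only at hbd
        obtain ⟨i', j', a1, a2⟩ := hs i j ((hal i j).2 (.inr ((hsplit i j).2 (.inl h))))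
        -- A node with one parenthesis strictly inside of `[x..m]` has the other one there too, so
        -- the partner pair cannot be on the second piece.
        have hpos : x < i' ∧ i' < m := by
          rcases a2 with ⟨a2, a3⟩ | ⟨a2, a3⟩
          · exact ⟨by have := a2.lt; omega, hnF.nest a2 (by omega) (by omega)⟩
          · have := a2.lt
            refine ⟨?_, by omega⟩
            by_contra hc
            rcases (not_lt.1 hc).eq_or_lt with rfl | hc
            · have := a2.right_unique hnF; omega
            · have := a2.nest hnF hc (by omega); omega
        refine ⟨i', j', ?_, a2⟩
        rcases (hal i' j').1 a1 with a4 | a4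
        · simp at a4; omega
        rcases (hsplit i' j').1 a4 with a5 | a5 | a5
        · exact a5
        · omega
        · have := g2.aligns_bounds a5
          simp only at this; omega
      have c2 : SelfClosed F G A₂ := by
        intro i j h
        have hbd := g2.aligns_bounds h
        simp only at hbd
        obtain ⟨i', j', a1, a2⟩ := hs i j ((hal i j).2 (.inr ((hsplit i j).2 (.inr (.inr h)))))
        -- The mate of a position after `m` is not in `[x..m]`, and positions before `x` are not on
        -- the path at all.
        have hpos : i' < x ∨ m < i' := by
          rcases a2 with ⟨a2, a3⟩ | ⟨a2, a3⟩
          · have := a2.lt; omega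
          · by_contra hc
            push Not at hc
            rcases hc.1.eq_or_lt with rfl | hc1
            · have := a2.right_unique hnF; omega
            rcases hc.2.eq_or_lt with rfl | hc2
            · exact a2.left_ne_right hnF rfl
            · have := hnF.nest a2 hc1 hc2; omega
        refine ⟨i', j', ?_, a2⟩
        rcases (hal i' j').1 a1 with a4 | a4
        · simp at a4; omega
        rcases (hsplit i' j').1 a4 with a5 | a5 | a5
        · have := g1.aligns_bounds a5
          simp only at this; omega
        · omega
        · exact a5
      have hne1 : 0 < A₁.length := List.length_pos_of_mem (List.mem_of_getLast? g1.2.1)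
      have hne2 : 0 < A₂.length := List.length_pos_of_mem (List.mem_of_head? g2.1)
      have f1 := ih (A := A₁) (by omega) g1
        (fun v hv => hb' v (by rw [e]; exact List.mem_append_left _ hv)) c1
      have f2 := ih (A := A₂) (by omega) g2
        (fun v hv => hb' v (by rw [e]; exact List.mem_append_right _ hv)) c2
      have := FragAlign.sub hband hnF hnG f1 f2
      rw [e, alignCost_append _ g1.2.1 g2.1, edgeCost_sub]
      simp only [subCost] at this
      convert this using 1
      ring

/-- Diagonal edges preserve y - x; the other edges change it by one and cost at least 1/2, because
the weights are normalized. -/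
theorem IsPath.band_bound (hw : Normalized w) {A : List (ℕ × ℕ)} {p q u : ℕ × ℕ}
    (hA : IsPath F G p q A) (hu : u ∈ A) :
    |((u.2 : ℝ) - u.1) - (p.2 - p.1)| ≤ 2 * alignCost (parenWeight w) F G A ∧
      0 ≤ alignCost (parenWeight w) F G A := by
  induction A generalizing p with
  | nil => simp at hu
  | cons a A ih =>
    obtain ⟨h1, h2, h3⟩ := hA
    simp only [List.head?_cons, Option.some.injEq] at h1
    subst h1
    cases A with
    | nil =>
      simp at hu
      subst hu
      simp [alignCost_singleton]
    | cons b A =>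
      obtain ⟨he, h5⟩ := List.isChain_cons_cons.1 h3
      have h2 : (b :: A).getLast? = some q := by simpa using h2
      have hcost : alignCost (parenWeight w) F G (a :: b :: A) =
          edgeCost (parenWeight w) F G a b + alignCost (parenWeight w) F G (b :: A) := by
        simp [alignCost, pathEdges_cons_cons]
      rw [hcost]
      have hedge : |((b.2 : ℝ) - b.1) - (a.2 - a.1)| ≤ 2 * edgeCost (parenWeight w) F G a b := by
        obtain ⟨x, y⟩ := a
        rcases he with ⟨hx, _, rfl⟩ | ⟨_, hy, rfl⟩ | ⟨_, _, rfl⟩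
        · rw [edgeCost_del]
          have : (1 : ℝ) ≤ w (F[x]?.map Paren.label) none := by
            exact_mod_cast hw.2 _ _ (by simp [List.getElem?_eq_getElem hx])
          simp only at this ⊢
          simp only [parenWeight, Option.map_none]
          push_cast
          rw [abs_le]; constructor <;> linarith
        · rw [edgeCost_ins]
          have : (1 : ℝ) ≤ w none (G[y]?.map Paren.label) := by
            exact_mod_cast hw.2 _ _ (by simp [List.getElem?_eq_getElem hy])
          simp only at this ⊢
          simp only [parenWeight, Option.map_none]
          push_cast
          rw [abs_le]; constructor <;> linarith
        · rw [edgeCost_sub]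
          have := parenWeight_nonneg (w := w) F[x]? G[y]?
          simp only at this ⊢
          push_cast
          rw [abs_le]; constructor <;> linarith
      have hn := (abs_nonneg _).trans hedge
      have hmain := ih ⟨rfl, h2, h5⟩ (p := b)
      rw [List.mem_cons] at hu
      rcases hu with rfl | hu
      · have : 0 ≤ alignCost (parenWeight w) F G (b :: A) := by
          apply List.sum_nonneg
          intro x hx
          obtain ⟨e, _, rfl⟩ := List.mem_map.1 hx
          unfold edgeCost
          split_ifs <;> exact parenWeight_nonneg _ _
        simp only [sub_self, abs_zero]
        constructor <;> linarith
      · obtain ⟨h6, h7⟩ := hmain hu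
        refine ⟨?_, by linarith⟩
        have := abs_add_le (((u.2 : ℝ) - u.1) - (b.2 - b.1)) (((b.2 : ℝ) - b.1) - (a.2 - a.1))
        rw [show ((u.2 : ℝ) - u.1) - (b.2 - b.1) + (((b.2 : ℝ) - b.1) - (a.2 - a.1)) =
          ((u.2 : ℝ) - u.1) - (a.2 - a.1) by ring] at this
        linarith

/-- A forest alignment of cost at most `k` is a fragment alignment within the band. -/
theorem IsForestAlignment.fragAlign (hF : BalancedStr F) (hG : BalancedStr G)
    (hw : Normalized w) {A : List (ℕ × ℕ)} (hA : IsForestAlignment F G A)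
    (hk : alignCost (parenWeight w) F G A ≤ k) :
    FragAlign w k F G 0 0 F.length G.length (alignCost (parenWeight w) F G A) := by
  obtain ⟨hp, hm⟩ := hA
  have hp : IsPath F G (0, 0) (F.length, G.length) A := hp
  refine hp.fragAlign (p := (0, 0)) (q := (F.length, G.length)) A.length le_rfl (fun v hv => ?_)
    fun i j h => ?_
  · have h1 := hp.mem_bounds hv
    have h2 := (hp.band_bound hw hv).1
    simp only [CharP.cast_eq_zero, sub_self, sub_zero] at h1 h2
    have h3 := abs_le.1 (h2.trans (mul_le_mul_of_nonneg_left hk zero_le_two))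
    refine ⟨h1.2.2.1, h1.2.2.2, ?_, ?_⟩
    · have : (v.1 : ℝ) ≤ (v.2 + 2 * k : ℕ) := by push_cast; linarith
      exact_mod_cast this
    · have : (v.2 : ℝ) ≤ (v.1 + 2 * k : ℕ) := by push_cast; linarith
      exact_mod_cast this
  · have hb := hp.aligns_bounds h
    simp only at hb
    obtain ⟨i', hi⟩ := hF.exists_node i (by omega)
    obtain ⟨j', hj⟩ := hG.exists_node j (by omega)
    have h' := hm i j i' j' h hi hj
    refine ⟨i', j', h', ?_⟩
    -- By monotonicity the two mates are on the same side, so an opening parenthesis is never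
    -- aligned to a closing one.
    have := hp.aligns_cases h h'
    rcases hi with hi | hi <;> rcases hj with hj | hj
    · exact .inl ⟨hi, hj⟩
    · have := hi.lt; have := hj.lt; omega
    · have := hi.lt; have := hj.lt; omega
    · exact .inr ⟨hi, hj⟩

theorem IsMate.unique {i j j' : ℕ} (h : IsMate F i j) (h' : IsMate F i j') : j = j' := by
  rcases h with h | h <;> rcases h' with h' | h'
  · exact h.right_unique h'
  · exact absurd rfl (h.left_ne_right h')
  · exact absurd rfl (h'.left_ne_right h)
  · exact h.left_unique h'

theorem FragAlign.exists_forestAlignment {c : ℝ}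
    (h : FragAlign w k F G 0 0 F.length G.length c) :
    ∃ A, IsForestAlignment F G A ∧ alignCost (parenWeight w) F G A = c := by
  obtain ⟨A, h1, h2, h3⟩ := h.exists_path
  refine ⟨A, ⟨h1, fun i j i' j' h hi hj => ?_⟩, h3⟩
  obtain ⟨i'', j'', h4, h5⟩ := h2 i j h
  have e : IsMate F i i'' ∧ IsMate G j j'' :=
    h5.elim (fun h => ⟨.inl h.1, .inl h.2⟩) (fun h => ⟨.inr h.1, .inr h.2⟩)
  rw [hi.unique e.1, hj.unique e.2]
  exact h4

end Conversion


/-! ### Entries of distance matrices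

The offset of a vertex `(x, y)` in the band is the number `a ≤ 4k` with `y + 2k = x + a`. -/

section Entries

variable {α : Type*} {w : Option α → Option α → ℝ≥0} {k : ℕ} {F G : List (Paren α)}

/-- `v` is the cost of some fragment alignment from offset `a` to offset `b`, rounded up,
or larger than the threshold. -/
def UpperEntry (w : Option α → Option α → ℝ≥0) (k : ℕ) (F G : List (Paren α)) (l r a b : ℕ)
    (v : ℝ) : Prop :=
  0 ≤ v ∧ (v ≤ k → ∃ y z c, y + 2 * k = l + a ∧ z + 2 * k = r + b ∧
    FragAlign w k F G l y r z c ∧ c ≤ v)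

/-- `v` is at most the cost of every fragment alignment from offset `a` to offset `b`. -/
def LowerEntry (w : Option α → Option α → ℝ≥0) (k : ℕ) (F G : List (Paren α)) (l r a b : ℕ)
    (v : ℝ) : Prop :=
  ∀ y z c, y + 2 * k = l + a → z + 2 * k = r + b → FragAlign w k F G l y r z c → v ≤ c

/-- `v` is the distance of the fragments, up to changes above the threshold. -/
def GoodEntry (w : Option α → Option α → ℝ≥0) (k : ℕ) (F G : List (Paren α)) (l r a b : ℕ)
    (v : ℝ) : Prop :=
  UpperEntry w k F G l r a b v ∧ LowerEntry w k F G l r a b v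

theorem upperEntry_of_lt {l r a b : ℕ} {v : ℝ} (h : (k : ℝ) < v) : UpperEntry w k F G l r a b v :=
  ⟨(Nat.cast_nonneg k).trans h.le, fun h' => absurd h' (not_le.2 h)⟩

theorem delCost_nonneg (x : ℕ) : 0 ≤ delCost w F x := parenWeight_nonneg _ _

theorem insCost_nonneg (y : ℕ) : 0 ≤ insCost w G y := parenWeight_nonneg _ _

theorem subCost_nonneg (x y : ℕ) : 0 ≤ subCost w F G x y := parenWeight_nonneg _ _

/-- Nonnegativity is part of `UpperEntry` for this purpose: if a sum is at most `k`, then so are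
both summands, and both alignments exist. -/
theorem UpperEntry.mul {l p r a b c : ℕ} {u v : ℝ} (h : UpperEntry w k F G l p a c u)
    (h' : UpperEntry w k F G p r c b v) : UpperEntry w k F G l r a b (u + v) := by
  refine ⟨add_nonneg h.1 h'.1, fun hk => ?_⟩
  obtain ⟨y, z, d, h1, h2, h3, h4⟩ := h.2 (by linarith [h'.1])
  obtain ⟨y', z', d', h1', h2', h3', h4'⟩ := h'.2 (by linarith [h.1])
  obtain rfl : z = y' := by omega
  exact ⟨y, z', _, h1, h2', h3.append h3', add_le_add h4 h4'⟩

/-- As no node crosses `p`, every alignment passes through some vertex (p, q); it is in the band, so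
its offset is one of the indices `c ≤ 4k` of the product. -/
theorem LowerEntry.mul {l p r a b : ℕ} {v : ℝ} (hl : l ≤ p) (hr : p ≤ r)
    (hp : ∀ i j, IsNode F i j → l ≤ i → j < r → i < p → p ≤ j → False)
    (h : ∀ c ≤ 4 * k, ∃ u u', LowerEntry w k F G l p a c u ∧ LowerEntry w k F G p r c b u' ∧
      v ≤ u + u') : LowerEntry w k F G l r a b v := by
  intro y z c h1 h2 h3
  obtain ⟨q, d, e, h4, h5, rfl⟩ := h3.split hl hr hp
  have hb := h4.band_right
  obtain ⟨u, u', h6, h7, h8⟩ := h (q + 2 * k - p) (by obtain ⟨_, _, _, _⟩ := hb; omega)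
  obtain ⟨_, _, _, _⟩ := hb
  have := h6 y q d h1 (by omega) h4
  have := h7 q z e (by omega) h2 h5
  linarith

/-! Extension to the right. -/

theorem UpperEntry.del_right {l r a b : ℕ} {v : ℝ} (h : UpperEntry w k F G l r a (b + 1) v)
    (hr : r + 1 ≤ F.length) (hb : b ≤ 4 * k) :
    UpperEntry w k F G l (r + 1) a b (v + delCost w F r) := by
  refine ⟨add_nonneg h.1 (delCost_nonneg _), fun hk => ?_⟩
  obtain ⟨y, z, d, h1, h2, h3, h4⟩ := h.2 (by linarith [delCost_nonneg (w := w) (F := F) r])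
  have hB := h3.band_right
  have hB' : InBand k F G (r + 1) z := by
    obtain ⟨_, _, _, _⟩ := hB
    refine ⟨hr, ?_, ?_, ?_⟩ <;> omega
  exact ⟨y, z, _, h1, by omega, h3.append (.single_del hB hB'), by linarith⟩

theorem UpperEntry.ins_right {l r a b z₀ : ℕ} {v : ℝ} (h : UpperEntry w k F G l r a b v)
    (hz : z₀ + 2 * k = r + b) (hG : z₀ < G.length) (hb : b + 1 ≤ 4 * k) :
    UpperEntry w k F G l r a (b + 1) (v + insCost w G z₀) := by
  refine ⟨add_nonneg h.1 (insCost_nonneg _), fun hk => ?_⟩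
  obtain ⟨y, z, d, h1, h2, h3, h4⟩ := h.2 (by linarith [insCost_nonneg (w := w) (G := G) z₀])
  obtain rfl : z = z₀ := by omega
  have hB := h3.band_right
  have hB' : InBand k F G r (z + 1) := by
    obtain ⟨_, _, _, _⟩ := hB
    refine ⟨?_, ?_, ?_, ?_⟩ <;> omega
  exact ⟨y, z + 1, _, h1, by omega, h3.append (.single_ins hB hB'), by linarith⟩

theorem UpperEntry.sub {l r a b c m r₀ z z₀ : ℕ} {u v : ℝ} (h : UpperEntry w k F G l m a c u)
    (h' : UpperEntry w k F G (m + 1) r₀ c b v) (hF : IsNode F m r₀) (hG : IsNode G z z₀)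
    (hz : z + 2 * k = m + c) (hz₀ : z₀ + 2 * k = r₀ + b)
    (hr : r = r₀ + 1) :
    UpperEntry w k F G l r a b (u + v + subCost w F G m z + subCost w F G r₀ z₀) := by
  subst hr
  have s1 := subCost_nonneg (w := w) (F := F) (G := G) m z
  have s2 := subCost_nonneg (w := w) (F := F) (G := G) r₀ z₀
  refine ⟨by linarith [h.1, h'.1], fun hk => ?_⟩
  obtain ⟨y, z', d, h1, h2, h3, h4⟩ := h.2 (by linarith [h'.1])
  obtain ⟨y', z₀', d', h1', h2', h3', h4'⟩ := h'.2 (by linarith [h.1])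
  obtain rfl : z = z' := by omega
  obtain rfl : y' = z + 1 := by omega
  obtain rfl : z₀' = z₀ := by omega
  have hB := h3'.band_right
  have hB' : InBand k F G (r₀ + 1) (z₀' + 1) := by
    obtain ⟨_, _, _, _⟩ := hB
    have := hF.lt_length
    have := hG.lt_length
    refine ⟨?_, ?_, ?_, ?_⟩ <;> omega
  refine ⟨y, z₀' + 1, _, h1, by omega,
    h3.append (.sub h3.band_right hF hG h3' (.nil hB')), by linarith⟩

/-- The three hypotheses correspond to the possible last steps in `FragAlign.tail`. Passing from `r`
to `r + 1` lowers the offset of an unchanged position of G by one, so a deletion comes from offset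
`b + 1`, an insertion from `b - 1`, and in an alignment of two closing parentheses the offset `b` is
kept. -/
theorem LowerEntry.step_right {l r a b : ℕ} {v : ℝ} (hl : l ≤ r)
    (hdel : b + 1 ≤ 4 * k → ∃ u, LowerEntry w k F G l r a (b + 1) u ∧ v ≤ u + delCost w F r)
    (hins : ∀ z₀ b', b = b' + 1 → z₀ + 1 + 2 * k = r + 1 + b → z₀ < G.length →
      ∃ u, LowerEntry w k F G l (r + 1) a b' u ∧ v ≤ u + insCost w G z₀)
    (hsub : ∀ m z z₀ c, IsNode F m r → l ≤ m → IsNode G z z₀ → z + 2 * k = m + c → c ≤ 4 * k →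
      z₀ + 2 * k = r + b → ∃ u u', LowerEntry w k F G l m a c u ∧
        LowerEntry w k F G (m + 1) r c b u' ∧
        v ≤ u + u' + subCost w F G m z + subCost w F G r z₀) :
    LowerEntry w k F G l (r + 1) a b v := by
  intro y z c h1 h2 h3
  rcases h3.tail with ⟨rfl, -, -⟩ | ⟨r₀, d, e, h4, rfl⟩ | ⟨z₀, d, rfl, h4, rfl⟩ |
    ⟨m, z', r₀, z₀, d, e, e', rfl, h4, h5, h6, h7, rfl⟩
  · omega
  · obtain rfl : r = r₀ := by omega
    obtain ⟨_, _, _, _⟩ := h4.band_right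
    obtain ⟨u, h5, h6⟩ := hdel (by omega)
    have := h5 y z d h1 (by omega) h4
    linarith
  · obtain ⟨_, _, _, _⟩ := h4.band_right
    obtain ⟨u, h5, h6⟩ := hins z₀ (b - 1) (by omega) (by omega) h3.band_right.2.1
    have := h5 y z₀ d h1 (by omega) h4
    linarith
  · obtain rfl : r = r₀ := by omega
    obtain ⟨_, _, _, _⟩ := h6.band_right
    obtain ⟨u, u', h8, h9, h10⟩ := hsub m z' z₀ (z' + 2 * k - m) h4 h6.le.1 h5 (by omega)
      (by omega) (by omega)
    have := h8 y z' d h1 (by omega) h6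
    have := h9 (z' + 1) z₀ e (by omega) (by omega) h7
    linarith

/-! Extension to the left. -/

theorem UpperEntry.del_left {x r a b : ℕ} {v : ℝ} (h : UpperEntry w k F G (x + 1) r a b v)
    (ha : a + 1 ≤ 4 * k) : UpperEntry w k F G x r (a + 1) b (v + delCost w F x) := by
  refine ⟨add_nonneg h.1 (delCost_nonneg _), fun hk => ?_⟩
  obtain ⟨y, z, d, h1, h2, h3, h4⟩ := h.2 (by linarith [delCost_nonneg (w := w) (F := F) x])
  have hB := h3.band_left
  have hB' : InBand k F G x y := by
    obtain ⟨_, _, _, _⟩ := hB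
    refine ⟨?_, ?_, ?_, ?_⟩ <;> omega
  exact ⟨y, z, _, by omega, h2, .del hB' h3, by linarith⟩

theorem UpperEntry.ins_left {x r a b y₀ : ℕ} {v : ℝ} (h : UpperEntry w k F G x r (a + 1) b v)
    (hy : y₀ + 2 * k = x + a) : UpperEntry w k F G x r a b (v + insCost w G y₀) := by
  refine ⟨add_nonneg h.1 (insCost_nonneg _), fun hk => ?_⟩
  obtain ⟨y, z, d, h1, h2, h3, h4⟩ := h.2 (by linarith [insCost_nonneg (w := w) (G := G) y₀])
  obtain rfl : y = y₀ + 1 := by omega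
  have hB := h3.band_left
  have hB' : InBand k F G x y₀ := by
    obtain ⟨_, _, _, _⟩ := hB
    refine ⟨?_, ?_, ?_, ?_⟩ <;> omega
  exact ⟨y₀, z, _, hy, h2, .ins hB' h3, by linarith⟩

theorem UpperEntry.sub_left {x r a b c m y₀ z₀ : ℕ} {u v : ℝ}
    (h : UpperEntry w k F G (x + 1) m a c u) (h' : UpperEntry w k F G (m + 1) r c b v)
    (hF : IsNode F x m) (hG : IsNode G y₀ z₀) (hy : y₀ + 2 * k = x + a)
    (hz : z₀ + 2 * k = m + c) :
    UpperEntry w k F G x r a b (u + v + subCost w F G x y₀ + subCost w F G m z₀) := by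
  have s1 := subCost_nonneg (w := w) (F := F) (G := G) x y₀
  have s2 := subCost_nonneg (w := w) (F := F) (G := G) m z₀
  refine ⟨by linarith [h.1, h'.1], fun hk => ?_⟩
  obtain ⟨y, z', d, h1, h2, h3, h4⟩ := h.2 (by linarith [h'.1])
  obtain ⟨y', z₀', d', h1', h2', h3', h4'⟩ := h'.2 (by linarith [h.1])
  obtain rfl : y = y₀ + 1 := by omega
  obtain rfl : z' = z₀ := by omega
  obtain rfl : y' = z' + 1 := by omega
  have hB := h3.band_left
  have hB' : InBand k F G x y₀ := by
    obtain ⟨_, _, _, _⟩ := hB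
    refine ⟨?_, ?_, ?_, ?_⟩ <;> omega
  exact ⟨y₀, z₀', _, hy, h2', .sub hB' hF hG h3 h3', by linarith⟩

/-- The constructors of `FragAlign` take off steps at the left end, so a case distinction suffices
here. The roles of the offsets are reversed: a deletion uses `a - 1` and an insertion uses `a + 1`.
-/
theorem LowerEntry.step_left {x r a b : ℕ} {v : ℝ} (hr : x < r)
    (hdel : ∀ a', a = a' + 1 →
      ∃ u, LowerEntry w k F G (x + 1) r a' b u ∧ v ≤ u + delCost w F x)
    (hins : ∀ y₀, y₀ + 2 * k = x + a → y₀ < G.length → a + 1 ≤ 4 * k →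
      ∃ u, LowerEntry w k F G x r (a + 1) b u ∧ v ≤ u + insCost w G y₀)
    (hsub : ∀ m y₀ z₀ c, IsNode F x m → m < r → IsNode G y₀ z₀ → y₀ + 2 * k = x + a →
      z₀ + 2 * k = m + c → c ≤ 4 * k → ∃ u u', LowerEntry w k F G (x + 1) m a c u ∧
        LowerEntry w k F G (m + 1) r c b u' ∧
        v ≤ u + u' + subCost w F G x y₀ + subCost w F G m z₀) :
    LowerEntry w k F G x r a b v := by
  intro y z c h1 h2 h3
  have hb := h3.band_left
  cases h3 with
  | nil => omega
  | @del _ _ _ _ d _ h4 =>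
    obtain ⟨_, _, _, _⟩ := h4.band_left
    obtain ⟨u, h5, h6⟩ := hdel (a - 1) (by omega)
    have := h5 y z d (by omega) h2 h4
    linarith
  | @ins _ _ _ _ d _ h4 =>
    obtain ⟨_, _, _, _⟩ := h4.band_left
    obtain ⟨u, h5, h6⟩ := hins y h1 (by omega) (by omega)
    have := h5 (y + 1) z d (by omega) h2 h4
    linarith
  | @sub _ _ m z₀ _ _ d e _ hF hG h6 h7 =>
    obtain ⟨_, _, _, _⟩ := h6.band_right
    obtain ⟨u, u', h8, h9, h10⟩ := hsub m y z₀ (z₀ + 2 * k - m) hF (by have := h7.le.1; omega) hG h1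
      (by omega) (by omega)
    have := h8 (y + 1) z₀ d (by omega) (by omega) h6
    have := h9 (z₀ + 1) z e (by omega) h2 h7
    linarith

/-! Empty fragments. -/

theorem UpperEntry.empty {x a y : ℕ} (hx : x ≤ F.length) (hy : y + 2 * k = x + a)
    (hG : y ≤ G.length) (ha : a ≤ 4 * k) : UpperEntry w k F G x x a a 0 :=
  ⟨le_rfl, fun _ => ⟨y, y, 0, hy, hy, .nil ⟨hx, hG, by omega, by omega⟩, le_rfl⟩⟩

/-- An empty fragment of F allows only insertions, so it suffices to look at the last inserted
character. -/
theorem LowerEntry.empty {x a b : ℕ} {v : ℝ}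
    (h0 : ∀ y, y + 2 * k = x + a → y ≤ G.length → a = b → v ≤ 0)
    (hins : ∀ z₀ b', b = b' + 1 → a ≤ b' → z₀ + 2 * k = x + b' → z₀ < G.length →
      ∃ u, LowerEntry w k F G x x a b' u ∧ v ≤ u + insCost w G z₀) :
    LowerEntry w k F G x x a b v := by
  intro y z c h1 h2 h3
  rcases h3.tail with ⟨-, rfl, rfl⟩ | ⟨r₀, d, e, h4, rfl⟩ | ⟨z₀, d, rfl, h4, rfl⟩ |
    ⟨m, z', r₀, z₀, d, e, e', rfl, h4, h5, h6, h7, rfl⟩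
  · exact h0 y h1 h3.band_left.2.1 (by omega)
  · have := h4.le; omega
  · obtain ⟨_, _, _, _⟩ := h4.band_right
    have := h4.le
    obtain ⟨u, h5, h6⟩ := hins z₀ (b - 1) (by omega) (by omega) (by omega) h3.band_right.2.1
    have := h5 y z₀ d h1 (by omega) h4
    linarith
  · have := h6.le; have := h7.le; omega

/-! Translation. -/

/-- An alignment in the band touches only the positions of G from `l - 2k` to `r + 2k`, so it can be
translated if G has the period `d` there. The lower bound needs the translation in the opposite
direction. -/
theorem GoodEntry.shift {l r a b d : ℕ} {v : ℝ} (h : GoodEntry w k F G l r a b v)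
    (hF : ∀ t, l ≤ t → t < r → F[t]? = F[t + d]?)
    (hG : ∀ t, l ≤ t + 2 * k → t < r + 2 * k → G[t]? = G[t + d]?)
    (hl : 2 * k ≤ l) (hr : r + d ≤ F.length) (hr' : r + d + 2 * k ≤ G.length) :
    GoodEntry w k F G (l + d) (r + d) a b v := by
  refine ⟨⟨h.1.1, fun hk => ?_⟩, fun y z c h1 h2 h3 => ?_⟩
  · obtain ⟨y, z, c, h1, h2, h3, h4⟩ := h.1.2 hk
    obtain ⟨_, _, _, _⟩ := h3.band_left
    obtain ⟨_, _, _, _⟩ := h3.band_right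
    refine ⟨y + d, z + d, c, by omega, by omega, h3.shift (by omega) (by omega) (by omega)
      (fun t ht => ?_) (fun t ht => ?_) hr (by omega), h4⟩
    · rw [hF _ (by omega) ht]; congr 1; omega
    · rw [hG _ (by omega) (by omega)]; congr 1; omega
  · obtain ⟨_, _, _, _⟩ := h3.band_left
    obtain ⟨_, _, _, _⟩ := h3.band_right
    have := h3.le
    refine h.2 (y - d) (z - d) c (by omega) (by omega) (h3.shift (by omega) (by omega) (by omega)
      (fun t ht => ?_) (fun t ht => ?_) (by omega) (by omega))
    · rw [hF (l + t) (by omega) (by omega)]; congr 1; omega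
    · rw [hG (y - d + t) (by omega) (by omega)]; congr 1; omega

/-- The capped distance is determined by a good entry for the entire strings. -/
theorem tedLE_eq_of_goodEntry (hF : BalancedStr F) (hG : BalancedStr G) (hw : Normalized w)
    {b : ℕ} {v : ℝ} (hb : G.length + 2 * k = F.length + b)
    (h : GoodEntry w k F G 0 F.length (2 * k) b v) :
    tedLE w k F G = if v ≤ k then (v : WithTop ℝ) else ⊤ := by
  have hle : ted w F G ≤ k → v ≤ ted w F G := fun hk => by
    obtain ⟨A, hA, he⟩ := (ted_isLeast w F G).1
    have := hA.fragAlign hF hG hw (he.trans_le hk)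
    rw [he] at this
    exact h.2 0 G.length _ (by omega) hb this
  have hge : v ≤ k → ted w F G ≤ v := fun hk => by
    obtain ⟨y, z, c, h1, h2, h3, h4⟩ := h.1.2 hk
    obtain rfl : y = 0 := by omega
    obtain rfl : z = G.length := by omega
    obtain ⟨A, hA, rfl⟩ := h3.exists_forestAlignment
    exact ((ted_isLeast w F G).2 ⟨A, hA, rfl⟩).trans h4
  unfold tedLE
  by_cases hv : v ≤ k
  · have h1 := hge hv
    have h2 := hle (h1.trans hv)
    rw [if_pos (h1.trans hv), if_pos hv, le_antisymm h1 h2]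
  · rw [if_neg hv, if_neg fun hk => hv ((hle hk).trans hk)]

theorem tedLE_eq_top (hF : BalancedStr F) (hG : BalancedStr G) (hw : Normalized w)
    (hb : ¬ InBand k F G F.length G.length) : tedLE w k F G = ⊤ := by
  unfold tedLE
  rw [if_neg]
  intro hk
  obtain ⟨A, hA, he⟩ := (ted_isLeast w F G).1
  exact hb (hA.fragAlign hF hG hw (he.trans_le hk)).band_right

end Entries


/-! ### Program notation and a program logic -/

instance (n : ℕ) : OfNat WExp n := ⟨.const n⟩
instance : Add WExp := ⟨.add⟩
instance : Sub WExp := ⟨.sub⟩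
instance : Mul WExp := ⟨.mul⟩
instance : Div WExp := ⟨.div⟩
instance : Add RExp := ⟨.add⟩

infixr:60 " ;; " => Cmd.seq

/-- The condition `e < f`. -/
def BExp.wlt (e f : WExp) : BExp := .not (.wle f e)

/-- The condition `e = f`. -/
def BExp.weq (e f : WExp) : BExp := .and (.wle e f) (.wle f e)

/-- The word variable `x`. -/
abbrev wv (x : ℕ) : WExp := .var x

attribute [simp] WExp.eval RExp.eval BExp.eval WExp.cost RExp.cost BExp.cost

section EvalLemmas

variable (orc : ℕ → ℕ → ℝ) (s : RAMState) (e f : WExp) (p q : RExp)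

@[simp] theorem WExp.eval_add : (e + f).eval s = e.eval s + f.eval s := rfl
@[simp] theorem WExp.eval_sub : (e - f).eval s = e.eval s - f.eval s := rfl
@[simp] theorem WExp.eval_mul : (e * f).eval s = e.eval s * f.eval s := rfl
@[simp] theorem WExp.eval_div : (e / f).eval s = e.eval s / f.eval s := rfl
@[simp] theorem WExp.eval_ofNat (n : ℕ) : (OfNat.ofNat n : WExp).eval s = n := rfl
@[simp] theorem RExp.eval_add : (p + q).eval orc s = p.eval orc s + q.eval orc s := rfl
@[simp] theorem WExp.cost_add : (e + f).cost = e.cost + f.cost + 1 := rfl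
@[simp] theorem WExp.cost_sub : (e - f).cost = e.cost + f.cost + 1 := rfl
@[simp] theorem WExp.cost_mul : (e * f).cost = e.cost + f.cost + 1 := rfl
@[simp] theorem WExp.cost_div : (e / f).cost = e.cost + f.cost + 1 := rfl
@[simp] theorem WExp.cost_ofNat (n : ℕ) : (OfNat.ofNat n : WExp).cost = 1 := rfl
@[simp] theorem RExp.cost_add : (p + q).cost = p.cost + q.cost + 1 := rfl
@[simp] theorem BExp.eval_wlt : (BExp.wlt e f).eval orc s ↔ e.eval s < f.eval s := by
  simp [BExp.wlt]
@[simp] theorem BExp.eval_weq : (BExp.weq e f).eval orc s ↔ e.eval s = f.eval s := by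
  simp [BExp.weq, le_antisymm_iff]
@[simp] theorem BExp.cost_wlt : (BExp.wlt e f).cost = f.cost + e.cost + 2 := rfl
@[simp] theorem BExp.cost_weq :
    (BExp.weq e f).cost = (e.cost + f.cost + 1) + (f.cost + e.cost + 1) + 1 := rfl

end EvalLemmas

namespace RAMState

variable (s : RAMState) (x y a b i j v : ℕ) (u : ℝ)

@[simp] theorem setW_wvar : (s.setW x v).wvar y = if y = x then v else s.wvar y := by
  simp [setW, Function.update_apply]
@[simp] theorem setW_warr : (s.setW x v).warr = s.warr := rfl
@[simp] theorem setW_rvar : (s.setW x v).rvar = s.rvar := rfl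
@[simp] theorem setW_rarr : (s.setW x v).rarr = s.rarr := rfl
@[simp] theorem setR_wvar : (s.setR x u).wvar = s.wvar := rfl
@[simp] theorem setR_warr : (s.setR x u).warr = s.warr := rfl
@[simp] theorem setR_rvar : (s.setR x u).rvar y = if y = x then u else s.rvar y := by
  simp [setR, Function.update_apply]
@[simp] theorem setR_rarr : (s.setR x u).rarr = s.rarr := rfl
@[simp] theorem storeW_wvar : (s.storeW a i v).wvar = s.wvar := rfl
@[simp] theorem storeW_warr : (s.storeW a i v).warr b j =
    if b = a ∧ j = i then v else s.warr b j := by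
  by_cases h : b = a
  · subst h; simp [storeW, Function.update_apply]
  · simp [storeW, h]
@[simp] theorem storeW_rvar : (s.storeW a i v).rvar = s.rvar := rfl
@[simp] theorem storeW_rarr : (s.storeW a i v).rarr = s.rarr := rfl
@[simp] theorem storeR_wvar : (s.storeR a i u).wvar = s.wvar := rfl
@[simp] theorem storeR_warr : (s.storeR a i u).warr = s.warr := rfl
@[simp] theorem storeR_rvar : (s.storeR a i u).rvar = s.rvar := rfl
@[simp] theorem storeR_rarr : (s.storeR a i u).rarr b j =
    if b = a ∧ j = i then u else s.rarr b j := by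
  by_cases h : b = a
  · subst h; simp [storeR, Function.update_apply]
  · simp [storeR, h]

end RAMState

/-- From the state `s` the command `c` halts in a state and after a time that satisfy `Q`. -/
def Halts (orc : ℕ → ℕ → ℝ) (B : ℕ) (c : Cmd) (s : RAMState) (Q : RAMState → ℕ → Prop) : Prop :=
  ∃ s' T, Exec orc B c s s' T ∧ Q s' T

section Rules

variable {orc : ℕ → ℕ → ℝ} {B : ℕ} {c d : Cmd} {s : RAMState} {Q R : RAMState → ℕ → Prop}

theorem Halts.mono (h : Halts orc B c s R) (hQ : ∀ s' T, R s' T → Q s' T) : Halts orc B c s Q :=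
  let ⟨s', T, h1, h2⟩ := h
  ⟨s', T, h1, hQ _ _ h2⟩

theorem Halts.skip (h : Q s 1) : Halts orc B .skip s Q := ⟨_, _, .skip s, h⟩

theorem Halts.setW {x : ℕ} {e : WExp} (hB : e.eval s ≤ B)
    (h : Q (s.setW x (e.eval s)) (e.cost + 1)) : Halts orc B (.setW x e) s Q :=
  ⟨_, _, .setW s x e hB, h⟩

theorem Halts.setR {x : ℕ} {e : RExp} (h : Q (s.setR x (e.eval orc s)) (e.cost + 1)) :
    Halts orc B (.setR x e) s Q :=
  ⟨_, _, .setR s x e, h⟩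

theorem Halts.storeW {a : ℕ} {i e : WExp} (hi : i.eval s ≤ B) (hB : e.eval s ≤ B)
    (h : Q (s.storeW a (i.eval s) (e.eval s)) (i.cost + e.cost + 1)) :
    Halts orc B (.storeW a i e) s Q :=
  ⟨_, _, .storeW s a i e hi hB, h⟩

theorem Halts.storeR {a : ℕ} {i : WExp} {e : RExp} (hi : i.eval s ≤ B)
    (h : Q (s.storeR a (i.eval s) (e.eval orc s)) (i.cost + e.cost + 1)) :
    Halts orc B (.storeR a i e) s Q :=
  ⟨_, _, .storeR s a i e hi, h⟩

theorem Halts.seq (h : Halts orc B c s fun s' T => Halts orc B d s' fun s'' T' => Q s'' (T + T')) :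
    Halts orc B (c ;; d) s Q :=
  let ⟨_, _, h1, _, _, h2, h3⟩ := h
  ⟨_, _, .seq h1 h2, h3⟩

theorem Halts.ite {b : BExp}
    (ht : b.eval orc s → Halts orc B c s fun s' T => Q s' (b.cost + 1 + T))
    (hf : ¬ b.eval orc s → Halts orc B d s fun s' T => Q s' (b.cost + 1 + T)) :
    Halts orc B (.ite b c d) s Q := by
  by_cases hb : b.eval orc s
  · obtain ⟨_, _, h1, h2⟩ := ht hb
    exact ⟨_, _, .iteTrue hb h1, h2⟩
  · obtain ⟨_, _, h1, h2⟩ := hf hb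
    exact ⟨_, _, .iteFalse hb h1, h2⟩

/-- The rule for loops, with an invariant and a potential that pays for the iterations. -/
theorem Halts.while {b : BExp} (I : RAMState → Prop) (Φ : RAMState → ℕ) (h0 : I s)
    (hstep : ∀ s, I s → b.eval orc s →
      Halts orc B c s fun s' T => I s' ∧ Φ s' + T + b.cost + 1 ≤ Φ s) :
    Halts orc B (.while b c) s fun s' T =>
      I s' ∧ ¬ b.eval orc s' ∧ Φ s' + T ≤ Φ s + b.cost + 1 := by
  obtain ⟨N, hN⟩ : ∃ N, Φ s ≤ N := ⟨_, le_rfl⟩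
  induction N generalizing s with
  | zero =>
    by_cases hb : b.eval orc s
    · obtain ⟨s', T, h1, h2, h3⟩ := hstep s h0 hb
      omega
    · exact ⟨s, _, .whileFalse hb, h0, hb, by omega⟩
  | succ N ih =>
    by_cases hb : b.eval orc s
    · obtain ⟨s', T, h1, h2, h3⟩ := hstep s h0 hb
      obtain ⟨s'', T', h4, h5, h6, h7⟩ := ih h2 (by omega)
      exact ⟨s'', _, .whileTrue hb h1 h4, h5, h6, by omega⟩
    · exact ⟨s, _, .whileFalse hb, h0, hb, by omega⟩

/-- The command that runs `body` for `i = 0, …, N - 1`. -/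
def Cmd.forLoop (i : ℕ) (N : WExp) (body : Cmd) : Cmd :=
  .setW i 0 ;; .while (.wlt (wv i) N) (body ;; .setW i (wv i + 1))

/-- The rule for counting loops, with a bound `C` on the time of an iteration. -/
theorem Halts.forLoop {i : ℕ} {e : WExp} {N : ℕ} (I : ℕ → RAMState → Prop) (C : ℕ)
    (hNB : N ≤ B) (h0 : I 0 (s.setW i 0))
    (hN : ∀ q s, I q s → e.eval s = N)
    (hset : ∀ q s, q < N → I q s → s.wvar i = q)
    (hstep : ∀ q s, q < N → I q s → s.wvar i = q → Halts orc B c s fun s' T =>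
      s'.wvar i = q ∧ T ≤ C ∧ I (q + 1) (s'.setW i (q + 1)))
    (hQ : ∀ s' T, I N s' → T ≤ (C + e.cost + 8) * N + e.cost + 7 → Q s' T) :
    Halts orc B (.forLoop i e c) s Q := by
  refine .seq (.setW (by simp) ?_)
  refine (Halts.while (fun s => ∃ q ≤ N, I q s ∧ (q < N → s.wvar i = q) ∧ (q = N → s.wvar i = N))
    (fun s => (C + e.cost + 8) * (N - s.wvar i)) ⟨0, by omega, ?_, ?_, ?_⟩ ?_).mono ?_
  · simpa using h0
  · intro h; simp
  · intro h; simp; omega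
  · rintro s ⟨q, hq, hI, h1, h2⟩ hb
    have hNs := hN q s hI
    have hlt : q < N := by
      by_contra hc
      have := h2 (by omega)
      simp [hNs] at hb; omega
    have hqi := h1 hlt
    refine .seq ((hstep q s hlt hI hqi).mono ?_)
    rintro s' T ⟨h3, h4, h5⟩
    refine .setW (by simp [h3]; omega) ⟨⟨q + 1, hlt, ?_, ?_, ?_⟩, ?_⟩
    · simpa [h3] using h5
    · simp [h3]
    · simp [h3]
    · simp only [BExp.cost_wlt, WExp.cost, WExp.cost_add, WExp.cost_ofNat, WExp.eval_add,
        WExp.eval, WExp.eval_ofNat, RAMState.setW_wvar, if_true, h3, hqi]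
      have e1 : N - q = (N - (q + 1)) + 1 := by omega
      rw [e1, Nat.mul_add]
      omega
  · rintro s' T ⟨⟨q, hq, hI, h1, h2⟩, hb, hT⟩
    have hNs := hN q s' hI
    have : q = N := by
      by_contra hc
      have := h1 (by omega)
      simp [hNs] at hb; omega
    subst this
    refine hQ _ _ hI ?_
    simp only [BExp.cost_wlt, WExp.cost, WExp.cost_ofNat, RAMState.setW_wvar, if_true,
      WExp.eval_ofNat] at hT ⊢
    have h0 : WExp.eval s 0 = 0 := rfl
    rw [h0, Nat.sub_zero] at hT
    omega

end Rules

/-! ### Filling matrices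

A `w × w` matrix in slot `σ` occupies the cells `σw², …, (σ+1)w² - 1` of the real array `0`.
The word variable `5` holds `w`. -/

/-- The state `s'` agrees with `s` in the word variables below `N`, in the word arrays, and in the
real variable `1`. -/
structure Keeps (N : ℕ) (s s' : RAMState) : Prop where
  wvar : ∀ x < N, s'.wvar x = s.wvar x
  warr : s'.warr = s.warr
  rvar : s'.rvar 1 = s.rvar 1

theorem Keeps.refl (N : ℕ) (s : RAMState) : Keeps N s s := ⟨fun _ _ => rfl, rfl, rfl⟩

theorem Keeps.trans {N : ℕ} {s s' s'' : RAMState} (h : Keeps N s s') (h' : Keeps N s' s'') :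
    Keeps N s s'' :=
  ⟨fun x hx => (h'.wvar x hx).trans (h.wvar x hx), h'.warr.trans h.warr, h'.rvar.trans h.rvar⟩

theorem Keeps.mono {N M : ℕ} {s s' : RAMState} (h : Keeps N s s') (hM : M ≤ N) : Keeps M s s' :=
  ⟨fun x hx => h.wvar x (hx.trans_le hM), h.warr, h.rvar⟩

theorem Keeps.setW {N x v : ℕ} {s s' : RAMState} (h : Keeps N s s') (hx : N ≤ x) :
    Keeps N s (s'.setW x v) :=
  ⟨fun y hy => by rw [RAMState.setW_wvar, if_neg (by omega), h.wvar y hy], h.warr, h.rvar⟩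

theorem Keeps.setR {N x : ℕ} {v : ℝ} {s s' : RAMState} (h : Keeps N s s') (hx : x ≠ 1) :
    Keeps N s (s'.setR x v) :=
  ⟨h.wvar, h.warr, by rw [RAMState.setR_rvar, if_neg hx.symm, h.rvar]⟩

theorem Keeps.storeR {N a i : ℕ} {v : ℝ} {s s' : RAMState} (h : Keeps N s s') :
    Keeps N s (s'.storeR a i v) :=
  ⟨h.wvar, h.warr, h.rvar⟩

/-- The entry `(a, b)` of the matrix in slot `σ`. -/
def RAMState.mat (s : RAMState) (w σ a b : ℕ) : ℝ := s.rarr 0 (σ * (w * w) + (a * w + b))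

/-- The state `s'` agrees with `s` in the real arrays outside of the matrix in slot `d`. -/
structure KeepsSlots (w d : ℕ) (s s' : RAMState) : Prop where
  rarr : ∀ c, c ≠ 0 → s'.rarr c = s.rarr c
  mat : ∀ σ a b, σ ≠ d → a < w → b < w → s'.mat w σ a b = s.mat w σ a b

theorem KeepsSlots.of_rarr_eq {w d : ℕ} {s s' : RAMState} (h : s'.rarr = s.rarr) :
    KeepsSlots w d s s' :=
  ⟨fun _ _ => by rw [h], fun _ _ _ _ _ _ => by rw [RAMState.mat, h, RAMState.mat]⟩

theorem KeepsSlots.trans {w d : ℕ} {s s' s'' : RAMState} (h : KeepsSlots w d s s')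
    (h' : KeepsSlots w d s' s'') : KeepsSlots w d s s'' :=
  ⟨fun c hc => (h'.rarr c hc).trans (h.rarr c hc),
    fun σ a b h1 h2 h3 => (h'.mat σ a b h1 h2 h3).trans (h.mat σ a b h1 h2 h3)⟩

/-- Addresses are numbers in mixed radix, so different slots do not overlap. The same fact separates
the rows of real array `1`. -/
theorem slot_address_inj {W σ σ' e e' : ℕ} (he : e < W) (he' : e' < W)
    (h : σ * W + e = σ' * W + e') : σ = σ' ∧ e = e' := by
  have h1 : σ = σ' := by
    have h2 : (e + W * σ) / W = σ := by rw [Nat.add_mul_div_left _ _ (by omega),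
      Nat.div_eq_of_lt he, zero_add]
    have h3 : (e' + W * σ') / W = σ' := by rw [Nat.add_mul_div_left _ _ (by omega),
      Nat.div_eq_of_lt he', zero_add]
    rw [← h2, ← h3]
    congr 1
    linarith
  subst h1
  exact ⟨rfl, by omega⟩

theorem entry_lt {w a b : ℕ} (ha : a < w) (hb : b < w) : a * w + b < w * w := by
  have : (a + 1) * w ≤ w * w := Nat.mul_le_mul_right _ ha
  linarith

/-- The command that fills the matrix in slot `d`, where the word variable `40` holds `d`, in
ascending or (if `rev`) descending order of the entries; `body` computes the entry whose indices
are in the word variables `52` and `53` into the real variable `5`. -/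
def Cmd.matFill (rev : Bool) (body : Cmd) : Cmd :=
  .forLoop 50 (wv 5 * wv 5)
    (.setW 51 (if rev then wv 5 * wv 5 - 1 - wv 50 else wv 50) ;;
      .setW 52 (wv 51 / wv 5) ;; .setW 53 (wv 51 - wv 52 * wv 5) ;; body ;;
      .storeR 0 (wv 40 * (wv 5 * wv 5) + wv 51) (.var 5))

/-- The body may read the entries of the matrix under construction that come earlier in the chosen
order. The recurrences for insertions need this: they refer to a neighbouring entry of the same
matrix. -/
theorem Halts.matFill {orc : ℕ → ℕ → ℝ} {B : ℕ} {body : Cmd} {s : RAMState} {w d C : ℕ}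
    (rev : Bool) (P : ℕ → ℕ → ℝ → Prop) (hw : s.wvar 5 = w) (hd : s.wvar 40 = d)
    (hW : w * w ≤ B) (hB : d * (w * w) + w * w ≤ B)
    (hbody : ∀ s₁ a b, a < w → b < w → Keeps 50 s s₁ → s₁.wvar 52 = a → s₁.wvar 53 = b →
      KeepsSlots w d s s₁ →
      (∀ a' b', a' < w → b' < w →
        (if rev then a * w + b < a' * w + b' else a' * w + b' < a * w + b) →
        P a' b' (s₁.mat w d a' b')) →
      Halts orc B body s₁ fun s₂ T =>
        T ≤ C ∧ Keeps 54 s₁ s₂ ∧ s₂.rarr = s₁.rarr ∧ P a b (s₂.rvar 5)) :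
    Halts orc B (.matFill rev body) s fun s' T =>
      T ≤ (C + 50) * (w * w) + 10 ∧ Keeps 50 s s' ∧ KeepsSlots w d s s' ∧
        ∀ a b, a < w → b < w → P a b (s'.mat w d a b) := by
  -- The position in the row-major order of the entry that is treated in round `q`.
  let idx : ℕ → ℕ := fun q => if rev then w * w - 1 - q else q
  have hidx : ∀ q, q < w * w → idx q < w * w := by
    intro q hq; simp only [idx]; split_ifs <;> omega
  refine Halts.forLoop (N := w * w) (fun q s₁ => Keeps 50 s s₁ ∧ KeepsSlots w d s s₁ ∧
      s₁.wvar 50 = q ∧ ∀ q' < q, ∀ a b, a < w → b < w → a * w + b = idx q' →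
        P a b (s₁.mat w d a b)) (C + 37)
    hW ?_ ?_ ?_ ?_ ?_
  · exact ⟨(Keeps.refl _ _).setW le_rfl, .of_rarr_eq rfl, by simp, by simp⟩
  · rintro q s₁ ⟨h1, -⟩
    simp [h1.wvar 5, hw]
  · rintro q s₁ - ⟨-, -, h, -⟩
    exact h
  · rintro q s₁ hq ⟨h1, h2, h3, h4⟩ -
    have h5 : s₁.wvar 5 = w := by rw [h1.wvar 5 (by omega), hw]
    have h40 : s₁.wvar 40 = d := by rw [h1.wvar 40 (by omega), hd]
    have hi := hidx q hq
    have hw0 : 0 < w := Nat.pos_of_ne_zero (by rintro rfl; omega)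
    have hev : (if rev then wv 5 * wv 5 - 1 - wv 50 else wv 50 : WExp).eval s₁ = idx q := by
      simp only [idx]; split_ifs <;> simp [h3, h5]
    have hcost : (if rev then wv 5 * wv 5 - 1 - wv 50 else wv 50 : WExp).cost ≤ 7 := by
      split_ifs <;> simp
    set e := idx q with he
    set a := e / w with ha
    have hab : a * w + (e - a * w) = e := by
      have := Nat.div_mul_le_self e w
      rw [← ha] at this
      omega
    have haw : a < w := Nat.div_lt_of_lt_mul hi
    have hbw : e - a * w < w := by
      have := Nat.lt_div_mul_add hw0 (a := e)
      rw [← ha] at this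
      omega
    refine .seq (.setW (by rw [hev]; omega) ?_)
    rw [hev]
    refine .seq (.setW ?_ (.seq (.setW ?_ (.seq ?_))))
    · simp [h5, ← ha]; nlinarith
    · simp [h5, ← ha]; omega
    simp only [WExp.eval, WExp.eval_div, WExp.eval_sub, WExp.eval_mul, RAMState.setW_wvar, h5,
      Nat.reduceEqDiff, if_true, if_false, ← ha]
    refine (hbody _ a (e - a * w) haw hbw (((h1.setW (by omega)).setW (by omega)).setW (by omega))
      (by simp) (by simp) (h2.trans (.of_rarr_eq rfl)) ?_).mono ?_
    · intro a' b' ha' hb' hlt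
      have hlt' := entry_lt ha' hb'
      rw [hab, he] at hlt
      refine h4 (idx (a' * w + b')) ?_ a' b' ha' hb' ?_
      · simp only [idx] at *; split_ifs at * <;> omega
      · simp only [idx]; split_ifs <;> omega
    · rintro s₂ T ⟨k1, k2, k3, k4⟩
      have g40 : s₂.wvar 40 = d := by rw [k2.wvar 40 (by omega)]; simp [h40]
      have g5 : s₂.wvar 5 = w := by rw [k2.wvar 5 (by omega)]; simp [h5]
      have g51 : s₂.wvar 51 = e := by rw [k2.wvar 51 (by omega)]; simp
      have g50 : s₂.wvar 50 = q := by rw [k2.wvar 50 (by omega)]; simp [h3]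
      refine .storeR (by simp [g40, g5, g51]; omega) ⟨?_, ?_, ?_, ?_, ?_, ?_⟩
      · simp [g50]
      · simp only [WExp.cost, WExp.cost_add, WExp.cost_mul, WExp.cost_div, WExp.cost_sub,
          RExp.cost]
        omega
      · exact (((((h1.setW (by omega)).setW (by omega)).setW (by omega)).trans
          (k2.mono (by omega))).storeR).setW le_rfl
      · refine ⟨fun c hc => ?_, fun σ a b h6 h7 h8 => ?_⟩
        · ext j
          simp [hc, k3, h2.rarr c hc]
        · rw [← h2.mat σ a b h6 h7 h8]
          simp only [RAMState.mat, RAMState.setW_rarr, RAMState.storeR_rarr, WExp.eval,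
            WExp.eval_add, WExp.eval_mul, g40, g5, g51, k3, true_and]
          rw [if_neg]
          intro h9
          exact h6 (slot_address_inj (entry_lt h7 h8) hi h9).1
      · simp
      · intro q' hq' a' b' ha' hb' hab'
        simp only [RAMState.mat, RAMState.setW_rarr, RAMState.storeR_rarr, WExp.eval,
            WExp.eval_add, WExp.eval_mul, g40, g5, g51, k3, true_and]
        by_cases hqq : q' = q
        · subst hqq
          rw [if_pos (by rw [hab'])]
          have hmod : a' = a := by
            have hab'' : a' * w + b' = e := hab'
            rw [ha, ← hab'', Nat.mul_comm, Nat.mul_add_div hw0, Nat.div_eq_of_lt hb', add_zero]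
          have hb'' : b' = e - a * w := by have hab'' : a' * w + b' = e := hab'; rw [hmod] at hab''; omega
          rw [hmod, hb'']
          exact k4
        · rw [if_neg]
          · exact h4 q' (by omega) a' b' ha' hb' hab'
          · intro h9
            have := (slot_address_inj (entry_lt ha' hb') hi h9).2
            rw [hab', he] at this
            simp only [idx] at this
            split_ifs at this <;> omega
  · rintro s' T ⟨h1, h2, h3, h4⟩ hT
    refine ⟨?_, h1, h2, fun a b ha hb => h4 (idx (a * w + b)) ?_ a b ha hb ?_⟩
    · simp only [WExp.cost, WExp.cost_mul] at hT
      exact hT.trans (by ring_nf; omega)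
    · have := entry_lt ha hb
      exact hidx _ this
    · have := entry_lt ha hb
      simp only [idx]; split_ifs <;> omega


/-! ### Powers of strings -/

section Powers

variable {β : Type*} (R : List β)

theorem strPow_succ (e : ℕ) : strPow R (e + 1) = R ++ strPow R e := by
  simp [strPow, List.replicate_succ]

theorem strPow_add (d e : ℕ) : strPow R (d + e) = strPow R d ++ strPow R e := by
  rw [strPow, List.replicate_add, List.flatten_append]; rfl

theorem strPow_length (e : ℕ) : (strPow R e).length = e * R.length := by
  simp [strPow]

theorem strPow_periodic {e t : ℕ} (h : t + R.length < e * R.length) :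
    (strPow R e)[t]? = (strPow R e)[t + R.length]? := by
  obtain _ | e := e
  · simp at h
  have h1 : t < (strPow R e).length := by
    rw [strPow_length]; rw [Nat.succ_mul] at h; omega
  conv_lhs => rw [strPow_add, List.getElem?_append_left h1]
  rw [strPow_succ, List.getElem?_append_right (by omega), Nat.add_sub_cancel]

theorem strPow_balanced {α : Type*} {R : List (Paren α)} (h : BalancedStr R) (e : ℕ) :
    BalancedStr (strPow R e) := by
  induction e with
  | zero => exact .nil
  | succ e ih => rw [strPow_succ]; exact .append h ih

theorem frag_strPow {d e m : ℕ} (h1 : d ≤ e) (h2 : e ≤ m) :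
    frag (strPow R m) (d * R.length) (e * R.length) = strPow R (e - d) := by
  obtain ⟨a, rfl⟩ := Nat.exists_eq_add_of_le h1
  obtain ⟨b, rfl⟩ := Nat.exists_eq_add_of_le h2
  rw [strPow_add, frag, List.take_left' (strPow_length _ _), strPow_add,
    List.drop_left' (strPow_length _ _), Nat.add_sub_cancel_left]

theorem frag_frag (X : List β) {p q a b : ℕ} (h : p + b ≤ q) :
    frag (frag X p q) a b = frag X (p + a) (p + b) := by
  apply List.ext_getElem?
  intro t
  simp only [frag_getElem?]
  split_ifs <;> first | rfl | omega | (rw [add_assoc])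

end Powers

/-! ### Inputs, blocks and jumps -/

/-- An input of the algorithm that satisfies the promises. -/
structure TedInput (α : Type*) where
  F : List (Paren α)
  G : List (Paren α)
  w : Option α → Option α → ℝ≥0
  k : ℕ
  L : List Block
  balF : BalancedStr F
  balG : BalancedStr G
  normalized : Normalized w
  one_le : 1 ≤ k
  free : ∀ b ∈ L, b.IsFree k F G
  disj : L.Pairwise Block.DisjointF

namespace TedInput

variable {α : Type*} (I : TedInput α)

/-- `[j₀..j₁)` is a free block without its first period, which has length `len`. -/
def Jump (j₀ j₁ len : ℕ) : Prop :=
  ∃ b ∈ I.L, 2 ≤ b.exp ∧ j₀ = b.pF + b.len ∧ j₁ = b.qF ∧ len = b.len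

variable {I}

/-- The fragments extended by one period on both sides are powers of the period, so the periodicity
holds one period beyond the block on either side, in F and in G. -/
theorem block_facts {b : Block} (hb : b ∈ I.L) :
    4 * I.k ≤ b.len ∧ b.len < 8 * I.k ∧ b.len ≤ b.pF ∧ b.qF + b.len ≤ I.F.length ∧ b.len ≤ b.pG ∧
      b.qG + b.len ≤ I.G.length ∧ b.qF = b.pF + b.exp * b.len ∧ b.qG = b.pG + b.exp * b.len ∧
      b.pF ≤ b.pG + 2 * I.k ∧ b.pG ≤ b.pF + 2 * I.k ∧ 1 ≤ b.exp ∧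
      (∀ t, b.pF ≤ t + b.len → t < b.qF → I.F[t]? = I.F[t + b.len]?) ∧
      (∀ t, b.pG ≤ t + b.len → t < b.qG → I.G[t]? = I.G[t + b.len]?) ∧
      (∀ u v, u ≤ v → v ≤ b.exp →
        BalancedStr (frag I.F (b.pF + u * b.len) (b.pF + v * b.len))) := by
  obtain ⟨h1, h2, R, h3, h4, h5, h6, h7, h8, h9, h10, h11, h12⟩ := I.free b hb
  rw [h4] at h5 h6 h7 h8 h9 h10 h11 h12
  have hk := I.one_le
  have e1 := congrArg List.length h11
  have e2 := congrArg List.length h12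
  rw [frag_length, strPow_length, h4, Nat.add_mul] at e1 e2
  have hpos : 0 < b.exp * b.len := Nat.mul_pos (by omega) (by omega)
  have q1 : b.qF = b.pF + b.exp * b.len := by omega
  have q2 : b.qG = b.pG + b.exp * b.len := by omega
  rw [abs_le] at h1
  refine ⟨h5, h6, h7, h8, h9, h10, q1, q2, by omega, by omega, h2, fun t h13 h14 => ?_,
    fun t h13 h14 => ?_, fun u v huv hv => ?_⟩
  · have := strPow_periodic R (e := b.exp + 2) (t := t - (b.pF - b.len))
      (by rw [h4, Nat.add_mul]; omega)
    rw [← h11, frag_getElem?, frag_getElem?, if_pos (by omega), if_pos (by omega), h4] at this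
    convert this using 2 <;> omega
  · have := strPow_periodic R (e := b.exp + 2) (t := t - (b.pG - b.len))
      (by rw [h4, Nat.add_mul]; omega)
    rw [← h12, frag_getElem?, frag_getElem?, if_pos (by omega), if_pos (by omega), h4] at this
    convert this using 2 <;> omega
  · have h13 := frag_strPow R (d := u + 1) (e := v + 1) (m := b.exp + 2) (by omega) (by omega)
    have hv' : (v + 1) * b.len ≤ (b.exp + 2) * b.len := Nat.mul_le_mul_right _ (by omega)
    simp only [Nat.add_mul, one_mul] at hv'
    rw [← h11, h4, frag_frag _ (by rw [Nat.add_mul]; omega)] at h13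
    rw [show b.pF + u * b.len = b.pF - b.len + (u + 1) * b.len by rw [Nat.add_mul]; omega,
      show b.pF + v * b.len = b.pF - b.len + (v + 1) * b.len by rw [Nat.add_mul]; omega, h13]
    exact strPow_balanced h3 _

theorem block_disjoint {b c : Block} (hb : b ∈ I.L) (hc : c ∈ I.L) (h1 : b.pF < c.qF)
    (h2 : c.pF < b.qF) : b = c := by
  by_contra hne
  have hs : Std.Symm Block.DisjointF := ⟨fun x y h => Disjoint.symm h⟩
  have hd : b.DisjointF c := I.disj.forall hb hc hne
  rw [Block.DisjointF, Finset.disjoint_left] at hd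
  have hk := I.one_le
  have f1 := block_facts hb
  have f2 := block_facts hc
  have g1 : 0 < b.exp * b.len := Nat.mul_pos (by omega) (by omega)
  have g2 : 0 < c.exp * c.len := Nat.mul_pos (by omega) (by omega)
  have := @hd (max b.pF c.pF) (by simp; omega)
  simp at this
  omega

theorem Jump.facts {j₀ j₁ len : ℕ} (h : I.Jump j₀ j₁ len) :
    4 * I.k ≤ len ∧ len < 8 * I.k ∧ 2 * len ≤ j₀ ∧ j₀ + len ≤ j₁ ∧ j₁ + len ≤ I.F.length ∧
      ∃ e, j₁ = j₀ + e * len ∧ 1 ≤ e := by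
  obtain ⟨b, hb, h1, rfl, rfl, rfl⟩ := h
  obtain ⟨e, he⟩ : ∃ e, b.exp = e + 2 := ⟨b.exp - 2, by omega⟩
  have hf := block_facts hb
  have h2 : b.exp * b.len = b.len + (e + 1) * b.len := by rw [he]; ring
  have h3 : (e + 1) * b.len = e * b.len + b.len := by ring
  refine ⟨by omega, by omega, by omega, by omega, by omega, e + 1, by omega, by omega⟩

theorem Jump.balanced {j₀ j₁ len : ℕ} (h : I.Jump j₀ j₁ len) {u v : ℕ} (huv : u ≤ v)
    (hv : j₀ - len + v * len ≤ j₁) :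
    BalancedStr (frag I.F (j₀ - len + u * len) (j₀ - len + v * len)) := by
  have hk := I.one_le
  obtain ⟨b, hb, h1, rfl, rfl, rfl⟩ := h
  have hf := block_facts hb
  rw [Nat.add_sub_cancel] at hv ⊢
  refine hf.2.2.2.2.2.2.2.2.2.2.2.2.2 u v huv ?_
  exact Nat.le_of_mul_le_mul_right (by omega : v * b.len ≤ b.exp * b.len) (by omega)

/-- A run of whole periods is balanced, so no node crosses its ends. This permits products at the
boundaries of periods. -/
theorem Jump.closed {j₀ j₁ len : ℕ} (h : I.Jump j₀ j₁ len) {u v i j : ℕ} (huv : u ≤ v)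
    (hv : j₀ - len + v * len ≤ j₁) (hn : IsNode I.F i j) :
    (j₀ - len + u * len ≤ i ∧ i < j₀ - len + v * len) ↔
      (j₀ - len + u * len ≤ j ∧ j < j₀ - len + v * len) :=
  hn.mem_balanced_iff (h.balanced huv hv) (by have := h.facts; omega)

theorem Jump.closed_period {j₀ j₁ len i j : ℕ} (h : I.Jump j₀ j₁ len) (hn : IsNode I.F i j) :
    (j₀ - len ≤ i ∧ i < j₀) ↔ (j₀ - len ≤ j ∧ j < j₀) := by
  have hf := h.facts
  have := h.closed (u := 0) (v := 1) (by omega) (by omega) hn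
  simp only [zero_mul, one_mul, add_zero] at this
  rwa [show j₀ - len + len = j₀ by omega] at this

theorem Jump.closed_block {j₀ j₁ len i j : ℕ} (h : I.Jump j₀ j₁ len) (hn : IsNode I.F i j) :
    (j₀ - len ≤ i ∧ i < j₁) ↔ (j₀ - len ≤ j ∧ j < j₁) := by
  obtain ⟨h1, h2, h3, h4, h5, e, h6, h7⟩ := h.facts
  have hj : j₀ - len + (e + 1) * len = j₁ := by rw [Nat.add_mul]; omega
  have := h.closed (u := 0) (v := e + 1) (by omega) hj.le hn
  rwa [hj, zero_mul, add_zero] at this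

theorem Jump.closed_jump {j₀ j₁ len i j : ℕ} (h : I.Jump j₀ j₁ len) (hn : IsNode I.F i j) :
    (j₀ ≤ i ∧ i < j₁) ↔ (j₀ ≤ j ∧ j < j₁) := by
  have h1 := h.closed_period hn
  have h2 := h.closed_block hn
  omega

/-- The blocks of distinct jumps are disjoint. -/
theorem Jump.unique {j₀ j₁ len j₀' j₁' len' : ℕ} (h : I.Jump j₀ j₁ len)
    (h' : I.Jump j₀' j₁' len') (h1 : j₀ - len < j₁') (h2 : j₀' - len' < j₁) :
    j₀ = j₀' ∧ j₁ = j₁' ∧ len = len' := by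
  obtain ⟨b, hb, _, rfl, rfl, rfl⟩ := h
  obtain ⟨c, hc, _, rfl, rfl, rfl⟩ := h'
  obtain rfl := block_disjoint hb hc (by omega) (by omega)
  exact ⟨rfl, rfl, rfl⟩

/-- The associated fragments are displaced by at most `2k` and the band adds another `2k`, so all
relevant positions of G are within `4k` of the associated fragment. As `4k ≤ len`, they are in the
zone where G is periodic. -/
theorem Jump.periodic {j₀ j₁ len : ℕ} (h : I.Jump j₀ j₁ len) {a b i : ℕ} {v : ℝ}
    (hi : j₀ + i * len ≤ j₁) (hv : GoodEntry I.w I.k I.F I.G (j₀ - len) j₀ a b v) :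
    GoodEntry I.w I.k I.F I.G (j₀ - len + i * len) (j₀ + i * len) a b v := by
  have hk := I.one_le
  obtain ⟨B, hb, _, rfl, rfl, rfl⟩ := h
  obtain ⟨h1, h2, h3, h4, h5, h6, h7, h8, h9, h10, h11, h12, h13, -⟩ := block_facts hb
  have pF : ∀ i t, B.pF ≤ t + B.len → t + i * B.len < B.qF + B.len →
      I.F[t]? = I.F[t + i * B.len]? := by
    intro i
    induction i with
    | zero => simp
    | succ i ih =>
      intro t ht ht'
      rw [Nat.succ_mul] at ht' ⊢
      rw [ih t ht (by omega), h12 _ (by omega) (by omega), add_assoc]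
  have pG : ∀ i t, B.pG ≤ t + B.len → t + i * B.len < B.qG + B.len →
      I.G[t]? = I.G[t + i * B.len]? := by
    intro i
    induction i with
    | zero => simp
    | succ i ih =>
      intro t ht ht'
      rw [Nat.succ_mul] at ht' ⊢
      rw [ih t ht (by omega), h13 _ (by omega) (by omega), add_assoc]
  exact hv.shift (fun t ht ht' => pF i t (by omega) (by omega))
    (fun t ht ht' => pG i t (by omega) (by omega)) (by omega) (by omega) (by omega)

/-! Weights of positions. -/

variable (I)

/-- The position `x` is in a jump. -/
def InJump (x : ℕ) : Prop := ∃ j₀ j₁ len, I.Jump j₀ j₁ len ∧ j₀ ≤ x ∧ x < j₁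

/-- The boundary `x` is not strictly inside of a jump. -/
def Clean (x : ℕ) : Prop := ∀ j₀ j₁ len, I.Jump j₀ j₁ len → ¬ (j₀ < x ∧ x < j₁)

open Classical in
/-- The weight of a position: `1` outside of the jumps, the length of the period at the start of
a jump, and `0` elsewhere. -/
noncomputable def wt (x : ℕ) : ℕ :=
  if h : ∃ len j₁, I.Jump x j₁ len then h.choose else if I.InJump x then 0 else 1

/-- The weight of the prefix of length `x`. -/
noncomputable def prefixWt (x : ℕ) : ℕ := ∑ y ∈ Finset.range x, I.wt y

variable {I}

theorem Jump.wt_eq {j₀ j₁ len : ℕ} (h : I.Jump j₀ j₁ len) : I.wt j₀ = len := by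
  have hk := I.one_le
  have he : ∃ len j₁, I.Jump j₀ j₁ len := ⟨len, j₁, h⟩
  obtain ⟨j', hj⟩ := he.choose_spec
  have h1 := hj.facts
  have h2 := h.facts
  rw [wt, dif_pos he, (h.unique hj (by omega) (by omega)).2.2]

theorem wt_of_not_inJump {x : ℕ} (h : ¬ I.InJump x) : I.wt x = 1 := by
  rw [wt, dif_neg, if_neg h]
  rintro ⟨len, j₁, hj⟩
  have := hj.facts
  have hk := I.one_le
  exact h ⟨_, _, _, hj, le_rfl, by omega⟩

theorem Jump.wt_inside {j₀ j₁ len x : ℕ} (h : I.Jump j₀ j₁ len) (h1 : j₀ < x) (h2 : x < j₁) :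
    I.wt x = 0 := by
  rw [wt, dif_neg, if_pos ⟨_, _, _, h, h1.le, h2⟩]
  rintro ⟨len', j₁', hj⟩
  have := hj.facts
  have hk := I.one_le
  have := (h.unique hj (by omega) (by omega)).1
  omega

theorem prefixWt_mono {x y : ℕ} (h : x ≤ y) : I.prefixWt x ≤ I.prefixWt y :=
  Finset.sum_le_sum_of_subset (Finset.range_mono h)

theorem prefixWt_succ {x : ℕ} (h : ¬ I.InJump x) : I.prefixWt (x + 1) = I.prefixWt x + 1 := by
  rw [prefixWt, Finset.sum_range_succ, wt_of_not_inJump h, prefixWt]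

theorem Jump.prefixWt {j₀ j₁ len : ℕ} (h : I.Jump j₀ j₁ len) :
    I.prefixWt j₁ = I.prefixWt j₀ + len := by
  have hf := h.facts
  have hk := I.one_le
  rw [TedInput.prefixWt, ← Finset.sum_range_add_sum_Ico _ (show j₀ ≤ j₁ by omega),
    Finset.sum_eq_sum_Ico_succ_bot (by omega), h.wt_eq, TedInput.prefixWt,
    Finset.sum_eq_zero (s := Finset.Ico (j₀ + 1) j₁), add_zero]
  intro x hx
  rw [Finset.mem_Ico] at hx
  exact h.wt_inside (by omega) (by omega)

theorem clean_of_not_inJump {x : ℕ} (h : ¬ I.InJump x) : I.Clean x :=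
  fun _ _ _ hj hx => h ⟨_, _, _, hj, hx.1.le, hx.2⟩

theorem clean_succ {x : ℕ} (h : ¬ I.InJump x) : I.Clean (x + 1) :=
  fun _ _ _ hj hx => h ⟨_, _, _, hj, by omega, by omega⟩

theorem Jump.clean_start {j₀ j₁ len : ℕ} (h : I.Jump j₀ j₁ len) : I.Clean j₀ := by
  intro j₀' j₁' len' hj hx
  have h1 := h.facts
  have h2 := hj.facts
  have := (h.unique hj (by omega) (by omega)).1
  omega

theorem Jump.clean_end {j₀ j₁ len : ℕ} (h : I.Jump j₀ j₁ len) : I.Clean j₁ := by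
  intro j₀' j₁' len' hj hx
  have h1 := h.facts
  have h2 := hj.facts
  have := (h.unique hj (by omega) (by omega)).2.1
  omega

/-- Distinct blocks are disjoint, so the first period of a block meets no jump and is processed
character by character. -/
theorem Jump.not_inJump_period {j₀ j₁ len x : ℕ} (h : I.Jump j₀ j₁ len) (h1 : j₀ - len ≤ x)
    (h2 : x < j₀) : ¬ I.InJump x := by
  rintro ⟨j₀', j₁', len', hj, hx⟩
  have h3 := h.facts
  have h4 := hj.facts
  have := (h.unique hj (by omega) (by omega)).1
  omega

theorem Jump.prefixWt_period {j₀ j₁ len : ℕ} (h : I.Jump j₀ j₁ len) {d : ℕ} (hd : d ≤ len) :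
    I.prefixWt (j₀ - len + d) = I.prefixWt (j₀ - len) + d := by
  have hf := h.facts
  induction d with
  | zero => rfl
  | succ d ih =>
    rw [← add_assoc, prefixWt_succ (h.not_inJump_period (by omega) (by omega)), ih (by omega),
      add_assoc]

theorem Clean.not_inJump {x : ℕ} (h : I.Clean x) (hs : ∀ j₁ len, ¬ I.Jump x j₁ len) :
    ¬ I.InJump x := by
  rintro ⟨j₀, j₁, len, hj, h1, h2⟩
  rcases h1.eq_or_lt with rfl | h1
  · exact hs _ _ hj
  · exact h _ _ _ hj ⟨h1, h2⟩

theorem Clean.not_inJump_pred {x : ℕ} (h : I.Clean (x + 1))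
    (hs : ∀ j₀ len, ¬ I.Jump j₀ (x + 1) len) : ¬ I.InJump x := by
  rintro ⟨j₀, j₁, len, hj, h1, h2⟩
  by_cases h3 : x + 1 = j₁
  · subst h3; exact hs _ _ hj
  · exact h _ _ _ hj ⟨by omega, by omega⟩

theorem inJump_iff {i j : ℕ} (hn : IsNode I.F i j) : I.InJump i ↔ I.InJump j := by
  constructor <;> rintro ⟨j₀, j₁, len, hj, h1, h2⟩
  · exact ⟨j₀, j₁, len, hj, (hj.closed_jump hn).1 ⟨h1, h2⟩⟩
  · exact ⟨j₀, j₁, len, hj, (hj.closed_jump hn).2 ⟨h1, h2⟩⟩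

theorem clean_length : I.Clean I.F.length := by
  intro j₀ j₁ len hj h
  have := hj.facts
  omega

theorem clean_zero : I.Clean 0 := by
  intro j₀ j₁ len hj h
  omega

/-- A clean boundary that a jump overlaps is outside of the jump. -/
theorem Clean.jump_le {x j₀ j₁ len : ℕ} (h : I.Clean x) (hj : I.Jump j₀ j₁ len) :
    x ≤ j₀ ∨ j₁ ≤ x := by
  have := h _ _ _ hj
  omega

theorem wt_le {x : ℕ} (hx : x < I.F.length) : I.wt x ≤ I.F.length := by
  by_cases h : I.InJump x
  · obtain ⟨j₀, j₁, len, hj, h1, h2⟩ := h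
    have := hj.facts
    rcases h1.eq_or_lt with rfl | h1
    · rw [hj.wt_eq]; omega
    · rw [hj.wt_inside h1 h2]; omega
  · rw [wt_of_not_inJump h]; omega

/-- This crude bound only serves to fit weights into words and to bound their logarithms; the bound
that matters for the time is `prefixWt_length_le`. -/
theorem prefixWt_le {x : ℕ} (hx : x ≤ I.F.length) : I.prefixWt x ≤ I.F.length * I.F.length := by
  refine (prefixWt_mono hx).trans ?_
  rw [prefixWt]
  refine (Finset.sum_le_card_nsmul _ _ I.F.length fun y hy => wt_le (Finset.mem_range.1 hy)).trans ?_
  simp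

end TedInput


/-- `v - 1` is the innermost node of `F` that encloses the boundary `x`, or `v = 0` and there is
none. -/
def IsEnclosing {α : Type*} (F : List (Paren α)) (x v : ℕ) : Prop :=
  (v = 0 ∧ ∀ i j, IsNode F i j → ¬ (i < x ∧ x ≤ j)) ∨
    ∃ i j, v = i + 1 ∧ IsNode F i j ∧ i < x ∧ x ≤ j ∧
      ∀ i' j', IsNode F i' j' → i' < x → x ≤ j' → i' ≤ i

/-- The command that lowers the real variable `5` to the value of `e` if `b` holds. -/
def Cmd.relaxIf (b : BExp) (e : RExp) : Cmd :=
  .ite b (.setR 6 e ;; .ite (.rle (.var 6) (.var 5)) (.setR 5 (.var 6)) .skip) .skip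

/-- The inequalities for the new value give lower entries. The last clause, that the new value
inherits every property shared by the old value and the candidate, gives upper entries. -/
theorem Halts.relaxIf {orc : ℕ → ℕ → ℝ} {B : ℕ} {b : BExp} {e : RExp} {s : RAMState}
    {Q : RAMState → ℕ → Prop}
    (h : ∀ s' T, T ≤ b.cost + e.cost + 8 → s'.wvar = s.wvar → s'.warr = s.warr →
      s'.rarr = s.rarr → s'.rvar 1 = s.rvar 1 → s'.rvar 5 ≤ s.rvar 5 →
      (b.eval orc s → s'.rvar 5 ≤ e.eval orc s) →
      (∀ P : ℝ → Prop, P (s.rvar 5) → (b.eval orc s → P (e.eval orc s)) → P (s'.rvar 5)) →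
      Q s' T) : Halts orc B (.relaxIf b e) s Q := by
  refine .ite (fun hb => .seq (.setR (.ite (fun hle => .setR ?_) (fun hle => .skip ?_))))
    (fun hb => .skip ?_)
  · simp at hle
    refine h _ _ ?_ rfl rfl rfl ?_ ?_ ?_ ?_
    · simp; omega
    · simp
    · simpa using hle
    · simp
    · intro P h1 h2
      simpa using h2 hb
  · simp at hle
    refine h _ _ ?_ rfl rfl rfl ?_ ?_ ?_ ?_
    · simp; omega
    · simp
    · simp
    · intro _; simpa using hle.le
    · intro P h1 h2
      simpa using h1
  · exact h _ _ (by omega) rfl rfl rfl rfl le_rfl (fun h => absurd h hb) (fun P h1 _ => h1)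

namespace TedInput

variable {α : Type*} (I : TedInput α)

/-- The oracle of the input. -/
noncomputable abbrev orc : ℕ → ℕ → ℝ := oracle I.w I.F I.G

/-- The tables of the preprocessing: the word variables `0`, `1`, `2`, `4`, `5`, `6` hold `|F|`,
`|G|`, `k`, `|F| + |G|`, `4k + 1` and `|F| + 1`; the word arrays hold the kinds (`0`), mates (`7`),
parents (`8`), the ends, periods and starts of the jumps (`9`, `10`, `12`), and the weights of the
prefixes (`13`). -/
structure Ready (s : RAMState) : Prop where
  v0 : s.wvar 0 = I.F.length
  v1 : s.wvar 1 = I.G.length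
  v2 : s.wvar 2 = I.k
  v4 : s.wvar 4 = I.F.length + I.G.length
  v5 : s.wvar 5 = 4 * I.k + 1
  v6 : s.wvar 6 = I.F.length + 1
  inf : s.rvar 1 = I.k + 1
  nodeF : ∀ i j, IsNode I.F i j →
    s.warr 0 i = 0 ∧ s.warr 0 j = 1 ∧ s.warr 7 i = j ∧ s.warr 7 j = i
  nodeG : ∀ i j, IsNode I.G i j → s.warr 0 (I.F.length + i) = 0 ∧
    s.warr 0 (I.F.length + j) = 1 ∧ s.warr 7 (I.F.length + i) = I.F.length + j ∧
    s.warr 7 (I.F.length + j) = I.F.length + i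
  mate_le : ∀ x, s.warr 7 x ≤ I.F.length + I.G.length
  jump : ∀ j₀ j₁ len, I.Jump j₀ j₁ len →
    s.warr 9 j₀ = j₁ ∧ s.warr 10 j₀ = len ∧ s.warr 12 j₁ = j₀
  no_jump : ∀ x, (∀ j₁ len, ¬ I.Jump x j₁ len) → s.warr 9 x = 0
  no_jump_end : ∀ x, (∀ j₀ len, ¬ I.Jump j₀ x len) → s.warr 12 x = 0
  pre : ∀ x ≤ I.F.length, I.Clean x → s.warr 13 x = I.prefixWt x
  par : ∀ i j, IsNode I.F i j → IsEnclosing I.F i (s.warr 8 i)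

/-- The bound on the words is large enough. -/
def BoundOK (B : ℕ) : Prop := (I.F.length + I.G.length + I.k + 2) ^ 8 ≤ B

/-- Slot `σ` holds the distances of `F[l..r)` and the fragments of `G` in the band. -/
def GoodMat (s : RAMState) (σ l r : ℕ) : Prop :=
  ∀ a b, a < 4 * I.k + 1 → b < 4 * I.k + 1 →
    GoodEntry I.w I.k I.F I.G l r a b (s.mat (4 * I.k + 1) σ a b)

/-- The real array `1` holds the distances of the inside of the node at `m` and the insides of the
nodes of `G` in the band. -/
def GoodInner (s : RAMState) (m : ℕ) : Prop :=
  ∀ j z z₀ a b, IsNode I.F m j → IsNode I.G z z₀ → z + 2 * I.k = m + a → a < 4 * I.k + 1 →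
    z₀ + 2 * I.k = j + b → b < 4 * I.k + 1 →
    GoodEntry I.w I.k I.F I.G (m + 1) j a b (s.rarr 1 (m * (4 * I.k + 1) + a))

variable {I}

theorem Ready.of_keeps {s s' : RAMState} (h : I.Ready s) (hk : Keeps 10 s s') : I.Ready s' := by
  obtain ⟨h1, h2, h3⟩ := hk
  constructor
  all_goals first
    | (rw [h1 _ (by omega)]; first | exact h.v0 | exact h.v1 | exact h.v2 | exact h.v4 | exact h.v5 | exact h.v6)
    | (rw [h3]; exact h.inf)
    | (rw [h2]; first | exact h.nodeF | exact h.nodeG | exact h.mate_le | exact h.jump | exact h.no_jump | exact h.no_jump_end | exact h.pre | exact h.par)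

theorem BoundOK.linear {B : ℕ} (h : I.BoundOK B) :
    1000 * (I.F.length + I.G.length + I.k + 2) ≤ B := by
  refine le_trans ?_ h
  have hk := I.one_le
  set b := I.F.length + I.G.length + I.k + 2
  have : 3 ^ 7 ≤ b ^ 7 := Nat.pow_le_pow_left (by omega) 7
  calc 1000 * b ≤ b ^ 7 * b := Nat.mul_le_mul_right _ (by omega)
    _ = b ^ 8 := by ring

/-- The exponent 8 is 2 + 3 + 3: the number of a slot is below the square of the base, and `4k + 1`
is at most its cube. -/
theorem BoundOK.slot {B σ : ℕ} (h : I.BoundOK B) (hσ : σ ≤ 3 * I.F.length + 4) :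
    σ * ((4 * I.k + 1) * (4 * I.k + 1)) + (4 * I.k + 1) * (4 * I.k + 1) ≤ B := by
  refine le_trans ?_ h
  have hk := I.one_le
  set b := I.F.length + I.G.length + I.k + 2
  have h1 : 4 * I.k + 1 ≤ b ^ 3 := by
    have : 3 ^ 2 ≤ b ^ 2 := Nat.pow_le_pow_left (by omega) 2
    calc 4 * I.k + 1 ≤ 9 * b := by omega
      _ ≤ b ^ 2 * b := Nat.mul_le_mul_right _ this
      _ = b ^ 3 := by ring
  have h2 : σ + 1 ≤ b ^ 2 := by
    have : 3 * b ≤ b * b := Nat.mul_le_mul_right _ (by omega)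
    rw [sq]; omega
  calc _ = (σ + 1) * ((4 * I.k + 1) * (4 * I.k + 1)) := by ring
    _ ≤ b ^ 2 * (b ^ 3 * b ^ 3) := Nat.mul_le_mul h2 (Nat.mul_le_mul h1 h1)
    _ = b ^ 8 := by ring

theorem BoundOK.sq {B : ℕ} (h : I.BoundOK B) :
    (4 * I.k + 1) * (4 * I.k + 1) ≤ B := by
  have := h.slot (σ := 0) (by omega)
  omega

theorem BoundOK.inner {B x a : ℕ} (h : I.BoundOK B) (hx : x ≤ I.F.length) (ha : a < 4 * I.k + 1) :
    x * (4 * I.k + 1) + a ≤ B := by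
  have h1 := h.slot (σ := x) (by omega)
  have h2 : x * (4 * I.k + 1) ≤ x * ((4 * I.k + 1) * (4 * I.k + 1)) :=
    Nat.mul_le_mul_left _ (Nat.le_mul_of_pos_left _ (by omega))
  have h3 : 4 * I.k + 1 ≤ (4 * I.k + 1) * (4 * I.k + 1) := Nat.le_mul_of_pos_left _ (by omega)
  omega

theorem orc_del {x : ℕ} (hx : x < I.F.length) :
    I.orc x (I.F.length + I.G.length) / 2 = delCost I.w I.F x := by
  simp [orc, oracle, delCost, parenWeight, List.getElem?_append_left hx]

theorem orc_ins {y : ℕ} : I.orc (I.F.length + I.G.length) (I.F.length + y) / 2 =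
    insCost I.w I.G y := by
  rw [orc, oracle, insCost, parenWeight, List.getElem?_append_right (by omega),
    List.getElem?_append_right (by omega), List.getElem?_eq_none (by omega), Nat.add_sub_cancel_left]

theorem orc_sub {x y : ℕ} (hx : x < I.F.length) :
    I.orc x (I.F.length + y) / 2 = subCost I.w I.F I.G x y := by
  rw [orc, oracle, subCost, parenWeight, List.getElem?_append_left hx,
    List.getElem?_append_right (by omega), Nat.add_sub_cancel_left]

theorem GoodMat.of_eq {s s' : RAMState} {σ σ' l r : ℕ} (h : I.GoodMat s σ l r)
    (he : ∀ a b, a < 4 * I.k + 1 → b < 4 * I.k + 1 →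
      s'.mat (4 * I.k + 1) σ' a b = s.mat (4 * I.k + 1) σ a b) : I.GoodMat s' σ' l r :=
  fun a b ha hb => by rw [he a b ha hb]; exact h a b ha hb

theorem GoodMat.keep {s s' : RAMState} {σ d l r : ℕ} (h : I.GoodMat s σ l r)
    (hk : KeepsSlots (4 * I.k + 1) d s s') (hd : σ ≠ d) : I.GoodMat s' σ l r :=
  h.of_eq fun a b ha hb => hk.mat σ a b hd ha hb

theorem GoodInner.keep {s s' : RAMState} {m : ℕ} (h : I.GoodInner s m)
    (hk : s'.rarr 1 = s.rarr 1) : I.GoodInner s' m := by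
  unfold GoodInner
  rw [hk]
  exact h

/-- A position of `F` with kind `1` is the closing parenthesis of its node. -/
theorem Ready.node_of_close {s : RAMState} (h : I.Ready s) {x : ℕ} (hx : x < I.F.length)
    (hk : s.warr 0 x = 1) : IsNode I.F (s.warr 7 x) x := by
  obtain ⟨y, hy | hy⟩ := I.balF.exists_node x hx
  · have := (h.nodeF _ _ hy).1; omega
  · rw [(h.nodeF _ _ hy).2.2.2]; exact hy

theorem Ready.node_of_open {s : RAMState} (h : I.Ready s) {x : ℕ} (hx : x < I.F.length)
    (hk : s.warr 0 x ≠ 1) : IsNode I.F x (s.warr 7 x) := by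
  obtain ⟨y, hy | hy⟩ := I.balF.exists_node x hx
  · rw [(h.nodeF _ _ hy).2.2.1]; exact hy
  · have := (h.nodeF _ _ hy).2.1; omega

theorem Ready.nodeG_of_close {s : RAMState} (h : I.Ready s) {x : ℕ} (hx : x < I.G.length)
    (hk : s.warr 0 (I.F.length + x) = 1) :
    IsNode I.G (s.warr 7 (I.F.length + x) - I.F.length) x := by
  obtain ⟨y, hy | hy⟩ := I.balG.exists_node x hx
  · have := (h.nodeG _ _ hy).1; omega
  · rw [(h.nodeG _ _ hy).2.2.2, Nat.add_sub_cancel_left]; exact hy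

theorem Ready.nodeG_of_open {s : RAMState} (h : I.Ready s) {x : ℕ} (hx : x < I.G.length)
    (hk : s.warr 0 (I.F.length + x) ≠ 1) :
    IsNode I.G x (s.warr 7 (I.F.length + x) - I.F.length) := by
  obtain ⟨y, hy | hy⟩ := I.balG.exists_node x hx
  · rw [(h.nodeG _ _ hy).2.2.1, Nat.add_sub_cancel_left]; exact hy
  · have := (h.nodeG _ _ hy).2.1; omega

theorem upperEntry_inf {l r a b : ℕ} : UpperEntry I.w I.k I.F I.G l r a b ((I.k : ℝ) + 1) :=
  upperEntry_of_lt (by linarith)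

end TedInput

/-! ### Matrix routines -/

/-- The address of the entry `(a, b)` in slot `σ`. -/
def WExp.entry (σ a b : WExp) : WExp := σ * (wv 5 * wv 5) + (a * wv 5 + b)

@[simp] theorem WExp.entry_eval (s : RAMState) (σ a b : WExp) : (WExp.entry σ a b).eval s =
    σ.eval s * (s.wvar 5 * s.wvar 5) + (a.eval s * s.wvar 5 + b.eval s) := rfl

@[simp] theorem WExp.entry_cost (σ a b : WExp) :
    (WExp.entry σ a b).cost = σ.cost + 3 + 1 + (a.cost + 1 + 1 + b.cost + 1) + 1 := rfl

/-- Copies the matrix in the slot given by the word variable `41`. -/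
def Cmd.copyMat : Cmd := .matFill false (.setR 5 (.cell 0 (.entry (wv 41) (wv 52) (wv 53))))

/-- The min-plus product of the matrices in the slots given by the word variables `41`, `42`. -/
def Cmd.mulMat : Cmd := .matFill false
  (.setR 5 (.var 1) ;; .forLoop 60 (wv 5) (.relaxIf (.wle 0 0)
    (.cell 0 (.entry (wv 41) (wv 52) (wv 60)) + .cell 0 (.entry (wv 42) (wv 60) (wv 53)))))

/-- The distances of the empty fragment at the position given by the word variable `41`. -/
def Cmd.emptyMat : Cmd := .matFill false
  (.setR 5 (.var 1) ;; .setW 60 (wv 41 + wv 53 - 2 * wv 2) ;;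
    .relaxIf (.and (.weq (wv 52) (wv 53)) (.and (.wle (2 * wv 2) (wv 41 + wv 53))
      (.wle (wv 60) (wv 1)))) (.cast 0) ;;
    .relaxIf (.and (.wlt (wv 52) (wv 53)) (.and (.wle (2 * wv 2 + 1) (wv 41 + wv 53))
      (.wle (wv 60) (wv 1))))
      (.cell 0 (.entry (wv 40) (wv 52) (wv 53 - 1)) + .half (.query (wv 4) (wv 0 + (wv 60 - 1)))))

/-- Extends the fragment `F[l..r)` to the right, where the word variables `30`, `31` hold `l`,
`r`. -/
def Cmd.rightStep : Cmd := .setW 40 (wv 31 + 1) ;; .matFill false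
  (.setR 5 (.var 1) ;;
    .relaxIf (.wle (wv 53 + 2) (wv 5)) (.cell 0 (.entry (wv 31) (wv 52) (wv 53 + 1)) +
      .half (.query (wv 31) (wv 4))) ;;
    .setW 60 (wv 31 + wv 53 - 2 * wv 2) ;;
    .relaxIf (.and (.wle 1 (wv 53)) (.and (.wle (2 * wv 2) (wv 31 + wv 53))
      (.wlt (wv 60) (wv 1))))
      (.cell 0 (.entry (wv 40) (wv 52) (wv 53 - 1)) + .half (.query (wv 4) (wv 0 + wv 60))) ;;
    .setW 61 (.cell 7 (wv 31)) ;;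
    .setW 62 (.cell 7 (wv 0 + wv 60) - wv 0) ;;
    .relaxIf (.and (.weq (.cell 0 (wv 31)) 1) (.and (.wle (wv 30) (wv 61))
      (.and (.wle (2 * wv 2) (wv 31 + wv 53)) (.and (.wlt (wv 60) (wv 1))
      (.and (.weq (.cell 0 (wv 0 + wv 60)) 1) (.and (.wle (wv 61) (wv 62 + 2 * wv 2))
      (.wlt (wv 62 + 2 * wv 2) (wv 61 + wv 5))))))))
      (.cell 0 (.entry (wv 61) (wv 52) (wv 62 + 2 * wv 2 - wv 61)) +
        .cell 1 (wv 61 * wv 5 + (wv 62 + 2 * wv 2 - wv 61)) +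
        .half (.query (wv 61) (wv 0 + wv 62)) + .half (.query (wv 31) (wv 0 + wv 60))))

/-- Extends the fragment `F[l..r)` to the left, where the word variables `30`, `31` hold `l`,
`r`. -/
def Cmd.leftStep : Cmd := .setW 40 (wv 6 + wv 30 - 1) ;; .setW 41 (wv 30 - 1) ;; .matFill true
  (.setR 5 (.var 1) ;;
    .relaxIf (.wle 1 (wv 52)) (.cell 0 (.entry (wv 6 + wv 30) (wv 52 - 1) (wv 53)) +
      .half (.query (wv 41) (wv 4))) ;;
    .setW 60 (wv 41 + wv 52 - 2 * wv 2) ;;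
    .relaxIf (.and (.wle (wv 52 + 2) (wv 5)) (.and (.wle (2 * wv 2) (wv 41 + wv 52))
      (.wlt (wv 60) (wv 1))))
      (.cell 0 (.entry (wv 40) (wv 52 + 1) (wv 53)) + .half (.query (wv 4) (wv 0 + wv 60))) ;;
    .setW 61 (.cell 7 (wv 41)) ;;
    .setW 62 (.cell 7 (wv 0 + wv 60) - wv 0) ;;
    .relaxIf (.and (.not (.weq (.cell 0 (wv 41)) 1)) (.and (.wle (2 * wv 2) (wv 41 + wv 52))
      (.and (.wlt (wv 60) (wv 1)) (.and (.not (.weq (.cell 0 (wv 0 + wv 60)) 1))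
      (.and (.wle (wv 61) (wv 62 + 2 * wv 2)) (.wlt (wv 62 + 2 * wv 2) (wv 61 + wv 5)))))))
      (.cell 1 (wv 41 * wv 5 + wv 52) +
        .cell 0 (.entry (wv 6 + (wv 61 + 1)) (wv 62 + 2 * wv 2 - wv 61) (wv 53)) +
        .half (.query (wv 41) (wv 0 + wv 60)) + .half (.query (wv 61) (wv 0 + wv 62))))

/-- Stores the distances of the inside `F[l..r)` of a node, where the word variables `30`, `31`
hold `l`, `r`. -/
def Cmd.recordInner : Cmd := .setW 41 (wv 30 - 1) ;; .forLoop 50 (wv 5)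
  (.setW 60 (wv 41 + wv 50 - 2 * wv 2) ;;
    .setW 61 (.cell 7 (wv 0 + wv 60) - wv 0) ;;
    .ite (.and (.wle (2 * wv 2) (wv 41 + wv 50)) (.and (.wlt (wv 60) (wv 1))
      (.and (.not (.weq (.cell 0 (wv 0 + wv 60)) 1)) (.and (.wle (wv 31) (wv 61 + 2 * wv 2))
      (.wlt (wv 61 + 2 * wv 2) (wv 31 + wv 5))))))
      (.storeR 1 (wv 41 * wv 5 + wv 50)
        (.cell 0 (.entry (wv 31) (wv 50) (wv 61 + 2 * wv 2 - wv 31)))) .skip)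

/-! ### Copies, min-plus products and empty fragments -/

namespace TedInput

variable {α : Type*} {I : TedInput α} {B : ℕ} {s : RAMState}

theorem copyMat_spec (hB : I.BoundOK B) (hR : I.Ready s) {d σ : ℕ} (hd : s.wvar 40 = d)
    (hσ : s.wvar 41 = σ) (hd' : d ≤ 3 * I.F.length + 4) (hne : σ ≠ d) :
    Halts I.orc B .copyMat s fun s' T =>
      T ≤ 200 * ((4 * I.k + 1) * (4 * I.k + 1)) ∧ Keeps 50 s s' ∧
        KeepsSlots (4 * I.k + 1) d s s' ∧
        ∀ l r, I.GoodMat s σ l r → I.GoodMat s' d l r := by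
  refine (Halts.matFill (C := 20) false (fun a b v => v = s.mat (4 * I.k + 1) σ a b) hR.v5 hd hB.sq
    (hB.slot hd') ?_).mono ?_
  · intro s₁ a b ha hb h1 h2 h3 h4 h5
    refine .setR ⟨by simp, (Keeps.refl _ _).setR (by simp), rfl, ?_⟩
    rw [← h4.mat σ a b hne ha hb]
    simp [h2, h3, h1.wvar 41, h1.wvar 5, hσ, hR.v5, RAMState.mat]
  · rintro s' T ⟨h1, h2, h3, h4⟩
    have hk := I.one_le
    have h5 : 10 ≤ 10 * ((4 * I.k + 1) * (4 * I.k + 1)) := by nlinarith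
    exact ⟨by omega, h2, h3, fun l r h => h.of_eq h4⟩

theorem mulMat_spec (hB : I.BoundOK B) (hR : I.Ready s) {d σ τ l p r : ℕ} (hd : s.wvar 40 = d)
    (hσ : s.wvar 41 = σ) (hτ : s.wvar 42 = τ) (hd' : d ≤ 3 * I.F.length + 4) (hne : σ ≠ d)
    (hne' : τ ≠ d) (h1 : I.GoodMat s σ l p) (h2 : I.GoodMat s τ p r) (hl : l ≤ p) (hr : p ≤ r)
    (hp : ∀ i j, IsNode I.F i j → l ≤ i → j < r → i < p → p ≤ j → False) :
    Halts I.orc B .mulMat s fun s' T =>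
      T ≤ 200 * ((4 * I.k + 1) * ((4 * I.k + 1) * (4 * I.k + 1))) ∧ Keeps 50 s s' ∧
        KeepsSlots (4 * I.k + 1) d s s' ∧ I.GoodMat s' d l r := by
  refine (Halts.matFill (C := 60 * (4 * I.k + 1) + 20) false
    (fun a b v => GoodEntry I.w I.k I.F I.G l r a b v) hR.v5 hd hB.sq
    (hB.slot hd') ?_).mono ?_
  · intro s₁ a b ha hb k1 k2 k3 k4 k5
    refine .seq (.setR ?_)
    -- After `q` rounds the running minimum is at most the sums for all middle offsets below `q`,
    -- and it remains a valid upper entry throughout.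
    refine Halts.forLoop (N := 4 * I.k + 1) (fun q s₂ => Keeps 54 s₁ s₂ ∧ s₂.rarr = s₁.rarr ∧
      s₂.wvar 60 = q ∧ UpperEntry I.w I.k I.F I.G l r a b (s₂.rvar 5) ∧
      ∀ c < q, s₂.rvar 5 ≤ s.mat (4 * I.k + 1) σ a c + s.mat (4 * I.k + 1) τ c b) 50
      ?_ ?_ ?_ ?_ ?_ ?_
    · have := hB.linear; omega
    · refine ⟨((Keeps.refl _ _).setR (by simp)).setW (by simp), rfl, by simp, ?_, by simp⟩
      simp [k1.rvar, hR.inf, upperEntry_inf]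
    · rintro q s₂ ⟨h3, -⟩
      simp [h3.wvar 5, k1.wvar 5, hR.v5]
    · rintro q s₂ - ⟨-, -, h, -⟩; exact h
    · rintro q s₂ hq ⟨h3, h4, h5, h6, h7⟩ -
      refine .relaxIf ?_
      intro s₃ T h8 h9 h10 h11 h12 h13 h14 h15
      have e : s₂.mat (4 * I.k + 1) σ a q + s₂.mat (4 * I.k + 1) τ q b =
          s.mat (4 * I.k + 1) σ a q + s.mat (4 * I.k + 1) τ q b := by
        rw [← k4.mat σ a q hne ha hq, ← k4.mat τ q b hne' hq hb]
        simp only [RAMState.mat, h4]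
      have g : s₂.wvar 5 = 4 * I.k + 1 ∧ s₂.wvar 41 = σ ∧ s₂.wvar 42 = τ ∧ s₂.wvar 52 = a ∧
          s₂.wvar 53 = b := by
        refine ⟨?_, ?_, ?_, ?_, ?_⟩ <;> rw [h3.wvar _ (by omega)]
        · rw [k1.wvar _ (by omega), hR.v5]
        · rw [k1.wvar _ (by omega), hσ]
        · rw [k1.wvar _ (by omega), hτ]
        · exact k2
        · exact k3
      obtain ⟨g1, g2, g3, g4, g5⟩ := g
      simp only [BExp.eval, le_refl, true_implies, RExp.eval_add, RExp.eval, WExp.entry_eval,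
        WExp.eval, g1, g2, g3, g4, g5, h5] at h14 h15
      simp only [RAMState.mat] at e
      rw [e] at h14 h15
      refine ⟨by rw [h9, h5], by simp at h8; omega, ?_, ?_, ?_, ?_, ?_⟩
      · exact (h3.trans ⟨fun x _ => by rw [h9], h10, h12⟩).setW (by omega)
      · rw [RAMState.setW_rarr, h11, h4]
      · simp
      · exact h15 _ h6 ((h1 a q ha hq).1.mul (h2 q b hq hb).1)
      · intro c hc
        rcases Nat.lt_succ_iff_lt_or_eq.1 hc with hc | rfl
        · exact h13.trans (h7 c hc)
        · exact h14
    · rintro s₂ T ⟨h3, h4, h5, h6, h7⟩ hT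
      refine ⟨?_, h3, h4, h6, LowerEntry.mul hl hr hp fun c hc =>
        ⟨_, _, (h1 a c ha (by omega)).2, (h2 c b (by omega) hb).2, h7 c (by omega)⟩⟩
      simp at hT ⊢
      omega
  · rintro s' T ⟨h3, h4, h5, h6⟩
    refine ⟨?_, h4, h5, h6⟩
    have h7 : 1 ≤ (4 * I.k + 1) * (4 * I.k + 1) := by nlinarith
    have h8 : (4 * I.k + 1) * (4 * I.k + 1) ≤
      (4 * I.k + 1) * ((4 * I.k + 1) * (4 * I.k + 1)) := Nat.le_mul_of_pos_left _ (by omega)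
    refine h3.trans ?_
    have h9 : (60 * (4 * I.k + 1) + 20 + 50) * ((4 * I.k + 1) * (4 * I.k + 1)) =
      60 * ((4 * I.k + 1) * ((4 * I.k + 1) * (4 * I.k + 1))) +
        70 * ((4 * I.k + 1) * (4 * I.k + 1)) := by ring
    omega

theorem emptyMat_spec (hB : I.BoundOK B) (hR : I.Ready s) {d x : ℕ} (hd : s.wvar 40 = d)
    (hx : s.wvar 41 = x) (hd' : d ≤ 3 * I.F.length + 4) (hxF : x ≤ I.F.length) :
    Halts I.orc B .emptyMat s fun s' T =>
      T ≤ 300 * ((4 * I.k + 1) * (4 * I.k + 1)) ∧ Keeps 50 s s' ∧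
        KeepsSlots (4 * I.k + 1) d s s' ∧ I.GoodMat s' d x x := by
  have hlin := hB.linear
  refine (Halts.matFill (C := 150) false
    (fun a b v => GoodEntry I.w I.k I.F I.G x x a b v) hR.v5 hd hB.sq (hB.slot hd') ?_).mono ?_
  · intro s₁ a b ha hb k1 k2 k3 k4 k5
    have R1 := hR.of_keeps (k1.mono (by omega))
    have g40 : s₁.wvar 40 = d := by rw [k1.wvar _ (by omega), hd]
    have g41 : s₁.wvar 41 = x := by rw [k1.wvar _ (by omega), hx]
    refine .seq (.setR (.seq (.setW ?_ (.seq (.relaxIf ?_)))))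
    · simp [g41, k3, R1.v2]; omega
    intro s₂ T₂ t2 w2 a2 r2 i2 _ c2 p2
    refine .relaxIf ?_
    intro s₃ T₃ t3 w3 a3 r3 i3 d3 c3 p3
    simp [g41, k3, k2, R1.v2, R1.v1, R1.v0, R1.v4, R1.v5, R1.inf] at w2 c2 p2 i2 a2 r2
    simp [w2, g40, g41, k3, k2, R1.v2, R1.v1, R1.v0, R1.v4, R1.v5, r2] at w3 c3 p3 r3 i3
    refine ⟨?_, ?_, by rw [r3], ?_, ?_⟩
    · simp at t2 t3 ⊢; omega
    · refine ⟨fun y hy => ?_, by rw [a3, a2], by rw [i3, i2, R1.inf]⟩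
      rw [w3, RAMState.setW_wvar, if_neg (by omega)]; rfl
    · refine p3 _ (p2 _ upperEntry_inf ?_) ?_
      · rintro rfl h2 h3
        exact .empty hxF (y := x + a - 2 * I.k) (by omega) (by omega) (by omega)
      · intro h1 h2 h3
        obtain ⟨b, rfl⟩ : ∃ b', b = b' + 1 := ⟨b - 1, by omega⟩
        rw [orc_ins]
        exact (k5 a b ha (by omega) (by simp)).1.ins_right (by omega) (by omega) (by omega)
    · refine LowerEntry.empty (fun y h1 h2 h3 => ?_) ?_
      · exact d3.trans (c2 h3 (by omega) (by omega))
      · intro z b' h1 h2 h3 h4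
        subst h1
        refine ⟨_, (k5 a b' ha (by omega) (by simp)).2, ?_⟩
        have := c3 (by omega) (by omega) (by omega)
        rw [orc_ins] at this
        rwa [show x + (b' + 1) - 2 * I.k - 1 = z by omega] at this
  · rintro s' T ⟨h1, h2, h3, h4⟩
    have h5 : 1 ≤ (4 * I.k + 1) * (4 * I.k + 1) := by nlinarith
    exact ⟨by omega, h2, h3, h4⟩

end TedInput


/-! ### Extending a fragment by one character and recording inner distances -/

namespace TedInput

variable {α : Type*} {I : TedInput α} {B : ℕ} {s : RAMState}

-- If `F[r]` closes a node that opens at `m`, then aligning this node combines the matrix of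
-- F[l..m), kept in slot `m`, with one inner distance from real array `1`; thus every entry takes
-- constant time. An insertion reads offset `b - 1` of the same row, hence the ascending order.
set_option maxHeartbeats 1000000 in
theorem rightStep_spec (hB : I.BoundOK B) (hR : I.Ready s) {l r : ℕ} (hl : s.wvar 30 = l)
    (hr : s.wvar 31 = r) (hlr : l ≤ r) (hrF : r < I.F.length) (hcur : I.GoodMat s r l r)
    (hsub : ∀ m, IsNode I.F m r → l ≤ m → I.GoodMat s m l m ∧ I.GoodInner s m) :
    Halts I.orc B .rightStep s fun s' T =>
      T ≤ 600 * ((4 * I.k + 1) * (4 * I.k + 1)) ∧ Keeps 40 s s' ∧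
        KeepsSlots (4 * I.k + 1) (r + 1) s s' ∧ I.GoodMat s' (r + 1) l (r + 1) := by
  have hlin := hB.linear
  refine .seq (.setW (by simp [hr]; omega) ?_)
  have hR' : I.Ready (s.setW 40 (r + 1)) := hR.of_keeps ((Keeps.refl _ _).setW (by simp))
  have hev : (wv 31 + 1 : WExp).eval s = r + 1 := by simp [hr]
  rw [hev]
  refine (Halts.matFill (C := 400) false
    (fun a b v => GoodEntry I.w I.k I.F I.G l (r + 1) a b v) hR'.v5
    (d := r + 1) (by simp) hB.sq (hB.slot (by omega)) ?_).mono ?_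
  · intro s₁ a b ha hb k1 k2 k3 k4 k5
    have R1 := hR'.of_keeps (k1.mono (by omega))
    have g40 : s₁.wvar 40 = r + 1 := by rw [k1.wvar _ (by omega)]; simp
    have g30 : s₁.wvar 30 = l := by rw [k1.wvar _ (by omega)]; simp [hl]
    have g31 : s₁.wvar 31 = r := by rw [k1.wvar _ (by omega)]; simp [hr]
    have hmat : ∀ σ a b, σ ≠ r + 1 → a < 4 * I.k + 1 → b < 4 * I.k + 1 →
        s₁.rarr 0 (σ * ((4 * I.k + 1) * (4 * I.k + 1)) + (a * (4 * I.k + 1) + b)) =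
          s.mat (4 * I.k + 1) σ a b := fun σ a b h1 h2 h3 => k4.mat σ a b h1 h2 h3
    have hin : s₁.rarr 1 = s.rarr 1 := k4.rarr 1 (by omega)
    have hG : ∀ x, s₁.warr 7 x ≤ I.F.length + I.G.length := R1.mate_le
    refine .seq (.setR (.seq (.relaxIf ?_)))
    intro s₂ T₂ t2 w2 a2 r2 i2 _ c2 p2
    simp [g31, k3, k2, R1.v5, R1.v4, R1.inf] at w2 c2 p2 i2 a2 r2
    refine .seq (.setW ?_ (.seq (.relaxIf ?_)))
    · simp [w2, g31, k3, R1.v2]; omega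
    intro s₃ T₃ t3 w3 a3 r3 i3 d3 c3 p3
    simp [w2, a2, r2, i2, g40, g31, k3, k2, R1.v0, R1.v1, R1.v2, R1.v5, R1.v4]
      at w3 c3 p3 i3 a3 r3 d3
    have hm1 := hG r
    have hm2 := hG (I.F.length + (r + b - 2 * I.k))
    refine .seq (.setW ?_ (.seq (.setW ?_ (.relaxIf ?_))))
    · simp [w3, w2, a3, g31]; omega
    · simp [w3, w2, a3, R1.v0]; omega
    intro s₄ T₄ t4 w4 a4 r4 i4 d4 c4 p4
    simp [w3, w2, a3, r3, i3, g31, g30, k3, k2, R1.v0, R1.v1, R1.v2, R1.v5]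
      at w4 c4 p4 i4 a4 r4 d4
    refine ⟨?_, ?_, r4, ?_, ?_⟩
    · simp at t2 t3 t4 ⊢; omega
    · refine ⟨fun y hy => ?_, a4, by rw [i4, R1.inf]⟩
      rw [w4, RAMState.setW_wvar, if_neg (by omega), RAMState.setW_wvar, if_neg (by omega), w3,
        RAMState.setW_wvar, if_neg (by omega), w2]
    · refine p4 _ (p3 _ (p2 _ upperEntry_inf fun h1 => ?_) fun h1 h2 h3 => ?_)
        fun h1 h2 h3 h4 h5 h6 h7 => ?_
      · rw [hmat r a (b + 1) (by omega) ha (by omega), orc_del hrF]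
        exact (hcur a (b + 1) ha (by omega)).1.del_right hrF (by omega)
      · obtain ⟨b, rfl⟩ : ∃ b', b = b' + 1 := ⟨b - 1, by omega⟩
        rw [orc_ins, Nat.add_sub_cancel]
        exact (k5 a b ha (by omega) (by simp)).1.ins_right (by omega) (by omega) (by omega)
      · have n1 := R1.node_of_close hrF h1
        have n2 := R1.nodeG_of_close (x := r + b - 2 * I.k) (by omega) h5
        have lt1 := n1.lt
        have lt2 := n2.lt
        obtain ⟨q1, q2⟩ := hsub _ n1 h2
        generalize s₁.warr 7 r = m at *
        generalize s₁.warr 7 (I.F.length + (r + b - 2 * I.k)) - I.F.length = z at *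
        rw [hmat m _ _ (by omega) ha (by omega), hin, orc_sub (by omega), orc_sub hrF]
        exact (q1 a _ ha (by omega)).1.sub (q2 _ _ _ _ b n1 n2 (by omega) (by omega) (by omega)
          hb).1 n1 n2 (by omega) (by omega) rfl
    · refine LowerEntry.step_right hlr (fun h1 => ?_) (fun z₀ b' h1 h2 h3 => ?_)
        fun m z z₀ c n1 h1 n2 h2 h3 h4 => ?_
      · refine ⟨_, (hcur a (b + 1) ha (by omega)).2, d4.trans (d3.trans ?_)⟩
        have := c2 (by omega)
        rwa [hmat r a (b + 1) (by omega) ha (by omega), orc_del hrF] at this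
      · subst h1
        refine ⟨_, (k5 a b' ha (by omega) (by simp)).2, d4.trans ?_⟩
        have := c3 (by omega) (by omega) (by omega)
        rw [orc_ins, Nat.add_sub_cancel] at this
        rwa [show r + (b' + 1) - 2 * I.k = z₀ by omega] at this
      · obtain ⟨q1, q2⟩ := hsub _ n1 h1
        have lt1 := n1.lt
        have lt2 := n2.lt_length
        have e1 := R1.nodeF _ _ n1
        have e2 := R1.nodeG _ _ n2
        have e3 : r + b - 2 * I.k = z₀ := by omega
        rw [e3, e1.2.2.2, e2.2.2.2, Nat.add_sub_cancel_left] at c4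
        have := c4 e1.2.1 h1 (by omega) (by omega) e2.2.1 (by omega) (by omega)
        rw [hmat m _ _ (by omega) ha (by omega), hin, orc_sub (by omega), orc_sub hrF] at this
        refine ⟨_, _, (q1 a c ha (by omega)).2, (q2 _ _ _ c b n1 n2 (by omega) (by omega) (by omega)
          hb).2, ?_⟩
        rwa [show z + 2 * I.k - m = c by omega] at this
  · rintro s' T ⟨h1, h2, h3, h4⟩
    have h5 : 1 ≤ (4 * I.k + 1) * (4 * I.k + 1) := by nlinarith
    refine ⟨?_, ((Keeps.refl 40 s).setW (by simp)).trans (h2.mono (by simp)),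
      .trans (s' := s.setW 40 (r + 1)) (.of_rarr_eq rfl) h3, h4⟩
    simp
    omega

-- The mirror image of `rightStep_spec`: the matrix of the part F[m+1..r) after the node is in slot
-- |F| + 1 + (m + 1). An insertion reads row `a + 1` of the same matrix, which is why it is filled
-- in descending order.
set_option maxHeartbeats 1000000 in
theorem leftStep_spec (hB : I.BoundOK B) (hR : I.Ready s) {x r : ℕ} (hl : s.wvar 30 = x + 1)
    (hxr : x < r) (hrF : r ≤ I.F.length)
    (hcur : I.GoodMat s (I.F.length + 1 + (x + 1)) (x + 1) r)
    (hsub : ∀ m, IsNode I.F x m → m < r ∧ I.GoodMat s (I.F.length + 1 + (m + 1)) (m + 1) r ∧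
      I.GoodInner s x) :
    Halts I.orc B .leftStep s fun s' T =>
      T ≤ 600 * ((4 * I.k + 1) * (4 * I.k + 1)) ∧ Keeps 40 s s' ∧
        KeepsSlots (4 * I.k + 1) (I.F.length + 1 + x) s s' ∧
        I.GoodMat s' (I.F.length + 1 + x) x r := by
  have hlin := hB.linear
  refine .seq (.setW (by simp [hl, hR.v6]; omega) ?_)
  have hev : (wv 6 + wv 30 - 1 : WExp).eval s = I.F.length + 1 + x := by simp [hl, hR.v6]
  rw [hev]
  refine .seq (.setW (by simp [hl, hR.v6]; omega) ?_)
  have hev' : (wv 30 - 1 : WExp).eval (s.setW 40 (I.F.length + 1 + x)) = x := by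
    simp [hl]
  rw [hev']
  have hK : Keeps 40 s ((s.setW 40 (I.F.length + 1 + x)).setW 41 x) :=
    ((Keeps.refl _ _).setW (by simp)).setW (by simp)
  have hR' := hR.of_keeps (hK.mono (by simp))
  refine (Halts.matFill (C := 400) true
    (fun a b v => GoodEntry I.w I.k I.F I.G x r a b v) hR'.v5
    (d := I.F.length + 1 + x) (by simp) hB.sq (hB.slot (by omega)) ?_).mono ?_
  · intro s₁ a b ha hb k1 k2 k3 k4 k5
    have R1 := hR'.of_keeps (k1.mono (by omega))
    have g40 : s₁.wvar 40 = I.F.length + 1 + x := by rw [k1.wvar _ (by omega)]; simp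
    have g41 : s₁.wvar 41 = x := by rw [k1.wvar _ (by omega)]; simp
    have g30 : s₁.wvar 30 = x + 1 := by rw [k1.wvar _ (by omega)]; simp [hl]
    have hmat : ∀ σ a b, σ ≠ I.F.length + 1 + x → a < 4 * I.k + 1 → b < 4 * I.k + 1 →
        s₁.rarr 0 (σ * ((4 * I.k + 1) * (4 * I.k + 1)) + (a * (4 * I.k + 1) + b)) =
          s.mat (4 * I.k + 1) σ a b := fun σ a b h1 h2 h3 => k4.mat σ a b h1 h2 h3
    have hin : s₁.rarr 1 = s.rarr 1 := k4.rarr 1 (by omega)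
    have hG : ∀ x, s₁.warr 7 x ≤ I.F.length + I.G.length := R1.mate_le
    refine .seq (.setR (.seq (.relaxIf ?_)))
    intro s₂ T₂ t2 w2 a2 r2 i2 _ c2 p2
    simp [g30, g41, k3, k2, R1.v5, R1.v4, R1.v6, R1.inf] at w2 c2 p2 i2 a2 r2
    refine .seq (.setW ?_ (.seq (.relaxIf ?_)))
    · simp [w2, g41, k2, R1.v2]; omega
    intro s₃ T₃ t3 w3 a3 r3 i3 d3 c3 p3
    simp [w2, a2, r2, i2, g40, g41, k3, k2, R1.v0, R1.v1, R1.v2, R1.v5, R1.v4]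
      at w3 c3 p3 i3 a3 r3 d3
    have hm1 := hG x
    have hm2 := hG (I.F.length + (x + a - 2 * I.k))
    refine .seq (.setW ?_ (.seq (.setW ?_ (.relaxIf ?_))))
    · simp [w3, w2, a3, g41]; omega
    · simp [w3, w2, a3, R1.v0]; omega
    intro s₄ T₄ t4 w4 a4 r4 i4 d4 c4 p4
    simp [w3, w2, a3, r3, i3, g41, k3, k2, R1.v0, R1.v1, R1.v2, R1.v5, R1.v6]
      at w4 c4 p4 i4 a4 r4 d4
    refine ⟨?_, ?_, r4, ?_, ?_⟩
    · simp at t2 t3 t4 ⊢; omega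
    · refine ⟨fun y hy => ?_, a4, by rw [i4, R1.inf]⟩
      rw [w4, RAMState.setW_wvar, if_neg (by omega), RAMState.setW_wvar, if_neg (by omega), w3,
        RAMState.setW_wvar, if_neg (by omega), w2]
    · refine p4 _ (p3 _ (p2 _ upperEntry_inf fun h1 => ?_) fun h1 h2 h3 => ?_)
        fun h1 h2 h3 h4 h5 h6 => ?_
      · rw [hmat _ (a - 1) b (by omega) (by omega) hb, orc_del (by omega)]
        obtain ⟨a, rfl⟩ : ∃ a', a = a' + 1 := ⟨a - 1, by omega⟩
        exact (hcur a b (by omega) hb).1.del_left (by omega)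
      · rw [orc_ins]
        refine (k5 (a + 1) b (by omega) hb ?_).1.ins_left (by omega)
        rw [if_pos rfl, Nat.add_mul a 1]; omega
      · have n1 := R1.node_of_open (by omega) h1
        have n2 := R1.nodeG_of_open (x := x + a - 2 * I.k) (by omega) h4
        obtain ⟨q0, q1, q2⟩ := hsub _ n1
        have lt1 := n1.lt
        have lt2 := n2.lt
        generalize s₁.warr 7 x = m at *
        generalize s₁.warr 7 (I.F.length + (x + a - 2 * I.k)) - I.F.length = z at *
        rw [hmat _ _ _ (by omega) (by omega) hb, hin, orc_sub (by omega), orc_sub (by omega)]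
        exact (q2 _ _ _ a _ n1 n2 (by omega) ha (by omega) (by omega)).1.sub_left
          (q1 _ b (by omega) hb).1 n1 n2 (by omega) (by omega)
    · refine LowerEntry.step_left hxr (fun a' h1 => ?_) (fun y₀ h1 h2 h3 => ?_)
        fun m y₀ z₀ c n1 h1 n2 h2 h3 h4 => ?_
      · subst h1
        refine ⟨_, (hcur a' b (by omega) hb).2, d4.trans (d3.trans ?_)⟩
        have := c2 (by omega)
        rwa [hmat _ _ b (by omega) (by omega) hb, orc_del (by omega), Nat.add_sub_cancel] at this
      · refine ⟨_, (k5 (a + 1) b (by omega) hb ?_).2, d4.trans ?_⟩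
        · rw [if_pos rfl, Nat.add_mul a 1]; omega
        have := c3 (by omega) (by omega) (by omega)
        rw [orc_ins] at this
        rwa [show x + a - 2 * I.k = y₀ by omega] at this
      · obtain ⟨q0, q1, q2⟩ := hsub _ n1
        have lt1 := n1.lt
        have lt2 := n2.lt_length
        have lt3 := n2.lt
        have e1 := R1.nodeF _ _ n1
        have e2 := R1.nodeG _ _ n2
        have e3 : x + a - 2 * I.k = y₀ := by omega
        rw [e3, e1.2.2.1, e2.2.2.1, Nat.add_sub_cancel_left] at c4
        have := c4 (by omega) (by omega) (by omega) (by omega) (by omega) (by omega)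
        rw [hmat _ _ _ (by omega) (by omega) hb, hin, orc_sub (by omega), orc_sub (by omega)] at this
        refine ⟨_, _, (q2 _ _ _ a c n1 n2 (by omega) ha (by omega) (by omega)).2,
          (q1 c b (by omega) hb).2, ?_⟩
        rwa [show z₀ + 2 * I.k - m = c by omega] at this
  · rintro s' T ⟨h1, h2, h3, h4⟩
    have h5 : 1 ≤ (4 * I.k + 1) * (4 * I.k + 1) := by nlinarith
    refine ⟨?_, hK.trans (h2.mono (by simp)),
      .trans (s' := (s.setW 40 (I.F.length + 1 + x)).setW 41 x) (.of_rarr_eq rfl) h3, h4⟩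
    simp
    omega

/-- The current matrix is that of the inside of the node. For each offset of an opening parenthesis
of G only the entry at the offset of its mate is kept, if this is in the band. -/
theorem recordInner_spec (hB : I.BoundOK B) (hR : I.Ready s) {x r : ℕ} (hl : s.wvar 30 = x + 1)
    (hr : s.wvar 31 = r) (hn : IsNode I.F x r) (hcur : I.GoodMat s r (x + 1) r) :
    Halts I.orc B .recordInner s fun s' T =>
      T ≤ 200 * ((4 * I.k + 1) * (4 * I.k + 1)) ∧ Keeps 40 s s' ∧ s'.rarr 0 = s.rarr 0 ∧
        I.GoodInner s' x ∧ ∀ m, I.GoodInner s m → I.GoodInner s' m := by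
  have hlin := hB.linear
  have hrF := hn.lt_length
  have hxr := hn.lt
  refine .seq (.setW (by simp [hl]; omega) ?_)
  have hev : (wv 30 - 1 : WExp).eval s = x := by simp [hl]
  rw [hev]
  refine Halts.forLoop (N := 4 * I.k + 1) (fun q s₁ => Keeps 40 s s₁ ∧ s₁.rarr 0 = s.rarr 0 ∧
      s₁.wvar 41 = x ∧ s₁.wvar 50 = q ∧ (∀ m a, m ≠ x → a < 4 * I.k + 1 →
        s₁.rarr 1 (m * (4 * I.k + 1) + a) = s.rarr 1 (m * (4 * I.k + 1) + a)) ∧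
      ∀ a < q, ∀ z z₀ b, IsNode I.G z z₀ → z + 2 * I.k = x + a →
        z₀ + 2 * I.k = r + b → b < 4 * I.k + 1 →
        s₁.rarr 1 (x * (4 * I.k + 1) + a) = s.mat (4 * I.k + 1) r a b) 150
      ?_ ?_ ?_ ?_ ?_ ?_
  · omega
  · exact ⟨((Keeps.refl _ _).setW (by simp)).setW (by simp), rfl, by simp, by simp, by simp,
      by simp⟩
  · rintro q s₁ ⟨h1, -⟩
    simp [h1.wvar 5, hR.v5]
  · rintro q s₁ - ⟨-, -, -, h, -⟩; exact h
  · rintro q s₁ hq ⟨h1, h2, h3, h4, h5, h6⟩ -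
    have R1 := hR.of_keeps (h1.mono (by omega))
    have hm := R1.mate_le (I.F.length + (x + q - 2 * I.k))
    have g31 : s₁.wvar 31 = r := by rw [h1.wvar _ (by omega), hr]
    refine .seq (.setW ?_ (.seq (.setW ?_ ?_)))
    · simp [h3, h4, R1.v2]; omega
    · simp [h3, h4, R1.v2, R1.v0]; omega
    refine .ite (fun hb => .storeR ?_ ?_) fun hb => .skip ?_
    · simp [h3, h4, R1.v5]
      exact hB.inner (by omega) hq
    · simp [h3, h4, R1.v2, R1.v0, R1.v1, R1.v5, g31] at hb ⊢
      obtain ⟨b1, b2, b3, b4, b5⟩ := hb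
      have n1 := R1.nodeG_of_open (x := x + q - 2 * I.k) (by omega) b3
      refine ⟨?_, ?_, ?_, ?_⟩
      · exact (((h1.setW (by omega)).setW (by omega)).storeR).setW (by omega)
      · ext j; simp [h2]
      · intro m a hm ha
        rw [if_neg]
        · exact h5 m a hm (by omega)
        · intro h9; exact hm (slot_address_inj (by omega) hq h9).1
      · intro a ha z z₀ b n2 e1 e2 hb'
        by_cases haq : a = q
        · subst haq
          obtain rfl : x + a - 2 * I.k = z := by omega
          obtain e3 := n1.right_unique n2
          rw [if_pos rfl, h2, RAMState.mat]
          congr 3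
          omega
        · rw [if_neg (by omega)]
          exact h6 a (by omega) z z₀ b n2 e1 e2 (by omega)
    · simp [h3, h4, R1.v2, R1.v0, R1.v1, R1.v5, g31] at hb ⊢
      refine ⟨((h1.setW (by omega)).setW (by omega)).setW (by omega), h2, fun m a hm ha => h5 m a hm (by omega), ?_⟩
      intro a ha z z₀ b n2 e1 e2 hb'
      by_cases haq : a = q
      · subst haq
        obtain rfl : x + a - 2 * I.k = z := by omega
        have e3 := R1.nodeG _ _ n2
        have := n2.lt_length
        have := n2.lt
        have := hb (by omega) (by omega) (by omega) (by omega)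
        omega
      · exact h6 a (by omega) z z₀ b n2 e1 e2 (by omega)
  · rintro s' T ⟨h1, h2, h3, h4, h5, h6⟩ hT
    have h7 : 1 ≤ 4 * I.k + 1 := by omega
    have h8 : (4 * I.k + 1) ≤ (4 * I.k + 1) * (4 * I.k + 1) := Nat.le_mul_of_pos_left _ (by omega)
    have hx : I.GoodInner s' x := by
      intro j z z₀ a b n1 n2 e1 ha e2 hb
      obtain rfl := n1.right_unique hn
      rw [h6 a ha z z₀ b n2 e1 e2 hb]
      exact hcur a b ha hb
    refine ⟨?_, h1, h2, hx, fun m hm => ?_⟩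
    · simp at hT ⊢
      omega
    · by_cases hmx : m = x
      · rw [hmx]; exact hx
      · intro j z z₀ a b n1 n2 e1 ha e2 hb
        rw [h5 m a hmx ha]
        exact hm j z z₀ a b n1 n2 e1 ha e2 hb

end TedInput


/-! ### Expanding a fragment -/

/-- Copies the current matrix from the slot of its right end to the slot of its left end. -/
def Cmd.syncLeft : Cmd := .setW 40 (wv 6 + wv 30) ;; .setW 41 (wv 31) ;; .copyMat

/-- Copies the current matrix from the slot of its left end to the slot of its right end. -/
def Cmd.syncRight : Cmd := .setW 40 (wv 31) ;; .setW 41 (wv 6 + wv 30) ;; .copyMat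

/-- Extends the current fragment to the right by a character or by a jump. -/
def Cmd.expandRight : Cmd := .setW 34 (.cell 9 (wv 31)) ;;
  .ite (.wle 1 (wv 34))
    (.setW 40 (wv 34) ;; .setW 41 (wv 31) ;; .setW 42 (wv 6 + wv 6 + wv 31) ;; .mulMat ;;
      .setW 31 (wv 34))
    (.rightStep ;; .setW 31 (wv 31 + 1)) ;;
  .syncLeft

/-- Extends the current fragment to the left by a character or by a jump. -/
def Cmd.expandLeft : Cmd := .setW 34 (.cell 12 (wv 30)) ;;
  .ite (.wle 1 (wv 34))
    (.setW 40 (wv 6 + wv 34) ;; .setW 41 (wv 6 + wv 6 + wv 34) ;; .setW 42 (wv 6 + wv 30) ;;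
      .mulMat ;; .setW 30 (wv 34))
    (.leftStep ;; .setW 30 (wv 30 - 1)) ;;
  .syncRight

/-- Extends the current fragment, the inside of a node, by the parentheses of the node. -/
def Cmd.expandNode : Cmd := .recordInner ;; .rightStep ;; .setW 31 (wv 31 + 1) ;; .syncLeft ;;
  .setW 40 (wv 6 + wv 31) ;; .setW 41 (wv 31) ;; .emptyMat ;; .leftStep ;; .setW 30 (wv 30 - 1) ;;
  .syncRight

/-- Extends the current fragment in the direction that does not cut nodes. -/
def Cmd.expand : Cmd := .setW 33 (.cell 7 (wv 31) + 1) ;;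
  .ite (.and (.weq (.cell 0 (wv 31)) 1) (.wle (wv 33) (wv 30)))
    (.ite (.weq (wv 33) (wv 30)) .expandNode .expandLeft) .expandRight

/-- Starts with the empty fragment at the position given by the word variables `30` and `31` and
extends it until its right end is given by the word variable `32`. -/
def Cmd.run : Cmd := .setW 40 (wv 30) ;; .setW 41 (wv 30) ;; .emptyMat ;;
  .setW 40 (wv 6 + wv 30) ;; .emptyMat ;; .while (.wlt (wv 31) (wv 32)) .expand

namespace TedInput

variable {α : Type*} (I : TedInput α)

/-- The fragment `F[L..R)` can be reached by extending the empty fragment at `p`. -/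
structure Reachable (L p R : ℕ) : Prop where
  left_le : L ≤ p
  le_right : p ≤ R
  right_le : R ≤ I.F.length
  clean_left : I.Clean L
  clean_start : I.Clean p
  clean_right : I.Clean R
  closed : ∀ i j, IsNode I.F i j → L ≤ j → j < R → L ≤ i
  kind : p = L ∨ IsNode I.F L (R - 1) ∧ p < R

/-- The invariant of the expansion, started in the state `s₀`, when the current fragment is
`F[l..r)`. -/
structure RunInv (s₀ : RAMState) (L p R : ℕ) (s : RAMState) (l r : ℕ) : Prop where
  keeps : Keeps 30 s₀ s
  v30 : s.wvar 30 = l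
  v31 : s.wvar 31 = r
  v32 : s.wvar 32 = R
  left_le : L ≤ l
  le_start : l ≤ p
  start_le : p ≤ r
  le_right : r ≤ R
  clean_left : I.Clean l
  clean_right : I.Clean r
  done : r = R → l = L
  curR : I.GoodMat s r l r
  curL : I.GoodMat s (I.F.length + 1 + l) l r
  openR : ∀ x j, IsNode I.F x j → l ≤ x → x < r → r ≤ j → p ≤ x ∧ I.GoodMat s x l x
  openL : ∀ i x, IsNode I.F i x → i < l → l ≤ x → x < r →
    x < p ∧ I.GoodMat s (I.F.length + 1 + (x + 1)) (x + 1) r ∧ ∃ m, IsNode I.F m r ∧ m < i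
  keepInner : ∀ m, I.GoodInner s₀ m → I.GoodInner s m
  inner : ∀ i j, IsNode I.F i j → ¬ I.InJump i → L ≤ i → j < R →
    I.GoodInner s i ∨ i < p ∧ p ≤ j ∧ (i < l ∨ r ≤ j)
  powers : ∀ σ a b, 2 * (I.F.length + 1) ≤ σ → a < 4 * I.k + 1 → b < 4 * I.k + 1 →
    s.mat (4 * I.k + 1) σ a b = s₀.mat (4 * I.k + 1) σ a b

variable {I} {B : ℕ} {s₀ s s' : RAMState} {L p R l r : ℕ}

/-- Both a single character and a jump satisfy `h1` and `h2`: a node left open by the step opens at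
`r`, and then the old current matrix is the one to remember for it. By `h1` no node that opens to
the left of `l` closes at `r`, so the last clause of the old `openL` shows that no node was waiting
on the left. -/
theorem RunInv.right (h : I.RunInv s₀ L p R s l r) (hG : I.Reachable L p R) {r' : ℕ}
    (hrr : r < r') (hrR : r' ≤ R) (hc : I.Clean r') (hk : Keeps 30 s s') (v30 : s'.wvar 30 = l)
    (v31 : s'.wvar 31 = r') (v32 : s'.wvar 32 = R)
    (hin : s'.rarr 1 = s.rarr 1)
    (hmat : ∀ σ a b, σ ≠ r' → σ ≠ I.F.length + 1 + l → a < 4 * I.k + 1 → b < 4 * I.k + 1 →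
      s'.mat (4 * I.k + 1) σ a b = s.mat (4 * I.k + 1) σ a b)
    (curR : I.GoodMat s' r' l r') (curL : I.GoodMat s' (I.F.length + 1 + l) l r')
    (h1 : ∀ i j, IsNode I.F i j → r ≤ j → j < r' → l ≤ i)
    (h2 : ∀ i j, IsNode I.F i j → r ≤ i → i < r' → r' ≤ j → i = r) :
    I.RunInv s₀ L p R s' l r' where
  keeps := h.keeps.trans hk
  v30 := v30
  v31 := v31
  v32 := v32
  left_le := h.left_le
  le_start := h.le_start
  start_le := h.start_le.trans hrr.le
  le_right := hrR
  clean_left := h.clean_left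
  clean_right := hc
  done := by
    intro e
    rcases hG.kind with e' | ⟨n, _⟩
    · have := h.left_le; have := h.le_start; omega
    · have := h1 _ _ n (by omega) (by omega)
      have := h.left_le
      omega
  curR := curR
  curL := curL
  openR := by
    intro x j n e1 e2 e3
    have := hG.right_le
    by_cases hx : x < r
    · have := h.openR x j n e1 hx (by omega)
      exact ⟨this.1, this.2.of_eq fun a b ha hb => hmat x a b (by omega) (by omega) ha hb⟩
    · obtain rfl := h2 x j n (by omega) e2 e3
      exact ⟨h.start_le, h.curR.of_eq fun a b ha hb => hmat x a b (by omega) (by omega) ha hb⟩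
  openL := by
    intro i x n e1 e2 e3
    exfalso
    by_cases hx : x < r
    · obtain ⟨-, -, m, hm, hmi⟩ := h.openL i x n e1 e2 hx
      have := h1 _ _ hm le_rfl hrr
      omega
    · have := h1 _ _ n (by omega) e3
      omega
  keepInner := fun m hm => (h.keepInner m hm).keep hin
  inner := by
    intro i j n e1 e2 e3
    rcases h.inner i j n e1 e2 e3 with e4 | ⟨e4, e5, e6⟩
    · exact .inl (e4.keep hin)
    · by_cases e7 : i < l
      · exact .inr ⟨e4, e5, .inl e7⟩
      · by_cases e8 : r' ≤ j
        · exact .inr ⟨e4, e5, .inr e8⟩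
        · have := h.start_le
          have := (h.openR i j n (by omega) (by omega) (by omega)).1
          omega
  powers := by
    intro σ a b e1 ha hb
    have := hG.right_le
    have := h.le_start
    have := hG.le_right
    rw [hmat σ a b (by omega) (by omega) ha hb, h.powers σ a b e1 ha hb]

/-- The fragment grows to the left only if `F[r]` closes a node that opens further to the left. That
node contains the fragment, so no node that opens in the fragment is left open, and `openR` becomes
void. A node left half-covered by the step closes at `l - 1`, and the old current matrix is
remembered for it. -/
theorem RunInv.left (h : I.RunInv s₀ L p R s l r) (hG : I.Reachable L p R) {l' m : ℕ}
    (hm : IsNode I.F m r) (hml : m < l') (hll : l' < l) (hrR : r < R) (hc : I.Clean l')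
    (hk : Keeps 30 s s') (v30 : s'.wvar 30 = l')
    (v31 : s'.wvar 31 = r) (v32 : s'.wvar 32 = R)
    (hin : s'.rarr 1 = s.rarr 1)
    (hmat : ∀ σ a b, σ ≠ r → σ ≠ I.F.length + 1 + l' → a < 4 * I.k + 1 → b < 4 * I.k + 1 →
      s'.mat (4 * I.k + 1) σ a b = s.mat (4 * I.k + 1) σ a b)
    (curR : I.GoodMat s' r l' r) (curL : I.GoodMat s' (I.F.length + 1 + l') l' r)
    (h1 : ∀ i j, IsNode I.F i j → i < l' → l' ≤ j → j < l → j + 1 = l) :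
    I.RunInv s₀ L p R s' l' r where
  keeps := h.keeps.trans hk
  v30 := v30
  v31 := v31
  v32 := v32
  left_le := by
    have := hG.closed _ _ hm (by have := h.left_le; have := h.le_start; have := h.start_le; omega)
      hrR
    omega
  le_start := hll.le.trans h.le_start
  start_le := h.start_le
  le_right := h.le_right
  clean_left := hc
  clean_right := h.clean_right
  done := by omega
  curR := curR
  curL := curL
  openR := by
    intro x j n e1 e2 e3
    have := hm.nest n
    have := n.lt
    have := hm.left_unique (i' := x) (by rcases e3.eq_or_lt with e | e; exacts [e ▸ n, by omega])
    omega
  openL := by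
    intro i x n e1 e2 e3
    have h3 := h.le_start
    have h4 := h.start_le
    have h5 := hG.right_le
    by_cases hx : l ≤ x
    · have := h.openL i x n (by omega) hx e3
      exact ⟨this.1, this.2.1.of_eq fun a b ha hb => hmat _ a b (by omega) (by omega) ha hb,
        this.2.2⟩
    · have h6 := h1 i x n e1 e2 (by omega)
      refine ⟨by omega, ?_, m, hm, ?_⟩
      · rw [h6]
        exact h.curL.of_eq fun a b ha hb => hmat _ a b (by omega) (by omega) ha hb
      · have := hm.nest n
        have := hm.right_unique (j' := x)
        by_contra hc'
        rcases (not_lt.1 hc').eq_or_lt with e | e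
        · subst e; have := this n; omega
        · have := n.nest hm; omega
  keepInner := fun m hm => (h.keepInner m hm).keep hin
  inner := by
    intro i j n e1 e2 e3
    have h3 := h.le_start
    rcases h.inner i j n e1 e2 e3 with e4 | ⟨e4, e5, e6⟩
    · exact .inl (e4.keep hin)
    · by_cases e7 : i < l'
      · exact .inr ⟨e4, e5, .inl e7⟩
      · by_cases e8 : r ≤ j
        · exact .inr ⟨e4, e5, .inr e8⟩
        · have := (h.openL i j n (by omega) (by omega) (by omega)).1
          omega
  powers := by
    intro σ a b e1 ha hb
    have := hG.right_le
    have := h.le_start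
    have := hG.le_right
    rw [hmat σ a b (by omega) (by omega) ha hb, h.powers σ a b e1 ha hb]

/-- The fragment becomes a whole node, so no node is half-covered any more. If it was a node around
the starting position, it has now moved to the nodes with known inner distances. -/
theorem RunInv.node (h : I.RunInv s₀ L p R s (l + 1) r) (hG : I.Reachable L p R)
    (hn : IsNode I.F l r) (hrR : r < R) (hc : I.Clean l) (hc' : I.Clean (r + 1))
    (hk : Keeps 30 s s') (v30 : s'.wvar 30 = l)
    (v31 : s'.wvar 31 = r + 1) (v32 : s'.wvar 32 = R)
    (hinner : I.GoodInner s' l) (hkeep : ∀ m, I.GoodInner s m → I.GoodInner s' m)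
    (hmat : ∀ σ a b, 2 * (I.F.length + 1) ≤ σ → a < 4 * I.k + 1 → b < 4 * I.k + 1 →
      s'.mat (4 * I.k + 1) σ a b = s.mat (4 * I.k + 1) σ a b)
    (curR : I.GoodMat s' (r + 1) l (r + 1))
    (curL : I.GoodMat s' (I.F.length + 1 + l) l (r + 1)) :
    I.RunInv s₀ L p R s' l (r + 1) where
  keeps := h.keeps.trans hk
  v30 := v30
  v31 := v31
  v32 := v32
  left_le := hG.closed _ _ hn
    (by have := h.left_le; have := h.le_start; have := h.start_le; omega) hrR
  le_start := by have := h.le_start; omega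
  start_le := by have := h.start_le; omega
  le_right := hrR
  clean_left := hc
  clean_right := hc'
  done := by
    intro e
    rcases hG.kind with e' | ⟨n, _⟩
    · have := h.left_le; have := h.le_start
      have := hG.closed _ _ hn
        (by have := h.left_le; have := h.le_start; have := h.start_le; omega) hrR
      omega
    · rw [show R - 1 = r by omega] at n
      exact hn.left_unique n
  curR := curR
  curL := curL
  openR := by
    intro x j n e1 e2 e3
    exfalso
    have := hn.nest n
    rcases e1.eq_or_lt with rfl | e1
    · have := hn.right_unique n; omega
    · by_cases e4 : x = r
      · subst e4; exact n.left_ne_right hn rfl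
      · omega
  openL := by
    intro i x n e1 e2 e3
    exfalso
    have := n.nest hn
    rcases e2.eq_or_lt with rfl | e2
    · exact hn.left_ne_right n rfl
    · by_cases e4 : x = r
      · subst e4; have := hn.left_unique n; omega
      · omega
  keepInner := fun m hm => hkeep m (h.keepInner m hm)
  inner := by
    intro i j n e1 e2 e3
    rcases h.inner i j n e1 e2 e3 with e4 | ⟨e4, e5, e6⟩
    · exact .inl (hkeep _ e4)
    · by_cases e7 : i < l
      · exact .inr ⟨e4, e5, .inl e7⟩
      · by_cases e8 : r + 1 ≤ j
        · exact .inr ⟨e4, e5, .inr e8⟩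
        · by_cases e9 : i = l
          · subst e9; exact .inl hinner
          · obtain rfl : j = r := by omega
            have := hn.left_unique n
            omega
  powers := by
    intro σ a b e1 ha hb
    rw [hmat σ a b e1 ha hb, h.powers σ a b e1 ha hb]

theorem syncLeft_spec (hB : I.BoundOK B) (hR : I.Ready s) {l r : ℕ} (hl : s.wvar 30 = l)
    (hr : s.wvar 31 = r) (hlr : l ≤ r) (hrF : r ≤ I.F.length) (h : I.GoodMat s r l r) :
    Halts I.orc B .syncLeft s fun s' T =>
      T ≤ 300 * ((4 * I.k + 1) * (4 * I.k + 1)) ∧ Keeps 40 s s' ∧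
        KeepsSlots (4 * I.k + 1) (I.F.length + 1 + l) s s' ∧
        I.GoodMat s' (I.F.length + 1 + l) l r := by
  have hlin := hB.linear
  refine .seq (.setW ?_ (.seq (.setW ?_ ?_)))
  · simp [hl, hR.v6]; omega
  · simp [hr]; omega
  simp [hl, hr, hR.v6]
  have hK : Keeps 40 s ((s.setW 40 (I.F.length + 1 + l)).setW 41 r) :=
    ((Keeps.refl _ _).setW (by simp)).setW (by simp)
  refine (copyMat_spec hB (hR.of_keeps (hK.mono (by simp))) (d := I.F.length + 1 + l) (σ := r)
    (by simp) (by simp) (by omega) (by omega)).mono ?_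
  rintro s' T ⟨h1, h2, h3, h4⟩
  have h5 : 1 ≤ (4 * I.k + 1) * (4 * I.k + 1) := by nlinarith
  exact ⟨by omega, hK.trans (h2.mono (by simp)),
    .trans (s' := (s.setW 40 (I.F.length + 1 + l)).setW 41 r) (.of_rarr_eq rfl) h3, h4 l r h⟩

theorem syncRight_spec (hB : I.BoundOK B) (hR : I.Ready s) {l r : ℕ} (hl : s.wvar 30 = l)
    (hr : s.wvar 31 = r) (hlr : l ≤ r) (hrF : r ≤ I.F.length)
    (h : I.GoodMat s (I.F.length + 1 + l) l r) :
    Halts I.orc B .syncRight s fun s' T =>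
      T ≤ 300 * ((4 * I.k + 1) * (4 * I.k + 1)) ∧ Keeps 40 s s' ∧
        KeepsSlots (4 * I.k + 1) r s s' ∧ I.GoodMat s' r l r := by
  have hlin := hB.linear
  refine .seq (.setW ?_ (.seq (.setW ?_ ?_)))
  · simp [hr]; omega
  · simp [hl, hR.v6]; omega
  simp [hl, hr, hR.v6]
  have hK : Keeps 40 s ((s.setW 40 r).setW 41 (I.F.length + 1 + l)) :=
    ((Keeps.refl _ _).setW (by simp)).setW (by simp)
  refine (copyMat_spec hB (hR.of_keeps (hK.mono (by simp))) (d := r) (σ := I.F.length + 1 + l)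
    (by simp) (by simp) (by omega) (by omega)).mono ?_
  rintro s' T ⟨h1, h2, h3, h4⟩
  have h5 : 1 ≤ (4 * I.k + 1) * (4 * I.k + 1) := by nlinarith
  exact ⟨by omega, hK.trans (h2.mono (by simp)),
    .trans (s' := (s.setW 40 r).setW 41 (I.F.length + 1 + l)) (.of_rarr_eq rfl) h3, h4 l r h⟩

end TedInput


/-! ### Expansion steps, their cost, and the complete run -/

namespace TedInput

variable {α : Type*} {I : TedInput α} {B : ℕ} {s₀ s s' : RAMState} {L p R l r : ℕ}

theorem Reachable.jump_le_right (hG : I.Reachable L p R) {j₁ len : ℕ} (hj : I.Jump r j₁ len)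
    (h : r < R) : j₁ ≤ R := by
  have := hG.clean_right.jump_le hj
  omega

theorem Reachable.le_jump_left (hG : I.Reachable L p R) {j₀ len : ℕ} (hj : I.Jump j₀ l len)
    (h : L < l) : L ≤ j₀ := by
  have := hG.clean_left.jump_le hj
  omega

/-- As `4k ≤ len`, the third factor `4k + 1` of the cost of a product is at most twice the weight of
the jump. -/
theorem jump_cost {j₀ j₁ len : ℕ} (hj : I.Jump j₀ j₁ len) :
    (4 * I.k + 1) * ((4 * I.k + 1) * (4 * I.k + 1)) ≤
      2 * (((4 * I.k + 1) * (4 * I.k + 1)) * len) := by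
  have := hj.facts
  have := I.one_le
  calc _ ≤ 2 * len * ((4 * I.k + 1) * (4 * I.k + 1)) := Nat.mul_le_mul_right _ (by omega)
    _ = _ := by ring

theorem expandRight_spec (hB : I.BoundOK B) (hR : I.Ready s) (hG : I.Reachable L p R)
    (h : I.RunInv s₀ L p R s l r) (hrR : r < R)
    (hpow : ∀ j₁ len, I.Jump r j₁ len → I.GoodMat s (2 * (I.F.length + 1) + r) r j₁)
    (hno : ∀ m, IsNode I.F m r → l ≤ m) :
    Halts I.orc B .expandRight s fun s' T => ∃ r' d, I.RunInv s₀ L p R s' l r' ∧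
      I.prefixWt r' = I.prefixWt r + d ∧ 1 ≤ d ∧
      T ≤ 1200 * ((4 * I.k + 1) * (4 * I.k + 1) * d) := by
  have hlin := hB.linear
  have hRF := hG.right_le
  have hlr : l ≤ r := h.le_start.trans h.start_le
  have h5 : 1 ≤ (4 * I.k + 1) * (4 * I.k + 1) := by nlinarith
  have h9 : s.warr 9 r ≤ I.F.length := by
    by_cases hj : ∃ j₁ len, I.Jump r j₁ len
    · obtain ⟨j₁, len, hj⟩ := hj
      rw [(hR.jump _ _ _ hj).1]
      have := hj.facts; omega
    · push Not at hj
      rw [hR.no_jump r hj]; omega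
  refine .seq (.setW ?_ ?_)
  · simp [h.v31]; omega
  simp only [WExp.eval, h.v31]
  have hK : Keeps 34 s (s.setW 34 (s.warr 9 r)) := (Keeps.refl _ _).setW (by simp)
  generalize ht : s.setW 34 (s.warr 9 r) = t at *
  have t34 : t.wvar 34 = s.warr 9 r := by rw [← ht]; simp
  have tr : t.rarr = s.rarr := by rw [← ht]; rfl
  have t30 : t.wvar 30 = l := by rw [hK.wvar _ (by omega), h.v30]
  have t31 : t.wvar 31 = r := by rw [hK.wvar _ (by omega), h.v31]
  have t32 : t.wvar 32 = R := by rw [hK.wvar _ (by omega), h.v32]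
  have tR : I.Ready t := hR.of_keeps (hK.mono (by omega))
  refine .seq (.ite (fun hb => ?_) fun hb => ?_)
  · simp [t34] at hb
    obtain ⟨j₁, len, hj⟩ : ∃ j₁ len, I.Jump r j₁ len := by
      by_contra hc
      push Not at hc
      have := hR.no_jump r hc
      omega
    have e9 := (hR.jump _ _ _ hj).1
    have hf := hj.facts
    have hk := I.one_le
    have hjR := hG.jump_le_right hj hrR
    rw [e9] at t34
    refine .seq (.setW ?_ (.seq (.setW ?_ (.seq (.setW ?_ (.seq ?_))))))
    · simp [t34]; omega
    · simp [t31]; omega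
    · simp [tR.v6, t31]; omega
    simp only [WExp.eval, WExp.eval_add, RAMState.setW_wvar, Nat.reduceEqDiff, if_true, if_false,
      t34, t31, tR.v6]
    have hK₁ : Keeps 34 t (((t.setW 40 j₁).setW 41 r).setW 42
        (I.F.length + 1 + (I.F.length + 1) + r)) :=
      (((Keeps.refl _ _).setW (by simp)).setW (by simp)).setW (by simp)
    have e34 : (((t.setW 40 j₁).setW 41 r).setW 42
        (I.F.length + 1 + (I.F.length + 1) + r)).wvar 34 = j₁ := by simp [t34]
    generalize hu : ((t.setW 40 j₁).setW 41 r).setW 42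
        (I.F.length + 1 + (I.F.length + 1) + r) = u at *
    have ur : u.rarr = s.rarr := by rw [← hu]; simp [tr]
    refine (mulMat_spec hB (tR.of_keeps (hK₁.mono (by omega))) (d := j₁) (σ := r)
      (τ := I.F.length + 1 + (I.F.length + 1) + r) (l := l) (p := r) (r := j₁)
      (by simp [← hu]) (by simp [← hu]) (by simp [← hu]) (by omega) (by omega) (by omega)
      (h.curR.of_eq fun _ _ _ _ => by simp only [RAMState.mat, ur])
      ((hpow _ _ hj).of_eq fun _ _ _ _ => by simp only [RAMState.mat, ur]; ring_nf) hlr (by omega)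
      ?_).mono ?_
    · intro i j n e1 e2 e3 e4
      have := hj.closed_jump n
      omega
    rintro v T ⟨q1, q2, q3, q4⟩
    have v34 : v.wvar 34 = j₁ := by rw [q2.wvar _ (by omega), e34]
    refine .setW (by simp [v34]; omega) ?_
    simp only [WExp.eval, v34]
    have hK₂ : Keeps 31 s (v.setW 31 j₁) :=
      ((hK.mono (by omega)).trans ((hK₁.mono (by omega)).trans (q2.mono (by omega)))).setW le_rfl
    refine (syncLeft_spec hB (hR.of_keeps (hK₂.mono (by omega))) (l := l) (r := j₁)
      (by rw [hK₂.wvar _ (by omega), h.v30]) (by simp) (by omega) (by omega)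
      (q4.of_eq fun _ _ _ _ => rfl)).mono ?_
    rintro v' T' ⟨p1, p2, p3, p4⟩
    refine ⟨j₁, len, ?_, hj.prefixWt, by omega, ?_⟩
    · refine h.right hG (by omega) hjR hj.clean_end ((hK₂.mono (by omega)).trans (p2.mono
        (by omega))) ?_ ?_ ?_ ?_ ?_ ?_ p4 ?_ ?_
      · rw [p2.wvar _ (by omega), hK₂.wvar _ (by omega), h.v30]
      · rw [p2.wvar _ (by omega)]; simp
      · rw [p2.wvar _ (by omega)]; simp
        rw [q2.wvar _ (by omega), ← hu]; simp [t32]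
      · rw [p3.rarr 1 (by omega), RAMState.setW_rarr, q3.rarr 1 (by omega), ur]
      · intro σ a b e1 e2 ha hb
        rw [p3.mat σ a b e2 ha hb]
        exact (q3.mat σ a b e1 ha hb).trans (by simp only [RAMState.mat, ur])
      · exact GoodMat.keep (s := v.setW 31 j₁) (q4.of_eq fun _ _ _ _ => rfl) p3 (by omega)
      · intro i j n e1 e2
        have := hj.closed_jump n
        omega
      · intro i j n e1 e2 e3
        have := hj.closed_jump n
        omega
    · have := jump_cost hj
      have h6 : (4 * I.k + 1) * (4 * I.k + 1) ≤ (4 * I.k + 1) * (4 * I.k + 1) * len :=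
        Nat.le_mul_of_pos_right _ (by omega)
      simp
      omega
  · simp [t34] at hb
    have hna : ¬ I.InJump r := by
      refine h.clean_right.not_inJump fun j₁ len hj => ?_
      have := (hR.jump _ _ _ hj).1
      have := hj.facts
      have := I.one_le
      omega
    refine .seq ((rightStep_spec hB tR (l := l) (r := r) t30 t31 hlr (by omega)
      (h.curR.of_eq fun _ _ _ _ => by simp only [RAMState.mat, tr]) ?_).mono ?_)
    · intro m n hm
      have lt := n.lt
      obtain ⟨e1, e2⟩ := h.openR m r n hm lt le_rfl
      refine ⟨e2.of_eq fun _ _ _ _ => by simp only [RAMState.mat, tr], ?_⟩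
      have := h.left_le
      -- By `openR` the node opens at or after the starting position, so it does not contain that
      -- position and its inner distances are known.
      rcases h.inner m r n (by rwa [inJump_iff n]) (by omega) hrR with e3 | e3
      · exact e3.keep (by rw [tr])
      · omega
    rintro v T ⟨q1, q2, q3, q4⟩
    have v31 : v.wvar 31 = r := by rw [q2.wvar _ (by omega), t31]
    refine .setW (by simp [v31]; omega) ?_
    simp only [WExp.eval, WExp.eval_add, WExp.eval_ofNat, v31]
    have hK₂ : Keeps 31 s (v.setW 31 (r + 1)) :=
      ((hK.mono (by omega)).trans (q2.mono (by omega))).setW le_rfl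
    refine (syncLeft_spec hB (hR.of_keeps (hK₂.mono (by omega))) (l := l) (r := r + 1)
      (by rw [hK₂.wvar _ (by omega), h.v30]) (by simp) (by omega) (by omega)
      (q4.of_eq fun _ _ _ _ => rfl)).mono ?_
    rintro v' T' ⟨p1, p2, p3, p4⟩
    refine ⟨r + 1, 1, ?_, prefixWt_succ hna, by omega, ?_⟩
    · refine h.right hG (by omega) hrR (clean_succ hna) ((hK₂.mono (by omega)).trans (p2.mono
        (by omega))) ?_ ?_ ?_ ?_ ?_ ?_ p4 ?_ ?_
      · rw [p2.wvar _ (by omega), hK₂.wvar _ (by omega), h.v30]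
      · rw [p2.wvar _ (by omega)]; simp
      · rw [p2.wvar _ (by omega)]; simp
        rw [q2.wvar _ (by omega), t32]
      · rw [p3.rarr 1 (by omega), RAMState.setW_rarr, q3.rarr 1 (by omega), tr]
      · intro σ a b e1 e2 ha hb
        rw [p3.mat σ a b e2 ha hb]
        exact (q3.mat σ a b e1 ha hb).trans (by simp only [RAMState.mat, tr])
      · exact GoodMat.keep (s := v.setW 31 (r + 1)) (q4.of_eq fun _ _ _ _ => rfl) p3 (by omega)
      · intro i j n e1 e2
        obtain rfl : j = r := by omega
        exact hno i n
      · intro i j n e1 e2 e3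
        omega
    · simp
      omega

theorem expandLeft_spec (hB : I.BoundOK B) (hR : I.Ready s) (hG : I.Reachable L p R)
    (h : I.RunInv s₀ L p R s l r) (hrR : r < R)
    (hpow : ∀ j₀ len, I.Jump j₀ l len → L ≤ j₀ → I.GoodMat s (2 * (I.F.length + 1) + j₀) j₀ l)
    {m : ℕ} (hm : IsNode I.F m r) (hml : m + 1 < l) :
    Halts I.orc B .expandLeft s fun s' T => ∃ l' d, I.RunInv s₀ L p R s' l' r ∧
      I.prefixWt l = I.prefixWt l' + d ∧ 1 ≤ d ∧
      T ≤ 1200 * ((4 * I.k + 1) * (4 * I.k + 1) * d) := by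
  have hlin := hB.linear
  have hRF := hG.right_le
  have hlr : l ≤ r := h.le_start.trans h.start_le
  have h5 : 1 ≤ (4 * I.k + 1) * (4 * I.k + 1) := by nlinarith
  have hLm : L ≤ m := hG.closed _ _ hm (by have := h.left_le; omega) hrR
  have h9 : s.warr 12 l ≤ I.F.length := by
    by_cases hj : ∃ j₀ len, I.Jump j₀ l len
    · obtain ⟨j₀, len, hj⟩ := hj
      rw [(hR.jump _ _ _ hj).2.2]
      have := hj.facts; omega
    · push Not at hj
      rw [hR.no_jump_end l hj]; omega
  refine .seq (.setW ?_ ?_)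
  · simp [h.v30]; omega
  simp only [WExp.eval, h.v30]
  have hK : Keeps 34 s (s.setW 34 (s.warr 12 l)) := (Keeps.refl _ _).setW (by simp)
  generalize ht : s.setW 34 (s.warr 12 l) = t at *
  have t34 : t.wvar 34 = s.warr 12 l := by rw [← ht]; simp
  have tr : t.rarr = s.rarr := by rw [← ht]; rfl
  have t30 : t.wvar 30 = l := by rw [hK.wvar _ (by omega), h.v30]
  have t31 : t.wvar 31 = r := by rw [hK.wvar _ (by omega), h.v31]
  have t32 : t.wvar 32 = R := by rw [hK.wvar _ (by omega), h.v32]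
  have tR : I.Ready t := hR.of_keeps (hK.mono (by omega))
  refine .seq (.ite (fun hb => ?_) fun hb => ?_)
  · simp [t34] at hb
    obtain ⟨j₀, len, hj⟩ : ∃ j₀ len, I.Jump j₀ l len := by
      by_contra hc
      push Not at hc
      have := hR.no_jump_end l hc
      omega
    have e9 := (hR.jump _ _ _ hj).2.2
    have hf := hj.facts
    have hk := I.one_le
    have hjL := hG.le_jump_left hj (by omega)
    have hmj := hj.closed_jump hm
    rw [e9] at t34
    refine .seq (.setW ?_ (.seq (.setW ?_ (.seq (.setW ?_ (.seq ?_))))))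
    · simp [t34, tR.v6]; omega
    · simp [t34, tR.v6]; omega
    · simp [tR.v6, t30]; omega
    simp only [WExp.eval, WExp.eval_add, RAMState.setW_wvar, Nat.reduceEqDiff, if_true, if_false,
      t34, t30, tR.v6]
    have hK₁ : Keeps 34 t (((t.setW 40 (I.F.length + 1 + j₀)).setW 41
        (I.F.length + 1 + (I.F.length + 1) + j₀)).setW 42 (I.F.length + 1 + l)) :=
      (((Keeps.refl _ _).setW (by simp)).setW (by simp)).setW (by simp)
    have e34 : (((t.setW 40 (I.F.length + 1 + j₀)).setW 41
        (I.F.length + 1 + (I.F.length + 1) + j₀)).setW 42 (I.F.length + 1 + l)).wvar 34 = j₀ := by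
      simp [t34]
    generalize hu : ((t.setW 40 (I.F.length + 1 + j₀)).setW 41
        (I.F.length + 1 + (I.F.length + 1) + j₀)).setW 42 (I.F.length + 1 + l) = u at *
    have ur : u.rarr = s.rarr := by rw [← hu]; simp [tr]
    refine (mulMat_spec hB (tR.of_keeps (hK₁.mono (by omega))) (d := I.F.length + 1 + j₀)
      (σ := I.F.length + 1 + (I.F.length + 1) + j₀) (τ := I.F.length + 1 + l) (l := j₀) (p := l)
      (r := r) (by simp [← hu]) (by simp [← hu]) (by simp [← hu]) (by omega) (by omega) (by omega)
      ((hpow _ _ hj hjL).of_eq fun _ _ _ _ => by simp only [RAMState.mat, ur]; ring_nf)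
      (h.curL.of_eq fun _ _ _ _ => by simp only [RAMState.mat, ur]) (by omega) hlr
      ?_).mono ?_
    · intro i j n e1 e2 e3 e4
      have := hj.closed_jump n
      omega
    rintro v T ⟨q1, q2, q3, q4⟩
    have v34 : v.wvar 34 = j₀ := by rw [q2.wvar _ (by omega), e34]
    refine .setW (by simp [v34]; omega) ?_
    simp only [WExp.eval, v34]
    have hK₂ : Keeps 30 s (v.setW 30 j₀) :=
      ((hK.mono (by omega)).trans ((hK₁.mono (by omega)).trans (q2.mono (by omega)))).setW le_rfl
    have w31 : (v.setW 30 j₀).wvar 31 = r := by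
      simp; rw [q2.wvar _ (by omega), ← hu]; simp [t31]
    have w32 : (v.setW 30 j₀).wvar 32 = R := by
      simp; rw [q2.wvar _ (by omega), ← hu]; simp [t32]
    refine (syncRight_spec hB (hR.of_keeps (hK₂.mono (by omega))) (l := j₀) (r := r)
      (by simp) w31 (by omega) (by omega) (q4.of_eq fun _ _ _ _ => rfl)).mono ?_
    rintro v' T' ⟨p1, p2, p3, p4⟩
    refine ⟨j₀, len, ?_, hj.prefixWt, by omega, ?_⟩
    · refine h.left hG hm (by omega) (by omega) hrR hj.clean_start (hK₂.trans (p2.mono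
        (by omega))) ?_ ?_ ?_ ?_ ?_ p4 ?_ ?_
      · rw [p2.wvar _ (by omega)]; simp
      · rw [p2.wvar _ (by omega), w31]
      · rw [p2.wvar _ (by omega), w32]
      · rw [p3.rarr 1 (by omega), RAMState.setW_rarr, q3.rarr 1 (by omega), ur]
      · intro σ a b e1 e2 ha hb
        rw [p3.mat σ a b e1 ha hb]
        exact (q3.mat σ a b e2 ha hb).trans (by simp only [RAMState.mat, ur])
      · exact GoodMat.keep (s := v.setW 30 j₀) (q4.of_eq fun _ _ _ _ => rfl) p3 (by omega)
      · intro i j n e1 e2 e3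
        have := hj.closed_jump n
        omega
    · have := jump_cost hj
      have h6 : (4 * I.k + 1) * (4 * I.k + 1) ≤ (4 * I.k + 1) * (4 * I.k + 1) * len :=
        Nat.le_mul_of_pos_right _ (by omega)
      simp
      omega
  · simp [t34] at hb
    obtain ⟨x, rfl⟩ : ∃ x, l = x + 1 := ⟨l - 1, by omega⟩
    have hna : ¬ I.InJump x := by
      refine h.clean_left.not_inJump_pred fun j₀ len hj => ?_
      have := (hR.jump _ _ _ hj).2.2
      have := hj.facts
      have := I.one_le
      omega
    refine .seq ((leftStep_spec hB tR (x := x) (r := r) t30 hlr (by omega)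
      (h.curL.of_eq fun _ _ _ _ => by simp only [RAMState.mat, tr]) ?_).mono ?_)
    · intro j n
      have hjr : j < r := by
        have := hm.nest n; omega
      have lt := n.lt
      obtain ⟨e1, e2, -⟩ := h.openL x j n (by omega) (by omega) hjr
      refine ⟨hjr, e2.of_eq fun _ _ _ _ => by simp only [RAMState.mat, tr], ?_⟩
      -- By `openL` the node closes before the starting position, so it was treated earlier.
      rcases h.inner x j n hna (by omega) (by omega) with e3 | e3
      · exact e3.keep (by rw [tr])
      · omega
    rintro v T ⟨q1, q2, q3, q4⟩
    have v30 : v.wvar 30 = x + 1 := by rw [q2.wvar _ (by omega), t30]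
    refine .setW (by simp [v30]; omega) ?_
    simp only [WExp.eval, WExp.eval_sub, WExp.eval_ofNat, v30, Nat.add_sub_cancel]
    have hK₂ : Keeps 30 s (v.setW 30 x) :=
      ((hK.mono (by omega)).trans (q2.mono (by omega))).setW le_rfl
    have w31 : (v.setW 30 x).wvar 31 = r := by
      simp; rw [q2.wvar _ (by omega), t31]
    have w32 : (v.setW 30 x).wvar 32 = R := by
      simp; rw [q2.wvar _ (by omega), t32]
    refine (syncRight_spec hB (hR.of_keeps (hK₂.mono (by omega))) (l := x) (r := r)
      (by simp) w31 (by omega) (by omega) (q4.of_eq fun _ _ _ _ => rfl)).mono ?_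
    rintro v' T' ⟨p1, p2, p3, p4⟩
    refine ⟨x, 1, ?_, prefixWt_succ hna, by omega, ?_⟩
    · refine h.left hG hm (by omega) (by omega) hrR (clean_of_not_inJump hna) (hK₂.trans (p2.mono
        (by omega))) ?_ ?_ ?_ ?_ ?_ p4 ?_ ?_
      · rw [p2.wvar _ (by omega)]; simp
      · rw [p2.wvar _ (by omega), w31]
      · rw [p2.wvar _ (by omega), w32]
      · rw [p3.rarr 1 (by omega), RAMState.setW_rarr, q3.rarr 1 (by omega), tr]
      · intro σ a b e1 e2 ha hb
        rw [p3.mat σ a b e1 ha hb]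
        exact (q3.mat σ a b e2 ha hb).trans (by simp only [RAMState.mat, tr])
      · exact GoodMat.keep (s := v.setW 30 x) (q4.of_eq fun _ _ _ _ => rfl) p3 (by omega)
      · intro i j n e1 e2 e3
        omega
    · simp
      omega

/-- The closing parenthesis is added first, and at that moment it can only be deleted. Adding the
opening parenthesis then takes the alignment of the whole node into account, using the inner
distances that have just been recorded. -/
theorem expandNode_spec (hB : I.BoundOK B) (hR : I.Ready s) (hG : I.Reachable L p R) {x : ℕ}
    (h : I.RunInv s₀ L p R s (x + 1) r) (hrR : r < R) (hn : IsNode I.F x r) :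
    Halts I.orc B .expandNode s fun s' T => I.RunInv s₀ L p R s' x (r + 1) ∧
      I.prefixWt (r + 1) = I.prefixWt r + 1 ∧ I.prefixWt (x + 1) = I.prefixWt x + 1 ∧
      T ≤ 2400 * ((4 * I.k + 1) * (4 * I.k + 1)) := by
  have hlin := hB.linear
  have hRF := hG.right_le
  have hlr : x + 1 ≤ r := h.le_start.trans h.start_le
  have h5 : 1 ≤ (4 * I.k + 1) * (4 * I.k + 1) := by nlinarith
  have hna : ¬ I.InJump r := by
    rintro ⟨j₀, j₁, len, hj, e1, e2⟩
    have := hj.closed_jump hn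
    have := h.clean_right.jump_le hj
    have := h.clean_left.jump_le hj
    omega
  have hnx : ¬ I.InJump x := by rwa [inJump_iff hn]
  refine .seq ((recordInner_spec hB hR h.v30 h.v31 hn h.curR).mono ?_)
  rintro s₁ T₁ ⟨t1, k1, r1, i1, g1⟩
  have R1 := hR.of_keeps (k1.mono (by omega))
  refine .seq ((rightStep_spec hB R1 (l := x + 1) (r := r) (by rw [k1.wvar _ (by omega), h.v30])
    (by rw [k1.wvar _ (by omega), h.v31]) hlr (by omega)
    (h.curR.of_eq fun _ _ _ _ => by simp only [RAMState.mat, r1]) ?_).mono ?_)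
  -- The mate of `r` is outside of the fragment, so this extension has no aligned node to consider.
  · intro m n hm
    have := hn.left_unique n
    omega
  rintro s₂ T₂ ⟨t2, k2, d2, m2⟩
  have k2' := k1.trans k2
  refine .seq (.setW (by simp [k2'.wvar, h.v31]; omega) ?_)
  simp only [WExp.eval, WExp.eval_add, WExp.eval_ofNat, k2'.wvar 31 (by omega), h.v31]
  have k3 : Keeps 31 s (s₂.setW 31 (r + 1)) := (k2'.mono (by omega)).setW le_rfl
  refine .seq ((syncLeft_spec hB (hR.of_keeps (k3.mono (by omega))) (l := x + 1) (r := r + 1)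
      (by rw [k3.wvar _ (by omega), h.v30]) (by simp) (by omega) (by omega)
      (m2.of_eq fun _ _ _ _ => rfl)).mono ?_)
  rintro s₄ T₄ ⟨t4, k4, d4, m4⟩
  have k4' : Keeps 31 s s₄ := k3.trans (k4.mono (by omega))
  have R4 := hR.of_keeps (k4'.mono (by omega))
  have s31 : s₄.wvar 31 = r + 1 := by rw [k4.wvar _ (by omega)]; simp
  have s32 : s₄.wvar 32 = R := by
    rw [k4.wvar _ (by omega)]; simp; rw [k2'.wvar _ (by omega), h.v32]
  -- The extension to the left reads the matrix of the part after the node; here this part is the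
  -- empty fragment at `r + 1`.
  refine .seq (.setW ?_ (.seq (.setW ?_ (.seq ?_))))
  · simp [R4.v6, s31]; omega
  · simp [s31]; omega
  simp [R4.v6, s31]
  have k5 : Keeps 40 s₄ ((s₄.setW 40 (I.F.length + 1 + (r + 1))).setW 41 (r + 1)) :=
    ((Keeps.refl _ _).setW (by simp)).setW (by simp)
  refine (emptyMat_spec hB (R4.of_keeps (k5.mono (by omega))) (d := I.F.length + 1 + (r + 1))
    (x := r + 1) (by simp) (by simp) (by omega) (by omega)).mono ?_
  rintro s₆ T₆ ⟨t6, k6, d6, m6⟩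
  have k6' : Keeps 40 s₄ s₆ := k5.trans (k6.mono (by omega))
  have d6' : KeepsSlots (4 * I.k + 1) (I.F.length + 1 + (r + 1)) s₄ s₆ :=
    .trans (s' := (s₄.setW 40 (I.F.length + 1 + (r + 1))).setW 41 (r + 1)) (.of_rarr_eq rfl) d6
  have e1 : s₆.rarr 1 = s₁.rarr 1 := by
    rw [d6'.rarr 1 (by omega), d4.rarr 1 (by omega), RAMState.setW_rarr, d2.rarr 1 (by omega)]
  refine .seq ((leftStep_spec hB (R4.of_keeps (k6'.mono (by omega))) (x := x) (r := r + 1)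
    (by rw [k6'.wvar _ (by omega), k4'.wvar _ (by omega), h.v30])
    (by omega) (by omega)
    (m4.keep d6' (by omega)) ?_).mono ?_)
  · intro m n
    obtain rfl := n.right_unique hn
    exact ⟨by omega, m6, i1.keep e1⟩
  rintro s₇ T₇ ⟨t7, k7, d7, m7⟩
  have k7' := k6'.trans k7
  have k7'' : Keeps 31 s s₇ := k4'.trans (k7'.mono (by omega))
  have e30 : s₇.wvar 30 = x + 1 := by rw [k7''.wvar _ (by omega), h.v30]
  refine .seq (.setW (by simp [e30]; omega) ?_)
  simp only [WExp.eval, WExp.eval_sub, WExp.eval_ofNat, e30, Nat.add_sub_cancel]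
  have k8 : Keeps 30 s (s₇.setW 30 x) := (k7''.mono (by omega)).setW le_rfl
  have w31 : (s₇.setW 30 x).wvar 31 = r + 1 := by
    simp; rw [k7'.wvar _ (by omega), s31]
  have w32 : (s₇.setW 30 x).wvar 32 = R := by
    simp; rw [k7'.wvar _ (by omega), s32]
  refine (syncRight_spec hB (hR.of_keeps (k8.mono (by omega))) (l := x) (r := r + 1)
    (by simp) w31 (by omega) (by omega) (m7.of_eq fun _ _ _ _ => rfl)).mono ?_
  rintro s₈ T₈ ⟨t8, k9, d8, m8⟩
  have e2 : s₈.rarr 1 = s₁.rarr 1 := by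
    rw [d8.rarr 1 (by omega), RAMState.setW_rarr, d7.rarr 1 (by omega), e1]
  refine ⟨?_, prefixWt_succ hna, prefixWt_succ hnx, ?_⟩
  · refine h.node hG hn hrR (clean_of_not_inJump hnx) (clean_succ hna)
      (k8.trans (k9.mono (by omega))) ?_ ?_ ?_ (i1.keep e2) (fun m hm => (g1 m hm).keep e2) ?_ m8 ?_
    · rw [k9.wvar _ (by omega)]; simp
    · rw [k9.wvar _ (by omega), w31]
    · rw [k9.wvar _ (by omega), w32]
    · intro σ a b hσ ha hb
      rw [d8.mat σ a b (by omega) ha hb]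
      refine (d7.mat σ a b (by omega) ha hb).trans ?_
      rw [d6'.mat σ a b (by omega) ha hb, d4.mat σ a b (by omega) ha hb]
      refine (d2.mat σ a b (by omega) ha hb).trans ?_
      simp only [RAMState.mat, r1]
    · exact GoodMat.keep (s := s₇.setW 30 x) (m7.of_eq fun _ _ _ _ => rfl) d8 (by omega)
  · simp
    omega

/-- Extension to the right has priority, except when it would cut a node that opens to the left of
the fragment. The gain `d` is the weight added on both sides together. -/
theorem expand_spec (hB : I.BoundOK B) (hR : I.Ready s) (hG : I.Reachable L p R)
    (h : I.RunInv s₀ L p R s l r) (hrR : r < R)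
    (hpow : ∀ j₀ j₁ len, I.Jump j₀ j₁ len → L ≤ j₀ → j₁ ≤ R →
      I.GoodMat s (2 * (I.F.length + 1) + j₀) j₀ j₁) :
    Halts I.orc B .expand s fun s' T => ∃ l' r' d, I.RunInv s₀ L p R s' l' r' ∧
      I.prefixWt r' + I.prefixWt l = I.prefixWt r + I.prefixWt l' + d ∧ 1 ≤ d ∧
      T ≤ 1300 * ((4 * I.k + 1) * (4 * I.k + 1) * d) := by
  have hlin := hB.linear
  have hRF := hG.right_le
  have hm := hR.mate_le r
  have h5 : 1 ≤ (4 * I.k + 1) * (4 * I.k + 1) := by nlinarith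
  refine .seq (.setW (by simp [h.v31]; omega) ?_)
  simp only [WExp.eval, WExp.eval_add, WExp.eval_ofNat, h.v31]
  have hK : Keeps 33 s (s.setW 33 (s.warr 7 r + 1)) := (Keeps.refl _ _).setW (by simp)
  have h' : I.RunInv s₀ L p R (s.setW 33 (s.warr 7 r + 1)) l r :=
    { h with keeps := h.keeps.trans (hK.mono (by omega)) }
  have t33 : (s.setW 33 (s.warr 7 r + 1)).wvar 33 = s.warr 7 r + 1 := by simp
  have hpow' : ∀ j₀ j₁ len, I.Jump j₀ j₁ len → L ≤ j₀ → j₁ ≤ R →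
    I.GoodMat (s.setW 33 (s.warr 7 r + 1)) (2 * (I.F.length + 1) + j₀) j₀ j₁ := hpow
  have ta : (s.setW 33 (s.warr 7 r + 1)).warr = s.warr := rfl
  generalize s.setW 33 (s.warr 7 r + 1) = t at *
  have tR : I.Ready t := hR.of_keeps (hK.mono (by omega))
  have hLr := h.left_le.trans (h.le_start.trans h.start_le)
  refine .ite (fun hb => ?_) fun hb => ?_
  · simp [ta, t33, h'.v30, h'.v31] at hb
    have n := hR.node_of_close (by omega) hb.1
    refine .ite (fun hb' => ?_) fun hb' => ?_
    · simp [t33, h'.v30] at hb'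
      obtain rfl : l = s.warr 7 r + 1 := by omega
      refine (expandNode_spec hB tR hG h' hrR n).mono ?_
      rintro s' T ⟨h1, h2, h3, h4⟩
      refine ⟨_, _, 2, h1, by omega, by omega, ?_⟩
      simp
      omega
    · simp [t33, h'.v30] at hb'
      refine (expandLeft_spec hB tR hG h' hrR (fun j₀ len hj hL => hpow' _ _ _ hj hL
        (h.le_start.trans hG.le_right)) n (by omega)).mono ?_
      rintro s' T ⟨l', d, h1, h2, h3, h4⟩
      have h6 : (4 * I.k + 1) * (4 * I.k + 1) ≤ (4 * I.k + 1) * (4 * I.k + 1) * d :=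
        Nat.le_mul_of_pos_right _ (by omega)
      refine ⟨_, _, d, h1, by omega, by omega, ?_⟩
      simp
      omega
  · simp [ta, t33, h'.v30, h'.v31] at hb
    refine (expandRight_spec hB tR hG h' hrR (fun j₁ len hj => hpow' _ _ _ hj
      hLr (hG.jump_le_right hj hrR)) ?_).mono ?_
    · intro m n
      have e := hR.nodeF _ _ n
      have := hb e.2.1
      omega
    rintro s' T ⟨r', d, h1, h2, h3, h4⟩
    have h6 : (4 * I.k + 1) * (4 * I.k + 1) ≤ (4 * I.k + 1) * (4 * I.k + 1) * d :=
      Nat.le_mul_of_pos_right _ (by omega)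
    refine ⟨_, _, d, h1, by omega, by omega, ?_⟩
    simp
    omega

/-- The hypothesis `hin` asks for inner distances only of nodes that do not contain the starting
position; the others are found on the way. The slots of the powers of periods remain intact, and all
slots below them are work space. -/
theorem run_spec (hB : I.BoundOK B) (hR : I.Ready s) (hG : I.Reachable L p R)
    (h30 : s.wvar 30 = p) (h31 : s.wvar 31 = p) (h32 : s.wvar 32 = R)
    (hpow : ∀ j₀ j₁ len, I.Jump j₀ j₁ len → L ≤ j₀ → j₁ ≤ R →
      I.GoodMat s (2 * (I.F.length + 1) + j₀) j₀ j₁)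
    (hin : ∀ i j, IsNode I.F i j → ¬ I.InJump i → L ≤ i → j < R →
      I.GoodInner s i ∨ i < p ∧ p ≤ j) :
    Halts I.orc B .run s fun s' T =>
      T ≤ 2000 * ((4 * I.k + 1) * (4 * I.k + 1) * (I.prefixWt R - I.prefixWt L + 1)) ∧
        Keeps 30 s s' ∧ I.GoodMat s' R L R ∧ (∀ m, I.GoodInner s m → I.GoodInner s' m) ∧
        (∀ i j, IsNode I.F i j → ¬ I.InJump i → L ≤ i → j < R → I.GoodInner s' i) ∧
        ∀ σ a b, 2 * (I.F.length + 1) ≤ σ → a < 4 * I.k + 1 → b < 4 * I.k + 1 →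
          s'.mat (4 * I.k + 1) σ a b = s.mat (4 * I.k + 1) σ a b := by
  have hlin := hB.linear
  have hRF := hG.right_le
  have hLp := hG.left_le
  have hpR := hG.le_right
  have h5 : 1 ≤ (4 * I.k + 1) * (4 * I.k + 1) := by nlinarith
  have k1 : Keeps 40 s ((s.setW 40 p).setW 41 p) :=
    ((Keeps.refl _ _).setW (by simp)).setW (by simp)
  refine .seq (.setW (by simp [h30]; omega) (.seq (.setW (by simp [h30]; omega) (.seq ?_))))
  simp only [WExp.eval, h30, RAMState.setW_wvar, Nat.reduceEqDiff, if_false]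
  refine (emptyMat_spec hB (hR.of_keeps (k1.mono (by omega))) (d := p) (x := p) (by simp) (by simp)
    (by omega) (by omega)).mono ?_
  rintro s₂ T₂ ⟨t2, k2, d2, m2⟩
  have k2' : Keeps 40 s s₂ := k1.trans (k2.mono (by omega))
  have g41 : s₂.wvar 41 = p := by rw [k2.wvar _ (by omega)]; simp
  have d2' : KeepsSlots (4 * I.k + 1) p s s₂ :=
    .trans (s' := (s.setW 40 p).setW 41 p) (.of_rarr_eq rfl) d2
  have e6 : s₂.wvar 6 = I.F.length + 1 := by rw [k2'.wvar _ (by omega), hR.v6]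
  have e30 : s₂.wvar 30 = p := by rw [k2'.wvar _ (by omega), h30]
  refine .seq (.setW (by simp [e6, e30]; omega) (.seq ?_))
  simp only [WExp.eval, WExp.eval_add, e6, e30]
  have k3 : Keeps 40 s (s₂.setW 40 (I.F.length + 1 + p)) := k2'.setW (by simp)
  refine (emptyMat_spec hB (hR.of_keeps (k3.mono (by omega))) (d := I.F.length + 1 + p) (x := p)
    (by simp) (by simpa using g41) (by omega) (by omega)).mono ?_
  rintro s₄ T₄ ⟨t4, k4, d4, m4⟩
  have k4' : Keeps 40 s s₄ := k3.trans (k4.mono (by omega))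
  have d4' : KeepsSlots (4 * I.k + 1) (I.F.length + 1 + p) s₂ s₄ :=
    .trans (s' := s₂.setW 40 (I.F.length + 1 + p)) (.of_rarr_eq rfl) d4
  have er : s₄.rarr 1 = s.rarr 1 := by rw [d4'.rarr 1 (by omega), d2'.rarr 1 (by omega)]
  have inv : I.RunInv s L p R s₄ p p :=
    { keeps := k4'.mono (by omega)
      v30 := by rw [k4'.wvar _ (by omega), h30]
      v31 := by rw [k4'.wvar _ (by omega), h31]
      v32 := by rw [k4'.wvar _ (by omega), h32]
      left_le := hLp
      le_start := le_rfl
      start_le := le_rfl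
      le_right := hpR
      clean_left := hG.clean_start
      clean_right := hG.clean_start
      done := by rcases hG.kind with e | e <;> omega
      curR := m2.keep d4' (by omega)
      curL := m4
      openR := by omega
      openL := by omega
      keepInner := fun m hm => hm.keep er
      inner := by
        intro i j n e1 e2 e3
        rcases hin i j n e1 e2 e3 with e | e
        · exact .inl (e.keep er)
        · exact .inr ⟨e.1, e.2, .inl e.1⟩
      powers := by
        intro σ a b hσ ha hb
        rw [d4'.mat σ a b (by omega) ha hb, d2'.mat σ a b (by omega) ha hb] }
  -- The potential is the weight that is still missing on both sides; each step adds at least one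
  -- unit of weight.
  refine (Halts.while (fun s' => ∃ l r, I.RunInv s L p R s' l r)
    (fun s' => 1400 * ((4 * I.k + 1) * (4 * I.k + 1) * (I.prefixWt R - I.prefixWt (s'.wvar 31) +
      (I.prefixWt (s'.wvar 30) - I.prefixWt L)))) ⟨p, p, inv⟩ ?_).mono ?_
  · rintro s₅ ⟨l, r, h⟩ hb
    simp [h.v31, h.v32] at hb
    refine (expand_spec hB (hR.of_keeps (h.keeps.mono (by omega))) hG h hb ?_).mono ?_
    · intro j₀ j₁ len hj e1 e2
      exact (hpow j₀ j₁ len hj e1 e2).of_eq fun a b ha hb => h.powers _ a b (by omega) ha hb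
    rintro s₆ T ⟨l', r', d, h', e1, e2, e3⟩
    refine ⟨⟨l', r', h'⟩, ?_⟩
    rw [h.v30, h.v31, h'.v30, h'.v31]
    have q1 := prefixWt_mono (I := I) h.left_le
    have q2 := prefixWt_mono (I := I) h.le_right
    have q3 := prefixWt_mono (I := I) h'.left_le
    have q4 := prefixWt_mono (I := I) h'.le_right
    rw [show I.prefixWt R - I.prefixWt r + (I.prefixWt l - I.prefixWt L) =
      I.prefixWt R - I.prefixWt r' + (I.prefixWt l' - I.prefixWt L) + d by omega,
      Nat.mul_add ((4 * I.k + 1) * (4 * I.k + 1)) _ d]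
    have h6 : (4 * I.k + 1) * (4 * I.k + 1) ≤ (4 * I.k + 1) * (4 * I.k + 1) * d :=
      Nat.le_mul_of_pos_right _ (by omega)
    simp
    omega
  · rintro s₅ T ⟨⟨l, r, h⟩, hb, hT⟩
    simp [h.v31, h.v32] at hb
    obtain rfl : r = R := by have := h.le_right; omega
    obtain rfl := h.done rfl
    have q1 := prefixWt_mono (I := I) hLp
    have q2 := prefixWt_mono (I := I) hpR
    rw [inv.v30, inv.v31, show I.prefixWt r - I.prefixWt p + (I.prefixWt p - I.prefixWt l) =
      I.prefixWt r - I.prefixWt l by omega] at hT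
    refine ⟨?_, h.keeps, h.curR, h.keepInner, ?_, h.powers⟩
    · rw [Nat.mul_add]
      simp at hT ⊢
      omega
    · intro i j n e1 e2 e3
      rcases h.inner i j n e1 e2 e3 with e | e
      · exact e
      · omega

end TedInput


/-! ### Powers of a period -/

/-- Multiplies the matrix in the slot given by the word variable `23` by the matrix in the slot
given by the word variable `42`. -/
def Cmd.mulInto : Cmd := .setW 40 (wv 6 + wv 6 + wv 6) ;; .setW 41 (wv 23) ;; .mulMat ;;
  .setW 40 (wv 23) ;; .setW 41 (wv 6 + wv 6 + wv 6) ;; .copyMat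

/-- Halves the word variable `22` and updates the power of the matrix accordingly. -/
def Cmd.powerStep : Cmd := .setW 22 (wv 22 / 2) ;; .setW 42 (wv 23) ;; .mulInto ;;
  .ite (.wle (2 * (wv 21 / (wv 22 * 2)) + 1) (wv 21 / wv 22)) (.setW 42 (wv 10) ;; .mulInto) .skip

/-- Computes the matrix of the jump that starts at the position given by the word variable
`10`. -/
def Cmd.power : Cmd := .setW 20 (.cell 10 (wv 10)) ;; .setW 30 (wv 10 - wv 20) ;;
  .setW 31 (wv 10 - wv 20) ;; .setW 32 (wv 10) ;; .run ;;
  .setW 21 ((.cell 9 (wv 10) - wv 10) / wv 20) ;; .setW 22 1 ;;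
  .while (.wle (wv 22 * 2) (wv 21)) (.setW 22 (wv 22 * 2)) ;;
  .setW 23 (wv 6 + wv 6 + wv 10) ;; .setW 40 (wv 23) ;; .setW 41 (wv 10) ;; .copyMat ;;
  .while (.wle 2 (wv 22)) .powerStep

namespace TedInput

variable {α : Type*} (I : TedInput α)

/-- Slot `σ` holds the distances of every `f` consecutive periods of a block that consists of `e`
periods of length `len` after the first one, which ends at `j₀`. -/
def GoodPower (s : RAMState) (j₀ len e σ f : ℕ) : Prop :=
  ∀ i, i + f ≤ e + 1 → I.GoodMat s σ (j₀ - len + i * len) (j₀ - len + (i + f) * len)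

variable {I} {B : ℕ} {s : RAMState}

theorem GoodPower.of_eq {s' : RAMState} {j₀ len e σ σ' f : ℕ} (h : I.GoodPower s j₀ len e σ f)
    (he : ∀ a b, a < 4 * I.k + 1 → b < 4 * I.k + 1 →
      s'.mat (4 * I.k + 1) σ' a b = s.mat (4 * I.k + 1) σ a b) : I.GoodPower s' j₀ len e σ' f :=
  fun i hi => (h i hi).of_eq he

/-- The product is formed in a scratch slot, since a product cannot overwrite its own factor, and is
then copied back. -/
theorem mulInto_spec (hB : I.BoundOK B) (hR : I.Ready s) {j₀ e len τ f g : ℕ}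
    (hj : I.Jump j₀ (j₀ + e * len) len)
    (h23 : s.wvar 23 = I.F.length + 1 + (I.F.length + 1) + j₀) (h42 : s.wvar 42 = τ)
    (hτ : τ ≤ I.F.length + 1 + (I.F.length + 1) + j₀)
    (hfg : f + g ≤ e + 1)
    (h1 : I.GoodPower s j₀ len e (I.F.length + 1 + (I.F.length + 1) + j₀) f)
    (h2 : I.GoodPower s j₀ len e τ g) :
    Halts I.orc B .mulInto s fun s' T =>
      T ≤ 500 * ((4 * I.k + 1) * ((4 * I.k + 1) * (4 * I.k + 1))) ∧ Keeps 40 s s' ∧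
        s'.rarr 1 = s.rarr 1 ∧
        (∀ σ a b, σ ≠ I.F.length + 1 + (I.F.length + 1) + j₀ → σ ≠ 3 * (I.F.length + 1) →
          a < 4 * I.k + 1 → b < 4 * I.k + 1 →
          s'.mat (4 * I.k + 1) σ a b = s.mat (4 * I.k + 1) σ a b) ∧
        I.GoodPower s' j₀ len e (I.F.length + 1 + (I.F.length + 1) + j₀) (f + g) := by
  have hlin := hB.linear
  have hf := hj.facts
  refine .seq (.setW (by simp [hR.v6]; omega) (.seq (.setW (by simp [h23]; omega) (.seq ?_))))
  simp only [WExp.eval, WExp.eval_add, RAMState.setW_wvar, Nat.reduceEqDiff, if_false, hR.v6, h23]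
  have k1 : Keeps 40 s ((s.setW 40 (I.F.length + 1 + (I.F.length + 1) + (I.F.length + 1))).setW 41
      (I.F.length + 1 + (I.F.length + 1) + j₀)) :=
    ((Keeps.refl _ _).setW (by simp)).setW (by simp)
  have g42 : ((s.setW 40 (I.F.length + 1 + (I.F.length + 1) + (I.F.length + 1))).setW 41
      (I.F.length + 1 + (I.F.length + 1) + j₀)).wvar 42 = τ := by simp [h42]
  have r1 : ((s.setW 40 (I.F.length + 1 + (I.F.length + 1) + (I.F.length + 1))).setW 41
      (I.F.length + 1 + (I.F.length + 1) + j₀)).rarr = s.rarr := rfl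
  have g40 : ((s.setW 40 (I.F.length + 1 + (I.F.length + 1) + (I.F.length + 1))).setW 41
      (I.F.length + 1 + (I.F.length + 1) + j₀)).wvar 40 =
      I.F.length + 1 + (I.F.length + 1) + (I.F.length + 1) := by simp
  have g41 : ((s.setW 40 (I.F.length + 1 + (I.F.length + 1) + (I.F.length + 1))).setW 41
      (I.F.length + 1 + (I.F.length + 1) + j₀)).wvar 41 =
      I.F.length + 1 + (I.F.length + 1) + j₀ := by simp
  generalize (s.setW 40 (I.F.length + 1 + (I.F.length + 1) + (I.F.length + 1))).setW 41
      (I.F.length + 1 + (I.F.length + 1) + j₀) = t at *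
  have hall : Halts I.orc B .mulMat t fun s' T =>
      T ≤ 200 * ((4 * I.k + 1) * ((4 * I.k + 1) * (4 * I.k + 1))) ∧ Keeps 50 t s' ∧
        KeepsSlots (4 * I.k + 1) (I.F.length + 1 + (I.F.length + 1) + (I.F.length + 1)) t s' ∧
        I.GoodPower s' j₀ len e (I.F.length + 1 + (I.F.length + 1) + (I.F.length + 1)) (f + g) := by
    have hi : ∀ i, i + (f + g) ≤ e + 1 → Halts I.orc B .mulMat t fun s' T =>
      T ≤ 200 * ((4 * I.k + 1) * ((4 * I.k + 1) * (4 * I.k + 1))) ∧ Keeps 50 t s' ∧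
        KeepsSlots (4 * I.k + 1) (I.F.length + 1 + (I.F.length + 1) + (I.F.length + 1)) t s' ∧
        I.GoodMat s' (I.F.length + 1 + (I.F.length + 1) + (I.F.length + 1)) (j₀ - len + i * len)
          (j₀ - len + (i + (f + g)) * len) := by
      intro i hi
      have m1 : i * len ≤ (i + f) * len := Nat.mul_le_mul_right _ (by omega)
      have m2 : (i + f) * len ≤ (i + (f + g)) * len := Nat.mul_le_mul_right _ (by omega)
      have m3 : (i + (f + g)) * len ≤ (e + 1) * len := Nat.mul_le_mul_right _ hi
      rw [Nat.add_mul e] at m3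
      refine mulMat_spec hB (hR.of_keeps (k1.mono (by omega))) g40 g41 g42 (by omega) (by omega)
        (by omega) (p := j₀ - len + (i + f) * len)
        ((h1 i (by omega)).of_eq fun _ _ _ _ => by simp only [RAMState.mat, r1])
        ((add_assoc i f g ▸ h2 (i + f) (by omega)).of_eq
          fun _ _ _ _ => by simp only [RAMState.mat, r1]) (by omega) (by omega) ?_
      intro i' j' n e1 e2 e3 e4
      have := hj.closed (u := i) (v := i + f) (by omega) (by omega) n
      omega
    -- There is one execution, but its result has to be correct for the runs of periods at all
    -- places `i`. The specification is applied once for each place, and determinism identifies the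
    -- final states.
    obtain ⟨s', T, h3, h4, h5, h6, -⟩ := hi 0 (by omega)
    refine ⟨s', T, h3, h4, h5, h6, fun i hi' => ?_⟩
    obtain ⟨s'', T', h3', -, -, -, h7⟩ := hi i hi'
    obtain ⟨rfl, rfl⟩ := h3.det h3'
    exact h7
  refine hall.mono ?_
  rintro s₁ T₁ ⟨t1, k2, d1, g1⟩
  have k2' : Keeps 40 s s₁ := k1.trans (k2.mono (by omega))
  have e6 : s₁.wvar 6 = I.F.length + 1 := by rw [k2'.wvar _ (by omega), hR.v6]
  have e23 : s₁.wvar 23 = I.F.length + 1 + (I.F.length + 1) + j₀ := by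
    rw [k2'.wvar _ (by omega), h23]
  refine .seq (.setW (by simp [e23]; omega) (.seq (.setW (by simp [e6]; omega) ?_)))
  simp only [WExp.eval, WExp.eval_add, RAMState.setW_wvar, Nat.reduceEqDiff, if_false, e6, e23]
  have k3 : Keeps 40 s₁ ((s₁.setW 40 (I.F.length + 1 + (I.F.length + 1) + j₀)).setW 41
      (I.F.length + 1 + (I.F.length + 1) + (I.F.length + 1))) :=
    ((Keeps.refl _ _).setW (by simp)).setW (by simp)
  have k3' := k2'.trans k3
  obtain ⟨s₂, T₂, hx, t2, k4, d2, -⟩ := copyMat_spec hB (hR.of_keeps (k3'.mono (by omega)))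
    (d := I.F.length + 1 + (I.F.length + 1) + j₀)
    (σ := I.F.length + 1 + (I.F.length + 1) + (I.F.length + 1)) (by simp) (by simp) (by omega)
    (by omega)
  refine ⟨s₂, T₂, hx, ?_, k3'.trans (k4.mono (by omega)), ?_, ?_, ?_⟩
  · have h5 : 1 ≤ (4 * I.k + 1) * (4 * I.k + 1) := by nlinarith
    have h8 : (4 * I.k + 1) * (4 * I.k + 1) ≤
      (4 * I.k + 1) * ((4 * I.k + 1) * (4 * I.k + 1)) := Nat.le_mul_of_pos_left _ (by omega)
    simp
    omega
  · rw [d2.rarr 1 (by omega), RAMState.setW_rarr, RAMState.setW_rarr, d1.rarr 1 (by omega), r1]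
  · intro σ a b e1 e2 ha hb
    rw [d2.mat σ a b e1 ha hb]
    refine (d1.mat σ a b (by omega) ha hb).trans ?_
    simp only [RAMState.mat, r1]
  · intro i hi
    obtain ⟨s₂', T₂', hx', -, -, -, h7⟩ := copyMat_spec hB (hR.of_keeps (k3'.mono (by omega)))
      (d := I.F.length + 1 + (I.F.length + 1) + j₀)
      (σ := I.F.length + 1 + (I.F.length + 1) + (I.F.length + 1)) (by simp) (by simp) (by omega)
      (by omega)
    obtain ⟨rfl, rfl⟩ := hx.det hx'
    exact h7 _ _ ((g1 i hi).of_eq fun _ _ _ _ => rfl)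

/-- The exponent `e` is read from its leading binary digit: the slot holds the power e / (2q),
squaring doubles the exponent, and one more period is multiplied if the next digit is 1. -/
theorem powerStep_spec (hB : I.BoundOK B) (hR : I.Ready s) {j₀ e len q : ℕ}
    (hj : I.Jump j₀ (j₀ + e * len) len) (h10 : s.wvar 10 = j₀) (h21 : s.wvar 21 = e)
    (h22 : s.wvar 22 = 2 * q) (hq : 1 ≤ q) (hqe : 2 * q ≤ e)
    (h23 : s.wvar 23 = I.F.length + 1 + (I.F.length + 1) + j₀)
    (h1 : I.GoodPower s j₀ len e (I.F.length + 1 + (I.F.length + 1) + j₀) (e / (2 * q)))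
    (h2 : I.GoodPower s j₀ len e j₀ 1) :
    Halts I.orc B .powerStep s fun s' T =>
      T ≤ 1100 * ((4 * I.k + 1) * ((4 * I.k + 1) * (4 * I.k + 1))) ∧ Keeps 22 s s' ∧
        s'.wvar 22 = q ∧ s'.wvar 23 = I.F.length + 1 + (I.F.length + 1) + j₀ ∧
        s'.rarr 1 = s.rarr 1 ∧
        (∀ σ a b, σ ≠ I.F.length + 1 + (I.F.length + 1) + j₀ → σ ≠ 3 * (I.F.length + 1) →
          a < 4 * I.k + 1 → b < 4 * I.k + 1 →
          s'.mat (4 * I.k + 1) σ a b = s.mat (4 * I.k + 1) σ a b) ∧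
        I.GoodPower s' j₀ len e (I.F.length + 1 + (I.F.length + 1) + j₀) (e / q) := by
  have hlin := hB.linear
  have hf := hj.facts
  have hk := I.one_le
  have h5 : 1 ≤ (4 * I.k + 1) * (4 * I.k + 1) := by nlinarith
  have h8 : (4 * I.k + 1) * (4 * I.k + 1) ≤
    (4 * I.k + 1) * ((4 * I.k + 1) * (4 * I.k + 1)) := Nat.le_mul_of_pos_left _ (by omega)
  have hel : e ≤ e * len := Nat.le_mul_of_pos_right _ (by omega)
  -- So e / q is twice the old exponent, or twice the old exponent plus one; the test in the program
  -- tells which.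
  have hdiv : e / (2 * q) = e / q / 2 := by rw [mul_comm, Nat.div_div_eq_div_mul]
  have hle := Nat.div_le_self e q
  rw [hdiv] at h1
  refine .seq (.setW (by simp [h22]; omega) (.seq (.setW (by simp [h23]; omega) (.seq ?_))))
  have he1 : (wv 22 / 2 : WExp).eval s = q := by simp [h22]
  have he2 : (wv 23).eval (s.setW 22 ((wv 22 / 2 : WExp).eval s)) =
    I.F.length + 1 + (I.F.length + 1) + j₀ := by simp [h23]
  rw [he2, he1]
  have k1 : Keeps 22 s ((s.setW 22 q).setW 42 (I.F.length + 1 + (I.F.length + 1) + j₀)) :=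
    ((Keeps.refl _ _).setW (by simp)).setW (by simp)
  refine (mulInto_spec hB (hR.of_keeps (k1.mono (by omega))) hj (by simp [h23]) (by simp) le_rfl
    (by omega) (h1.of_eq fun _ _ _ _ => rfl) (h1.of_eq fun _ _ _ _ => rfl)).mono ?_
  rintro s₁ T₁ ⟨t1, k2, r1, d1, g1⟩
  have k2' := k1.trans (k2.mono (by omega))
  have e22 : s₁.wvar 22 = q := by rw [k2.wvar _ (by omega)]; simp
  have e23 : s₁.wvar 23 = I.F.length + 1 + (I.F.length + 1) + j₀ := by
    rw [k2.wvar _ (by omega)]; simp [h23]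
  have e21 : s₁.wvar 21 = e := by rw [k2'.wvar _ (by omega), h21]
  have e10 : s₁.wvar 10 = j₀ := by rw [k2'.wvar _ (by omega), h10]
  have d1' : ∀ σ a b, σ ≠ I.F.length + 1 + (I.F.length + 1) + j₀ → σ ≠ 3 * (I.F.length + 1) →
      a < 4 * I.k + 1 → b < 4 * I.k + 1 →
      s₁.mat (4 * I.k + 1) σ a b = s.mat (4 * I.k + 1) σ a b :=
    fun σ a b e1 e2 ha hb => (d1 σ a b e1 e2 ha hb).trans rfl
  refine .ite (fun hb => ?_) fun hb => .skip ?_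
  · simp only [BExp.eval, WExp.eval_add, WExp.eval_mul, WExp.eval_div, WExp.eval, WExp.eval_ofNat,
      e21, e22] at hb
    rw [mul_comm q 2, hdiv] at hb
    refine .seq (.setW (by simp [e10]; omega) ?_)
    simp only [WExp.eval, e10]
    have k3 : Keeps 24 s₁ (s₁.setW 42 j₀) := (Keeps.refl _ _).setW (by simp)
    refine (mulInto_spec hB (hR.of_keeps ((k2'.trans (k3.mono (by omega))).mono (by omega))) hj
      (by simp [e23]) (by simp) (by omega) (by omega) (g1.of_eq fun _ _ _ _ => rfl)
      ((h2.of_eq fun a b ha hb => d1' _ a b (by omega) (by omega) ha hb).of_eq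
        fun _ _ _ _ => rfl)).mono ?_
    rintro s₂ T₂ ⟨t2, k4, r2, d2, g2⟩
    have k4' := k3.trans (k4.mono (by omega))
    refine ⟨?_, k2'.trans (k4'.mono (by omega)), ?_, ?_, ?_, ?_, ?_⟩
    · simp; omega
    · rw [k4'.wvar _ (by omega), e22]
    · rw [k4'.wvar _ (by omega), e23]
    · rw [r2]; exact r1
    · intro σ a b e1 e2 ha hb
      rw [d2 σ a b e1 e2 ha hb]
      exact d1' σ a b e1 e2 ha hb
    · rwa [show e / q / 2 + e / q / 2 + 1 = e / q by omega] at g2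
  · simp only [BExp.eval, WExp.eval_add, WExp.eval_mul, WExp.eval_div, WExp.eval, WExp.eval_ofNat,
      e21, e22] at hb
    rw [mul_comm q 2, hdiv] at hb
    refine ⟨?_, k2', e22, e23, r1, d1', ?_⟩
    · simp; omega
    · rwa [show e / q / 2 + e / q / 2 = e / q by omega] at g1

-- A run over the first period costs O(k²) per character and thus O(k³) in all, because the period
-- is shorter than `8k`. Then O(log n) products give the power for the jump.
set_option maxHeartbeats 1000000 in
theorem power_spec (hB : I.BoundOK B) (hR : I.Ready s) {j₀ j₁ len : ℕ} (hj : I.Jump j₀ j₁ len)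
    (h10 : s.wvar 10 = j₀) (hin : ∀ i j, IsNode I.F i j → j₀ - len ≤ i → j < j₀ →
      I.GoodInner s i) :
    Halts I.orc B .power s fun s' T =>
      T ≤ 8000 * ((4 * I.k + 1) * ((4 * I.k + 1) * (4 * I.k + 1)) *
        (Nat.log 2 I.F.length + 1)) ∧ Keeps 20 s s' ∧
        I.GoodMat s' (2 * (I.F.length + 1) + j₀) j₀ j₁ ∧
        (∀ m, I.GoodInner s m → I.GoodInner s' m) ∧
        (∀ σ a b, 2 * (I.F.length + 1) ≤ σ → σ ≠ 2 * (I.F.length + 1) + j₀ →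
          σ ≠ 3 * (I.F.length + 1) → a < 4 * I.k + 1 → b < 4 * I.k + 1 →
          s'.mat (4 * I.k + 1) σ a b = s.mat (4 * I.k + 1) σ a b) := by
  have hlin := hB.linear
  obtain ⟨f1, f2, f3, f4, f5, e, rfl, f6⟩ := hj.facts
  have hk := I.one_le
  have h5 : 1 ≤ (4 * I.k + 1) * (4 * I.k + 1) := by nlinarith
  have h8 : (4 * I.k + 1) * (4 * I.k + 1) ≤
    (4 * I.k + 1) * ((4 * I.k + 1) * (4 * I.k + 1)) := Nat.le_mul_of_pos_left _ (by omega)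
  have hel : e ≤ e * len := Nat.le_mul_of_pos_right _ (by omega)
  obtain ⟨a9, a10, -⟩ := hR.jump _ _ _ hj
  refine .seq (.setW (by simp [h10, a10]; omega) ?_)
  have he1 : (WExp.cell 10 (wv 10)).eval s = len := by simp [h10, a10]
  rw [he1]
  have k1 : Keeps 20 s (s.setW 20 len) := (Keeps.refl _ _).setW (by simp)
  refine .seq (.setW (by simp [h10]; omega) ?_)
  have he2 : (wv 10 - wv 20 : WExp).eval (s.setW 20 len) = j₀ - len := by simp [h10]
  rw [he2]
  refine .seq (.setW (by simp [h10]; omega) ?_)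
  have he3 : (wv 10 - wv 20 : WExp).eval ((s.setW 20 len).setW 30 (j₀ - len)) = j₀ - len := by
    simp [h10]
  rw [he3]
  refine .seq (.setW (by simp [h10]; omega) ?_)
  have he4 : (wv 10).eval (((s.setW 20 len).setW 30 (j₀ - len)).setW 31 (j₀ - len)) = j₀ := by
    simp [h10]
  rw [he4]
  have hG : I.Reachable (j₀ - len) (j₀ - len) j₀ :=
    { left_le := le_rfl
      le_right := by omega
      right_le := by omega
      clean_left := clean_of_not_inJump (hj.not_inJump_period le_rfl (by omega))
      clean_start := clean_of_not_inJump (hj.not_inJump_period le_rfl (by omega))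
      clean_right := hj.clean_start
      closed := fun i j n e1 e2 => ((hj.closed_period n).2 ⟨e1, e2⟩).1
      kind := .inl rfl }
  have k2 : Keeps 20 s ((((s.setW 20 len).setW 30 (j₀ - len)).setW 31 (j₀ - len)).setW 32 j₀) :=
    ((k1.setW (by simp)).setW (by simp)).setW (by simp)
  refine .seq ((run_spec hB (hR.of_keeps (k2.mono (by omega))) hG (by simp) (by simp) (by simp)
    ?_ ?_).mono ?_)
  -- There is no jump within the first period, so no power is needed for this run.
  · intro j₀' j₁' len' hj' e1 e2
    have := hj'.facts
    exact absurd ⟨_, _, _, hj', le_rfl, by omega⟩ (hj.not_inJump_period e1 (by omega))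
  · intro i j n _ e1 e2
    exact .inl (hin i j n e1 e2)
  rintro s₁ T₁ ⟨t1, k3, m3, g3, -, d3⟩
  have k3' : Keeps 20 s s₁ := k2.trans (k3.mono (by omega))
  have R1 := hR.of_keeps (k3'.mono (by omega))
  have e10 : s₁.wvar 10 = j₀ := by rw [k3'.wvar _ (by omega), h10]
  have e20 : s₁.wvar 20 = len := by rw [k3.wvar _ (by omega)]; simp
  have he5 : ((WExp.cell 9 (wv 10) - wv 10) / wv 20 : WExp).eval s₁ = e := by
    simp [e10, e20, (R1.jump _ _ _ hj).1]
    exact Nat.mul_div_cancel _ (by omega)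
  refine .seq (.setW (by rw [he5]; omega) ?_)
  rw [he5]
  refine .seq (.setW (by simp; omega) (.seq ?_))
  rw [WExp.eval_ofNat]
  have k4 : Keeps 20 s ((s₁.setW 21 e).setW 22 1) := (k3'.setW (by simp)).setW (by simp)
  have hlog : Nat.log 2 e ≤ Nat.log 2 I.F.length := Nat.log_mono_right (by omega)
  -- This loop finds the largest power of two that is at most `e`, that is, the place of the leading
  -- binary digit.
  refine (Halts.while (fun s' => ∃ a, a ≤ Nat.log 2 e ∧ s' = (s₁.setW 21 e).setW 22 (2 ^ a))
    (fun s' => 20 * (Nat.log 2 e - Nat.log 2 (s'.wvar 22))) ⟨0, by omega, by simp⟩ ?_).mono ?_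
  · rintro s' ⟨a, ha, rfl⟩ hb
    simp [← pow_succ] at hb
    have hb' : a + 1 ≤ Nat.log 2 e := Nat.le_log_of_pow_le (by omega) hb
    refine .setW (by simp [← pow_succ]; omega) ⟨⟨a + 1, hb', ?_⟩, ?_⟩
    · simp [RAMState.setW, pow_succ]
    · simp [← pow_succ, Nat.log_pow]
      omega
  rintro s' T₂ ⟨⟨a, ha, rfl⟩, hb, t2⟩
  simp [← pow_succ] at hb
  have hae : 2 ^ a ≤ e := Nat.pow_le_of_le_log (by omega) ha
  have k5 : Keeps 20 s ((s₁.setW 21 e).setW 22 (2 ^ a)) := (k3'.setW (by simp)).setW (by simp)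
  have R5 := hR.of_keeps (k5.mono (by omega))
  have g10 : ((s₁.setW 21 e).setW 22 (2 ^ a)).wvar 10 = j₀ := by simp [e10]
  have g21 : ((s₁.setW 21 e).setW 22 (2 ^ a)).wvar 21 = e := by simp
  have g22 : ((s₁.setW 21 e).setW 22 (2 ^ a)).wvar 22 = 2 ^ a := by simp
  have r5 : ((s₁.setW 21 e).setW 22 (2 ^ a)).rarr = s₁.rarr := rfl
  generalize (s₁.setW 21 e).setW 22 (2 ^ a) = t at *
  refine .seq (.setW (by simp [R5.v6, g10]; omega) (.seq (.setW (by simp [R5.v6, g10]; omega)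
    (.seq (.setW (by simp [R5.v6, g10]; omega) (.seq ?_))))))
  simp only [WExp.eval, WExp.eval_add, RAMState.setW_wvar, Nat.reduceEqDiff, if_false, if_true,
    R5.v6, g10]
  have k6 : Keeps 23 t (((t.setW 23 (I.F.length + 1 + (I.F.length + 1) + j₀)).setW 40
      (I.F.length + 1 + (I.F.length + 1) + j₀)).setW 41 j₀) :=
    (((Keeps.refl _ _).setW (by simp)).setW (by simp)).setW (by simp)
  have k6' := k5.trans (k6.mono (by omega))
  have hcopy := copyMat_spec hB (hR.of_keeps (k6'.mono (by omega)))
    (d := I.F.length + 1 + (I.F.length + 1) + j₀) (σ := j₀) (by simp) (by simp) (by omega)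
    (by omega)
  obtain ⟨s₃, T₃, hx, t3, k7, d7, m7⟩ := hcopy
  refine ⟨s₃, T₃, hx, ?_⟩
  have r6 : (((t.setW 23 (I.F.length + 1 + (I.F.length + 1) + j₀)).setW 40
      (I.F.length + 1 + (I.F.length + 1) + j₀)).setW 41 j₀).rarr = s₁.rarr := r5
  have g23 : (((t.setW 23 (I.F.length + 1 + (I.F.length + 1) + j₀)).setW 40
      (I.F.length + 1 + (I.F.length + 1) + j₀)).setW 41 j₀).wvar 23 =
      I.F.length + 1 + (I.F.length + 1) + j₀ := by simp
  generalize ((t.setW 23 (I.F.length + 1 + (I.F.length + 1) + j₀)).setW 40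
      (I.F.length + 1 + (I.F.length + 1) + j₀)).setW 41 j₀ = u at *
  -- The matrix was computed for the first period; by periodicity it serves for all `e + 1` periods.
  have pw1 : I.GoodPower s₁ j₀ len e j₀ 1 := by
    intro i hi a b ha hb
    have m1 : (i + 1) * len ≤ (e + 1) * len := Nat.mul_le_mul_right _ hi
    rw [Nat.add_mul, Nat.add_mul] at m1
    rw [show j₀ - len + (i + 1) * len = j₀ + i * len by rw [Nat.add_mul]; omega]
    exact hj.periodic (by omega) (m3 a b ha hb)
  have pw3 : I.GoodPower s₃ j₀ len e (I.F.length + 1 + (I.F.length + 1) + j₀) 1 :=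
    fun i hi => m7 _ _ ((pw1 i hi).of_eq fun _ _ _ _ => by simp only [RAMState.mat, r6])
  have pw3' : I.GoodPower s₃ j₀ len e j₀ 1 :=
    fun i hi => ((pw1 i hi).of_eq fun _ _ _ _ => by simp only [RAMState.mat, r6]).keep d7
      (by omega)
  have k7' := k6.trans (k7.mono (by omega))
  refine (Halts.while (fun s' => Keeps 22 s₃ s' ∧ s'.wvar 23 = I.F.length + 1 + (I.F.length + 1) + j₀
      ∧ s'.rarr 1 = s₃.rarr 1 ∧
      (∀ σ a b, σ ≠ I.F.length + 1 + (I.F.length + 1) + j₀ → σ ≠ 3 * (I.F.length + 1) →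
          a < 4 * I.k + 1 → b < 4 * I.k + 1 →
          s'.mat (4 * I.k + 1) σ a b = s₃.mat (4 * I.k + 1) σ a b) ∧
      ∃ q, s'.wvar 22 = 2 ^ q ∧ 2 ^ q ≤ e ∧
        I.GoodPower s' j₀ len e (I.F.length + 1 + (I.F.length + 1) + j₀) (e / 2 ^ q))
    (fun s' => 1200 * ((4 * I.k + 1) * ((4 * I.k + 1) * (4 * I.k + 1)) * Nat.log 2 (s'.wvar 22)))
    ⟨.refl _ _, ?_, rfl, fun _ _ _ _ _ _ _ => rfl, a, ?_, hae, ?_⟩ ?_).mono ?_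
  · rw [k7.wvar _ (by omega), g23]
  · rw [k7'.wvar _ (by omega), g22]
  · rwa [show e / 2 ^ a = 1 from Nat.div_eq_of_lt_le (by omega) (by rw [pow_succ] at hb; omega)]
  · rintro v ⟨p1, p2, p3, p4, q, p5, p6, p7⟩ hb'
    obtain _ | q := q
    · simp [p5] at hb'
    have kv := (k7'.mono (by omega : 22 ≤ 23)).trans p1
    have kv' := k5.trans (kv.mono (by omega))
    rw [pow_succ'] at p5 p6 p7
    refine (powerStep_spec hB (hR.of_keeps (kv'.mono (by omega))) hj
      (by rw [kv'.wvar _ (by omega), h10]) (by rw [kv.wvar _ (by omega), g21]) p5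
      (Nat.one_le_two_pow) p6 p2 p7
      (pw3'.of_eq fun a b ha hb => p4 _ a b (by omega) (by omega) ha hb)).mono ?_
    rintro v' T ⟨q1, q2, q3, q4, q5, q6, q7⟩
    refine ⟨⟨p1.trans q2, q4, q5.trans p3, ?_, q, q3, by omega, q7⟩, ?_⟩
    · intro σ a b e1 e2 ha hb
      rw [q6 σ a b e1 e2 ha hb, p4 σ a b e1 e2 ha hb]
    · rw [q3, p5, ← pow_succ', Nat.log_pow (by omega), Nat.log_pow (by omega),
        Nat.mul_add _ q 1]
      simp
      omega
  · rintro v T ⟨⟨p1, p2, p3, p4, q, p5, p6, p7⟩, hb', t4⟩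
    have hq : q = 0 := by
      by_contra hq
      have : 2 ^ 1 ≤ 2 ^ q := Nat.pow_le_pow_right (by omega) (by omega)
      simp [p5] at hb'
      omega
    subst hq
    have kv := (k7'.mono (by omega : 22 ≤ 23)).trans p1
    have kv' := k5.trans (kv.mono (by omega))
    have e1 : v.rarr 1 = s₁.rarr 1 := by rw [p3, d7.rarr 1 (by omega), r6]
    refine ⟨?_, kv', ?_, fun m hm => GoodInner.keep (g3 m (hm.keep rfl)) e1, ?_⟩
    · rw [k7'.wvar 22 (by omega), g22, Nat.log_pow (by omega)] at t4
      rw [show I.prefixWt j₀ - I.prefixWt (j₀ - len) = len by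
        have := hj.prefixWt_period le_rfl
        rw [show j₀ - len + len = j₀ by omega] at this
        omega] at t1
      have h9 : (4 * I.k + 1) * (4 * I.k + 1) * (len + 1) ≤
          2 * ((4 * I.k + 1) * ((4 * I.k + 1) * (4 * I.k + 1))) := by
        calc _ ≤ (4 * I.k + 1) * (4 * I.k + 1) * (2 * (4 * I.k + 1)) :=
              Nat.mul_le_mul_left _ (by omega)
          _ = _ := by ring
      have h10 : (4 * I.k + 1) * ((4 * I.k + 1) * (4 * I.k + 1)) * a ≤
          (4 * I.k + 1) * ((4 * I.k + 1) * (4 * I.k + 1)) * Nat.log 2 I.F.length :=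
        Nat.mul_le_mul_left _ (by omega)
      have h11 : Nat.log 2 I.F.length ≤
          (4 * I.k + 1) * ((4 * I.k + 1) * (4 * I.k + 1)) * Nat.log 2 I.F.length :=
        Nat.le_mul_of_pos_left _ (by omega)
      rw [Nat.mul_add _ (Nat.log 2 I.F.length) 1]
      simp [Nat.log_pow] at t2 t4 ⊢
      omega
    -- The jump omits the first period, so the `e` consecutive periods start at index 1.
    · have := p7 1 (by simp; omega)
      simp only [pow_zero, Nat.div_one, one_mul] at this
      rw [show j₀ - len + len = j₀ by omega, show j₀ - len + (1 + e) * len = j₀ + e * len by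
        rw [Nat.add_mul]; omega] at this
      exact this.of_eq fun _ _ _ _ => by rw [two_mul]
    · intro σ a b e1 e2 e3 ha hb
      rw [p4 σ a b (by omega) e3 ha hb, d7.mat σ a b (by omega) ha hb]
      refine Eq.trans ?_ ((d3 σ a b e1 ha hb).trans rfl)
      simp only [RAMState.mat, r6]

end TedInput


/-! ### Sweeping over the forest -/

/-- The condition that the node whose parentheses are given by the word variables `11` and `10` is
the heavy child of the node given by the predecessor of the word variable `12`. -/
def BExp.heavy : BExp := .and (.wle 1 (wv 12))
  (.wlt (.cell 13 (.cell 7 (wv 12 - 1) + 1) - .cell 13 (wv 12 - 1))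
    (2 * (.cell 13 (wv 10 + 1) - .cell 13 (wv 11))))

/-- Processes the closing parenthesis at the position given by the word variable `10`. -/
def Cmd.closeNode : Cmd := .setW 11 (.cell 7 (wv 10)) ;; .setW 12 (.cell 8 (wv 11)) ;;
  .setW 13 (.cell 11 (wv 11)) ;; .ite (.wle 1 (wv 13)) .skip (.setW 13 (wv 11 + 1)) ;;
  .ite .heavy (.storeW 11 (wv 12 - 1) (wv 13))
    (.setW 30 (wv 13) ;; .setW 31 (wv 13) ;; .setW 32 (wv 10 + 1) ;; .run)

/-- Processes the position given by the word variable `10`. -/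
def Cmd.sweepStep : Cmd := .ite (.wle 1 (.cell 9 (wv 10)))
  (.power ;; .setW 10 (.cell 9 (wv 10)))
  (.ite (.weq (.cell 0 (wv 10)) 1) .closeNode .skip ;; .setW 10 (wv 10 + 1))

/-- Computes the matrix of the whole forest. -/
def Cmd.sweep : Cmd := .setW 10 0 ;; .while (.wlt (wv 10) (wv 0)) .sweepStep ;;
  .setW 30 0 ;; .setW 31 0 ;; .setW 32 (wv 0) ;; .run

theorem IsEnclosing.unique {α : Type*} {F : List (Paren α)} {x u v : ℕ} (h : IsEnclosing F x u)
    (h' : IsEnclosing F x v) : u = v := by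
  rcases h with ⟨rfl, h⟩ | ⟨i, j, rfl, hn, h1, h2, h3⟩ <;>
    rcases h' with ⟨rfl, h'⟩ | ⟨i', j', rfl, hn', h1', h2', h3'⟩
  · rfl
  · exact absurd ⟨h1', h2'⟩ (h _ _ hn')
  · exact absurd ⟨h1, h2⟩ (h' _ _ hn)
  · have := h3 _ _ hn' h1' h2'
    have := h3' _ _ hn h1 h2
    omega

namespace TedInput

variable {α : Type*} (I : TedInput α)

/-- The weight of the node `[i..j]`. -/
noncomputable def nodeWt (i j : ℕ) : ℕ := I.prefixWt (j + 1) - I.prefixWt i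

/-- The node `[i..j]` is outside of the jumps and has more than half of the weight of its parent
`[p..q]`. -/
structure IsHeavy (i j p q : ℕ) : Prop where
  node : IsNode I.F i j
  active : ¬ I.InJump i
  parent : IsNode I.F p q
  enclosing : IsEnclosing I.F i (p + 1)
  wt_lt : I.nodeWt p q < 2 * I.nodeWt i j

/-- The node `[i..j]` is outside of the jumps and has at most half of the weight of its parent, or
no parent. -/
def IsLight (i j : ℕ) : Prop := IsNode I.F i j ∧ ¬ I.InJump i ∧ ∀ p q, ¬ I.IsHeavy i j p q

open Classical in
/-- A bound on the time at the position `y`. -/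
noncomputable def sweepCost (y : ℕ) : ℕ :=
  200 + (if ∃ j₁ len, I.Jump y j₁ len then 8000 * ((4 * I.k + 1) * ((4 * I.k + 1) * (4 * I.k + 1)) *
        (Nat.log 2 I.F.length + 1)) else 0) +
    ∑ i ∈ Finset.range I.F.length, if I.IsLight i y then
      2000 * ((4 * I.k + 1) * (4 * I.k + 1) * (I.nodeWt i y + 1)) else 0

/-- The position inside of the node at `i` from which the computation for this node starts. -/
def startOf (s : RAMState) (i : ℕ) : ℕ := if 1 ≤ s.warr 11 i then s.warr 11 i else i + 1

/-- The invariant of the sweep when the prefix of length `x` has been processed. -/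
structure SweepInv (s : RAMState) (x : ℕ) : Prop where
  ready : I.Ready s
  v10 : s.wvar 10 = x
  le : x ≤ I.F.length
  clean : I.Clean x
  powers : ∀ j₀ j₁ len, I.Jump j₀ j₁ len → j₁ ≤ x →
    I.GoodMat s (2 * (I.F.length + 1) + j₀) j₀ j₁
  start : ∀ i j, IsNode I.F i j → ¬ I.InJump i →
    i < startOf s i ∧ startOf s i ≤ j ∧ I.Clean (startOf s i)
  heavy : ∀ i j p q, I.IsHeavy i j p q → j < x → startOf s p = startOf s i
  inner : ∀ i j, IsNode I.F i j → ¬ I.InJump i → j < x → I.GoodInner s i ∨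
    ∃ i' j' p q, I.IsHeavy i' j' p q ∧ j' < x ∧ x ≤ q ∧ i' ≤ i ∧ j ≤ j' ∧ i < startOf s i' ∧
      startOf s i' ≤ j

variable {I} {B : ℕ} {s s' : RAMState} {x : ℕ}

/-! ### Heavy children and the invariant of the sweep -/

theorem IsHeavy.facts {i j p q : ℕ} (h : I.IsHeavy i j p q) : p < i ∧ j < q ∧ i < j ∧
    ∀ i' j', IsNode I.F i' j' → i' < i → i ≤ j' → i' ≤ p := by
  rcases h.enclosing with ⟨e, -⟩ | ⟨p', q', e, hn, h1, h2, h3⟩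
  · omega
  · obtain rfl : p = p' := by omega
    obtain rfl := hn.right_unique h.parent
    have := h.node.left_ne_right hn
    exact ⟨h1, hn.nest h.node h1 (by omega), h.node.lt, h3⟩

theorem not_inJump_of_encloses {i p q : ℕ} (h : ¬ I.InJump i) (hp : IsNode I.F p q) (h1 : p < i) (h2 : i < q) : ¬ I.InJump p := by
  rintro ⟨j₀, j₁, len, hj, h3, h4⟩
  have := (hj.closed_jump hp).1 ⟨h3, h4⟩
  exact h ⟨j₀, j₁, len, hj, by omega, by omega⟩

/-- Two disjoint children cannot both have more than half of the weight of their parent. Hence the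
start handed up by a heavy child is never overwritten by a sibling. -/
theorem IsHeavy.disjoint {i j p q i' j' : ℕ} (h : I.IsHeavy i j p q) (h' : I.IsHeavy i' j' p q)
    (hi : i < i') : False := by
  obtain ⟨a1, a2, a3, a4⟩ := h.facts
  obtain ⟨b1, b2, b3, b4⟩ := h'.facts
  have h1 : j < i' := by
    have := h'.node.left_ne_right h.node
    by_contra hc
    have := b4 i j h.node hi (by omega)
    omega
  have q1 := prefixWt_mono (I := I) a1.le
  have q2 := prefixWt_mono (I := I) (by omega : i ≤ j + 1)
  have q3 := prefixWt_mono (I := I) (by omega : j + 1 ≤ i')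
  have q4 := prefixWt_mono (I := I) (by omega : i' ≤ j' + 1)
  have q5 := prefixWt_mono (I := I) (by omega : j' + 1 ≤ q + 1)
  have w1 := h.wt_lt
  have w2 := h'.wt_lt
  simp only [nodeWt] at w1 w2
  omega

theorem IsHeavy.child_unique {i j p q i' j' q' : ℕ} (h : I.IsHeavy i j p q)
    (h' : I.IsHeavy i' j' p q') : i = i' := by
  obtain rfl := h.parent.right_unique h'.parent
  by_contra hne
  rcases Nat.lt_or_gt_of_ne hne with e | e
  · exact h.disjoint h' e
  · exact h'.disjoint h e

theorem IsHeavy.parent_unique {i j p q j' p' q' : ℕ} (h : I.IsHeavy i j p q)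
    (h' : I.IsHeavy i j' p' q') : p = p' := by
  have := h.enclosing.unique h'.enclosing
  omega

/-- A parent that reaches beyond the first period contains the whole block, because periods and
blocks cut no nodes. Period and jump both weigh `len`, so the parent weighs at least `2 * len`,
while a node in the period weighs at most `len`. Therefore no node of the period is waiting for a
later run when the sweep reaches the jump. -/
theorem Jump.not_heavy {j₀ j₁ len i j p q : ℕ} (hj : I.Jump j₀ j₁ len) (h : I.IsHeavy i j p q)
    (h1 : j₀ - len ≤ i) (h2 : j < j₀) (h3 : j₀ ≤ q) : False := by
  obtain ⟨a1, a2, a3, a4⟩ := h.facts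
  obtain ⟨f1, f2, f3, f4, f5, -⟩ := hj.facts
  have c1 := hj.closed_period h.parent
  have c2 := hj.closed_block h.parent
  have q1 := prefixWt_mono (I := I) (by omega : p ≤ j₀ - len)
  have q2 := prefixWt_mono (I := I) h1
  have q3 := prefixWt_mono (I := I) (by omega : j + 1 ≤ j₀)
  have q4 := prefixWt_mono (I := I) (by omega : j₁ ≤ q + 1)
  have q5 := hj.prefixWt_period le_rfl
  rw [show j₀ - len + len = j₀ by omega] at q5
  have q6 := hj.prefixWt
  have w1 := h.wt_lt
  simp only [nodeWt] at w1
  omega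

theorem Ready.heavy_iff (hR : I.Ready s) {i : ℕ} (hn : IsNode I.F i x) (ha : ¬ I.InJump i)
    (h10 : s.wvar 10 = x) (h11 : s.wvar 11 = i) (h12 : s.wvar 12 = s.warr 8 i) :
    BExp.heavy.eval I.orc s ↔ ∃ q, I.IsHeavy i x (s.warr 8 i - 1) q ∧ 1 ≤ s.warr 8 i := by
  have hx : ¬ I.InJump x := by rwa [← inJump_iff hn]
  have lt := hn.lt
  have lt' := hn.lt_length
  have p1 := hR.pre i (by omega) (clean_of_not_inJump ha)
  have p2 := hR.pre (x + 1) (by omega) (clean_succ hx)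
  have hp := hR.par i x hn
  simp only [BExp.heavy, BExp.eval, BExp.eval_wlt, WExp.eval, WExp.eval_add, WExp.eval_sub,
    WExp.eval_mul, WExp.eval_ofNat, h10, h11, h12, p1, p2]
  generalize s.warr 8 i = v at *
  constructor
  · rintro ⟨e1, e2⟩
    rcases hp with ⟨e, -⟩ | ⟨p, q, rfl, hpq, h1, h2, h3⟩
    · omega
    · have hi := hn.left_ne_right hpq
      have hpa := not_inJump_of_encloses ha hpq h1 (by omega)
      have hqa : ¬ I.InJump q := by rwa [← inJump_iff hpq]
      have lt2 := hpq.lt_length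
      rw [Nat.add_sub_cancel, (hR.nodeF _ _ hpq).2.2.1, hR.pre (q + 1) (by omega) (clean_succ hqa),
        hR.pre p (by omega) (clean_of_not_inJump hpa)] at e2
      exact ⟨q, ⟨hn, ha, hpq, .inr ⟨p, q, rfl, hpq, h1, h2, h3⟩, e2⟩, e1⟩
  · rintro ⟨q, h, e1⟩
    refine ⟨e1, ?_⟩
    obtain ⟨p, rfl⟩ : ∃ p, v = p + 1 := ⟨v - 1, by omega⟩
    rw [Nat.add_sub_cancel] at h ⊢
    obtain ⟨a1, a2, a3, -⟩ := h.facts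
    have hpa := not_inJump_of_encloses ha h.parent a1 (by omega)
    have hqa : ¬ I.InJump q := by rwa [← inJump_iff h.parent]
    have lt2 := h.parent.lt_length
    rw [(hR.nodeF _ _ h.parent).2.2.1, hR.pre (q + 1) (by omega) (clean_succ hqa),
      hR.pre p (by omega) (clean_of_not_inJump hpa)]
    exact h.wt_lt

/-- A pending node that is enclosed by the node `[i..x]` is below its heavy child. -/
theorem IsHeavy.parent_eq {i i' j' p q i'' : ℕ} (h : I.IsHeavy i' j' p q) (hn : IsNode I.F i x)
    (h1 : j' < x) (h2 : x ≤ q) (h3 : i ≤ i'') (h4 : i'' ≤ j') : p = i := by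
  obtain ⟨a1, a2, a3, a4⟩ := h.facts
  have e1 : i < i' := by
    by_contra hc
    rcases (not_lt.1 hc).eq_or_lt with e | e
    · subst e
      have := h.node.right_unique hn
      omega
    · have := h.node.left_ne_right hn
      have := hn.left_ne_right h.node
      have := h.node.nest hn e (by omega)
      omega
  have e2 := a4 i x hn e1 (by omega)
  by_contra hne
  have := hn.nest h.parent (by omega) (by omega)
  omega

theorem Ready.storeStart (h : I.Ready s) (i v : ℕ) : I.Ready (s.storeW 11 i v) := by
  constructor
  all_goals simp only [RAMState.storeW_wvar, RAMState.storeW_warr, RAMState.storeW_rvar]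
  · exact h.v0
  · exact h.v1
  · exact h.v2
  · exact h.v4
  · exact h.v5
  · exact h.v6
  · exact h.inf
  · simpa using h.nodeF
  · simpa using h.nodeG
  · simpa using h.mate_le
  · simpa using h.jump
  · simpa using h.no_jump
  · simpa using h.no_jump_end
  · simpa using h.pre
  · simpa using h.par

theorem SweepInv.of_keeps (h : I.SweepInv s x) (hk : Keeps 11 s s')
    (hp : ∀ j₀ j₁ len, I.Jump j₀ j₁ len → j₁ ≤ x → I.GoodMat s' (2 * (I.F.length + 1) + j₀) j₀ j₁)
    (hi : ∀ m, I.GoodInner s m → I.GoodInner s' m) : I.SweepInv s' x where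
  ready := h.ready.of_keeps (hk.mono (by omega))
  v10 := by rw [hk.wvar _ (by omega), h.v10]
  le := h.le
  clean := h.clean
  powers := hp
  start := by simp only [startOf, hk.warr]; exact h.start
  heavy := by simp only [startOf, hk.warr]; exact h.heavy
  inner := by
    intro i j n e1 e2
    simp only [startOf, hk.warr]
    exact (h.inner i j n e1 e2).imp_left (hi i)

/-- Covers the steps that complete no node outside of the jumps: crossing a jump and passing an
opening parenthesis. -/
theorem SweepInv.advance (h : I.SweepInv s x) {y : ℕ} (hxy : x < y) (hy : y ≤ I.F.length)
    (hc : I.Clean y) (hp : ∀ j₀ j₁ len, I.Jump j₀ j₁ len → x < j₁ → j₁ ≤ y →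
      I.GoodMat s (2 * (I.F.length + 1) + j₀) j₀ j₁)
    (hn : ∀ i j, IsNode I.F i j → x ≤ j → j < y → x ≤ i ∧ I.InJump i) :
    I.SweepInv (s.setW 10 y) y where
  ready := h.ready.of_keeps ((Keeps.refl _ _).setW le_rfl)
  v10 := by simp
  le := hy
  clean := hc
  powers := by
    intro j₀ j₁ len hj h1
    by_cases h2 : x < j₁
    · exact hp _ _ _ hj h2 h1
    · exact h.powers _ _ _ hj (by omega)
  start := h.start
  heavy := by
    intro i j p q hh h1
    by_cases h2 : x ≤ j
    · exact absurd (hn i j hh.node h2 h1).2 hh.active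
    · exact h.heavy i j p q hh (by omega)
  inner := by
    intro i j n e1 e2
    by_cases h2 : x ≤ j
    · exact absurd (hn i j n h2 e2).2 e1
    · refine (h.inner i j n e1 (by omega)).imp_right ?_
      rintro ⟨i', j', p, q, hh, f1, f2, f3⟩
      refine ⟨i', j', p, q, hh, by omega, ?_, f3⟩
      by_contra hc
      have := (hn p q hh.parent f2 (by omega)).1
      have := hh.facts
      omega

theorem sweepCost_ge (y : ℕ) : 200 ≤ I.sweepCost y := by
  rw [sweepCost, add_assoc]; exact Nat.le_add_right _ _

theorem Jump.sweepCost_ge {j₀ j₁ len : ℕ} (hj : I.Jump j₀ j₁ len) :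
    200 + 8000 * ((4 * I.k + 1) * ((4 * I.k + 1) * (4 * I.k + 1)) *
        (Nat.log 2 I.F.length + 1)) ≤ I.sweepCost j₀ := by
  rw [sweepCost, if_pos ⟨_, _, hj⟩]
  exact Nat.le_add_right _ _

theorem IsLight.sweepCost_ge {i j : ℕ} (h : I.IsLight i j) :
    200 + 2000 * ((4 * I.k + 1) * (4 * I.k + 1) * (I.nodeWt i j + 1)) ≤ I.sweepCost j := by
  classical
  have lt := h.1.lt
  have lt' := h.1.lt_length
  have := Finset.single_le_sum (f := fun i => if I.IsLight i j then
      2000 * ((4 * I.k + 1) * (4 * I.k + 1) * (I.nodeWt i j + 1)) else 0) (fun _ _ => Nat.zero_le _)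
      (Finset.mem_range.2 (by omega : i < I.F.length))
  simp only [if_pos h] at this
  refine (Nat.add_le_add_left this 200).trans ?_
  rw [sweepCost]
  gcongr
  exact Nat.le_add_right _ _

/-- No distances are computed for a heavy node: its start is handed to the parent. The nodes of its
heavy path continue to wait, now below the closed node instead of below its heavy child. -/
theorem SweepInv.close_heavy (h : I.SweepInv s x) {i p q : ℕ} (hh : I.IsHeavy i x p q) :
    I.SweepInv ((s.storeW 11 p (startOf s i)).setW 10 (x + 1)) (x + 1) := by
  obtain ⟨a1, a2, a3, a4⟩ := hh.facts
  have hx : ¬ I.InJump x := by rw [← inJump_iff hh.node]; exact hh.active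
  have lt := hh.node.lt_length
  have hst := h.start i x hh.node hh.active
  have est : ∀ i', startOf ((s.storeW 11 p (startOf s i)).setW 10 (x + 1)) i' =
      if i' = p then startOf s i else startOf s i' := by
    intro i'
    by_cases e : i' = p
    · subst e
      have : 1 ≤ startOf s i := by omega
      simp [startOf] at this ⊢
      omega
    · simp [startOf, e]
  refine
    { ready := (h.ready.storeStart _ _).of_keeps ((Keeps.refl _ _).setW le_rfl)
      v10 := by simp
      le := lt
      clean := clean_succ hx
      powers := ?_
      start := ?_
      heavy := ?_
      inner := ?_ }
  · intro j₀ j₁ len hj h1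
    refine h.powers _ _ _ hj ?_
    by_contra hc
    have := hj.facts
    have := I.one_le
    exact hx ⟨_, _, _, hj, by omega, by omega⟩
  · intro i' j' n e1
    rw [est]
    split_ifs with e
    · subst e
      obtain rfl := n.right_unique hh.parent
      exact ⟨by omega, by omega, hst.2.2⟩
    · exact h.start i' j' n e1
  · intro i' j' p' q' hh' e1
    have hb := hh'.facts
    rw [est, est]
    have e2 : i' ≠ p := by
      rintro rfl
      have := hh'.node.right_unique hh.parent
      omega
    rw [if_neg e2]
    by_cases e3 : j' = x
    · subst e3
      obtain rfl := hh.node.left_unique hh'.node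
      rw [if_pos (hh'.parent_unique hh)]
    · have e4 : p' ≠ p := by
        rintro rfl
        obtain rfl := hh.child_unique hh'
        exact e3 (hh'.node.right_unique hh.node)
      rw [if_neg e4]
      exact h.heavy _ _ _ _ hh' (by omega)
  · intro i' j' n e1 e2
    -- A waiting node that contains the start of the closed node may name the closed node as the top
    -- of its heavy path.
    have root : i ≤ i' → j' ≤ x → i' < startOf s i → startOf s i ≤ j' →
        ∃ i'' j'' p' q', I.IsHeavy i'' j'' p' q' ∧ j'' < x + 1 ∧ x + 1 ≤ q' ∧ i'' ≤ i' ∧ j' ≤ j'' ∧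
          i' < startOf ((s.storeW 11 p (startOf s i)).setW 10 (x + 1)) i'' ∧
          startOf ((s.storeW 11 p (startOf s i)).setW 10 (x + 1)) i'' ≤ j' := by
      intro f1 f2 f3 f4
      refine ⟨i, x, p, q, hh, by omega, by omega, f1, f2, ?_⟩
      rw [est, if_neg (by omega)]
      exact ⟨f3, f4⟩
    by_cases e3 : j' = x
    · subst e3
      obtain rfl := hh.node.left_unique n
      exact .inr (root le_rfl le_rfl hst.1 hst.2.1)
    · rcases h.inner i' j' n e1 (by omega) with e4 | ⟨i₁, j₁, p₁, q₁, hh₁, f1, f2, f3, f4, f5, f6⟩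
      · exact .inl e4
      · refine .inr ?_
        -- The node was waiting below the heavy child of the node that is closing now. The two have
        -- the same start, so the top of the path moves up by one.
        by_cases e5 : q₁ = x
        · subst e5
          obtain rfl := hh.node.left_unique hh₁.parent
          have := h.heavy _ _ _ _ hh₁ f1
          have := hh₁.facts
          exact root (by omega) (by omega) (by omega) (by omega)
        · refine ⟨i₁, j₁, p₁, q₁, hh₁, by omega, by omega, f3, f4, ?_⟩
          rw [est, if_neg]
          · exact ⟨f5, f6⟩
          · rintro rfl
            have := hh₁.node.right_unique hh.parent
            omega

/-- The run for a light node settles all nodes inside of it, so everything that was waiting below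
its heavy child is released. -/
theorem SweepInv.close_light (h : I.SweepInv s x) {i : ℕ} (hl : I.IsLight i x)
    (hin : ∀ i' j', IsNode I.F i' j' → ¬ I.InJump i' → i ≤ i' → j' < x + 1 → I.GoodInner s i') :
    I.SweepInv (s.setW 10 (x + 1)) (x + 1) := by
  obtain ⟨hn, ha, hl⟩ := hl
  have hx : ¬ I.InJump x := by rwa [← inJump_iff hn]
  have lt := hn.lt_length
  refine
    { ready := h.ready.of_keeps ((Keeps.refl _ _).setW le_rfl)
      v10 := by simp
      le := lt
      clean := clean_succ hx
      powers := ?_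
      start := h.start
      heavy := ?_
      inner := ?_ }
  · intro j₀ j₁ len hj h1
    refine h.powers _ _ _ hj ?_
    by_contra hc
    have := hj.facts
    have := I.one_le
    exact hx ⟨_, _, _, hj, by omega, by omega⟩
  · intro i' j' p' q' hh' e1
    by_cases e3 : j' = x
    · subst e3
      obtain rfl := hn.left_unique hh'.node
      exact absurd hh' (hl _ _)
    · exact h.heavy _ _ _ _ hh' (by omega)
  · intro i' j' n e1 e2
    by_cases e3 : j' = x
    · subst e3
      obtain rfl := hn.left_unique n
      exact .inl (hin _ _ n e1 le_rfl (by omega))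
    · rcases h.inner i' j' n e1 (by omega) with e4 | ⟨i₁, j₁, p₁, q₁, hh₁, f1, f2, f3, f4, f5⟩
      · exact .inl e4
      · by_cases e5 : q₁ = x
        · subst e5
          obtain rfl := hn.left_unique hh₁.parent
          have := hh₁.facts
          exact .inl (hin _ _ n e1 (by omega) (by omega))
        · exact .inr ⟨i₁, j₁, p₁, q₁, hh₁, by omega, by omega, f3, f4, f5⟩

theorem SweepInv.reachable (h : I.SweepInv s x) {i : ℕ} (hn : IsNode I.F i x)
    (ha : ¬ I.InJump i) : I.Reachable i (startOf s i) (x + 1) := by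
  obtain ⟨h1, h2, h3⟩ := h.start i x hn ha
  have hx : ¬ I.InJump x := by rwa [← inJump_iff hn]
  have lt := hn.lt_length
  refine ⟨h1.le, by omega, lt, clean_of_not_inJump ha, h3, clean_succ hx, ?_,
    .inr ⟨hn, by omega⟩⟩
  intro i' j' n e1 e2
  by_cases e3 : j' = x
  · subst e3; exact (hn.left_unique n).le
  · have := n.left_ne_right hn
    have := hn.left_ne_right n
    by_contra hc
    have := n.nest hn (by omega) (by omega)
    omega

/-- A node inside of `[i..x]` that is still waiting is on the heavy path that ends in `i`, so it
contains the start. This is the hypothesis of `run_spec`. -/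
theorem SweepInv.inner_cases (h : I.SweepInv s x) {i : ℕ} (hn : IsNode I.F i x)
    (ha : ¬ I.InJump i) {i' j' : ℕ} (n : IsNode I.F i' j') (e1 : ¬ I.InJump i') (e2 : i ≤ i')
    (e3 : j' < x + 1) : I.GoodInner s i' ∨ i' < startOf s i ∧ startOf s i ≤ j' := by
  by_cases e4 : j' = x
  · subst e4
    obtain rfl := hn.left_unique n
    have := h.start _ _ hn ha
    exact .inr ⟨this.1, this.2.1⟩
  · refine (h.inner i' j' n e1 (by omega)).imp_right ?_
    rintro ⟨i₁, j₁, p₁, q₁, hh₁, f1, f2, f3, f4, f5, f6⟩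
    have lt := n.lt
    obtain rfl := hh₁.parent_eq hn f1 f2 e2 (by omega)
    rw [h.heavy _ _ _ _ hh₁ f1]
    exact ⟨f5, f6⟩

theorem closeNode_spec (hB : I.BoundOK B) (h : I.SweepInv s x) {i : ℕ} (hn : IsNode I.F i x)
    (ha : ¬ I.InJump i) : Halts I.orc B .closeNode s fun s' T =>
      T + 100 ≤ I.sweepCost x ∧ I.SweepInv (s'.setW 10 (x + 1)) (x + 1) ∧ s'.wvar 10 = x := by
  have hlin := hB.linear
  have lt := hn.lt
  have lt' := hn.lt_length
  have hR := h.ready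
  have hst := h.start i x hn ha
  have hcost := sweepCost_ge (I := I) x
  have hx : ¬ I.InJump x := by rwa [← inJump_iff hn]
  have e7 : s.warr 7 x = i := (hR.nodeF _ _ hn).2.2.2
  have e8 : s.warr 8 i ≤ I.F.length := by
    rcases hR.par i x hn with ⟨e, -⟩ | ⟨p, q, e, -, h1, -⟩ <;> omega
  have e11 : s.warr 11 i ≤ I.F.length := by
    have := hst.2.1
    simp only [startOf] at this
    split_ifs at this <;> omega
  refine .seq (.setW (by simp [h.v10, e7]; omega) ?_)
  rw [show (WExp.cell 7 (wv 10)).eval s = i by simp [h.v10, e7]]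
  refine .seq (.setW (by simp; omega) ?_)
  rw [show (WExp.cell 8 (wv 11)).eval (s.setW 11 i) = s.warr 8 i by simp]
  refine .seq (.setW (by simp; omega) ?_)
  rw [show (WExp.cell 11 (wv 11)).eval ((s.setW 11 i).setW 12 (s.warr 8 i)) = s.warr 11 i by simp]
  have k1 : Keeps 11 s (((s.setW 11 i).setW 12 (s.warr 8 i)).setW 13 (s.warr 11 i)) :=
    (((Keeps.refl _ _).setW (by simp)).setW (by simp)).setW (by simp)
  have g11 : (((s.setW 11 i).setW 12 (s.warr 8 i)).setW 13 (s.warr 11 i)).wvar 11 = i := by simp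
  have g12 : (((s.setW 11 i).setW 12 (s.warr 8 i)).setW 13 (s.warr 11 i)).wvar 12 =
    s.warr 8 i := by simp
  have g13 : (((s.setW 11 i).setW 12 (s.warr 8 i)).setW 13 (s.warr 11 i)).wvar 13 =
    s.warr 11 i := by simp
  have gr : (((s.setW 11 i).setW 12 (s.warr 8 i)).setW 13 (s.warr 11 i)).rarr = s.rarr := rfl
  generalize ((s.setW 11 i).setW 12 (s.warr 8 i)).setW 13 (s.warr 11 i) = t at *
  -- The rest of the program, common to both ways of finding the start: it is read from the table
  -- or, if no heavy child has stored one, it is `i + 1`.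
  have tail : ∀ t' T, T ≤ 40 → Keeps 11 s t' → t'.wvar 11 = i → t'.wvar 12 = s.warr 8 i →
      t'.wvar 13 = startOf s i → t'.rarr = s.rarr → Halts I.orc B
      (.ite .heavy (.storeW 11 (wv 12 - 1) (wv 13))
        (.setW 30 (wv 13) ;; .setW 31 (wv 13) ;; .setW 32 (wv 10 + 1) ;; .run)) t' fun s' T' =>
      T + T' + 100 ≤ I.sweepCost x ∧ I.SweepInv (s'.setW 10 (x + 1)) (x + 1) ∧
        s'.wvar 10 = x := by
    intro t' T hT k2 u11 u12 u13 ur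
    have inv : I.SweepInv t' x := h.of_keeps k2
      (fun j₀ j₁ len hj h1 => (h.powers j₀ j₁ len hj h1).of_eq
        fun _ _ _ _ => by simp only [RAMState.mat, ur]) (fun m hm => hm.keep (by rw [ur]))
    have u8 : t'.warr 8 i = s.warr 8 i := by rw [k2.warr]
    have us : startOf t' i = startOf s i := by simp only [startOf, k2.warr]
    have hiff := inv.ready.heavy_iff hn ha inv.v10 u11 (by rw [u12, u8])
    rw [u8] at hiff
    refine .ite (fun hb => ?_) fun hb => ?_
    · obtain ⟨q, hh, h1⟩ := hiff.1 hb
      refine .storeW (by simp [u12]; omega) (by simp [u13]; omega) ?_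
      rw [show (wv 12 - 1 : WExp).eval t' = s.warr 8 i - 1 by simp [u12],
        show (wv 13).eval t' = startOf t' i by simp [u13, us]]
      refine ⟨by simp [BExp.heavy]; omega, inv.close_heavy hh, by simp [inv.v10]⟩
    · have hl : I.IsLight i x := by
        refine ⟨hn, ha, fun p q hh => hb (hiff.2 ?_)⟩
        have := hh.enclosing.unique (hR.par i x hn)
        exact ⟨q, by rwa [← this, Nat.add_sub_cancel], by omega⟩
      refine .seq (.setW (by simp [u13]; omega) (.seq (.setW (by simp [u13]; omega)
        (.seq (.setW (by simp [inv.v10]; omega) ?_)))))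
      simp only [WExp.eval, WExp.eval_add, WExp.eval_ofNat, RAMState.setW_wvar, Nat.reduceEqDiff,
        if_false, if_true, u13, inv.v10]
      have k3 : Keeps 30 t' (((t'.setW 30 (startOf s i)).setW 31 (startOf s i)).setW 32 (x + 1)) :=
        (((Keeps.refl _ _).setW (by simp)).setW (by simp)).setW (by simp)
      refine (run_spec hB (inv.ready.of_keeps (k3.mono (by omega))) (us ▸ inv.reachable hn ha)
        (by simp) (by simp) (by simp) ?_ ?_).mono ?_
      · intro j₀ j₁ len hj h1 h2
        refine (inv.powers _ _ _ hj ?_).of_eq fun _ _ _ _ => rfl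
        by_contra hc
        have := hj.facts
        have := I.one_le
        exact hx ⟨_, _, _, hj, by omega, by omega⟩
      · intro i' j' n e1 e2 e3
        rw [← us]
        exact inv.inner_cases hn ha n e1 e2 e3
      · rintro s' T' ⟨p1, p2, p3, p4, p5, p6⟩
        have k4 : Keeps 11 t' s' := (k3.trans p2).mono (by omega)
        have inv' : I.SweepInv s' x := inv.of_keeps k4
          (fun j₀ j₁ len hj h1 => (inv.powers j₀ j₁ len hj h1).of_eq
            fun a b ha hb => p6 _ a b (by omega) ha hb) p4
        refine ⟨?_, inv'.close_light hl p5, inv'.v10⟩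
        have hc := hl.sweepCost_ge
        simp only [nodeWt] at hc
        simp [BExp.heavy]
        omega
  refine .seq (.ite (fun hb => .skip ?_) fun hb => .setW (by simp [g11]; omega) ?_)
  · simp [g13] at hb
    refine (tail t 40 le_rfl k1 g11 g12 ?_ gr).mono ?_
    · rw [g13, startOf, if_pos hb]
    · rintro s' T ⟨h1, h2⟩
      refine ⟨?_, h2⟩
      simp at h1 ⊢
      omega
  · simp [g13] at hb
    simp only [WExp.eval, WExp.eval_add, WExp.eval_ofNat, g11]
    refine (tail (t.setW 13 (i + 1)) 40 le_rfl (k1.setW (by simp)) (by simp [g11]) (by simp [g12])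
      ?_ gr).mono ?_
    · simp [startOf, hb]
    · rintro s' T ⟨h1, h2⟩
      refine ⟨?_, h2⟩
      simp at h1 ⊢
      omega

theorem sweepStep_spec (hB : I.BoundOK B) (h : I.SweepInv s x) (hx : x < I.F.length) :
    Halts I.orc B .sweepStep s fun s' T => ∃ y, x < y ∧ I.SweepInv s' y ∧
      T + 10 ≤ I.sweepCost x := by
  have hlin := hB.linear
  have hR := h.ready
  have hcost := sweepCost_ge (I := I) x
  refine .ite (fun hb => ?_) fun hb => ?_
  · simp [h.v10] at hb
    obtain ⟨j₁, len, hj⟩ : ∃ j₁ len, I.Jump x j₁ len := by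
      by_contra hc
      push Not at hc
      have := hR.no_jump x hc
      omega
    have hf := hj.facts
    have hk := I.one_le
    refine .seq ((power_spec hB hR hj h.v10 ?_).mono ?_)
    · intro i j n e1 e2
      have lt := n.lt
      rcases h.inner i j n (hj.not_inJump_period e1 (by omega)) e2 with
        e3 | ⟨i', j', p, q, hh, f1, f2, f3, f4, -⟩
      · exact e3
      · exfalso
        have := hj.closed_period hh.node
        exact hj.not_heavy hh (by omega) f1 f2
    · rintro s₁ T ⟨t1, k1, m1, g1, d1⟩
      have e9 : (WExp.cell 9 (wv 10)).eval s₁ = j₁ := by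
        simp [k1.wvar 10 (by omega), k1.warr, h.v10, (hR.jump _ _ _ hj).1]
      have inv : I.SweepInv s₁ x := h.of_keeps (k1.mono (by omega)) (fun j₀' j₁' len' hj' h1 =>
        (h.powers _ _ _ hj' h1).of_eq fun a b ha hb => by
          have := hj'.facts
          exact d1 _ a b (by omega) (by omega) (by omega) ha hb) g1
      refine .setW (by rw [e9]; omega) ⟨j₁, by omega, ?_, ?_⟩
      · rw [e9]
        refine inv.advance (by omega) (by omega) hj.clean_end ?_ ?_
        · intro j₀' j₁' len' hj' h1 h2
          have hf' := hj'.facts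
          obtain ⟨rfl, rfl, -⟩ := hj'.unique hj (by omega) (by omega)
          exact m1
        · intro i j n e1 e2
          have := (hj.closed_jump n).2 ⟨e1, e2⟩
          exact ⟨this.1, _, _, _, hj, this⟩
      · have := hj.sweepCost_ge
        simp
        omega
  · simp [h.v10] at hb
    have hna : ¬ I.InJump x := by
      refine h.clean.not_inJump fun j₁ len hj => ?_
      have := (hR.jump _ _ _ hj).1
      have := hj.facts
      have := I.one_le
      omega
    refine .seq (.ite (fun hb' => ?_) fun hb' => .skip ?_)
    · simp [h.v10] at hb'
      have hn := hR.node_of_close hx (by omega)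
      refine (closeNode_spec hB h hn (by rwa [inJump_iff hn])).mono ?_
      rintro s₁ T ⟨t1, h1, h2⟩
      refine .setW (by simp [h2]; omega) ⟨x + 1, by omega, ?_, ?_⟩
      · rwa [show (wv 10 + 1 : WExp).eval s₁ = x + 1 by simp [h2]]
      · simp
        omega
    · simp [h.v10] at hb'
      refine .setW (by simp [h.v10]; omega) ⟨x + 1, by omega, ?_, ?_⟩
      · rw [show (wv 10 + 1 : WExp).eval s = x + 1 by simp [h.v10]]
        refine h.advance (by omega) hx (clean_succ hna) ?_ ?_
        · intro j₀ j₁ len hj h1 h2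
          have := hj.facts
          have := I.one_le
          exact absurd ⟨_, _, _, hj, by omega, by omega⟩ hna
        · intro i j n e1 e2
          obtain rfl : j = x := by omega
          have := (hR.nodeF _ _ n).2.1
          omega
      · simp
        omega

theorem sweep_spec (hB : I.BoundOK B) (hR : I.Ready s) (h11 : ∀ i, s.warr 11 i = 0) :
    Halts I.orc B .sweep s fun s' T =>
      T ≤ 2000 * ((4 * I.k + 1) * (4 * I.k + 1) * (I.prefixWt I.F.length + 1)) +
        (∑ y ∈ Finset.range I.F.length, I.sweepCost y) + 100 ∧
        I.GoodMat s' I.F.length 0 I.F.length ∧ I.Ready s' := by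
  have hlin := hB.linear
  have inv0 : I.SweepInv (s.setW 10 0) 0 :=
    { ready := hR.of_keeps ((Keeps.refl _ _).setW le_rfl)
      v10 := by simp
      le := by omega
      clean := clean_zero
      powers := by
        intro j₀ j₁ len hj h
        have := hj.facts
        have := I.one_le
        omega
      start := by
        intro i j n ha
        have := n.lt
        simp only [startOf, RAMState.setW_warr, h11]
        exact ⟨by simp, by simpa using n.lt, by simpa using clean_succ ha⟩
      heavy := by omega
      inner := by omega }
  refine .seq (.setW (by simp) (.seq ?_))
  rw [WExp.eval_ofNat]
  refine (Halts.while (fun s' => ∃ x, I.SweepInv s' x)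
    (fun s' => ∑ y ∈ Finset.Ico (s'.wvar 10) I.F.length, I.sweepCost y) ⟨0, inv0⟩ ?_).mono ?_
  · rintro s₁ ⟨x, h⟩ hb
    simp [h.v10, h.ready.v0] at hb
    refine (sweepStep_spec hB h hb).mono ?_
    rintro s₂ T ⟨y, hxy, h', hT⟩
    refine ⟨⟨y, h'⟩, ?_⟩
    rw [h.v10, h'.v10, Finset.sum_eq_sum_Ico_succ_bot hb]
    have := Finset.sum_le_sum_of_subset (f := I.sweepCost)
      (Finset.Ico_subset_Ico_left hxy : Finset.Ico y I.F.length ⊆ Finset.Ico (x + 1) I.F.length)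
    simp
    omega
  · rintro s₁ T ⟨⟨x, h⟩, hb, hT⟩
    simp [h.v10, h.ready.v0] at hb
    obtain rfl : x = I.F.length := by have := h.le; omega
    refine .seq (.setW (by simp) (.seq (.setW (by simp) (.seq (.setW
      (by simp [h.ready.v0]; omega) ?_)))))
    simp only [WExp.eval, WExp.eval_ofNat, RAMState.setW_wvar, Nat.reduceEqDiff, if_false,
      OfNat.zero_ne_ofNat, h.ready.v0]
    have k1 : Keeps 30 s₁ (((s₁.setW 30 0).setW 31 0).setW 32 I.F.length) :=
      (((Keeps.refl _ _).setW (by simp)).setW (by simp)).setW (by simp)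
    have hG : I.Reachable 0 0 I.F.length :=
      ⟨le_rfl, by omega, le_rfl, clean_zero, clean_zero, clean_length, by omega, .inl rfl⟩
    refine (run_spec hB (h.ready.of_keeps (k1.mono (by omega))) hG (by simp) (by simp) (by simp)
      ?_ ?_).mono ?_
    · intro j₀ j₁ len hj h1 h2
      exact (h.powers _ _ _ hj h2).of_eq fun _ _ _ _ => rfl
    · intro i j n e1 e2 e3
      refine .inl ?_
      -- A waiting node would have an ancestor that closes at or after the end of F, so at the end
      -- nothing is waiting and the last run may start at 0.
      rcases h.inner i j n e1 e3 with e4 | ⟨i', j', p, q, hh, f1, f2, -⟩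
      · exact e4.keep rfl
      · have := hh.parent.lt_length
        omega
    · rintro s₂ T₂ ⟨t2, k2, m2, -⟩
      refine ⟨?_, m2, h.ready.of_keeps ((k1.trans k2).mono (by omega))⟩
      rw [h.v10, Finset.Ico_self, Finset.sum_empty, RAMState.setW_wvar, if_pos rfl,
        ← Finset.range_eq_Ico] at hT
      have : I.prefixWt 0 = 0 := by simp [prefixWt]
      rw [this, Nat.sub_zero] at t2
      simp at hT ⊢
      omega

end TedInput


/-! ### Preprocessing -/

/-- Computes the mates and the parents of the positions of `F · G`. -/
def Cmd.mates : Cmd := .setW 21 0 ;; .forLoop 20 (wv 4)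
  (.ite (.weq (.cell 0 (wv 20)) 1)
    (.setW 22 (wv 21 - 1) ;; .storeW 7 (wv 20) (wv 22) ;; .storeW 7 (wv 22) (wv 20) ;;
      .setW 21 (.cell 8 (wv 22)))
    (.storeW 8 (wv 20) (wv 21) ;; .setW 21 (wv 20 + 1)))

/-- Computes the tables of the jumps. -/
def Cmd.jumps : Cmd := .forLoop 20 (wv 3)
  (.ite (.wle 2 (.cell 6 (wv 20)))
    (.setW 21 (.cell 1 (wv 20) + .cell 5 (wv 20)) ;; .storeW 9 (wv 21) (.cell 2 (wv 20)) ;;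
      .storeW 10 (wv 21) (.cell 5 (wv 20)) ;; .storeW 12 (.cell 2 (wv 20)) (wv 21)) .skip)

/-- Computes the weights of the prefixes. -/
def Cmd.prefixes : Cmd := .setW 20 0 ;; .while (.wlt (wv 20) (wv 0))
  (.ite (.wle 1 (.cell 9 (wv 20)))
    (.storeW 13 (.cell 9 (wv 20)) (.cell 13 (wv 20) + .cell 10 (wv 20)) ;;
      .setW 20 (.cell 9 (wv 20)))
    (.storeW 13 (wv 20 + 1) (.cell 13 (wv 20) + 1) ;; .setW 20 (wv 20 + 1)))

/-- Computes the tables that the algorithm uses. -/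
def Cmd.preprocess : Cmd := .setW 4 (wv 0 + wv 1) ;; .setW 5 (4 * wv 2 + 1) ;;
  .setW 6 (wv 0 + 1) ;; .setR 1 (.cast (wv 2 + 1)) ;; .mates ;; .jumps ;; .prefixes

/-- The state `s'` agrees with `s` in the word variables below `20`, in the real variables, and in
the word arrays that are not in `D`. -/
structure KeepsOff (D : List ℕ) (s s' : RAMState) : Prop where
  wvar : ∀ x < 20, s'.wvar x = s.wvar x
  rvar : s'.rvar = s.rvar
  warr : ∀ c ∉ D, s'.warr c = s.warr c

theorem KeepsOff.refl (D : List ℕ) (s : RAMState) : KeepsOff D s s :=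
  ⟨fun _ _ => rfl, rfl, fun _ _ => rfl⟩

theorem KeepsOff.setW {D : List ℕ} {s s' : RAMState} (h : KeepsOff D s s') {x v : ℕ}
    (hx : 20 ≤ x) : KeepsOff D s (s'.setW x v) :=
  ⟨fun y hy => by rw [RAMState.setW_wvar, if_neg (by omega), h.wvar y hy], h.rvar, h.warr⟩

theorem KeepsOff.storeW {D : List ℕ} {s s' : RAMState} (h : KeepsOff D s s') {a i v : ℕ}
    (ha : a ∈ D) : KeepsOff D s (s'.storeW a i v) := by
  refine ⟨h.wvar, h.rvar, fun c hc => ?_⟩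
  rw [← h.warr c hc]
  ext j
  rw [RAMState.storeW_warr, if_neg]
  rintro ⟨rfl, -⟩
  exact hc ha

theorem isEnclosing_zero {α : Type*} {F : List (Paren α)} : IsEnclosing F 0 0 :=
  .inl ⟨rfl, by omega⟩

theorem IsNode.isEnclosing_succ {α : Type*} {F : List (Paren α)} {i j : ℕ} (h : IsNode F i j) :
    IsEnclosing F (i + 1) (i + 1) :=
  .inr ⟨i, j, rfl, h, by omega, h.lt, by omega⟩

theorem IsNode.isEnclosing_right {α : Type*} {F : List (Paren α)} {i j : ℕ} (h : IsNode F i j) :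
    IsEnclosing F j (i + 1) := by
  refine .inr ⟨i, j, rfl, h, h.lt, le_rfl, fun i' j' h' h1 h2 => ?_⟩
  by_contra hc
  have := h.nest h' (by omega) (by omega)
  omega

/-- The boundaries just before and just after a node are enclosed by the same nodes, so closing a
node restores the innermost open node from before it. -/
theorem IsEnclosing.of_left {α : Type*} {F : List (Paren α)} {i j v : ℕ} (h : IsNode F i j)
    (hv : IsEnclosing F i v) : IsEnclosing F (j + 1) v := by
  have key : ∀ i' j', IsNode F i' j' → (i' < j + 1 ∧ j + 1 ≤ j' ↔ i' < i ∧ i ≤ j') := by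
    intro i' j' h'
    have lt := h.lt
    have e1 := h.left_ne_right h'
    have e2 := h'.left_ne_right h
    constructor
    · rintro ⟨h1, h2⟩
      refine ⟨?_, by omega⟩
      by_contra hc
      rcases (not_lt.1 hc).eq_or_lt with rfl | e
      · have := h.right_unique h'; omega
      · have := h.nest h' e (by omega); omega
    · rintro ⟨h1, h2⟩
      have := h'.nest h h1 (by omega)
      omega
  rcases hv with ⟨rfl, hv⟩ | ⟨i', j', rfl, h', h1, h2, h3⟩
  · refine .inl ⟨rfl, fun i' j' h' hc => hv i' j' h' ((key i' j' h').1 hc)⟩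
  · have := (key i' j' h').2 ⟨h1, h2⟩
    refine .inr ⟨i', j', rfl, h', this.1, this.2, fun i'' j'' h'' e1 e2 => ?_⟩
    have := (key i'' j'' h'').1 ⟨e1, e2⟩
    exact h3 i'' j'' h'' this.1 this.2

theorem IsNode.kind_left {α : Type*} {F : List (Paren α)} {i j : ℕ} (h : IsNode F i j) :
    (F[i]?.map Paren.kind).getD 0 = 0 := by
  obtain ⟨a, ha⟩ := h.2.1
  simp [ha, Paren.kind]

theorem IsNode.kind_right {α : Type*} {F : List (Paren α)} {i j : ℕ} (h : IsNode F i j) :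
    (F[j]?.map Paren.kind).getD 0 = 1 := by
  obtain ⟨a, ha⟩ := h.2.2.1
  simp [ha, Paren.kind]

/-- The table of parents doubles as the stack: word variable `21` points to the innermost open node,
and closing that node replaces the pointer by the stored parent. Pointers are shifted by one so that
0 means that no node is open. -/
theorem mates_spec {α : Type*} {H : List (Paren α)} (hH : BalancedStr H) {orc : ℕ → ℕ → ℝ} {B : ℕ}
    {s : RAMState} (hB : H.length ≤ B) (h4 : s.wvar 4 = H.length)
    (h0 : s.warr 0 = fun i => (H[i]?.map Paren.kind).getD 0) (h7 : s.warr 7 = fun _ => 0) :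
    Halts orc B .mates s fun s' T => T ≤ 100 * (H.length + 1) ∧ KeepsOff [7, 8] s s' ∧
      (∀ x, s'.warr 7 x ≤ H.length) ∧
      ∀ i j, IsNode H i j → s'.warr 7 i = j ∧ s'.warr 7 j = i ∧ IsEnclosing H i (s'.warr 8 i) := by
  refine .seq (.setW (by simp) (Halts.forLoop (N := H.length) (fun x s' => KeepsOff [7, 8] s s' ∧
    s'.wvar 20 = x ∧ (∀ y, s'.warr 7 y ≤ H.length) ∧ IsEnclosing H x (s'.wvar 21) ∧
    (∀ i j, IsNode H i j → i < x → IsEnclosing H i (s'.warr 8 i)) ∧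
    (∀ i j, IsNode H i j → j < x → s'.warr 7 i = j ∧ s'.warr 7 j = i)) 60 hB ?_ ?_ ?_ ?_ ?_))
  · refine ⟨((KeepsOff.refl _ _).setW (by simp)).setW (by simp), by simp, by simp [h7],
      by simpa using isEnclosing_zero, by omega, by omega⟩
  · rintro x s' ⟨h, -⟩
    simp [h.wvar, h4]
  · rintro x s' - ⟨-, h, -⟩
    exact h
  · rintro x s' hx ⟨k, h20, hle, henc, hpar, hmate⟩ -
    have k0 : ∀ y, s'.warr 0 y = (H[y]?.map Paren.kind).getD 0 := by
      intro y; rw [k.warr 0 (by simp), h0]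
    obtain ⟨y, hn | hn⟩ := hH.exists_node x hx
    · refine .ite (fun hb => ?_) fun hb => ?_
      · simp [h20, k0, hn.kind_left] at hb
      have hv : s'.wvar 21 ≤ H.length := by
        rcases henc with ⟨e, -⟩ | ⟨i, j, e, h, h1, -⟩ <;> omega
      refine .seq (.storeW (by simp [h20]; omega) (by simp; omega) (.setW (by simp [h20]; omega) ?_))
      simp only [WExp.eval, WExp.eval_add, WExp.eval_ofNat, RAMState.storeW_wvar, h20]
      refine ⟨by simp [h20], by simp, ?_, by simp, by simpa using hle, ?_, ?_, ?_⟩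
      · exact ((k.storeW (by simp)).setW (by simp)).setW (by simp)
      · simpa using hn.isEnclosing_succ
      · intro i j h h1
        by_cases e : i = x
        · subst e; simpa using henc
        · simpa [e] using hpar i j h (by omega)
      · intro i j h h1
        have := hn.left_ne_right h
        simpa using hmate i j h (by omega)
    · have hvy := henc.unique hn.isEnclosing_right
      have lt := hn.lt
      refine .ite (fun hb => ?_) fun hb => ?_
      swap
      · simp [h20, k0, hn.kind_right] at hb
      have hv : s'.warr 8 y ≤ H.length := by
        rcases hpar y x hn lt with ⟨e, -⟩ | ⟨i, j, e, h, h1, -⟩ <;> omega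
      refine .seq (.setW (by simp [hvy]; omega) (.seq (.storeW (by simp [h20]; omega)
        (by simp [hvy]; omega) (.seq (.storeW (by simp [hvy]; omega) (by simp [h20]; omega)
        (.setW (by simp [hvy]; omega) ?_))))))
      simp only [WExp.eval, WExp.eval_sub, WExp.eval_ofNat, RAMState.storeW_wvar,
        RAMState.setW_wvar, Nat.reduceEqDiff, if_true, if_false, h20, hvy, Nat.add_sub_cancel]
      refine ⟨by simp [h20], by simp, ?_, by simp, ?_, ?_, ?_, ?_⟩
      · exact ((((k.setW (by simp)).storeW (by simp)).storeW (by simp)).setW (by simp)).setW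
          (by simp)
      · intro z
        simp
        split_ifs
        · omega
        · omega
        · exact hle z
      · simpa using (hpar y x hn lt).of_left hn
      · intro i j h h1
        have : i ≠ x := h.left_ne_right hn
        simpa using hpar i j h (by omega)
      · intro i j h h1
        have e1 := h.left_ne_right hn
        have e2 := hn.left_ne_right h
        have e3 := h.lt
        by_cases e : j = x
        · subst e
          obtain rfl := h.left_unique hn
          simp
        · have e4 : i ≠ y := by
            rintro rfl
            exact e (h.right_unique hn)
          have := hmate i j h (by omega)
          simp [e1, e, e4, Ne.symm e2]
          exact this
  · rintro s' T ⟨k, -, hle, -, hpar, hmate⟩ hT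
    refine ⟨?_, k, hle, fun i j h => ?_⟩
    · simp at hT ⊢
      omega
    · have := h.lt_length
      have := h.lt
      exact ⟨(hmate i j h (by omega)).1, (hmate i j h (by omega)).2, hpar i j h (by omega)⟩

/-! ### Tables of the jumps and of the weights of prefixes -/

namespace TedInput

variable {α : Type*} {I : TedInput α} {B : ℕ} {s s' : RAMState}

/-- Disjoint nonempty blocks start at different positions of F. Hence reading the list of blocks
takes O(n) time. -/
theorem length_blocks_le : I.L.length ≤ I.F.length := by
  have hnd : (I.L.map Block.pF).Nodup := by
    rw [List.nodup_map_iff_inj_on]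
    · intro b hb c hc h
      have hk := I.one_le
      obtain ⟨h1, -, -, -, -, -, h2, -, -, -, h3, -⟩ := block_facts hb
      obtain ⟨h1', -, -, -, -, -, h2', -, -, -, h3', -⟩ := block_facts hc
      have g1 : 0 < b.exp * b.len := Nat.mul_pos (by omega) (by omega)
      have g2 : 0 < c.exp * c.len := Nat.mul_pos (by omega) (by omega)
      exact block_disjoint hb hc (by omega) (by omega)
    · refine I.disj.imp_of_mem ?_
      rintro b c hb hc h rfl
      have hk := I.one_le
      obtain ⟨h1, -, -, -, -, -, h2, -, -, -, h3, -⟩ := block_facts hb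
      have g1 : 0 < b.exp * b.len := Nat.mul_pos (by omega) (by omega)
      rw [Block.DisjointF, Finset.disjoint_self_iff_empty, Finset.Ico_eq_empty_iff] at h
      omega
  have hsub : (I.L.map Block.pF).toFinset ⊆ Finset.range I.F.length := by
    intro x hx
    simp only [List.mem_toFinset, List.mem_map] at hx
    obtain ⟨b, hb, rfl⟩ := hx
    have hk := I.one_le
    obtain ⟨h1, h4, h5, h6, -, -, h2, -, -, -, h3, -⟩ := block_facts hb
    have g1 : 0 < b.exp * b.len := Nat.mul_pos (by omega) (by omega)
    rw [Finset.mem_range]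
    omega
  have := Finset.card_le_card hsub
  rwa [List.toFinset_card_of_nodup hnd, List.length_map, Finset.card_range] at this

theorem jumps_spec (hB : I.BoundOK B) (h3 : s.wvar 3 = I.L.length)
    (h1 : s.warr 1 = fun i => (I.L[i]?.map Block.pF).getD 0)
    (h2 : s.warr 2 = fun i => (I.L[i]?.map Block.qF).getD 0)
    (h5 : s.warr 5 = fun i => (I.L[i]?.map Block.len).getD 0)
    (h6 : s.warr 6 = fun i => (I.L[i]?.map Block.exp).getD 0)
    (h9 : s.warr 9 = fun _ => 0) (h12 : s.warr 12 = fun _ => 0) :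
    Halts I.orc B .jumps s fun s' T => T ≤ 100 * (I.F.length + 1) ∧ KeepsOff [9, 10, 12] s s' ∧
      (∀ j₀ j₁ len, I.Jump j₀ j₁ len →
        s'.warr 9 j₀ = j₁ ∧ s'.warr 10 j₀ = len ∧ s'.warr 12 j₁ = j₀) ∧
      (∀ x, (∀ j₁ len, ¬ I.Jump x j₁ len) → s'.warr 9 x = 0) ∧
      (∀ x, (∀ j₀ len, ¬ I.Jump j₀ x len) → s'.warr 12 x = 0) := by
  have hlin := hB.linear
  have hL := I.length_blocks_le
  refine Halts.forLoop (N := I.L.length) (fun q s' => KeepsOff [9, 10, 12] s s' ∧ s'.wvar 20 = q ∧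
    (∀ p < q, ∀ b, I.L[p]? = some b → 2 ≤ b.exp → s'.warr 9 (b.pF + b.len) = b.qF ∧
      s'.warr 10 (b.pF + b.len) = b.len ∧ s'.warr 12 b.qF = b.pF + b.len) ∧
    (∀ x, (∀ j₁ len, ¬ I.Jump x j₁ len) → s'.warr 9 x = 0) ∧
    (∀ x, (∀ j₀ len, ¬ I.Jump j₀ x len) → s'.warr 12 x = 0)) 60 (by omega) ?_ ?_ ?_ ?_ ?_
  · exact ⟨(KeepsOff.refl _ _).setW (by simp), by simp, by omega, by simp [h9], by simp [h12]⟩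
  · rintro q s' ⟨h, -⟩
    simp [h.wvar, h3]
  · rintro q s' - ⟨-, h, -⟩
    exact h
  · rintro q s' hq ⟨k, h20, hd, hn, hn'⟩ -
    obtain ⟨b, hb⟩ : ∃ b, I.L[q]? = some b := ⟨_, List.getElem?_eq_getElem hq⟩
    have hbL : b ∈ I.L := List.mem_of_getElem? hb
    have a1 : s'.warr 1 q = b.pF := by rw [k.warr 1 (by simp), h1]; simp [hb]
    have a2 : s'.warr 2 q = b.qF := by rw [k.warr 2 (by simp), h2]; simp [hb]
    have a5 : s'.warr 5 q = b.len := by rw [k.warr 5 (by simp), h5]; simp [hb]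
    have a6 : s'.warr 6 q = b.exp := by rw [k.warr 6 (by simp), h6]; simp [hb]
    refine .ite (fun hc => ?_) fun hc => .skip ?_
    · simp [h20, a6] at hc
      have hj : I.Jump (b.pF + b.len) b.qF b.len := ⟨b, hbL, hc, rfl, rfl, rfl⟩
      have hf := hj.facts
      refine .seq (.setW (by simp [h20, a1, a5]; omega) (.seq (.storeW
        (by simp [h20, a1, a5]; omega) (by simp [h20, a2]; omega) (.seq (.storeW
        (by simp [h20, a1, a5]; omega) (by simp [h20, a5]; omega) (.storeW
        (by simp [h20, a2]; omega) (by simp [h20, a1, a5]; omega) ?_))))))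
      simp only [WExp.eval, WExp.eval_add, RAMState.storeW_wvar, RAMState.setW_wvar,
        RAMState.storeW_warr, RAMState.setW_warr, Nat.reduceEqDiff, if_true, if_false, h20, a1, a2,
        a5, false_and, OfNat.ofNat_eq_ofNat]
      refine ⟨by simp [h20], by simp, ?_, by simp, ?_, ?_, ?_⟩
      · exact ((((k.setW (by simp)).storeW (by simp)).storeW (by simp)).storeW (by simp)).setW
          (by simp)
      · intro p hp c hc' he
        have hcL : c ∈ I.L := List.mem_of_getElem? hc'
        have hjc : I.Jump (c.pF + c.len) c.qF c.len := ⟨c, hcL, he, rfl, rfl, rfl⟩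
        have hfc := hjc.facts
        have hk := I.one_le
        by_cases hbc : c = b
        · subst hbc
          simp
        · have hne : ¬ (c.pF < b.qF ∧ b.pF < c.qF) := fun h => hbc (block_disjoint hcL hbL h.1 h.2)
          have hpq : p ≠ q := by rintro rfl; rw [hb] at hc'; simp at hc'; exact hbc hc'.symm
          have e1 : c.pF + c.len ≠ b.pF + b.len := by omega
          have e2 : c.qF ≠ b.qF := by omega
          simp [e1, e2]
          exact hd p (by omega) c hc' he
      · intro x hx
        have : x ≠ b.pF + b.len := by rintro rfl; exact hx _ _ hj
        simpa [this] using hn x hx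
      · intro x hx
        have : x ≠ b.qF := by rintro rfl; exact hx _ _ hj
        simpa [this] using hn' x hx
    · simp [h20, a6] at hc
      refine ⟨h20, by simp, k.setW (by simp), by simp, ?_, hn, hn'⟩
      intro p hp c hc' he
      by_cases hpq : p = q
      · subst hpq; rw [hb] at hc'; simp at hc'; subst hc'; omega
      · exact hd p (by omega) c hc' he
  · rintro s' T ⟨k, -, hd, hn, hn'⟩ hT
    refine ⟨?_, k, ?_, hn, hn'⟩
    · simp at hT ⊢
      omega
    · rintro j₀ j₁ len ⟨b, hb, he, rfl, rfl, rfl⟩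
      obtain ⟨p, hp, rfl⟩ := List.getElem_of_mem hb
      exact hd p hp _ (List.getElem?_eq_getElem hp) he

/-- The loop crosses each jump in one step, so the table is filled at clean boundaries only; the
algorithm reads it nowhere else. -/
theorem prefixes_spec (hB : I.BoundOK B) (h0 : s.wvar 0 = I.F.length)
    (hjump : ∀ j₀ j₁ len, I.Jump j₀ j₁ len → s.warr 9 j₀ = j₁ ∧ s.warr 10 j₀ = len)
    (hno : ∀ x, (∀ j₁ len, ¬ I.Jump x j₁ len) → s.warr 9 x = 0) (h13 : s.warr 13 = fun _ => 0) :
    Halts I.orc B .prefixes s fun s' T => T ≤ 100 * (I.F.length + 1) ∧ KeepsOff [13] s s' ∧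
      ∀ x ≤ I.F.length, I.Clean x → s'.warr 13 x = I.prefixWt x := by
  have hlin := hB.linear
  have hsq : I.F.length * I.F.length ≤ B := by
    refine le_trans ?_ hB
    have : I.F.length * I.F.length ≤ (I.F.length + I.G.length + I.k + 2) ^ 2 := by
      rw [sq]; exact Nat.mul_le_mul (by omega) (by omega)
    exact this.trans (Nat.pow_le_pow_right (by omega) (by omega))
  refine .seq (.setW (by simp) ?_)
  rw [WExp.eval_ofNat]
  refine (Halts.while (fun s' => KeepsOff [13] s s' ∧ s'.wvar 20 ≤ I.F.length ∧
    I.Clean (s'.wvar 20) ∧ ∀ x ≤ s'.wvar 20, I.Clean x → s'.warr 13 x = I.prefixWt x)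
    (fun s' => 60 * (I.F.length - s'.wvar 20)) ⟨(KeepsOff.refl _ _).setW (by simp), by simp,
      by simpa using clean_zero, ?_⟩ ?_).mono ?_
  · intro x hx _
    obtain rfl : x = 0 := by simpa using hx
    simp [h13, prefixWt]
  · rintro s' ⟨k, hle, hcl, hpre⟩ hb
    have e0 : s'.wvar 0 = I.F.length := by rw [k.wvar _ (by omega), h0]
    have e9 : s'.warr 9 = s.warr 9 := k.warr _ (by simp)
    have e10 : s'.warr 10 = s.warr 10 := k.warr _ (by simp)
    simp [e0] at hb
    have hx := hpre _ le_rfl hcl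
    generalize h20 : s'.wvar 20 = x at *
    refine .ite (fun hc => ?_) fun hc => ?_
    · simp [h20, e9] at hc
      obtain ⟨j₁, len, hj⟩ : ∃ j₁ len, I.Jump x j₁ len := by
        by_contra hc'
        push Not at hc'
        have := hno x hc'
        omega
      have hf := hj.facts
      have hk := I.one_le
      obtain ⟨a9, a10⟩ := hjump _ _ _ hj
      have hw := hj.prefixWt
      have hle' := prefixWt_le (I := I) (by omega : j₁ ≤ I.F.length)
      refine .seq (.storeW (by simp [h20, e9, a9]; omega) (by simp [h20, e10, a10, hx]; omega)
        (.setW (by simp [h20, e9, a9]; omega) ?_))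
      simp only [WExp.eval, WExp.eval_add, RAMState.storeW_wvar, RAMState.storeW_warr,
        Nat.reduceEqDiff, if_false, false_and, h20, e9, e10, a9, a10, hx]
      refine ⟨⟨(k.storeW (by simp)).setW (by simp), by simp; omega, by simpa using hj.clean_end,
        ?_⟩, ?_⟩
      · intro y hy hyc
        simp at hy ⊢
        split_ifs with e
        · rw [e, hw]
        · have := hyc.jump_le hj
          exact hpre y (by omega) hyc
      · simp
        omega
    · simp [h20, e9] at hc
      have hna : ¬ I.InJump x := by
        refine hcl.not_inJump fun j₁ len hj => ?_
        have := (hjump _ _ _ hj).1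
        have := hj.facts
        have := I.one_le
        omega
      have hw := prefixWt_succ hna
      have hle' := prefixWt_le (I := I) (by omega : x + 1 ≤ I.F.length)
      refine .seq (.storeW (by simp [h20]; omega) (by simp [h20, hx]; omega)
        (.setW (by simp [h20]; omega) ?_))
      simp only [WExp.eval, WExp.eval_add, WExp.eval_ofNat, RAMState.storeW_wvar, h20, hx]
      refine ⟨⟨(k.storeW (by simp)).setW (by simp), by simp; omega, by simpa using clean_succ hna,
        ?_⟩, ?_⟩
      · intro y hy hyc
        simp at hy ⊢
        split_ifs with e
        · rw [e, hw]
        · exact hpre y (by omega) hyc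
      · simp
        omega
  · rintro s' T ⟨⟨k, hle, hcl, hpre⟩, hb, hT⟩
    have e0 : s'.wvar 0 = I.F.length := by rw [k.wvar _ (by omega), h0]
    simp [e0] at hb
    refine ⟨?_, k, fun x hx => hpre x (by omega)⟩
    simp at hT ⊢
    omega

end TedInput


/-! ### The algorithm -/

/-- The cost of inserting all characters, if the first forest is empty. -/
def Cmd.insertAll : Cmd := .setW 4 (wv 0 + wv 1) ;;
  .forLoop 20 (wv 1) (.setR 0 (.var 0 + .half (.query (wv 4) (wv 20))))

/-- The algorithm. -/
def Cmd.ted : Cmd :=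
  .ite (.and (.wle (wv 1) (wv 0 + 2 * wv 2)) (.wle (wv 0) (wv 1 + 2 * wv 2)))
    (.ite (.wle 1 (wv 0))
      (.preprocess ;; .sweep ;;
        .setR 0 (.cell 0 (.entry (wv 0) (2 * wv 2) (wv 1 + 2 * wv 2 - wv 0))))
      .insertAll ;;
      .ite (.rle (.var 0) (.cast (wv 2))) (.setW 0 1) (.setW 0 0))
    (.setW 0 0)

theorem isNode_append_cases {α : Type*} {F G : List (Paren α)} (hF : BalancedStr F) {i j : ℕ}
    (h : IsNode (F ++ G) i j) (hi : i < F.length) : IsNode F i j := by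
  obtain ⟨y, hy | hy⟩ := hF.exists_node i hi
  · have := h.right_unique ((isNode_append_left hy.lt_length).2 hy)
    subst this
    exact hy
  · exact absurd rfl (h.left_ne_right ((isNode_append_left hi).2 hy))

/-- Mates and parents are computed in one pass over F · G. At a position of F the innermost
enclosing node belongs to F. -/
theorem IsEnclosing.of_append {α : Type*} {F G : List (Paren α)} (hF : BalancedStr F) {x v : ℕ}
    (hx : x < F.length) (h : IsEnclosing (F ++ G) x v) : IsEnclosing F x v := by
  have lift : ∀ {i j}, IsNode F i j → IsNode (F ++ G) i j :=
    fun hn => (isNode_append_left hn.lt_length).2 hn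
  rcases h with ⟨rfl, h⟩ | ⟨i, j, rfl, hn, h1, h2, h3⟩
  · exact .inl ⟨rfl, fun i j hn => h i j (lift hn)⟩
  · exact .inr ⟨i, j, rfl, isNode_append_cases hF hn (by omega), h1, h2,
      fun i' j' hn' => h3 i' j' (lift hn')⟩

namespace TedInput

variable {α : Type*} {I : TedInput α} {B : ℕ}

theorem preprocess_spec (hB : I.BoundOK B) :
    Halts I.orc B .preprocess (initState I.F I.G I.k I.L) fun s' T =>
      T ≤ 400 * (I.F.length + I.G.length + 1) ∧ I.Ready s' ∧ ∀ i, s'.warr 11 i = 0 := by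
  have hlin := hB.linear
  set s := initState I.F I.G I.k I.L with hs
  have v0 : s.wvar 0 = I.F.length := rfl
  have v1 : s.wvar 1 = I.G.length := rfl
  have v2 : s.wvar 2 = I.k := rfl
  have v3 : s.wvar 3 = I.L.length := rfl
  have w0 : s.warr 0 = fun i => ((I.F ++ I.G)[i]?.map Paren.kind).getD 0 := rfl
  have w1 : s.warr 1 = fun i => (I.L[i]?.map Block.pF).getD 0 := rfl
  have w2 : s.warr 2 = fun i => (I.L[i]?.map Block.qF).getD 0 := rfl
  have w5 : s.warr 5 = fun i => (I.L[i]?.map Block.len).getD 0 := rfl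
  have w6 : s.warr 6 = fun i => (I.L[i]?.map Block.exp).getD 0 := rfl
  have w7 : s.warr 7 = fun _ => 0 := rfl
  have w9 : s.warr 9 = fun _ => 0 := rfl
  have w11 : s.warr 11 = fun _ => 0 := rfl
  have w12 : s.warr 12 = fun _ => 0 := rfl
  have w13 : s.warr 13 = fun _ => 0 := rfl
  clear_value s
  refine .seq (.setW (by simp [v0, v1]; omega) (.seq (.setW (by simp [v2]; omega) (.seq (.setW
    (by simp [v0]; omega) (.seq (.setR (.seq ?_))))))))
  simp only [WExp.eval, WExp.eval_add, WExp.eval_mul, WExp.eval_ofNat, RAMState.setW_wvar,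
    Nat.reduceEqDiff, if_false, OfNat.zero_ne_ofNat, OfNat.one_ne_ofNat, RExp.eval, v0, v1, v2]
  have g4 : ((((s.setW 4 (I.F.length + I.G.length)).setW 5 (4 * I.k + 1)).setW 6
      (I.F.length + 1)).setR 1 ((I.k + 1 : ℕ) : ℝ)).wvar 4 = I.F.length + I.G.length := by simp
  have g5 : ((((s.setW 4 (I.F.length + I.G.length)).setW 5 (4 * I.k + 1)).setW 6
      (I.F.length + 1)).setR 1 ((I.k + 1 : ℕ) : ℝ)).wvar 5 = 4 * I.k + 1 := by simp
  have g6 : ((((s.setW 4 (I.F.length + I.G.length)).setW 5 (4 * I.k + 1)).setW 6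
      (I.F.length + 1)).setR 1 ((I.k + 1 : ℕ) : ℝ)).wvar 6 = I.F.length + 1 := by simp
  have gv : ∀ x < 4, ((((s.setW 4 (I.F.length + I.G.length)).setW 5 (4 * I.k + 1)).setW 6
      (I.F.length + 1)).setR 1 ((I.k + 1 : ℕ) : ℝ)).wvar x = s.wvar x := by
    intro x hx
    simp only [RAMState.setR_wvar, RAMState.setW_wvar]
    rw [if_neg (by omega), if_neg (by omega), if_neg (by omega)]
  have gr : ((((s.setW 4 (I.F.length + I.G.length)).setW 5 (4 * I.k + 1)).setW 6
      (I.F.length + 1)).setR 1 ((I.k + 1 : ℕ) : ℝ)).rvar 1 = I.k + 1 := by simp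
  have ga : ((((s.setW 4 (I.F.length + I.G.length)).setW 5 (4 * I.k + 1)).setW 6
      (I.F.length + 1)).setR 1 ((I.k + 1 : ℕ) : ℝ)).warr = s.warr := rfl
  generalize (((s.setW 4 (I.F.length + I.G.length)).setW 5 (4 * I.k + 1)).setW 6
      (I.F.length + 1)).setR 1 ((I.k + 1 : ℕ) : ℝ) = t at *
  have hlen : (I.F ++ I.G).length = I.F.length + I.G.length := List.length_append
  refine (mates_spec (I.balF.append I.balG) (by rw [hlen]; omega) (by rw [g4, hlen])
    (by rw [ga, w0]) (by rw [ga, w7])).mono ?_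
  rintro s₁ T₁ ⟨t1, k1, hle, hmate⟩
  refine .seq ((jumps_spec hB (by rw [k1.wvar _ (by omega), gv _ (by omega), v3])
    (by rw [k1.warr _ (by simp), ga, w1]) (by rw [k1.warr _ (by simp), ga, w2])
    (by rw [k1.warr _ (by simp), ga, w5]) (by rw [k1.warr _ (by simp), ga, w6])
    (by rw [k1.warr _ (by simp), ga, w9]) (by rw [k1.warr _ (by simp), ga, w12])).mono ?_)
  rintro s₂ T₂ ⟨t2, k2, hj, hn, hn'⟩
  refine (prefixes_spec hB (by rw [k2.wvar _ (by omega), k1.wvar _ (by omega), gv _ (by omega),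
    v0]) (fun _ _ _ h => ⟨(hj _ _ _ h).1, (hj _ _ _ h).2.1⟩) hn
    (by rw [k2.warr _ (by simp), k1.warr _ (by simp), ga, w13])).mono ?_
  rintro s₃ T₃ ⟨t3, k3, hpre⟩
  have kv : ∀ x < 20, s₃.wvar x = t.wvar x := fun x hx => by
    rw [k3.wvar x hx, k2.wvar x hx, k1.wvar x hx]
  have a0 : s₃.warr 0 = fun i => ((I.F ++ I.G)[i]?.map Paren.kind).getD 0 := by
    rw [k3.warr _ (by simp), k2.warr _ (by simp), k1.warr _ (by simp), ga, w0]
  have a7 : s₃.warr 7 = s₁.warr 7 := by rw [k3.warr _ (by simp), k2.warr _ (by simp)]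
  have a8 : s₃.warr 8 = s₁.warr 8 := by rw [k3.warr _ (by simp), k2.warr _ (by simp)]
  have a9 : s₃.warr 9 = s₂.warr 9 := k3.warr _ (by simp)
  have a10 : s₃.warr 10 = s₂.warr 10 := k3.warr _ (by simp)
  have a12 : s₃.warr 12 = s₂.warr 12 := k3.warr _ (by simp)
  have a11 : s₃.warr 11 = fun _ => 0 := by
    rw [k3.warr _ (by simp), k2.warr _ (by simp), k1.warr _ (by simp), ga, w11]
  refine ⟨?_, ?_, fun i => by rw [a11]⟩
  · simp at t1 ⊢
    omega
  · refine
      { v0 := by rw [kv _ (by omega), gv _ (by omega), v0]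
        v1 := by rw [kv _ (by omega), gv _ (by omega), v1]
        v2 := by rw [kv _ (by omega), gv _ (by omega), v2]
        v4 := by rw [kv _ (by omega), g4]
        v5 := by rw [kv _ (by omega), g5]
        v6 := by rw [kv _ (by omega), g6]
        inf := by rw [k3.rvar, k2.rvar, k1.rvar, gr]
        nodeF := ?_
        nodeG := ?_
        mate_le := by rw [a7, ← hlen]; exact hle
        jump := by rw [a9, a10, a12]; exact hj
        no_jump := by rw [a9]; exact hn
        no_jump_end := by rw [a12]; exact hn'
        pre := hpre
        par := ?_ }
    · intro i j h
      have h' := (isNode_append_left (G := I.G) h.lt_length).2 h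
      rw [a0, a7]
      exact ⟨h'.kind_left, h'.kind_right, (hmate i j h').1, (hmate i j h').2.1⟩
    · intro i j h
      have h' := (isNode_append_right (F := I.F)).2 h
      rw [a0, a7]
      exact ⟨h'.kind_left, h'.kind_right, (hmate _ _ h').1, (hmate _ _ h').2.1⟩
    · intro i j h
      have h' := (isNode_append_left (G := I.G) h.lt_length).2 h
      rw [a8]
      have := h.lt
      have := h.lt_length
      exact (hmate i j h').2.2.of_append I.balF (by omega)

theorem goodEntry_insertions {y : ℕ} (hy : y ≤ I.G.length) (hk : y ≤ 2 * I.k) :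
    GoodEntry I.w I.k I.F I.G 0 0 (2 * I.k) (2 * I.k + y)
      (∑ z ∈ Finset.range y, insCost I.w I.G z) := by
  induction y with
  | zero =>
    refine ⟨.empty (y := 0) (by omega) (by omega) (by omega) (by omega), .empty ?_ ?_⟩
    · intro _ _ _ _; simp
    · intro z b' h1 h2; omega
  | succ y ih =>
    have h := ih (by omega) (by omega)
    rw [Finset.sum_range_succ]
    refine ⟨h.1.ins_right (by omega) (by omega) (by omega), .empty ?_ ?_⟩
    · intro _ _ _ _; omega
    · intro z b' h1 h2 h3 h4
      obtain rfl : b' = 2 * I.k + y := by omega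
      obtain rfl : z = y := by omega
      exact ⟨_, h.2, le_rfl⟩

/-- If F is empty, then m = t = 0 and even filling a single matrix would exceed the time bound, so
the cost of the insertions is summed directly. -/
theorem insertAll_spec (hB : I.BoundOK B) (hF : I.F.length = 0) (hG : I.G.length ≤ 2 * I.k) :
    Halts I.orc B .insertAll (initState I.F I.G I.k I.L) fun s' T =>
      T ≤ 100 * (I.G.length + 1) ∧ s'.wvar 2 = I.k ∧
      GoodEntry I.w I.k I.F I.G 0 I.F.length (2 * I.k) (2 * I.k + I.G.length) (s'.rvar 0) := by
  have hlin := hB.linear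
  set s := initState I.F I.G I.k I.L with hs
  have v0 : s.wvar 0 = I.F.length := rfl
  have v1 : s.wvar 1 = I.G.length := rfl
  have v2 : s.wvar 2 = I.k := rfl
  have r0 : s.rvar 0 = 0 := rfl
  clear_value s
  refine .seq (.setW (by simp [v0, v1]; omega) ?_)
  refine Halts.forLoop (N := I.G.length) (fun q s' => s'.wvar 20 = q ∧ s'.wvar 1 = I.G.length ∧
    s'.wvar 2 = I.k ∧ s'.wvar 4 = I.F.length + I.G.length ∧
    s'.rvar 0 = ∑ z ∈ Finset.range q, insCost I.w I.G z) 20 (by omega) ?_ ?_ ?_ ?_ ?_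
  · simp [v0, v1, v2, r0]
  · rintro q s' ⟨-, h, -⟩; simpa using h
  · rintro q s' - ⟨h, -⟩; exact h
  · rintro q s' hq ⟨h20, h1, h2, h4, h0⟩ -
    refine .setR ⟨by simp [h20], by simp, by simp, by simp [h1], by simp [h2], by simp [h4], ?_⟩
    have := orc_ins (I := I) (y := q)
    rw [hF, zero_add, zero_add] at this
    rw [Finset.sum_range_succ, ← this]
    simp [h0, h4, h20, hF]
  · rintro s' T ⟨-, -, h2, -, h0⟩ hT
    refine ⟨?_, h2, ?_⟩
    · simp at hT ⊢
      omega
    · rw [h0, hF]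
      exact goodEntry_insertions le_rfl hG

/-- The second alternative for the time retains |F| ≥ 1, which is needed to absorb the cost of the
last run into the weight of F. If the lengths differ by more than `2k`, then the answer is infinite
and nothing is computed. -/
theorem ted_spec (hB : I.BoundOK B) :
    Halts I.orc B .ted (initState I.F I.G I.k I.L) fun s' T =>
      s'.output = tedLE I.w I.k I.F I.G ∧ (T ≤ 500 * (I.F.length + I.G.length + 1) ∨
        1 ≤ I.F.length ∧ T ≤ 500 * (I.F.length + I.G.length + 1) +
          2000 * ((4 * I.k + 1) * (4 * I.k + 1) * (I.prefixWt I.F.length + 1)) +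
          (∑ y ∈ Finset.range I.F.length, I.sweepCost y)) := by
  have hlin := hB.linear
  have v0 : (initState I.F I.G I.k I.L).wvar 0 = I.F.length := rfl
  have v1 : (initState I.F I.G I.k I.L).wvar 1 = I.G.length := rfl
  have v2 : (initState I.F I.G I.k I.L).wvar 2 = I.k := rfl
  have finish : ∀ {s : RAMState} {b T : ℕ} {P : ℕ → Prop}, s.wvar 2 = I.k →
      I.G.length + 2 * I.k = I.F.length + b →
      GoodEntry I.w I.k I.F I.G 0 I.F.length (2 * I.k) b (s.rvar 0) → P (T + 7) →
      Halts I.orc B (.ite (.rle (.var 0) (.cast (wv 2))) (.setW 0 1) (.setW 0 0)) s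
        fun s' T' => s'.output = tedLE I.w I.k I.F I.G ∧ P (T + T') := by
    intro s b T P h2 hb hg hP
    rw [tedLE_eq_of_goodEntry I.balF I.balG I.normalized hb hg]
    refine .ite (fun hc => .setW (by simp; omega) ⟨?_, hP⟩) fun hc => .setW (by simp) ⟨?_, hP⟩
    · simp [h2] at hc
      simp [RAMState.output, hc]
    · simp [h2] at hc
      simp [RAMState.output, hc]
  refine .ite (fun hb => ?_) fun hb => .setW (by simp) ⟨?_, .inl ?_⟩
  · simp [v0, v1, v2] at hb
    refine .seq (.ite (fun hc => ?_) fun hc => ?_)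
    · simp [v0] at hc
      refine .seq ((preprocess_spec hB).mono ?_)
      rintro s₁ T₁ ⟨t1, hR, h11⟩
      refine .seq ((sweep_spec hB hR h11).mono ?_)
      rintro s₂ T₂ ⟨t2, hm, hR₂⟩
      have hg := hm (2 * I.k) (I.G.length + 2 * I.k - I.F.length) (by omega) (by omega)
      refine .setR ?_
      refine (finish (b := I.G.length + 2 * I.k - I.F.length) (T := 0) (P := fun T => T = 7)
        ?_ (by omega) ?_ rfl).mono ?_
      · simp [hR₂.v2]
      · simpa [hR₂.v0, hR₂.v1, hR₂.v2, hR₂.v5, RAMState.mat] using hg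
      · rintro s' T ⟨h1, h2⟩
        refine ⟨h1, .inr ⟨by omega, ?_⟩⟩
        simp
        omega
    · simp [v0] at hc
      have hF : I.F.length = 0 := by simp [hc]
      refine (insertAll_spec hB hF (by omega)).mono ?_
      rintro s₂ T₂ ⟨t2, h2, hg⟩
      refine (finish (b := 2 * I.k + I.G.length) (T := 0) (P := fun T => T = 7)
        h2 (by omega) hg rfl).mono ?_
      rintro s' T ⟨h3, h4⟩
      refine ⟨h3, .inl ?_⟩
      simp
      omega
  · simp [v0, v1, v2] at hb
    rw [tedLE_eq_top I.balF I.balG I.normalized]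
    · simp [RAMState.output]
    · rintro ⟨h1, h2, h3, h4⟩
      have := hb (by omega)
      omega
  · simp
    omega

end TedInput


/-! ### Bounds on the time -/

theorem exists_isEnclosing {α : Type*} (F : List (Paren α)) (x : ℕ) : ∃ v, IsEnclosing F x v := by
  classical
  by_cases h : ∃ i j, IsNode F i j ∧ i < x ∧ x ≤ j
  · obtain ⟨i, j, hn, h1, h2⟩ := h
    have hs := Nat.findGreatest_spec (P := fun i => ∃ j, IsNode F i j ∧ i < x ∧ x ≤ j) h1.le
      ⟨j, hn, h1, h2⟩
    obtain ⟨j', h3, h4, h5⟩ := hs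
    exact ⟨_, .inr ⟨_, j', rfl, h3, h4, h5, fun i' j' h6 h7 h8 =>
      Nat.le_findGreatest h7.le ⟨j', h6, h7, h8⟩⟩⟩
  · push Not at h
    exact ⟨0, .inl ⟨rfl, fun i j hn hc => absurd hc.2 (not_le.2 (h i j hn hc.1))⟩⟩

namespace TedInput

variable {α : Type*} {I : TedInput α}

theorem nodeWt_mono {i j i' j' : ℕ} (h1 : i' ≤ i) (h2 : j ≤ j') : I.nodeWt i j ≤ I.nodeWt i' j' :=
  tsub_le_tsub (prefixWt_mono (by omega)) (prefixWt_mono h1)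

theorem one_le_nodeWt {i j : ℕ} (h : ¬ I.InJump i) (hij : i ≤ j) : 1 ≤ I.nodeWt i j := by
  have h1 := prefixWt_succ h
  have h2 := prefixWt_mono (I := I) (by omega : i + 1 ≤ j + 1)
  rw [nodeWt]
  omega

theorem nodeWt_eq_sum {i j n : ℕ} (hij : i ≤ j) (hj : j < n) :
    I.nodeWt i j = ∑ z ∈ Finset.range n, if i ≤ z ∧ z ≤ j then I.wt z else 0 := by
  rw [nodeWt, prefixWt, prefixWt, ← Finset.sum_filter,
    ← Finset.sum_range_add_sum_Ico _ (by omega : i ≤ j + 1), Nat.add_sub_cancel_left]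
  congr 1
  ext z
  simp
  omega

/-- Light nodes have at least twice the weight of the light nodes inside of them. -/
theorem IsLight.two_mul_nodeWt_le {i j i' j' : ℕ} (h : I.IsLight i j) (h' : IsNode I.F i' j')
    (hi : i' < i) (hj : i < j') : 2 * I.nodeWt i j ≤ I.nodeWt i' j' := by
  obtain ⟨hn, ha, hl⟩ := h
  obtain ⟨v, hv⟩ := exists_isEnclosing I.F i
  rcases hv with ⟨rfl, e⟩ | ⟨p, q, rfl, hpq, h1, h2, h3⟩
  · exact absurd ⟨hi, hj.le⟩ (e i' j' h')
  · have h4 := h3 i' j' h' hi hj.le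
    have h5 : I.nodeWt p q ≤ I.nodeWt i' j' := by
      refine nodeWt_mono h4 ?_
      rcases h4.eq_or_lt with rfl | h4
      · exact (hpq.right_unique h').le
      · exact (h'.nest hpq h4 (by omega)).le
    by_contra hc
    exact hl p q ⟨hn, ha, hpq, .inr ⟨p, q, rfl, hpq, h1, h2, h3⟩, by omega⟩

theorem IsLight.log_nodeWt_lt {i j i' j' : ℕ} (h : I.IsLight i j) (h' : I.IsLight i' j')
    (hi : i' < i) (hj : i < j') : Nat.log 2 (I.nodeWt i j) < Nat.log 2 (I.nodeWt i' j') := by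
  have h1 := h.two_mul_nodeWt_le h'.1 hi hj
  have h2 := one_le_nodeWt h.2.1 h.1.lt.le
  calc _ < Nat.log 2 (I.nodeWt i j) + 1 := Nat.lt_succ_self _
    _ = Nat.log 2 (I.nodeWt i j * 2) := (Nat.log_mul_base (by omega) (by omega)).symm
    _ ≤ _ := Nat.log_mono_right (by omega)

-- The light nodes around `z` are nested, and the binary logarithms of their weights are strictly
-- increasing from the inside to the outside; so the logarithm is injective on them.
open Classical in
theorem card_light_le (z : ℕ) :
    (((Finset.range I.F.length ×ˢ Finset.range I.F.length).filter
      fun p => I.IsLight p.1 p.2).filter fun p => p.1 ≤ z ∧ z ≤ p.2).card ≤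
      Nat.log 2 (I.prefixWt I.F.length) + 1 := by
  rw [← Finset.card_range (Nat.log 2 (I.prefixWt I.F.length) + 1)]
  refine Finset.card_le_card_of_injOn (fun p => Nat.log 2 (I.nodeWt p.1 p.2)) ?_ ?_
  · rintro ⟨i, j⟩ hp
    simp only [Finset.coe_filter, Finset.mem_filter, Finset.mem_product, Finset.mem_range,
      Set.mem_ofPred_eq, Finset.coe_range, Set.mem_Iio] at hp ⊢
    refine Nat.lt_succ_of_le (Nat.log_mono_right ?_)
    exact (Nat.sub_le _ _).trans (prefixWt_mono (by omega))
  · rintro ⟨i, j⟩ hp ⟨i', j'⟩ hp' heq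
    simp only [Finset.coe_filter, Finset.mem_filter, Finset.mem_product, Finset.mem_range,
      Set.mem_ofPred_eq] at hp hp' heq
    obtain ⟨⟨-, hl⟩, h1, h2⟩ := hp
    obtain ⟨⟨-, hl'⟩, h1', h2'⟩ := hp'
    have e1 := hl.1.left_ne_right hl'.1
    have e2 := hl'.1.left_ne_right hl.1
    rcases Nat.lt_trichotomy i i' with e | e | e
    · have := hl'.log_nodeWt_lt hl e (by omega)
      omega
    · subst e
      rw [hl.1.right_unique hl'.1]
    · have := hl.log_nodeWt_lt hl' e (by omega)
      omega

-- Double counting: the weight of a node is the sum of the weights of its positions, so each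
-- position is counted once for every light node that contains it.
open Classical in
theorem sum_light_le :
    ∑ y ∈ Finset.range I.F.length, ∑ i ∈ Finset.range I.F.length,
      (if I.IsLight i y then I.nodeWt i y else 0) ≤
      I.prefixWt I.F.length * (Nat.log 2 (I.prefixWt I.F.length) + 1) := by
  calc _ = ∑ p ∈ (Finset.range I.F.length ×ˢ Finset.range I.F.length).filter
        fun p => I.IsLight p.1 p.2, I.nodeWt p.1 p.2 := by
        rw [Finset.sum_comm, Finset.sum_filter, Finset.sum_product]
    _ = ∑ p ∈ (Finset.range I.F.length ×ˢ Finset.range I.F.length).filter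
        (fun p => I.IsLight p.1 p.2), ∑ z ∈ Finset.range I.F.length,
          if p.1 ≤ z ∧ z ≤ p.2 then I.wt z else 0 := by
        refine Finset.sum_congr rfl fun p hp => ?_
        simp only [Finset.mem_filter, Finset.mem_product, Finset.mem_range] at hp
        exact nodeWt_eq_sum hp.2.1.lt.le hp.1.2
    _ = ∑ z ∈ Finset.range I.F.length, (((Finset.range I.F.length ×ˢ
        Finset.range I.F.length).filter fun p => I.IsLight p.1 p.2).filter
          fun p => p.1 ≤ z ∧ z ≤ p.2).card * I.wt z := by
        rw [Finset.sum_comm]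
        refine Finset.sum_congr rfl fun z _ => ?_
        rw [← Finset.sum_filter, Finset.sum_const, smul_eq_mul]
    _ ≤ ∑ z ∈ Finset.range I.F.length, (Nat.log 2 (I.prefixWt I.F.length) + 1) * I.wt z :=
        Finset.sum_le_sum fun z _ => Nat.mul_le_mul_right _ (card_light_le z)
    _ = _ := by rw [← Finset.mul_sum, mul_comm, prefixWt]

open Classical in
theorem card_jumps_le :
    ((Finset.range I.F.length).filter fun y => ∃ j₁ len, I.Jump y j₁ len).card ≤ I.L.length := by
  calc _ ≤ (I.L.map fun b => b.pF + b.len).toFinset.card := by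
        refine Finset.card_le_card fun y hy => ?_
        obtain ⟨j₁, len, b, hb, -, rfl, -⟩ := (Finset.mem_filter.1 hy).2
        exact List.mem_toFinset.2 (List.mem_map.2 ⟨b, hb, rfl⟩)
    _ ≤ _ := (List.toFinset_card_le _).trans_eq (List.length_map _)

theorem sum_sweepCost_le :
    ∑ y ∈ Finset.range I.F.length, I.sweepCost y ≤ 200 * I.F.length +
      I.L.length * (8000 * ((4 * I.k + 1) * ((4 * I.k + 1) * (4 * I.k + 1)) *
        (Nat.log 2 I.F.length + 1))) +
      4000 * ((4 * I.k + 1) * (4 * I.k + 1)) *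
        (I.prefixWt I.F.length * (Nat.log 2 (I.prefixWt I.F.length) + 1)) := by
  classical
  simp only [sweepCost, Finset.sum_add_distrib]
  refine Nat.add_le_add (Nat.add_le_add ?_ ?_) ?_
  · simp [mul_comm]
  · rw [← Finset.sum_filter, Finset.sum_const, smul_eq_mul]
    refine Nat.mul_le_mul_right _ ?_
    convert card_jumps_le (I := I)
  · refine le_trans ?_ (Nat.mul_le_mul_left _ sum_light_le)
    rw [Finset.mul_sum]
    refine Finset.sum_le_sum fun y _ => ?_
    rw [Finset.mul_sum]
    refine Finset.sum_le_sum fun i _ => ?_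
    split_ifs with h
    -- A light node weighs at least 1, so the additive 1 in the cost of a run is paid for by
    -- doubling the constant.
    · have h1 := one_le_nodeWt h.2.1 h.1.lt.le
      calc _ ≤ 2000 * ((4 * I.k + 1) * (4 * I.k + 1) * (2 * I.nodeWt i y)) := by
            gcongr; omega
        _ = _ := by ring
    · simp

theorem sum_blocks_le {n c : ℕ} (L : List Block) (h : ∀ b ∈ L, b.len ≤ c) :
    ∑ y ∈ Finset.range n, (L.map fun b => (if b.pF ≤ y ∧ y < b.pF + b.len then 1 else 0) +
      if y = b.pF + b.len then b.len else 0).sum ≤ 2 * c * L.length := by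
  induction L with
  | nil => simp
  | cons b L ih =>
    simp only [List.map_cons, List.sum_cons, Finset.sum_add_distrib, List.length_cons]
    have h1 := ih fun b hb => h b (List.mem_cons_of_mem _ hb)
    have h2 := h b List.mem_cons_self
    have h3 : ∑ y ∈ Finset.range n, (if b.pF ≤ y ∧ y < b.pF + b.len then 1 else 0) ≤ b.len := by
      rw [← Finset.card_filter]
      calc _ ≤ (Finset.Ico b.pF (b.pF + b.len)).card := by
            refine Finset.card_le_card fun y hy => ?_
            simpa using (Finset.mem_filter.1 hy).2
        _ = b.len := by simp
    have h4 : ∑ y ∈ Finset.range n, (if y = b.pF + b.len then b.len else 0) ≤ b.len := by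
      rw [Finset.sum_ite_eq']
      split_ifs <;> simp
    rw [Nat.mul_add]
    omega

/-- A block contributes at most twice the length of its period: once for the characters of the first
period and once for the weight at the start of the jump. Both are at most `8k`. -/
theorem prefixWt_length_le :
    I.prefixWt I.F.length ≤ nonFree I.F I.L + 16 * I.k * I.L.length := by
  classical
  have hk := I.one_le
  have h := sum_blocks_le (n := I.F.length) (c := 8 * I.k) I.L fun b hb => by
    have := block_facts hb; omega
  rw [show 2 * (8 * I.k) * I.L.length = 16 * I.k * I.L.length by ring] at h
  refine le_trans ?_ (Nat.add_le_add_left h _)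
  rw [nonFree, Finset.card_filter, prefixWt, ← Finset.sum_add_distrib]
  refine Finset.sum_le_sum fun y _ => ?_
  have single : ∀ b ∈ I.L, (if b.pF ≤ y ∧ y < b.pF + b.len then 1 else 0) +
      (if y = b.pF + b.len then b.len else 0) ≤
      (I.L.map fun b => (if b.pF ≤ y ∧ y < b.pF + b.len then 1 else 0) +
        if y = b.pF + b.len then b.len else 0).sum := fun b hb =>
    List.single_le_sum (fun _ _ => Nat.zero_le _) _ (List.mem_map.2 ⟨b, hb, rfl⟩)
  by_cases hj : I.InJump y
  · obtain ⟨j₀, j₁, len, hj, h1, h2⟩ := hj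
    rcases h1.eq_or_lt with rfl | h1
    · rw [hj.wt_eq]
      obtain ⟨b, hb, -, rfl, -, rfl⟩ := hj
      have := single b hb
      rw [if_pos rfl] at this
      omega
    · rw [hj.wt_inside h1 h2]; omega
  · rw [wt_of_not_inJump hj]
    by_cases hf : ∀ b ∈ I.L, ¬ (b.pF ≤ y ∧ y < b.qF)
    · rw [if_pos hf]; omega
    · push Not at hf
      obtain ⟨b, hb, h1, h2⟩ := hf
      have hs := single b hb
      have hbf := block_facts hb
      have h3 : y < b.pF + b.len := by
        -- A position of a block outside of the jumps is in the first period; a block of exponent 1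
        -- consists of that period only.
        by_cases he : 2 ≤ b.exp
        · by_contra hc
          exact hj ⟨_, _, _, ⟨b, hb, he, rfl, rfl, rfl⟩, not_lt.1 hc, h2⟩
        · have : b.exp = 1 := by omega
          rw [this] at hbf
          omega
      rw [if_pos ⟨h1, h3⟩] at hs
      omega

/-- A jump is preceded by at least a full period, so position 0 has weight 1. This turns the factor
`prefixWt + 1` of the last run into `2 * prefixWt`. -/
theorem one_le_prefixWt_length (h : 1 ≤ I.F.length) : 1 ≤ I.prefixWt I.F.length := by
  have h0 : ¬ I.InJump 0 := by
    rintro ⟨j₀, j₁, len, hj, h1, -⟩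
    have := hj.facts
    have := I.one_le
    omega
  have h1 := prefixWt_succ h0
  have h2 := prefixWt_mono (I := I) h
  rw [zero_add] at h1
  omega

end TedInput

/-! ### Natural logarithms and the final estimate -/

theorem Nat.log_two_le_two_mul_log {f n : ℕ} (hf : 1 ≤ f) (hfn : f ≤ n) :
    (Nat.log 2 f : ℝ) ≤ 2 * Real.log n := by
  have h1 : (Nat.log 2 f : ℝ) ≤ Real.logb 2 f := Real.natLog_le_logb f 2
  have h2 : Real.log f ≤ Real.log n :=
    Real.log_le_log (by exact_mod_cast hf) (by exact_mod_cast hfn)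
  have h3 := Real.log_two_gt_d9
  have h4 : 0 ≤ Real.log f := Real.log_natCast_nonneg f
  rw [Real.logb, le_div_iff₀ (by linarith)] at h1
  nlinarith [Nat.cast_nonneg (α := ℝ) (Nat.log 2 f)]

theorem one_le_two_mul_log {n : ℕ} (hn : 2 ≤ n) : 1 ≤ 2 * Real.log n := by
  have h2 : Real.log 2 ≤ Real.log n := Real.log_le_log (by norm_num) (by exact_mod_cast hn)
  have h3 := Real.log_two_gt_d9
  linarith

theorem BalancedStr.two_le_length {α : Type*} {F : List (Paren α)} (h : BalancedStr F)
    (hF : 1 ≤ F.length) : 2 ≤ F.length := by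
  obtain ⟨y, hy | hy⟩ := h.exists_node 0 hF
  · have := hy.lt; have := hy.lt_length; omega
  · have := hy.lt; omega

theorem theorem6 :
    ∃ (P : Cmd) (c d : ℕ), ∀ (α : Type*) (F G : List (Paren α))
      (w : Option α → Option α → ℝ≥0) (k : ℕ) (L : List Block) (n m t : ℕ),
      BalancedStr F → BalancedStr G → Normalized w → 1 ≤ k →
      (∀ b ∈ L, b.IsFree k F G) → L.Pairwise Block.DisjointF →
      n = F.length + G.length → m = nonFree F L → t = L.length →
      Computes P ((n + k + 2) ^ d) w F G k L (tedLE w k F G)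
        (c * (n * Real.log n + m * k ^ 2 * Real.log n + t * k ^ 3 * Real.log n + 1)) := by
  -- The exponent 8 comes from the addresses of the matrix entries, see `BoundOK.slot`. The leading
  -- constant is generous.
  refine ⟨.ted, 100000000, 8, ?_⟩
  intro α F G w k L n m t hF hG hw hk hfree hdisj hn hm ht
  let I : TedInput α := ⟨F, G, w, k, L, hF, hG, hw, hk, hfree, hdisj⟩
  have hB : I.BoundOK ((n + k + 2) ^ 8) := by rw [hn]; exact le_rfl
  obtain ⟨s, T, hx, hout, hT⟩ := TedInput.ted_spec hB
  refine ⟨s, T, hx, hout, ?_⟩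
  have hlog : 0 ≤ Real.log n := Real.log_natCast_nonneg n
  -- The linear term is covered by n log n, since a nonempty balanced string has at least two
  -- characters and log 2 > 1/2. For n = 0 the additive constant remains.
  have h1 : 500 * ((n : ℝ) + 1) ≤ 2000 * (n * Real.log n) + 500 := by
    by_cases h0 : n = 0
    · simp [h0]
    · have h2 : 2 ≤ n := by
        have := (hF.append hG).two_le_length (by rw [List.length_append]; omega)
        rwa [List.length_append, ← hn] at this
      have := one_le_two_mul_log h2
      nlinarith [Nat.cast_nonneg (α := ℝ) n]
  have hm0 : 0 ≤ (m : ℝ) * k ^ 2 * Real.log n := by positivity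
  have ht0 : 0 ≤ (t : ℝ) * k ^ 3 * Real.log n := by positivity
  have hn0 : 0 ≤ (n : ℝ) * Real.log n := by positivity
  push_cast
  rcases hT with hT | ⟨hF1, hT⟩
  · have hT' : T ≤ 500 * (n + 1) := by rw [hn]; exact hT
    have : (T : ℝ) ≤ 500 * ((n : ℝ) + 1) := by exact_mod_cast hT'
    linarith
  · have hsum := TedInput.sum_sweepCost_le (I := I)
    have hP := TedInput.prefixWt_length_le (I := I)
    have hP1 := TedInput.one_le_prefixWt_length hF1
    have hP2 := TedInput.prefixWt_le (I := I) (le_refl I.F.length)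
    change 1 ≤ F.length at hF1
    change I.prefixWt F.length ≤ nonFree F L + 16 * k * L.length at hP
    rw [← hm, ← ht] at hP
    set p := I.prefixWt F.length with hp
    have hT' : T ≤ 500 * (n + 1) + 2000 * ((4 * k + 1) * (4 * k + 1) * (p + 1)) + (200 * F.length +
        t * (8000 * ((4 * k + 1) * ((4 * k + 1) * (4 * k + 1)) * (Nat.log 2 F.length + 1))) +
        4000 * ((4 * k + 1) * (4 * k + 1)) * (p * (Nat.log 2 p + 1))) := by
      rw [hn, ht]
      exact hT.trans (Nat.add_le_add_left hsum _)
    have hn2 : 2 ≤ n := by have := hF.two_le_length hF1; omega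
    have hl1 := one_le_two_mul_log hn2
    have hl2 : ((Nat.log 2 F.length + 1 : ℕ) : ℝ) ≤ 4 * Real.log n := by
      have := Nat.log_two_le_two_mul_log hF1 (by omega : F.length ≤ n)
      push_cast
      linarith
    -- As p ≤ |F|², the logarithm of the weight is at most about twice that of |F|; the words and
    -- the time depend on `k`, but this logarithm does not.
    have hl3 : ((Nat.log 2 p + 1 : ℕ) : ℝ) ≤ 8 * Real.log n := by
      have e1 : Nat.log 2 p ≤ 2 * Nat.log 2 F.length + 1 := by
        refine Nat.le_of_lt_succ (Nat.log_lt_of_lt_pow (by omega) ?_)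
        have e2 := Nat.lt_pow_succ_log_self (b := 2) (by omega) F.length
        calc p ≤ F.length * F.length := hP2
          _ < 2 ^ (Nat.log 2 F.length).succ * 2 ^ (Nat.log 2 F.length).succ :=
              Nat.mul_lt_mul'' e2 e2
          _ = _ := by rw [← pow_add]; congr 1; omega
      have := Nat.log_two_le_two_mul_log hF1 (by omega : F.length ≤ n)
      have e3 : ((Nat.log 2 p + 1 : ℕ) : ℝ) ≤ ((2 * Nat.log 2 F.length + 1 + 1 : ℕ) : ℝ) := by
        exact_mod_cast Nat.succ_le_succ e1
      push_cast at e3 ⊢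
      linarith
    have hk2 : (4 * k + 1) * (4 * k + 1) ≤ 25 * k ^ 2 := by nlinarith
    have hk3 : (4 * k + 1) * ((4 * k + 1) * (4 * k + 1)) ≤ 125 * k ^ 3 := by
      calc _ ≤ (5 * k) * (25 * k ^ 2) := Nat.mul_le_mul (by omega) hk2
        _ = _ := by ring
    have hTn : T ≤ 500 * (n + 1) + 200 * n + 100000 * (k ^ 2 * p) +
        1000000 * (t * k ^ 3 * (Nat.log 2 F.length + 1)) +
        100000 * (k ^ 2 * p * (Nat.log 2 p + 1)) := by
      -- Here 4k + 1 ≤ 5k and p ≥ 1 are used.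
      have a1 : 2000 * ((4 * k + 1) * (4 * k + 1) * (p + 1)) ≤ 2000 * (25 * k ^ 2 * (2 * p)) := by
        gcongr; omega
      have a2 : t * (8000 * ((4 * k + 1) * ((4 * k + 1) * (4 * k + 1)) *
          (Nat.log 2 F.length + 1))) ≤ t * (8000 * (125 * k ^ 3 * (Nat.log 2 F.length + 1))) := by
        gcongr
      have a3 : 4000 * ((4 * k + 1) * (4 * k + 1)) * (p * (Nat.log 2 p + 1)) ≤
          4000 * (25 * k ^ 2) * (p * (Nat.log 2 p + 1)) := by
        gcongr
      ring_nf at a1 a2 a3 hT' ⊢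
      omega
    have hTr : (T : ℝ) ≤ 500 * ((n : ℝ) + 1) + 200 * n + 100000 * ((k : ℝ) ^ 2 * p) +
        1000000 * ((t : ℝ) * k ^ 3 * ((Nat.log 2 F.length + 1 : ℕ) : ℝ)) +
        100000 * ((k : ℝ) ^ 2 * p * ((Nat.log 2 p + 1 : ℕ) : ℝ)) := by
      exact_mod_cast hTn
    have hpr : (p : ℝ) ≤ m + 16 * k * t := by exact_mod_cast hP
    have b1 : (k : ℝ) ^ 2 * p * Real.log n ≤
        m * k ^ 2 * Real.log n + 16 * (t * k ^ 3 * Real.log n) := by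
      calc _ ≤ (k : ℝ) ^ 2 * (m + 16 * k * t) * Real.log n := by gcongr
        _ = _ := by ring
    have b2 : (k : ℝ) ^ 2 * p ≤ 2 * ((k : ℝ) ^ 2 * p * Real.log n) := by
      calc (k : ℝ) ^ 2 * p = (k : ℝ) ^ 2 * p * 1 := by ring
        _ ≤ (k : ℝ) ^ 2 * p * (2 * Real.log n) := by gcongr
        _ = _ := by ring
    have b3 : (t : ℝ) * k ^ 3 * ((Nat.log 2 F.length + 1 : ℕ) : ℝ) ≤
        4 * (t * k ^ 3 * Real.log n) := by
      calc _ ≤ (t : ℝ) * k ^ 3 * (4 * Real.log n) := by gcongr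
        _ = _ := by ring
    have b4 : (k : ℝ) ^ 2 * p * ((Nat.log 2 p + 1 : ℕ) : ℝ) ≤
        8 * ((k : ℝ) ^ 2 * p * Real.log n) := by
      calc _ ≤ (k : ℝ) ^ 2 * p * (8 * Real.log n) := by gcongr
        _ = _ := by ring
    have b5 : (n : ℝ) ≤ 2 * (n * Real.log n) := by
      nlinarith [Nat.cast_nonneg (α := ℝ) n]
    linarith
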